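/- An ordered graph is a finite simple graph $G$ together with a linear order $\prec$ on its vertex set; an induced ordered subgraph is an induced subgraph with the restricted order. An edge $ac$ crosses an edge $bd$ if $a\prec b\prec c\prec d$. For vertices $u\prec v$, a crossing sequence from $u$ to $v$ is a sequence of distinct edges $e_1,\dots,e_k$ ($k\ge 1$) such that $u$ is the smaller end of $e_1$, $v$ is the larger end of $e_k$, and $e_i$ crosses $e_{i+1}$ for $1\le i<k$. A rotation of $\prec$ is a linear order obtained from $\prec$ by repeatedly making the largest element the smallest. For $v\prec u$, a crossing sequence from $u$ to $v$ is a crossing sequence from $u$ to $v$ with respect to a rotation $\prec'$ of $\prec$ with $u\prec' v$. Let $\mathcal H$ be the family of all ordered graphs that contain two distinct non-adjacent vertices $u,v$ such that there are a crossing sequence from $u$ to $v$ and a crossing sequence from $v$ to $u$. An ordered hole is an ordered graph with vertices $c_1\prec\dots\prec c_k$, $k\ge 4$, and edge set $\{c_1c_2,\dots,c_{k-1}c_k,c_kc_1\}$. An ordered graph is $\mathcal H$-free (ordered-hole-free) if no induced ordered subgraph of it belongs to $\mathcal H$ (is an ordered hole). **Theorem.** Every $\mathcal H$-free ordered graph with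 clique number $\omega\ge 2$ has chromatic number at most $3\cdot 4^{\omega}(\omega-1)$, and at most $3\cdot 4^{\omega-1}$ if it is also ordered-hole-free. Moreover, there is a polynomial-time algorithm that takes an $\mathcal H$-free ordered graph (given by the adjacency matrix with the vertices listed in increasing order) and computes its clique number $\omega$ and a proper colouring which, if $\omega\ge 2$, uses at most $3\cdot 4^{\omega}(\omega-1)$ colours, and at most $3\cdot 4^{\omega-1}$ colours if the graph is also ordered-hole-free. Here polynomial time means that, for some fixed program of a random access machine with unit-cost addition and subtraction, the number of steps is bounded by a polynomial in the number of vertices. -/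

import Mathlib

/-! ### Ordered graphs

An ordered graph is a `SimpleGraph V` together with a `LinearOrder V`.  Its induced ordered
subgraphs are the graphs `G.induce S` with the order inherited by the subtype `S`. -/

/-- The rotation of the linear order `<` that moves the final segment `U` (an upper set) in front
of all other elements, as a strict order relation. -/
def RotLT {V : Type*} [LinearOrder V] (U : UpperSet V) (x y : V) : Prop :=
  (x ∈ U ∧ y ∉ U) ∨ ((x ∈ U ↔ y ∈ U) ∧ x < y)

/-- An edge is written as the pair (smaller end, larger end) with respect to the order `r`.
The edge `ac` crosses the edge `bd` when `a, b, c, d` occur in this order. -/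
def Crosses {V : Type*} (r : V → V → Prop) (e f : V × V) : Prop :=
  r e.1 f.1 ∧ r f.1 e.2 ∧ r e.2 f.2

/-- `es` is a crossing sequence from `u` to `v` in the graph `G` ordered by `r`
(used only when `r u v`). -/
structure IsCrossingSeq {V : Type*} (G : SimpleGraph V) (r : V → V → Prop) (u v : V)
    (es : List (V × V)) : Prop where
  edge : ∀ e ∈ es, r e.1 e.2 ∧ G.Adj e.1 e.2
  nodup : es.Nodup
  first : es.head?.map Prod.fst = some u
  last : es.getLast?.map Prod.snd = some v
  crosses : es.IsChain (Crosses r)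

/-- There is a crossing sequence from `u` to `v` in the ordered graph `G`; if `v < u`, this is
read in a rotation of the order in which `u` comes before `v`. -/
def HasCrossingSeq {V : Type*} [LinearOrder V] (G : SimpleGraph V) (u v : V) : Prop :=
  (u < v ∧ ∃ es, IsCrossingSeq G (· < ·) u v es) ∨
  (v < u ∧ ∃ U : UpperSet V, RotLT U u v ∧ ∃ es, IsCrossingSeq G (RotLT U) u v es)

/-- Membership of an ordered graph in the family `𝓗`. -/
def InFamilyH {W : Type*} [LinearOrder W] (H : SimpleGraph W) : Prop :=
  ∃ u v : W, u ≠ v ∧ ¬ H.Adj u v ∧ HasCrossingSeq H u v ∧ HasCrossingSeq H v u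

/-- The vertices are `c₀ < ⋯ < cₖ₋₁` with `k ≥ 4`, and the edges are exactly the pairs of
consecutive vertices and the pair `c₀ cₖ₋₁`. -/
def IsOrderedHole {W : Type*} [LinearOrder W] (H : SimpleGraph W) : Prop :=
  ∃ k : ℕ, 4 ≤ k ∧ ∃ c : Fin k ≃o W, ∀ i j : Fin k, H.Adj (c i) (c j) ↔
    ((i : ℕ) + 1 = j ∨ (j : ℕ) + 1 = i ∨
      ((i : ℕ) = 0 ∧ (j : ℕ) + 1 = k) ∨ ((j : ℕ) = 0 ∧ (i : ℕ) + 1 = k))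

/-- No induced ordered subgraph belongs to `𝓗`. -/
def HFree {V : Type*} [LinearOrder V] (G : SimpleGraph V) : Prop :=
  ∀ S : Set V, ¬ InFamilyH (G.induce S)

/-- No induced ordered subgraph is an ordered hole. -/
def OrderedHoleFree {V : Type*} [LinearOrder V] (G : SimpleGraph V) : Prop :=
  ∀ S : Set V, ¬ IsOrderedHole (G.induce S)

/-! ### Random access machines

Structured programs for a unit-cost random access machine with addition and (truncated)
subtraction, but without multiplication: one unit of cost can at most double the largest number
in memory, so that polynomial time here is polynomial time on a Turing machine.  The memory has
scalar variables and arrays, all numbered by `ℕ`; a program mentions finitely many of them. -/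

structure RamState where
  var : ℕ → ℕ
  arr : ℕ → ℕ → ℕ

inductive RamExpr where
  | const (k : ℕ)
  | var (x : ℕ)
  | read (a : ℕ) (i : RamExpr)
  | add (e f : RamExpr)
  | sub (e f : RamExpr)

namespace RamExpr

def eval (s : RamState) : RamExpr → ℕ
  | const k => k
  | var x => s.var x
  | read a i => s.arr a (i.eval s)
  | add e f => e.eval s + f.eval s
  | sub e f => e.eval s - f.eval s

/-- The time for evaluating an expression: one unit for each node. -/
def cost : RamExpr → ℕ
  | const _ => 1
  | var _ => 1
  | read _ i => i.cost + 1
  | add e f => e.cost + f.cost + 1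
  | sub e f => e.cost + f.cost + 1

end RamExpr

inductive RamProg where
  | skip
  /-- `x := e` -/
  | assign (x : ℕ) (e : RamExpr)
  /-- `a[i] := e` -/
  | write (a : ℕ) (i e : RamExpr)
  | seq (p q : RamProg)
  /-- if `b ≠ 0` then `p` else `q` -/
  | branch (b : RamExpr) (p q : RamProg)
  /-- while `b ≠ 0` do `p` -/
  | loop (b : RamExpr) (p : RamProg)

/-- `RamExec p s s' t`: started in state `s`, the program `p` halts in state `s'` after exactly
`t` units of time. -/
inductive RamExec : RamProg → RamState → RamState → ℕ → Prop where
  | skip (s : RamState) : RamExec .skip s s 1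
  | assign (s : RamState) (x : ℕ) (e : RamExpr) :
      RamExec (.assign x e) s { s with var := Function.update s.var x (e.eval s) } (e.cost + 1)
  | write (s : RamState) (a : ℕ) (i e : RamExpr) :
      RamExec (.write a i e) s
        { s with
          arr := Function.update s.arr a (Function.update (s.arr a) (i.eval s) (e.eval s)) }
        (i.cost + e.cost + 1)
  | seq {p q : RamProg} {s s' s'' : RamState} {t t' : ℕ} :
      RamExec p s s' t → RamExec q s' s'' t' → RamExec (.seq p q) s s'' (t + t')
  | branch_true {b : RamExpr} {p q : RamProg} {s s' : RamState} {t : ℕ} :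
      b.eval s ≠ 0 → RamExec p s s' t → RamExec (.branch b p q) s s' (b.cost + 1 + t)
  | branch_false {b : RamExpr} {p q : RamProg} {s s' : RamState} {t : ℕ} :
      b.eval s = 0 → RamExec q s s' t → RamExec (.branch b p q) s s' (b.cost + 1 + t)
  | loop_true {b : RamExpr} {p : RamProg} {s s' s'' : RamState} {t t' : ℕ} :
      b.eval s ≠ 0 → RamExec p s s' t → RamExec (.loop b p) s' s'' t' →
      RamExec (.loop b p) s s'' (b.cost + 1 + t + t')
  | loop_false {b : RamExpr} {p : RamProg} {s : RamState} :
      b.eval s = 0 → RamExec (.loop b p) s s (b.cost + 1)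

open Classical in
/-- The input: variable `0` holds the number `n` of vertices, array `0` holds the adjacency matrix
row by row (vertices numbered increasingly), and everything else is `0`. -/
noncomputable def ramInput {n : ℕ} (G : SimpleGraph (Fin n)) : RamState where
  var x := if x = 0 then n else 0
  arr a k := if a = 0 ∧ ∃ u v : Fin n, k = (u : ℕ) * n + v ∧ G.Adj u v then 1 else 0

/-- The output number: variable `1`. -/
def RamState.outNumber (s : RamState) : ℕ := s.var 1

/-- The output colouring: array `1`, whose entry `v` is the colour of the vertex `v`. -/
def RamState.outColour (s : RamState) (v : ℕ) : ℕ := s.arr 1 v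

/-! ### Chords and crossing-connectivity -/

section Chords
variable {V : Type*} [LinearOrder V]

/-! An `HFree` graph enters the colouring only through `CrossClosed`: if a < b < c < d, if ac and bd
are edges, and if a is joined to d by a path of crossing edges without ends strictly between a and
d, then ad is an edge. Indeed ac, bd is a crossing sequence from a to d, and from the path one
extracts a crossing sequence from d to a in the rotation that starts with d; so a and d must be
adjacent (`crossClosed_of_not_inFamilyH`).

A graph is capped if ac and bd force ad without any such path (`Capped`). The first half of the
proof finds three colours whose classes are capped. Vertices are collected in increasing sets, the
layers. In each gap (p, q) between consecutive collected vertices a step takes the vertices with a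
neighbour beyond one end, the neighbours of the ends that would be cut off from them, and the
vertices caught in between by chains of crossing edges; the two directions alternate. All edges
leaving a gap cross edges that are joined to one fixed edge around the gap (`GapBase`), and
therefore the vertices taken in a gap are pairwise linked (`PickSystem.taken_linked`,
`gapInv_stepL`). A vertex with a neighbour outside of its closed gap is taken within two steps. So,
if vertices are coloured by their level modulo 3, a monochromatic edge within a gap of the starting
set joins vertices taken in the same gap by the same step, or a vertex and an end of its gap; the
links then make the classes capped (`PartialState.capped_layer`). Once the layers are stable no gap
has edges leaving it, and a new round starts in each gap, with the colours shifted to suit the upper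
end of the gap.

The second half splits capped graphs. A triangle-free capped graph has a proper colouring with four
colours (`TriangleFreeCapped.zone_proper`). In a capped graph with largest cliques of size j, the
edges between the first two vertices of the j-cliques form a triangle-free capped graph
(`startEdge_triangleFreeCapped`); colouring it with four colours lowers the clique number of every
class. After ω - 1 such refinements the 3 · 4^(ω-1) classes are independent, and this number is at
most 3 · 4^ω · (ω-1) for ω ≥ 2.

For the algorithm, every object above is defined by quantifiers over vertices or is a fixed point
reached after at most N iterations. Both are expressed in a small language of bounded sums, parallel
assignments and N-fold repetitions, which is compiled to the machine with a polynomial time bound.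
The clique number is computable because two adjacent vertices and their common neighbours above them
induce a capped graph (`maskAdj_capped`), where cliques can be recognized recursively by their first
two vertices. The bound on the chromatic number is read off from the output of the program. -/

def ChordIn (A : V → V → Prop) (e : V × V) : Prop := e.1 < e.2 ∧ A e.1 e.2

/-- No end of `e` lies strictly between `a` and `d`. -/
def Avoids (a d : V) (e : V × V) : Prop := ¬ (a < e.1 ∧ e.1 < d) ∧ ¬ (a < e.2 ∧ e.2 < d)

def ChordAv (A : V → V → Prop) (a d : V) (e : V × V) : Prop := ChordIn A e ∧ Avoids a d e

def CrossSym (e f : V × V) : Prop :=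
  (e.1 < f.1 ∧ f.1 < e.2 ∧ e.2 < f.2) ∨ (f.1 < e.1 ∧ e.1 < f.2 ∧ f.2 < e.2)

def CrossStep (A : V → V → Prop) (a d : V) (e f : V × V) : Prop :=
  ChordAv A a d e ∧ ChordAv A a d f ∧ CrossSym e f

/-- `e` and `f` are joined by a path of crossing chords without ends between `a` and `d`. -/
def ConnAv (A : V → V → Prop) (a d : V) (e f : V × V) : Prop :=
  ChordAv A a d e ∧ ChordAv A a d f ∧ Relation.ReflTransGen (CrossStep A a d) e f

def EndAt (e : V × V) (a : V) : Prop := e.1 = a ∨ e.2 = a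

/-- `a` and `d` are joined by crossing chords going around the interval between them. -/
def Linked (A : V → V → Prop) (a d : V) : Prop :=
  ∃ e f, EndAt e a ∧ EndAt f d ∧ ConnAv A a d e f

/-- The form in which `HFree` is used. -/
def CrossClosed (A : V → V → Prop) : Prop :=
  ∀ a b c d, a < b → b < c → c < d → A a c → A b d → Linked A a d → A a d

variable {A : V → V → Prop} {a d a' d' : V} {e f g : V × V}

theorem CrossSym.symm (h : CrossSym e f) : CrossSym f e := by
  unfold CrossSym at *; tauto

theorem CrossStep.symm (h : CrossStep A a d e f) : CrossStep A a d f e := ⟨h.2.1, h.1, h.2.2.symm⟩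

theorem ConnAv.refl (h : ChordAv A a d e) : ConnAv A a d e e := ⟨h, h, .refl⟩

theorem ConnAv.symm (h : ConnAv A a d e f) : ConnAv A a d f e :=
  ⟨h.2.1, h.1, by
    have h3 := h.2.2
    induction h3 with
    | refl => exact .refl
    | tail _ h2 ih => exact .head h2.symm (ih ⟨h.1, h2.1, by assumption⟩)⟩

theorem ConnAv.trans (h : ConnAv A a d e f) (h' : ConnAv A a d f g) : ConnAv A a d e g :=
  ⟨h.1, h'.2.1, h.2.2.trans h'.2.2⟩

theorem ConnAv.of_cross (h : ChordAv A a d e) (h' : ChordAv A a d f) (hc : CrossSym e f) :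
    ConnAv A a d e f := ⟨h, h', .single ⟨h, h', hc⟩⟩

theorem ChordAv.mono (h : ChordAv A a d e) (ha : a ≤ a') (hd : d' ≤ d) : ChordAv A a' d' e :=
  ⟨h.1, fun x => h.2.1 ⟨ha.trans_lt x.1, x.2.trans_le hd⟩,
    fun x => h.2.2 ⟨ha.trans_lt x.1, x.2.trans_le hd⟩⟩

theorem ConnAv.mono (h : ConnAv A a d e f) (ha : a ≤ a') (hd : d' ≤ d) : ConnAv A a' d' e f :=
  ⟨h.1.mono ha hd, h.2.1.mono ha hd,
    Relation.ReflTransGen.mono (r := CrossStep A a d)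
      (fun _ _ x => ⟨x.1.mono ha hd, x.2.1.mono ha hd, x.2.2⟩) _ _ h.2.2⟩

/-- Chain of crossing chords leaving `v` to the left which gets strictly below `x`. -/
inductive LeftReach (A : V → V → Prop) (v : V) : V → Prop
  | base {u x : V} : A u v → u < v → u < x → LeftReach A v x
  | step {w u x : V} : LeftReach A v w → w < v → A u w → u < x → LeftReach A v x

theorem LeftReach.trans {z s x : V} (h : LeftReach A z s) (hs : s < z) (h' : LeftReach A s x) :
    LeftReach A z x := by
  induction h' with
  | base h1 h2 h3 => exact .step h hs h1 h3
  | step h1 h2 h3 h4 ih => exact .step ih (h2.trans hs) h3 h4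

/-- All points between the reach of `z` and `z` are covered by chords linked to a chord at `z`,
whose ends are at most `z`. -/
theorem LeftReach.cover {z x : V} (h : LeftReach A z x) :
    ∃ e : V × V, e.2 = z ∧ ∀ t, x ≤ t → t < z → ∃ f : V × V, f.1 < t ∧ t < f.2 ∧ f.2 ≤ z ∧
      ∀ d, ConnAv A z d e f := by
  induction h with
  | @base u x h1 h2 h3 =>
    refine ⟨(u, z), rfl, fun t hxt htz => ⟨(u, z), h3.trans_le hxt, htz, le_rfl, fun d => ?_⟩⟩
    exact .refl ⟨⟨h2, h1⟩, fun y => absurd (y.1.trans h2) (lt_irrefl _), fun y => lt_irrefl _ y.1⟩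
  | @step w u x h1 h2 h3 h4 ih =>
    obtain ⟨e, he, ih⟩ := ih
    refine ⟨e, he, fun t hxt htz => ?_⟩
    -- Below `w`, let `f` be the chord over `w`. Either `f` starts at or below `u` and covers `t` as
    -- well, or `(u, w)` crosses `f` and covers `t` itself.
    by_cases hwt : w ≤ t
    · exact ih t hwt htz
    push Not at hwt
    obtain ⟨f, f1, f2, f3, f4⟩ := ih w le_rfl h2
    by_cases hu : f.1 ≤ u
    · exact ⟨f, hu.trans_lt (h4.trans_le hxt), hwt.trans f2, f3, f4⟩
    push Not at hu
    refine ⟨(u, w), h4.trans_le hxt, hwt, h2.le, fun d => (f4 d).trans ?_⟩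
    refine .of_cross (f4 d).2.1 ⟨⟨h4.trans_le hxt |>.trans hwt, h3⟩, fun y => ?_, fun y => ?_⟩
      (Or.inr ⟨hu, f1, f2⟩)
    · exact absurd (y.1.trans (h4.trans_le hxt |>.trans hwt)) h2.not_gt
    · exact absurd y.1 h2.not_gt

/-- Notions to the right are the notions to the left for the order dual `Vᵒᵈ`. A chord has its
smaller end first, so dualizing swaps the components of the pair; this is where the symmetry of `A`
is needed. -/
def RightReach (A : V → V → Prop) (v x : V) : Prop := @LeftReach Vᵒᵈ _ A v x

theorem RightReach.base {v u x : V} (h1 : A u v) (h2 : v < u) (h3 : x < u) : RightReach A v x :=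
  LeftReach.base (V := Vᵒᵈ) h1 h2 h3

theorem crossSym_dual {e f : V × V} (h : CrossSym e f) :
    @CrossSym Vᵒᵈ _ (e.2, e.1) (f.2, f.1) := by
  rcases h with h | h
  · exact Or.inr ⟨h.2.2, h.2.1, h.1⟩
  · exact Or.inl ⟨h.2.2, h.2.1, h.1⟩

theorem chordAv_dual (hs : ∀ u v, A u v → A v u) {e : V × V} (h : ChordAv A a d e) :
    @ChordAv Vᵒᵈ _ A d a (e.2, e.1) :=
  ⟨⟨h.1.1, hs _ _ h.1.2⟩, fun x => h.2.2 ⟨x.2, x.1⟩, fun x => h.2.1 ⟨x.2, x.1⟩⟩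

theorem connAv_dual (hs : ∀ u v, A u v → A v u) {e f : V × V} (h : ConnAv A a d e f) :
    @ConnAv Vᵒᵈ _ A d a (e.2, e.1) (f.2, f.1) :=
  ⟨chordAv_dual hs h.1, chordAv_dual hs h.2.1,
    Relation.ReflTransGen.lift (r := CrossStep A a d) (fun e : V × V => ((e.2, e.1) : Vᵒᵈ × Vᵒᵈ))
      (fun _ _ x => ⟨chordAv_dual hs x.1, chordAv_dual hs x.2.1, crossSym_dual x.2.2⟩) _ _ h.2.2⟩

theorem linked_dual (hs : ∀ u v, A u v → A v u) (h : Linked A a d) : @Linked Vᵒᵈ _ A d a := by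
  obtain ⟨e, f, he, hf, h⟩ := h
  exact ⟨(f.2, f.1), (e.2, e.1), hf.symm, he.symm, (connAv_dual hs h).symm⟩

theorem RightReach.cover (hs : ∀ u v, A u v → A v u) {z x : V} (h : RightReach A z x) :
    ∃ e : V × V, e.1 = z ∧ ∀ t, t ≤ x → z < t → ∃ f : V × V, f.1 < t ∧ t < f.2 ∧ z ≤ f.1 ∧
      ∀ a, ConnAv A a z e f := by
  obtain ⟨e, he, h⟩ := LeftReach.cover (V := Vᵒᵈ) h
  refine ⟨(e.2, e.1), he, fun t ht hz => ?_⟩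
  obtain ⟨f, f1, f2, f3, f4⟩ := h t ht hz
  refine ⟨(f.2, f.1), f2, f1, f3, fun a => ?_⟩
  exact connAv_dual (V := Vᵒᵈ) (A := A) hs (f4 a)

end Chords

/-! ### One step of the construction inside a gap -/

section GapStep
variable {V : Type*} [LinearOrder V]

/-- `t` has a neighbour below the gap `(p, q)`. -/
def ExitL (A : V → V → Prop) (p q t : V) : Prop := p < t ∧ t < q ∧ ∃ u, u < p ∧ A u t

/-- No vertex of the gap `(p, q)` has a neighbour above it. -/
def NoExitR (A : V → V → Prop) (p q : V) : Prop := ∀ t w, p < t → t < q → A t w → w ≤ q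

/-- Hooks are neighbours of an end of the gap which would lose this end because a picked vertex
separates them from it. The edge to the end crosses a chord of a separating vertex, so picking the
hook keeps all chords joined. New hooks may separate further neighbours of the ends, but the three
stages `HookL0`, `HookR`, `HookL` already give a closed set, because of `Picked.top`. -/
def HookL0 (A : V → V → Prop) (p q v : V) : Prop :=
  p < v ∧ v < q ∧ A p v ∧ ∃ t, t < v ∧ ExitL A p q t

/-- A hook at `q` need not reach below `p`. When some vertex of the gap has a neighbour above `q`,
such hooks are not picked, so that every picked vertex reaches below `p`; then `GapClosed` forbids
it neighbours above `q`. -/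
def HookR (A : V → V → Prop) (p q v : V) : Prop :=
  NoExitR A p q ∧ p < v ∧ v < q ∧ A v q ∧ ∃ t, v < t ∧ (ExitL A p q t ∨ HookL0 A p q t)

def HookL (A : V → V → Prop) (p q v : V) : Prop :=
  p < v ∧ v < q ∧ A p v ∧ ∃ t, t < v ∧ (ExitL A p q t ∨ HookR A p q t)

def Picked (A : V → V → Prop) (p q v : V) : Prop :=
  ExitL A p q v ∨ HookR A p q v ∨ HookL A p q v

/-- The chords witnessing that `t` is picked. -/
def PickChord (A : V → V → Prop) (p q t : V) (e : V × V) : Prop :=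
  (∃ u, u < p ∧ A u t ∧ e = (u, t)) ∨ (HookL A p q t ∧ e = (p, t)) ∨ (HookR A p q t ∧ e = (t, q))

/-- Vertices which are caught between vertices of `P`. -/
def Caught (A : V → V → Prop) (P : V → Prop) (p q z : V) : Prop :=
  p < z ∧ z < q ∧ ¬ P z ∧ ∃ s₁ s₂, s₁ < z ∧ z < s₂ ∧
    (s₁ = p ∨ P s₁) ∧ (s₂ = q ∨ P s₂) ∧
    (∀ x, s₁ < x → x < s₂ → ¬ P x) ∧ LeftReach A z s₁ ∧ RightReach A z s₂

def Taken (A : V → V → Prop) (P : V → Prop) (p q z : V) : Prop := P z ∨ Caught A P p q z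

/-- The vertices of the gap are not both left- and right-connected to the outside. -/
def GapClosed (A : V → V → Prop) (p q : V) : Prop :=
  ∀ v, p < v → v < q → ¬ (LeftReach A v p ∧ RightReach A v q)

/-- All chords leaving the gap cross chords that are connected outside of the gap to `g`. -/
def GapBase (A : V → V → Prop) (p q : V) (g : V × V) : Prop :=
  ChordAv A p q g ∧
  (∀ u t, u < p → p < t → t < q → A u t → ∃ f, CrossSym (u, t) f ∧ ConnAv A p q f g) ∧
  (∀ t w, p < t → t < q → q < w → A t w → ∃ f, CrossSym (t, w) f ∧ ConnAv A p q f g)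

/-- The boundary vertex `x` of the gap is joined to the base `g`. -/
def BdLinked (A : V → V → Prop) (p q : V) (g : V × V) (x : V) : Prop :=
  A p q ∨ ∃ f, EndAt f x ∧ ConnAv A p q f g

variable {A : V → V → Prop} {p q a d s s' t v z : V} {e f g : V × V}

theorem chordAv_mk {u t : V} (h : u < t) (hA : A u t) (h1 : u ≤ a ∨ d ≤ u) (h2 : t ≤ a ∨ d ≤ t) :
    ChordAv A a d (u, t) :=
  ⟨⟨h, hA⟩, fun x => h1.elim (fun y => y.not_gt x.1) fun y => y.not_gt x.2,
    fun x => h2.elim (fun y => y.not_gt x.1) fun y => y.not_gt x.2⟩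

theorem HookL0.hookL (h : HookL0 A p q v) : HookL A p q v :=
  ⟨h.1, h.2.1, h.2.2.1, h.2.2.2.imp fun _ x => ⟨x.1, Or.inl x.2⟩⟩

theorem Picked.lt (h : Picked A p q v) : p < v ∧ v < q := by
  rcases h with h | h | h
  · exact ⟨h.1, h.2.1⟩
  · exact ⟨h.2.1, h.2.2.1⟩
  · exact ⟨h.1, h.2.1⟩

theorem ExitL.leftReach (h : ExitL A p q v) : LeftReach A v p := by
  obtain ⟨h1, _, u, hu, hA⟩ := h
  exact .base hA (hu.trans h1) hu

theorem HookL0.leftReach (h : HookL0 A p q v) : LeftReach A v p := by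
  obtain ⟨h1, _, hA, t, ht, h3, _, u, hu, hA'⟩ := h
  exact .step (.base hA h1 h3) ht hA' hu

/-- A hooked vertex above a picked one is reached through an exit, or through a right hook. -/
theorem HookL.cases (h : HookL A p q v) :
    HookL0 A p q v ∨ ∃ t, t < v ∧ HookR A p q t := by
  obtain ⟨h1, h2, h3, t, h4, h5 | h5⟩ := h
  · exact Or.inl ⟨h1, h2, h3, t, h4, h5⟩
  · exact Or.inr ⟨t, h4, h5⟩

/-- Above every picked vertex there is an exit or a simple left hook, not below it. -/
theorem Picked.top (h : Picked A p q v) : ∃ t, v ≤ t ∧ (ExitL A p q t ∨ HookL0 A p q t) := by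
  rcases h with h | h | h
  · exact ⟨v, le_rfl, Or.inl h⟩
  · obtain ⟨_, _, _, _, t, ht, h⟩ := h
    exact ⟨t, ht.le, h⟩
  · rcases h.cases with h0 | ⟨t, ht, htr⟩
    · exact ⟨v, le_rfl, Or.inr h0⟩
    · obtain ⟨_, _, _, _, t2, ht2, h2⟩ := htr
      by_cases hv : v ≤ t2
      · exact ⟨t2, hv, h2⟩
      push Not at hv
      refine ⟨v, le_rfl, Or.inr ⟨h.1, h.2.1, h.2.2.1, ?_⟩⟩
      rcases h2 with h2 | h2
      · exact ⟨t2, hv, h2⟩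
      · obtain ⟨_, _, _, t3, ht3, h3⟩ := h2
        exact ⟨t3, ht3.trans hv, h3⟩

theorem top_chord (h : ExitL A p q t ∨ HookL0 A p q t) :
    ∃ u, u ≤ p ∧ A u t ∧ PickChord A p q t (u, t) ∧ p < t ∧ t < q := by
  rcases h with h | h
  · obtain ⟨h1, h2, u, hu, hA⟩ := h
    exact ⟨u, hu.le, hA, Or.inl ⟨u, hu, hA, rfl⟩, h1, h2⟩
  · exact ⟨p, le_rfl, h.2.2.1, Or.inr (Or.inl ⟨h.hookL, rfl⟩), h.1, h.2.1⟩

theorem Picked.exists_chord (h : Picked A p q v) : ∃ e, PickChord A p q v e := by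
  rcases h with h | h | h
  · obtain ⟨h1, h2, u, hu, hA⟩ := h
    exact ⟨_, Or.inl ⟨u, hu, hA, rfl⟩⟩
  · exact ⟨_, Or.inr (Or.inr ⟨h, rfl⟩)⟩
  · exact ⟨_, Or.inr (Or.inl ⟨h, rfl⟩)⟩

/-- Picked vertices outside of `(a, d)` whose chords are joined to the base. -/
theorem GapBase.exit_conn (hb : GapBase A p q g) {u : V} (hu : u < p) (hA : A u t) (ht : p < t ∧ t < q)
    (ha : p ≤ a) (hd : d ≤ q) (htad : t ≤ a ∨ d ≤ t) : ConnAv A a d (u, t) g := by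
  obtain ⟨f, hf, hc⟩ := hb.2.1 u t hu ht.1 ht.2 hA
  have hc := hc.mono ha hd
  exact (ConnAv.of_cross (chordAv_mk (hu.trans ht.1) hA (Or.inl (hu.le.trans ha)) htad) hc.1 hf).trans hc

theorem HookL0.conn (hb : GapBase A p q g) (h : HookL0 A p q v) (ha : p ≤ a) (hd : d ≤ q)
    (hva : v ≤ a) : ConnAv A a d (p, v) g := by
  obtain ⟨h1, h2, hA, t, ht, h3, h4, u, hu, hA'⟩ := h
  have := hb.exit_conn hu hA' ⟨h3, h4⟩ ha hd (Or.inl (ht.le.trans hva))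
  exact (ConnAv.of_cross (chordAv_mk h1 hA (Or.inl ha) (Or.inl hva)) this.1
    (Or.inr ⟨hu, h3, ht⟩)).trans this

/-- The table of connections between picked vertices. -/
theorem picked_conn (hb : GapBase A p q g) (ha : Picked A p q a) (hd : Picked A p q d) (had : a < d) :
    ∃ e f, PickChord A p q a e ∧ PickChord A p q d f ∧ ConnAv A a d e f := by
  have hal := ha.lt
  have hdl := hd.lt
  -- two chords of the stated shapes avoid `(a, d)`
  have topc : ∀ t, (d ≤ t) → ∀ u, u ≤ p → A u t → p < t → ChordAv A a d (u, t) := fun t ht u hu hA hp =>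
    chordAv_mk (hu.trans_lt hp) hA (Or.inl (hu.trans hal.1.le)) (Or.inr ht)
  have case1 : (ExitL A p q a ∨ HookL0 A p q a) → ∃ e f, PickChord A p q a e ∧ PickChord A p q d f ∧
      ConnAv A a d e f := by
    intro h
    -- an exit `t ≤ a` and a chord of `a` joined to the base
    obtain ⟨e, he, hec, t, hta, ht⟩ : ∃ e, PickChord A p q a e ∧ ConnAv A a d e g ∧
        ∃ t, t ≤ a ∧ ExitL A p q t := by
      rcases h with h | h
      · obtain ⟨h1, h2, u, hu, hA⟩ := id h
        exact ⟨_, Or.inl ⟨u, hu, hA, rfl⟩,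
          hb.exit_conn hu hA ⟨h1, h2⟩ hal.1.le hdl.2.le (Or.inl le_rfl), a, le_rfl, h⟩
      · refine ⟨_, Or.inr (Or.inl ⟨h.hookL, rfl⟩), h.conn hb hal.1.le hdl.2.le le_rfl, ?_⟩
        obtain ⟨_, _, _, t, ht, h⟩ := h
        exact ⟨t, ht.le, h⟩
    obtain ⟨ht1, ht2, w, hw, hwA⟩ := ht
    have htc := hb.exit_conn hw hwA ⟨ht1, ht2⟩ hal.1.le hdl.2.le (Or.inl hta)
    rcases hd with hd | hd | hd
    · obtain ⟨h1, h2, u, hu, hA⟩ := hd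
      exact ⟨e, _, he, Or.inl ⟨u, hu, hA, rfl⟩, hec.trans
        (hb.exit_conn hu hA ⟨h1, h2⟩ hal.1.le hdl.2.le (Or.inr le_rfl)).symm⟩
    · refine ⟨e, _, he, Or.inr (Or.inr ⟨hd, rfl⟩), hec.trans ?_⟩
      have hdc : ChordAv A a d (d, q) := chordAv_mk hdl.2 hd.2.2.2.1 (Or.inr le_rfl) (Or.inr hdl.2.le)
      obtain ⟨_, _, _, _, t2, ht2', h2 | h2⟩ := hd
      · obtain ⟨h3, h4, u, hu, hA⟩ := h2
        refine ((ConnAv.of_cross hdc (topc t2 ht2'.le u hu.le hA h3)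
          (Or.inr ⟨hu.trans hdl.1, ht2', h4⟩)).trans
          (hb.exit_conn hu hA ⟨h3, h4⟩ hal.1.le hdl.2.le (Or.inr ht2'.le))).symm
      · refine ((ConnAv.of_cross hdc (topc t2 ht2'.le p le_rfl h2.2.2.1 h2.1)
          (Or.inr ⟨hdl.1, ht2', h2.2.1⟩)).trans
          ((ConnAv.of_cross (topc t2 ht2'.le p le_rfl h2.2.2.1 h2.1) htc.1
            (Or.inr ⟨hw, ht1, hta.trans_lt (had.trans ht2')⟩)).trans htc)).symm
    · refine ⟨e, _, he, Or.inr (Or.inl ⟨hd, rfl⟩), hec.trans ?_⟩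
      have hdc : ChordAv A a d (p, d) := chordAv_mk hdl.1 hd.2.2.1 (Or.inl hal.1.le) (Or.inr le_rfl)
      exact ((ConnAv.of_cross hdc htc.1 (Or.inr ⟨hw, ht1, hta.trans_lt had⟩)).trans htc).symm
  -- a chord `(t, q)` with `t ≤ a` crosses or is joined to all chords of `d`
  have caseR : ∀ t, t ≤ a → p < t → A t q → ∃ f, PickChord A p q d f ∧ ConnAv A a d (t, q) f := by
    intro t hta hpt hA
    have htc : ChordAv A a d (t, q) := chordAv_mk (hta.trans_lt hal.2) hA (Or.inl hta) (Or.inr hdl.2.le)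
    rcases hd with hd | hd | hd
    · obtain ⟨h1, h2, u, hu, hA'⟩ := hd
      exact ⟨_, Or.inl ⟨u, hu, hA', rfl⟩, .of_cross htc (topc d le_rfl u hu.le hA' h1)
        (Or.inr ⟨hu.trans hpt, hta.trans_lt had, h2⟩)⟩
    · refine ⟨_, Or.inr (Or.inr ⟨hd, rfl⟩), ?_⟩
      have hdc : ChordAv A a d (d, q) := chordAv_mk hdl.2 hd.2.2.2.1 (Or.inr le_rfl) (Or.inr hdl.2.le)
      obtain ⟨_, _, _, _, t2, ht2', h2⟩ := hd
      obtain ⟨u, hu, hA', _, h3, h4⟩ := top_chord h2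
      have h5 := topc t2 ht2'.le u hu hA' h3
      exact (ConnAv.of_cross htc h5 (Or.inr ⟨hu.trans_lt hpt, hta.trans_lt (had.trans ht2'), h4⟩)).trans
        (.of_cross h5 hdc (Or.inl ⟨hu.trans_lt hdl.1, ht2', h4⟩))
    · exact ⟨_, Or.inr (Or.inl ⟨hd, rfl⟩), .of_cross htc (topc d le_rfl p le_rfl hd.2.2.1 hdl.1)
        (Or.inr ⟨hpt, hta.trans_lt had, hdl.2⟩)⟩
  -- A right hook, or a left hook above a right hook, provides a chord `(t, q)` with `t ≤ a`; in the
  -- remaining cases `a` is joined to the base.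
  rcases ha with ha | ha | ha
  · exact case1 (Or.inl ha)
  · obtain ⟨f, hf, hc⟩ := caseR a le_rfl hal.1 ha.2.2.2.1
    exact ⟨_, f, Or.inr (Or.inr ⟨ha, rfl⟩), hf, hc⟩
  · rcases ha.cases with h0 | ⟨t, ht, htr⟩
    · exact case1 (Or.inr h0)
    · obtain ⟨f, hf, hc⟩ := caseR t ht.le htr.2.1 htr.2.2.2.1
      refine ⟨_, f, Or.inr (Or.inl ⟨ha, rfl⟩), hf, (ConnAv.of_cross (chordAv_mk hal.1 ha.2.2.1
        (Or.inl hal.1.le) (Or.inl le_rfl)) hc.1 (Or.inl ⟨htr.2.1, ht, hal.2⟩)).trans hc⟩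

/-- Chords of picked vertices are joined to the base avoiding any interval without picked vertices. -/
theorem PickChord.conn_base (hb : GapBase A p q g) (h : PickChord A p q t e) (ht : Picked A p q t)
    (hs : p ≤ s) (hs' : s' ≤ q) (hS : ∀ x, s < x → x < s' → ¬ Picked A p q x) :
    ConnAv A s s' e g := by
  -- All chords used below have their end inside the gap at a picked vertex, so they avoid the
  -- interval.
  have out : ∀ x, Picked A p q x → x ≤ s ∨ s' ≤ x := fun x hx => by
    by_contra hcon; push Not at hcon; exact hS x hcon.1 hcon.2 hx
  have topc : ∀ t, (ExitL A p q t ∨ HookL0 A p q t) → ∃ u, u ≤ p ∧ p < t ∧ t < q ∧ ConnAv A s s' (u, t) g := by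
    rintro t (h | h)
    · have hp : Picked A p q t := Or.inl h
      obtain ⟨h1, h2, u, hu, hA⟩ := h
      exact ⟨u, hu.le, h1, h2, hb.exit_conn hu hA ⟨h1, h2⟩ hs hs' (out _ hp)⟩
    · have hp : Picked A p q t := Or.inr (Or.inr h.hookL)
      obtain ⟨h1, h2, hA, t2, ht2, h3⟩ := h
      have hp2 : Picked A p q t2 := Or.inl h3
      obtain ⟨h3, h4, u, hu, hA'⟩ := h3
      have := hb.exit_conn hu hA' ⟨h3, h4⟩ hs hs' (out _ hp2)
      exact ⟨p, le_rfl, h1, h2, (ConnAv.of_cross (chordAv_mk h1 hA (Or.inl hs) (out _ hp)) this.1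
        (Or.inr ⟨hu, h3, ht2⟩)).trans this⟩
  have rc : ∀ t, HookR A p q t → ConnAv A s s' (t, q) g := by
    intro t h
    have hp : Picked A p q t := Or.inr (Or.inl h)
    obtain ⟨_, h1, h2, hA, t2, ht2, h3⟩ := h
    obtain ⟨u, hu, h4, h5, hc⟩ := topc t2 h3
    exact (ConnAv.of_cross (chordAv_mk h2 hA (out _ hp) (Or.inr hs')) hc.1
      (Or.inr ⟨hu.trans_lt h1, ht2, h5⟩)).trans hc
  rcases h with ⟨u, hu, hA, rfl⟩ | ⟨hh, rfl⟩ | ⟨hh, rfl⟩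
  · exact hb.exit_conn hu hA ht.lt hs hs' (out _ ht)
  · have hc := ChordAv.mono (chordAv_mk (a := s) (d := s') ht.lt.1 hh.2.2.1 (Or.inl hs) (out _ ht)) le_rfl le_rfl
    obtain ⟨h1, h2, hA, t2, ht2, h3 | h3⟩ := hh
    · have hp2 : Picked A p q t2 := Or.inl h3
      obtain ⟨h3, h4, u, hu, hA'⟩ := h3
      have := hb.exit_conn hu hA' ⟨h3, h4⟩ hs hs' (out _ hp2)
      exact (ConnAv.of_cross hc this.1 (Or.inr ⟨hu, h3, ht2⟩)).trans this
    · exact (ConnAv.of_cross hc (rc t2 h3).1 (Or.inl ⟨h3.2.1, ht2, h2⟩)).trans (rc t2 h3)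
  · exact rc t hh

end GapStep

/-! ### Closing a set of picked vertices -/

section PickSystem
variable {V : Type*} [LinearOrder V]

/-- A set `P` of vertices of the gap `(p, q)`, each with chords `C` leaving the gap. -/
structure PickSystem (A : V → V → Prop) (p q : V) (g : V × V) (P : V → Prop)
    (C : V → V × V → Prop) : Prop where
  symm : ∀ u v, A u v → A v u
  lt : ∀ v, P v → p < v ∧ v < q
  ex : ∀ v, P v → ∃ e, C v e
  shape : ∀ v e, C v e → (∃ u, u ≤ p ∧ A u v ∧ e = (u, v)) ∨
    (NoExitR A p q ∧ A v q ∧ e = (v, q) ∧ ∃ t, v < t ∧ P t)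
  exitL : ∀ u t, A u t → u < p → p < t → t < q → P t
  hookL : ∀ s t, A p t → P s → s < t → t < q → P t
  hookR : ∀ s t, NoExitR A p q → A t q → P s → p < t → t < s → P t
  conn : ∀ a d, P a → P d → a < d → ∃ e f, C a e ∧ C d f ∧ ConnAv A a d e f
  base : ∀ t e s s', P t → C t e → p ≤ s → s' ≤ q → (∀ x, s < x → x < s' → ¬ P x) → ConnAv A s s' e g
  -- In both cases a taken vertex has no neighbour above `q`; in the second one such a neighbour
  -- would contradict `GapClosed`.
  reach : NoExitR A p q ∨ ∀ v, P v → LeftReach A v p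
  -- The path from `d` arrives at `p` itself, or at an exit chord whose upper end is not below `d`;
  -- from there the base leads on to `p`.
  bdL : ∀ d, P d → ∃ e f, C d e ∧ ConnAv A p d e f ∧
    (EndAt f p ∨ ∃ u t, u < p ∧ d ≤ t ∧ t < q ∧ A u t ∧ f = (u, t))

theorem RightReach.trans {A : V → V → Prop} {z s x : V} (h : RightReach A z s) (hs : z < s)
    (h' : RightReach A s x) : RightReach A z x :=
  LeftReach.trans (V := Vᵒᵈ) h hs h'

variable {A : V → V → Prop} {p q a d s s' t v z : V} {e f g : V × V} {P : V → Prop}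
  {C : V → V × V → Prop}

namespace PickSystem
variable (H : PickSystem A p q g P C)
include H

theorem taken_lt (h : Taken A P p q v) : p < v ∧ v < q := by
  rcases h with h | h
  · exact H.lt v h
  · exact ⟨h.1, h.2.1⟩

theorem chordAv (h : C v e) (hv : p < v ∧ v < q) (ha : p ≤ a) (hd : d ≤ q)
    (hvad : v ≤ a ∨ d ≤ v) : ChordAv A a d e := by
  rcases H.shape v e h with ⟨u, hu, hA, rfl⟩ | ⟨_, hA, rfl, _⟩
  · exact chordAv_mk (hu.trans_lt hv.1) hA (Or.inl (hu.trans ha)) hvad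
  · exact chordAv_mk hv.2 hA hvad (Or.inr hd)

/-- A chord over a picked vertex, between vertices that are not picked, crosses its chords. -/
theorem caught_bounds (hc : GapClosed A p q) (h : Caught A P p q z) :
    ∃ s₁ s₂, s₁ < z ∧ z < s₂ ∧ P s₁ ∧ P s₂ ∧
    (∀ x, s₁ < x → x < s₂ → ¬ P x) ∧ LeftReach A z s₁ ∧ RightReach A z s₂ := by
  obtain ⟨hz1, hz2, hzP, s₁, s₂, h1, h2, h3, h4, h5, h6, h7⟩ := h
  -- If `s₁ = p`, the chord that covers `p` on the way from `z` to the left has an exit as its upper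
  -- end, a picked vertex between `s₁` and `s₂`.
  have hs1 : P s₁ := by
    rcases h3 with rfl | h3
    · obtain ⟨e, he, hcov⟩ := h6.cover
      obtain ⟨f, f1, f2, f3, f4⟩ := hcov s₁ le_rfl h1
      have := H.exitL f.1 f.2 (f4 z).2.1.1.2 f1 f2 (f3.trans_lt hz2)
      exact absurd this (h5 _ f2 (f3.trans_lt h2))
    · exact h3
  refine ⟨s₁, s₂, h1, h2, hs1, ?_, h5, h6, h7⟩
  -- For `s₂ = q`, the chord over `q` starts in the gap, against `NoExitR`; or else `z` reaches
  -- below `p` through `s₁`, against `GapClosed`.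
  rcases h4 with rfl | h4
  · rcases H.reach with hN | hN
    · exfalso
      obtain ⟨e, he, hcov⟩ := h7.cover H.symm
      obtain ⟨f, f1, f2, f3, f4⟩ := hcov s₂ le_rfl h2
      exact f2.not_ge (hN f.1 f.2 (hz1.trans_le f3) f1 (f4 z).2.1.1.2)
    · exact absurd ⟨h6.trans h1 (hN _ hs1), h7⟩ (hc z hz1 hz2)
  · exact h4

/-- A caught vertex is joined on its left side to a picked vertex. -/
theorem taken_left (hc : GapClosed A p q) (h : Taken A P p q z) :
    ∃ s, s ≤ z ∧ P s ∧ (∀ x, s < x → x ≤ z → ¬ P x) ∧ ∃ e₀, ∀ e, C s e → ∃ e', EndAt e' z ∧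
      (∀ d, d ≤ q → ConnAv A z d e' e) ∧ (s < z → e' = e₀) ∧
      ∀ u, s ≤ u → u < z → ∃ f, f.1 < u ∧ u < f.2 ∧ f.2 ≤ z ∧ ∀ d, d ≤ q → ConnAv A z d f e := by
  rcases h with h | h
  · refine ⟨z, le_rfl, h, fun x h1 h2 => absurd h1 h2.not_gt, (z, z), fun e he => ⟨e, ?_, fun d hd => ?_,
      fun h => absurd h (lt_irrefl _), fun u h1 h2 => absurd h2 h1.not_gt⟩⟩
    · rcases H.shape z e he with ⟨u, _, _, rfl⟩ | ⟨_, _, rfl, _⟩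
      · exact Or.inr rfl
      · exact Or.inl rfl
    · exact .refl (H.chordAv he (H.lt z h) (H.lt z h).1.le hd (Or.inl le_rfl))
  · obtain ⟨s₁, s₂, h1, h2, h3, h4, h5, h6, h7⟩ := H.caught_bounds hc h
    obtain ⟨e₀, he₀, hcov⟩ := h6.cover
    have hs := H.lt _ h3
    refine ⟨s₁, h1.le, h3, fun x g1 g2 => h5 x g1 (g2.trans_lt h2), e₀, fun e he => ?_⟩
    obtain ⟨f, f1, f2, f3, f4⟩ := hcov s₁ le_rfl h1
    -- The upper end of `f` lies above `s₁` and is not picked. So the lower end is not below `p`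
    -- (this would be an exit), and it is not `p` (this would be a left hook); hence `f` crosses
    -- every chord of `s₁`.
    have fp : p ≤ f.1 := by
      by_contra hcon
      push Not at hcon
      exact h5 f.2 f2 (f3.trans_lt h2)
        (H.exitL f.1 f.2 (f4 z).2.1.1.2 hcon (hs.1.trans f2) (f3.trans_lt h.2.1))
    have fx : CrossSym f e := by
      rcases H.shape s₁ e he with ⟨u, hu, hA', rfl⟩ | ⟨hN, hA', rfl, _⟩
      · rcases (hu.trans fp).eq_or_lt with g | g
        · have hxp : f.1 = p := le_antisymm (g ▸ hu) fp
          exact absurd (H.hookL s₁ f.2 (hxp ▸ (f4 z).2.1.1.2) h3 f2 (f3.trans_lt h.2.1))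
            (h5 _ f2 (f3.trans_lt h2))
        · exact Or.inr ⟨g, f1, f2⟩
      · exact Or.inl ⟨f1, f2, f3.trans_lt h.2.1⟩
    have fe : ∀ d, d ≤ q → ConnAv A z d f e := fun d hd =>
      .of_cross (f4 d).2.1 (H.chordAv he hs h.1.le hd (Or.inl h1.le)) fx
    refine ⟨e₀, Or.inr he₀, fun d hd => (f4 d).trans (fe d hd), fun _ => rfl, fun u g1 g2 => ?_⟩
    obtain ⟨f', k1, k2, k3, k4⟩ := hcov u g1 g2
    exact ⟨f', k1, k2, k3, fun d hd => (k4 d).symm.trans ((f4 d).trans (fe d hd))⟩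

/-- A caught vertex is joined on its right side to a picked vertex. -/
theorem taken_right (hc : GapClosed A p q) (h : Taken A P p q z) :
    ∃ s, z ≤ s ∧ P s ∧ (∀ x, z ≤ x → x < s → ¬ P x) ∧ ∀ e, C s e → (∃ e', EndAt e' z ∧
      (∀ a, p ≤ a → ConnAv A a z e' e)) ∧
      ∀ u, z < u → u ≤ s → ∃ f, f.1 < u ∧ u < f.2 ∧ z ≤ f.1 ∧ ∀ a, p ≤ a → ConnAv A a z f e := by
  rcases h with h | h
  · refine ⟨z, le_rfl, h, fun x h1 h2 => absurd h2 h1.not_gt, fun e he => ⟨⟨e, ?_, fun d hd => ?_⟩,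
      fun u h1 h2 => absurd h1 h2.not_gt⟩⟩
    · rcases H.shape z e he with ⟨u, _, _, rfl⟩ | ⟨_, _, rfl, _⟩
      · exact Or.inr rfl
      · exact Or.inl rfl
    · exact .refl (H.chordAv he (H.lt z h) hd (H.lt z h).2.le (Or.inr le_rfl))
  · obtain ⟨s₁, s₂, h1, h2, h3, h4, h5, h6, h7⟩ := H.caught_bounds hc h
    obtain ⟨e₀, he₀, hcov⟩ := h7.cover H.symm
    have hs := H.lt _ h4
    refine ⟨s₂, h2.le, h4, fun x g1 g2 => h5 x (h1.trans_le g1) g2, fun e he => ?_⟩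
    obtain ⟨f, f1, f2, f3, f4⟩ := hcov s₂ le_rfl h2
    have fx : CrossSym f e := by
      rcases H.shape s₂ e he with ⟨u, hu, hA', rfl⟩ | ⟨hN, hA', rfl, _⟩
      · exact Or.inr ⟨hu.trans_lt (h.1.trans_le f3), f1, f2⟩
      · have hf1 : p < f.1 := h.1.trans_le f3
        have h8 := hN f.1 f.2 hf1 (f1.trans hs.2) (f4 z).2.1.1.2
        rcases h8.eq_or_lt with h8 | h8
        · exact absurd (H.hookR s₂ f.1 hN (h8 ▸ (f4 z).2.1.1.2) h4 hf1 f1)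
            (h5 _ (h1.trans_le f3) f1)
        · exact Or.inl ⟨f1, f2, h8⟩
    have fe : ∀ a, p ≤ a → ConnAv A a z f e := fun a ha =>
      .of_cross (f4 a).2.1 (H.chordAv he hs ha h.2.1.le (Or.inr h2.le)) fx
    refine ⟨⟨e₀, Or.inl he₀, fun d hd => (f4 d).trans (fe d hd)⟩, fun u g1 g2 => ?_⟩
    obtain ⟨f', k1, k2, k3, k4⟩ := hcov u g2 g1
    exact ⟨f', k1, k2, k3, fun d hd => (k4 d).symm.trans ((f4 d).trans (fe d hd))⟩

/-- The path goes from `a` to the picked vertex `s ≤ a`, from a chord of `s` to a chord of the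
picked vertex `s' ≥ d`, and back to `d`. The field `conn` supplies just one pair of joined chords,
which is why `taken_left` and `taken_right` serve all chords of `s` and `s'`. -/
theorem taken_linked (hc : GapClosed A p q) (ha : Taken A P p q a) (hd : Taken A P p q d) (had : a < d) :
    Linked A a d := by
  obtain ⟨s, hs, hsP, _, _, hse⟩ := H.taken_left hc ha
  obtain ⟨s', hs', hsP', _, hse'⟩ := H.taken_right hc hd
  obtain ⟨e, f, he, hf, hef⟩ := H.conn s s' hsP hsP' (hs.trans_lt (had.trans_le hs'))
  obtain ⟨e', h1, h2, _⟩ := hse e he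
  obtain ⟨⟨f', h3, h4⟩, _⟩ := hse' f hf
  exact ⟨e', f', h1, h3, (h2 d (H.taken_lt hd).2.le).trans
    ((hef.mono hs hs').trans (h4 a (H.taken_lt ha).1.le).symm)⟩

theorem hookL_taken (hc : GapClosed A p q) (hA : A p v) (hv : v < q) (ht : Taken A P p q t) (htv : t < v) :
    P v := by
  obtain ⟨s, hs, hsP, _⟩ := H.taken_left hc ht
  exact H.hookL s v hA hsP (hs.trans_lt htv) hv

theorem hookR_taken (hc : GapClosed A p q) (hN : NoExitR A p q) (hA : A v q) (hv : p < v)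
    (ht : Taken A P p q t) (htv : v < t) : P v := by
  obtain ⟨s, hs, hsP, _⟩ := H.taken_right hc ht
  exact H.hookR s v hN hA hsP hv (htv.trans_le hs)

/-- A caught vertex reaches the picked vertex below it, and from there it continues below `p`. -/
theorem reach_taken (hc : GapClosed A p q) :
    NoExitR A p q ∨ ∀ v, Taken A P p q v → LeftReach A v p := by
  rcases H.reach with h | h
  · exact Or.inl h
  · refine Or.inr fun v hv => ?_
    rcases hv with hv | hv
    · exact h v hv
    · obtain ⟨s₁, s₂, h1, h2, h3, h4, h5, h6, h7⟩ := H.caught_bounds hc hv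
      exact h6.trans h1 (h _ h3)

/-- Taken vertices have no neighbours above the gap. -/
theorem taken_no_exitR (hc : GapClosed A p q) (hv : Taken A P p q v) {w : V} (hA : A v w) : w ≤ q := by
  have hl := H.taken_lt hv
  rcases H.reach_taken hc with h | h
  · exact h v w hl.1 hl.2 hA
  · by_contra hcon
    push Not at hcon
    exact hc v hl.1 hl.2 ⟨h v hv, .base (H.symm _ _ hA) (hl.2.trans hcon) hcon⟩

/-- Left boundary and taken vertex. -/
theorem linked_left (hc : GapClosed A p q) (hb : GapBase A p q g ∧ BdLinked A p q g p ∨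
    ∀ u t, u < p → p < t → t < q → ¬ A u t) (hd : Taken A P p q d) : Linked A p d := by
  obtain ⟨s', hs', hsP', _, hse'⟩ := H.taken_right hc hd
  have hdl := H.taken_lt hd
  obtain ⟨e, f, he, hef, hf⟩ := H.bdL s' hsP'
  obtain ⟨⟨e', h3, h4⟩, _⟩ := hse' e he
  have hc1 : ConnAv A p d e' f := (h4 p le_rfl).trans (hef.mono le_rfl hs')
  rcases hf with hf | ⟨u, t, hu, ht, htq, hA, rfl⟩
  · exact ⟨f, e', hf, h3, hc1.symm⟩
  · have hpt : p < t := hdl.1.trans_le (hs'.trans ht)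
    rcases hb with ⟨hb, hbd⟩ | hb
    · rcases hbd with hpq | ⟨f, hf, hfg⟩
      · refine ⟨(p, q), e', Or.inl rfl, h3, (hc1.trans (.of_cross hc1.2.1
          (chordAv_mk (hpt.trans htq) hpq (Or.inl le_rfl) (Or.inr hdl.2.le)) (Or.inl ⟨hu, hpt, htq⟩))).symm⟩
      · exact ⟨f, e', hf, h3, (hfg.mono le_rfl hdl.2.le).trans ((hb.exit_conn hu hA ⟨hpt, htq⟩ le_rfl
          hdl.2.le (Or.inr (hs'.trans ht))).symm.trans hc1.symm)⟩
    · exact absurd hA (hb u t hu hpt htq)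

/-- Taken vertex and right boundary. -/
theorem linked_right (hc : GapClosed A p q) (hb : GapBase A p q g) (hbd : BdLinked A p q g q)
    (bdR : ∀ a, P a → ∃ e f, C a e ∧ ConnAv A a q e f ∧
      (EndAt f q ∨ ∃ u t, u < p ∧ p < t ∧ t ≤ a ∧ A u t ∧ f = (u, t)))
    (ha : Taken A P p q a) : Linked A a q := by
  obtain ⟨s, hs, hsP, _, _, hse⟩ := H.taken_left hc ha
  have hal := H.taken_lt ha
  obtain ⟨e, f, he, hef, hf⟩ := bdR s hsP
  obtain ⟨e', h1, h2, _⟩ := hse e he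
  have hc1 : ConnAv A a q e' f := (h2 q le_rfl).trans (hef.mono hs le_rfl)
  rcases hf with hf | ⟨u, t, hu, hpt, ht, hA, rfl⟩
  · exact ⟨e', f, h1, hf, hc1⟩
  · have htq : t < q := (ht.trans hs).trans_lt hal.2
    rcases hbd with hpq | ⟨f, hf, hfg⟩
    · exact ⟨e', (p, q), h1, Or.inr rfl, hc1.trans (.of_cross hc1.2.1
        (chordAv_mk (hpt.trans htq) hpq (Or.inl hal.1.le) (Or.inr le_rfl)) (Or.inl ⟨hu, hpt, htq⟩))⟩
    · exact ⟨e', f, h1, hf, hc1.trans ((hb.exit_conn hu hA ⟨hpt, htq⟩ hal.1.le le_rfl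
        (Or.inl (ht.trans hs))).trans (hfg.mono hal.1.le le_rfl).symm)⟩

/-- The new gaps are closed. -/
theorem gapClosed (hs : s = p ∨ Taken A P p q s) (hs' : s' = q ∨ Taken A P p q s')
    (hT : ∀ x, s < x → x < s' → ¬ Taken A P p q x) : GapClosed A s s' := by
  rintro v hv1 hv2 ⟨hL, hR⟩
  have hps : p ≤ s := hs.elim (fun h => h.ge) fun h => (H.taken_lt h).1.le
  have hsq : s' ≤ q := hs'.elim (fun h => h.le) fun h => (H.taken_lt h).2.le
  -- If an end of the new gap is only caught, it is replaced by the picked vertex, or old end, which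
  -- it reaches. Then `v` is caught between `a` and `b`, so it was taken.
  obtain ⟨a, ha1, ha2, ha3, ha4⟩ : ∃ a, a ≤ s ∧ (a = p ∨ P a) ∧ LeftReach A v a ∧
      ∀ x, a < x → x ≤ s → ¬ P x := by
    rcases hs with h | h | h
    · exact ⟨s, le_rfl, Or.inl h, hL, fun x h1 h2 => absurd h1 h2.not_gt⟩
    · exact ⟨s, le_rfl, Or.inr h, hL, fun x h1 h2 => absurd h1 h2.not_gt⟩
    · obtain ⟨_, _, _, s₁, s₂, h1, h2, h3, h4, h5, h6, h7⟩ := h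
      exact ⟨s₁, h1.le, h3, hL.trans hv1 h6, fun x g1 g2 => h5 x g1 (g2.trans_lt h2)⟩
  obtain ⟨b, hb1, hb2, hb3, hb4⟩ : ∃ b, s' ≤ b ∧ (b = q ∨ P b) ∧ RightReach A v b ∧
      ∀ x, s' ≤ x → x < b → ¬ P x := by
    rcases hs' with h | h | h
    · exact ⟨s', le_rfl, Or.inl h, hR, fun x h1 h2 => absurd h2 h1.not_gt⟩
    · exact ⟨s', le_rfl, Or.inr h, hR, fun x h1 h2 => absurd h2 h1.not_gt⟩
    · obtain ⟨_, _, _, s₁, s₂, h1, h2, h3, h4, h5, h6, h7⟩ := h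
      exact ⟨s₂, h2.le, h4, hR.trans hv2 h7, fun x g1 g2 => h5 x (h1.trans_le g1) g2⟩
  have hno : ∀ x, a < x → x < b → ¬ P x := by
    intro x h1 h2 hx
    rcases le_or_gt x s with h3 | h3
    · exact ha4 x h1 h3 hx
    · rcases le_or_gt s' x with h4 | h4
      · exact hb4 x h4 h2 hx
      · exact hT x h3 h4 (Or.inl hx)
  refine hT v hv1 hv2 (Or.inr ⟨hps.trans_lt hv1, hv2.trans_le hsq,
    fun h => hT v hv1 hv2 (Or.inl h), a, b, ha1.trans_lt hv1, hv2.trans_le hb1, ha2, hb2, hno, ha3, hb3⟩)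

/-- The new gaps have the base `g`. -/
theorem gapBase (hc : GapClosed A p q) (hg : ChordAv A s s' g)
    (hR : ∀ t w, p < t → t < q → q < w → A t w → ∃ f, CrossSym (t, w) f ∧ ConnAv A p q f g)
    (hs : s = p ∨ Taken A P p q s) (hs' : s' = q ∨ Taken A P p q s')
    (hT : ∀ x, s < x → x < s' → ¬ Taken A P p q x) : GapBase A s s' g := by
  have hps : p ≤ s := hs.elim (fun h => h.ge) fun h => (H.taken_lt h).1.le
  have hsq : s' ≤ q := hs'.elim (fun h => h.le) fun h => (H.taken_lt h).2.le
  have hTP : ∀ x, s < x → x < s' → ¬ P x := fun x h1 h2 h3 => hT x h1 h2 (Or.inl h3)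
  refine ⟨hg, fun u t hu ht1 ht2 hA => ?_, fun t w ht1 ht2 hw hA => ?_⟩
  -- With `u < p` the vertex `t` would be an exit, and with `u = p` a left hook; so `p < u < s`.
  -- Then `(u, t)` crosses a chord of the picked vertex `r ≤ s`, or a chord on the way from `s` to
  -- `r`.
  · have hpu : p ≤ u := by
      by_contra hcon
      push Not at hcon
      exact hTP t ht1 ht2 (H.exitL u t hA hcon (hps.trans_lt ht1) (ht2.trans_le hsq))
    have hsT : Taken A P p q s := hs.resolve_left fun h => by rw [h] at hu; exact hu.not_ge hpu
    have htq := ht2.trans_le hsq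
    have hup : u ≠ p := fun h => hT t ht1 ht2 (Or.inl (H.hookL_taken hc (h ▸ hA) htq hsT ht1))
    obtain ⟨r, hr, hrP, hrx, _, hre⟩ := H.taken_left hc hsT
    obtain ⟨e, he⟩ := H.ex r hrP
    obtain ⟨e', _, _, _, hcov⟩ := hre e he
    rcases lt_or_ge u r with hur | hur
    · have hbs := H.base r e s s' hrP he hps hsq hTP
      refine ⟨e, ?_, hbs⟩
      rcases H.shape r e he with ⟨x, hx, hA', rfl⟩ | ⟨hN, hA', rfl, _⟩
      · exact Or.inr ⟨hx.trans_lt (lt_of_le_of_ne hpu hup.symm), hur, hr.trans_lt ht1⟩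
      · exact Or.inl ⟨hur, hr.trans_lt ht1, htq⟩
    · obtain ⟨f, f1, f2, f3, f4⟩ := hcov u hur hu
      exact ⟨f, Or.inr ⟨f1, f2, f3.trans_lt ht1⟩, (f4 s' hsq).trans (H.base r e s s' hrP he hps hsq hTP)⟩
  · have htq := ht2.trans_le hsq
    have hpt := hps.trans_lt ht1
    -- A chord going beyond `q` left the old gap already and is covered by `hR`; the others are
    -- treated as on the left side.
    rcases lt_or_ge q w with hqw | hqw
    · obtain ⟨f, h1, h2⟩ := hR t w hpt htq hqw hA
      exact ⟨f, h1, (h2.mono hps hsq).1.elim fun _ _ => h2.mono hps hsq⟩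
    · have hsT : Taken A P p q s' := hs'.resolve_left fun h => by rw [h] at hw; exact hw.not_ge hqw
      obtain ⟨r, hr, hrP, hrx, hre⟩ := H.taken_right hc hsT
      obtain ⟨e, he⟩ := H.ex r hrP
      obtain ⟨_, hcov⟩ := hre e he
      have hbs := H.base r e s s' hrP he hps hsq hTP
      rcases lt_or_ge r w with hrw | hrw
      · refine ⟨e, ?_, hbs⟩
        rcases H.shape r e he with ⟨x, hx, hA', rfl⟩ | ⟨hN, hA', rfl, _⟩
        · exact Or.inr ⟨hx.trans_lt hpt, ht2.trans_le hr, hrw⟩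
        · rcases hqw.eq_or_lt with h | h
          · exact absurd (H.hookR_taken hc hN (h ▸ hA) hpt hsT ht2) (hTP t ht1 ht2)
          · exact Or.inl ⟨ht2.trans_le hr, hrw, h⟩
      · obtain ⟨f, f1, f2, f3, f4⟩ := hcov w hw hrw
        exact ⟨f, Or.inl ⟨ht2.trans_le f3, f1, f2⟩, (f4 s hps).trans hbs⟩

/-- A taken left boundary of a new gap is joined to the base. -/
theorem bdLinked_left (hc : GapClosed A p q) (hs : Taken A P p q s) (hsq : s' ≤ q)
    (hT : ∀ x, s < x → x < s' → ¬ P x) : BdLinked A s s' g s := by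
  obtain ⟨r, hr, hrP, hrx, _, hre⟩ := H.taken_left hc hs
  obtain ⟨e, he⟩ := H.ex r hrP
  obtain ⟨e', h1, h2, _⟩ := hre e he
  exact Or.inr ⟨e', h1, (h2 s' hsq).trans (H.base r e s s' hrP he (H.taken_lt hs).1.le hsq hT)⟩

theorem bdLinked_right (hc : GapClosed A p q) (hs : Taken A P p q s') (hps : p ≤ s)
    (hT : ∀ x, s < x → x < s' → ¬ P x) : BdLinked A s s' g s' := by
  obtain ⟨r, hr, hrP, hrx, hre⟩ := H.taken_right hc hs
  obtain ⟨e, he⟩ := H.ex r hrP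
  obtain ⟨⟨e', h1, h2⟩, _⟩ := hre e he
  exact Or.inr ⟨e', h1, (h2 s hps).trans (H.base r e s s' hrP he hps (H.taken_lt hs).2.le hT)⟩

/-- A new neighbour of the right boundary joins it to the base. -/
theorem bdLinked_right_of_adj (hc : GapClosed A p q) (hs : Taken A P p q s)
    (hT : ∀ x, s < x → x < q → ¬ Taken A P p q x) {b : V} (hb : Taken A P p q b) (hA : A b q) :
    BdLinked A s q g q := by
  have hsl := H.taken_lt hs
  have hbl := H.taken_lt hb
  have hbs : b ≤ s := by
    by_contra hcon; push Not at hcon; exact hT b hcon hbl.2 hb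
  rcases hbs.eq_or_lt with rfl | hbs
  · exact Or.inl hA
  have hTP : ∀ x, s < x → x < q → ¬ P x := fun x h1 h2 h3 => hT x h1 h2 (Or.inl h3)
  -- A caught vertex has a picked vertex above it, but nothing is taken above `s`.
  have hsP : P s := by
    obtain ⟨r, hr, hrP, _⟩ := H.taken_right hc hs
    rcases hr.eq_or_lt with rfl | h
    · exact hrP
    · exact absurd hrP (hTP r h (H.lt r hrP).2)
  obtain ⟨e, he⟩ := H.ex s hsP
  have hbase := H.base s e s q hsP he hsl.1.le le_rfl hTP
  refine Or.inr ⟨(b, q), Or.inr rfl, (ConnAv.of_cross (chordAv_mk hbl.2 hA (Or.inl hbs.le) (Or.inr le_rfl))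
    hbase.1 ?_).trans hbase⟩
  rcases H.shape s e he with ⟨x, hx, hA', rfl⟩ | ⟨hN, hA', rfl, t, ht, htP⟩
  · exact Or.inr ⟨hx.trans_lt hbl.1, hbs, hsl.2⟩
  · exact absurd htP (hTP t ht (H.lt t htP).2)

end PickSystem
end PickSystem

/-! ### The step to the left, and the first step in a gap without exits -/

section Steps
variable {V : Type*} [LinearOrder V]
variable {A : V → V → Prop} {p q a b c d o s s' t v z : V} {e f g : V × V}

/-- The vertices added to the gap `(p, q)` in a step to the left. -/
def TakenL (A : V → V → Prop) (p q z : V) : Prop := Taken A (Picked A p q) p q z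

def HasExit (A : V → V → Prop) (p q : V) : Prop := ∃ t u, p < t ∧ t < q ∧ A t u ∧ (u < p ∨ q < u)

/-- The invariant of the gaps; `hp` and `hq` tell whether the ends are known to be linked. -/
def GapInv (A : V → V → Prop) (p q : V) (hp hq : Prop) : Prop :=
  GapClosed A p q ∧ (HasExit A p q → ∃ g, GapBase A p q g ∧ (hp → BdLinked A p q g p) ∧
    (hq → BdLinked A p q g q))

theorem picked_system (hs : ∀ u v, A u v → A v u) (hb : GapBase A p q g) :
    PickSystem A p q g (Picked A p q) (PickChord A p q) where
  symm := hs
  lt _ h := h.lt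
  ex _ h := h.exists_chord
  shape v e h := by
    rcases h with ⟨u, hu, hA, rfl⟩ | ⟨h, rfl⟩ | ⟨h, rfl⟩
    · exact Or.inl ⟨u, hu.le, hA, rfl⟩
    · exact Or.inl ⟨p, le_rfl, h.2.2.1, rfl⟩
    · obtain ⟨h1, h2, h3, h4, t, ht, h5⟩ := h
      exact Or.inr ⟨h1, h4, rfl, t, ht, h5.elim Or.inl fun h => Or.inr (Or.inr h.hookL)⟩
  exitL u t hA hu h1 h2 := Or.inl ⟨h1, h2, u, hu, hA⟩
  hookL s t hA hs hst ht := by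
    have hp := hs.lt.1.trans hst
    rcases hs with hs | hs | hs
    · exact Or.inr (Or.inr ⟨hp, ht, hA, s, hst, Or.inl hs⟩)
    · exact Or.inr (Or.inr ⟨hp, ht, hA, s, hst, Or.inr hs⟩)
    · obtain ⟨_, _, _, x, hx, h⟩ := hs
      exact Or.inr (Or.inr ⟨hp, ht, hA, x, hx.trans hst, h⟩)
  hookR s t hN hA hs hp hts := by
    have hq := hts.trans hs.lt.2
    obtain ⟨x, hx, h⟩ := hs.top
    exact Or.inr (Or.inl ⟨hN, hp, hq, hA, x, hts.trans_le hx, h⟩)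
  conn a d ha hd had := picked_conn hb ha hd had
  base t e s s' ht he hs hs' hS := he.conn_base hb ht hs hs' hS
  reach := by
    by_cases hN : NoExitR A p q
    · exact Or.inl hN
    refine Or.inr fun v hv => ?_
    rcases hv with h | h | h
    · exact h.leftReach
    · exact absurd h.1 hN
    · rcases h.cases with h | ⟨t, _, h⟩
      · exact h.leftReach
      · exact absurd h.1 hN
  bdL d hd := by
    have hl := hd.lt
    rcases hd with h | h | h
    · obtain ⟨h1, h2, u, hu, hA⟩ := h
      exact ⟨_, _, Or.inl ⟨u, hu, hA, rfl⟩, .refl (chordAv_mk (hu.trans h1) hA (Or.inl hu.le) (Or.inr le_rfl)),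
        Or.inr ⟨u, d, hu, le_rfl, h2, hA, rfl⟩⟩
    · refine ⟨(d, q), ?_⟩
      have hdc : ChordAv A p d (d, q) := chordAv_mk hl.2 h.2.2.2.1 (Or.inr le_rfl) (Or.inr hl.2.le)
      obtain ⟨t, ht, h5⟩ := h.2.2.2.2
      obtain ⟨u, hu, hA, _, h6, h7⟩ := top_chord h5
      refine ⟨(u, t), Or.inr (Or.inr ⟨h, rfl⟩), .of_cross hdc (chordAv_mk (hu.trans_lt h6) hA (Or.inl hu)
        (Or.inr ht.le)) (Or.inr ⟨hu.trans_lt hl.1, ht, h7⟩), ?_⟩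
      rcases hu.eq_or_lt with rfl | hu
      · exact Or.inl (Or.inl rfl)
      · exact Or.inr ⟨u, t, hu, ht.le, h7, hA, rfl⟩
    · exact ⟨_, _, Or.inr (Or.inl ⟨h, rfl⟩), .refl (chordAv_mk hl.1 h.2.2.1 (Or.inl le_rfl) (Or.inr le_rfl)),
        Or.inl (Or.inl rfl)⟩

theorem picked_bdR (h : Picked A p q a) : ∃ e f, PickChord A p q a e ∧ ConnAv A a q e f ∧
    (EndAt f q ∨ ∃ u t, u < p ∧ p < t ∧ t ≤ a ∧ A u t ∧ f = (u, t)) := by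
  have hl := h.lt
  rcases h with h | h | h
  · obtain ⟨h1, h2, u, hu, hA⟩ := h
    exact ⟨_, _, Or.inl ⟨u, hu, hA, rfl⟩, .refl (chordAv_mk (hu.trans h1) hA (Or.inl (hu.trans h1).le)
      (Or.inl le_rfl)), Or.inr ⟨u, a, hu, h1, le_rfl, hA, rfl⟩⟩
  · exact ⟨_, _, Or.inr (Or.inr ⟨h, rfl⟩), .refl (chordAv_mk hl.2 h.2.2.2.1 (Or.inl le_rfl) (Or.inr le_rfl)),
      Or.inl (Or.inr rfl)⟩
  · have hac : ChordAv A a q (p, a) := chordAv_mk hl.1 h.2.2.1 (Or.inl hl.1.le) (Or.inl le_rfl)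
    refine ⟨(p, a), ?_⟩
    rcases h.cases with h0 | ⟨t, ht, htr⟩
    · obtain ⟨t, ht, h1, h2, u, hu, hA⟩ := h0.2.2.2
      exact ⟨(u, t), Or.inr (Or.inl ⟨h, rfl⟩), .of_cross hac (chordAv_mk (hu.trans h1) hA
        (Or.inl (hu.trans hl.1).le) (Or.inl ht.le)) (Or.inr ⟨hu, h1, ht⟩), Or.inr ⟨u, t, hu, h1, ht.le, hA, rfl⟩⟩
    · exact ⟨(t, q), Or.inr (Or.inl ⟨h, rfl⟩), .of_cross hac (chordAv_mk htr.2.2.1 htr.2.2.2.1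
        (Or.inl ht.le) (Or.inr le_rfl)) (Or.inl ⟨htr.2.1, ht, hl.2⟩), Or.inl (Or.inr rfl)⟩

theorem Picked.exists_exit (h : Picked A p q v) : ∃ t, ExitL A p q t := by
  obtain ⟨t, _, h | h⟩ := h.top
  · exact ⟨t, h⟩
  · obtain ⟨_, _, _, t, _, h⟩ := h
    exact ⟨t, h⟩

theorem TakenL.exists_picked (hs : ∀ u v, A u v → A v u) (hc : GapClosed A p q) (h : TakenL A p q v) :
    ∃ t, Picked A p q t := by
  by_contra hcon
  push Not at hcon
  rcases h with h | h
  · exact hcon _ h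
  · obtain ⟨h1, h2, _, s₁, s₂, _, _, h3, h4, _, h5, h6⟩ := h
    rcases h3 with rfl | h3
    · rcases h4 with rfl | h4
      · exact hc v h1 h2 ⟨h5, h6⟩
      · exact hcon _ h4
    · exact hcon _ h3

theorem TakenL.hasExit (hs : ∀ u v, A u v → A v u) (hc : GapClosed A p q) (h : TakenL A p q v) :
    HasExit A p q := by
  obtain ⟨t, ht⟩ := h.exists_picked hs hc
  obtain ⟨t, h1, h2, u, hu, hA⟩ := ht.exists_exit
  exact ⟨t, u, h1, h2, hs _ _ hA, Or.inl hu⟩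

theorem TakenL.system (hs : ∀ u v, A u v → A v u) {hp hq : Prop} (hi : GapInv A p q hp hq)
    (h : TakenL A p q v) : ∃ g, GapBase A p q g ∧ (hp → BdLinked A p q g p) ∧
    (hq → BdLinked A p q g q) ∧ PickSystem A p q g (Picked A p q) (PickChord A p q) := by
  obtain ⟨g, h1, h2, h3⟩ := hi.2 (h.hasExit hs hi.1)
  exact ⟨g, h1, h2, h3, picked_system hs h1⟩

theorem TakenL.lt (h : TakenL A p q v) : p < v ∧ v < q := by
  rcases h with h | h
  · exact h.lt
  · exact ⟨h.1, h.2.1⟩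

/-- Properties of a step, as used by the colouring argument. -/
theorem gapInv_stepL (hs : ∀ u v, A u v → A v u) {hp hq : Prop} (hi : GapInv A p q hp hq)
    (h1 : s = p ∨ TakenL A p q s) (h2 : s' = q ∨ TakenL A p q s') (hss : s < s')
    (hT : ∀ x, s < x → x < s' → ¬ TakenL A p q x) {k k' : Prop}
    (hk : k → s = p → hp ∨ ∃ b, TakenL A p q b ∧ A p b)
    (hk' : k' → s' = q → hq ∨ ∃ b, TakenL A p q b ∧ A b q) : GapInv A s s' k k' := by
  -- If nothing is taken then the gap is unchanged and keeps its base.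
  by_cases hne : ∃ v, TakenL A p q v
  swap
  · push Not at hne
    have e1 : s = p := h1.resolve_right (hne s)
    have e2 : s' = q := h2.resolve_right (hne s')
    subst e1 e2
    refine ⟨hi.1, fun hx => ?_⟩
    obtain ⟨g, g1, g2, g3⟩ := hi.2 hx
    refine ⟨g, g1, fun h => g2 ?_, fun h => g3 ?_⟩
    · exact (hk h rfl).resolve_right fun ⟨b, hb, _⟩ => hne b hb
    · exact (hk' h rfl).resolve_right fun ⟨b, hb, _⟩ => hne b hb
  obtain ⟨v, hv⟩ := hne
  obtain ⟨g, hb, bp, bq, H⟩ := hv.system hs hi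
  have hc := hi.1
  have hps : p ≤ s := h1.elim (fun h => h.ge) fun h => h.lt.1.le
  have hsq : s' ≤ q := h2.elim (fun h => h.le) fun h => h.lt.2.le
  have hTP : ∀ x, s < x → x < s' → ¬ Picked A p q x := fun x h1 h2 h3 => hT x h1 h2 (Or.inl h3)
  obtain ⟨t, ht⟩ := hv.exists_picked hs hc
  obtain ⟨t, ht⟩ := ht.exists_exit
  have htP : Picked A p q t := Or.inl ht
  obtain ⟨ht1, ht2, u, hu, hA⟩ := ht
  have hout : t ≤ s ∨ s' ≤ t := by
    by_contra hcon; push Not at hcon; exact hTP t hcon.1 hcon.2 htP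
  have htc := hb.exit_conn hu hA ⟨ht1, ht2⟩ hps hsq hout
  -- If the ends of the old gap satisfied `BdLinked` through the edge `p q`, this edge crosses an
  -- exit chord, which is joined to the base; so it becomes a proper link for the new gap.
  have hpqc : A p q → ConnAv A s s' (p, q) g := fun hpq =>
    (ConnAv.of_cross (chordAv_mk (ht1.trans ht2) hpq (Or.inl hps) (Or.inr hsq)) htc.1
      (Or.inr ⟨hu, ht1, ht2⟩)).trans htc
  refine ⟨H.gapClosed h1 h2 hT, fun _ => ⟨g, H.gapBase hc (hb.1.mono hps hsq) hb.2.2 h1 h2 hT, fun hk1 => ?_,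
    fun hk1 => ?_⟩⟩
  · rcases h1 with rfl | h1
    · rcases hk hk1 rfl with h | ⟨b, hbT, hbA⟩
      · rcases bp h with h | ⟨f, hf, hfg⟩
        · exact Or.inr ⟨_, Or.inl rfl, hpqc h⟩
        · exact Or.inr ⟨f, hf, hfg.mono hps hsq⟩
      -- The end is linked through its edge to the taken vertex `b`: this edge crosses a chord of
      -- `s'`, the lowest taken vertex, unless `b = s'` and the ends of the new gap are adjacent.
      · have hsT : TakenL A s q s' := h2.resolve_left fun h => by
          subst h; exact hT b hbT.lt.1 hbT.lt.2 hbT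
        have hbs : s' ≤ b := by
          by_contra hcon; push Not at hcon; exact hT b hbT.lt.1 hcon hbT
        rcases hbs.eq_or_lt with rfl | hbs
        · exact Or.inl hbA
        have hbc : ChordAv A s s' (s, b) := chordAv_mk hbT.lt.1 hbA (Or.inl le_rfl) (Or.inr hbs.le)
        refine Or.inr ⟨(s, b), Or.inl rfl, ?_⟩
        have hsP : Picked A s q s' := by
          obtain ⟨r, hr, hrP, _⟩ := H.taken_left hc hsT
          rcases hr.eq_or_lt with rfl | h
          · exact hrP
          · exact absurd hrP (hTP r hrP.lt.1 h)
        rcases hsP with h | h | h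
        · obtain ⟨g1, g2, u', hu', hA'⟩ := h
          have := hb.exit_conn hu' hA' ⟨g1, g2⟩ le_rfl hsq (Or.inr le_rfl)
          exact (ConnAv.of_cross hbc this.1 (Or.inr ⟨hu', g1, hbs⟩)).trans this
        · have := H.base s' _ s s' (Or.inr (Or.inl h)) (Or.inr (Or.inr ⟨h, rfl⟩)) le_rfl hsq hTP
          exact (ConnAv.of_cross hbc this.1 (Or.inl ⟨h.2.1, hbs, hbT.lt.2⟩)).trans this
        · obtain ⟨_, _, _, x, hx, h⟩ := h
          have : Picked A s q x := h.elim Or.inl fun h => Or.inr (Or.inl h)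
          exact absurd this (hTP x this.lt.1 hx)
    · exact H.bdLinked_left hc h1 hsq hTP
  · rcases h2 with rfl | h2
    · rcases hk' hk1 rfl with h | ⟨b, hbT, hbA⟩
      · rcases bq h with h | ⟨f, hf, hfg⟩
        · exact Or.inr ⟨_, Or.inr rfl, hpqc h⟩
        · exact Or.inr ⟨f, hf, hfg.mono hps hsq⟩
      · have hsT : TakenL A p s' s := h1.resolve_left fun h => by
          subst h; exact hT b hbT.lt.1 hbT.lt.2 hbT
        exact H.bdLinked_right_of_adj hc hsT hT hbT hbA
    · exact H.bdLinked_right hc h2 hps hTP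

/-- It suffices to link `a` and `d`. Taken vertices and linked ends are joined around the gap. The
alternative `A p q` in `BdLinked` does no harm: for `a = p` and `d = q` it is the conclusion, and
otherwise the edge `p q` crosses an exit chord, if one is needed. -/
theorem quad_stepL (hs : ∀ u v, A u v → A v u) (hcl : CrossClosed A) {hp hq : Prop}
    (hi : GapInv A p q hp hq) (ha : (a = p ∧ hp) ∨ TakenL A p q a) (hd : (d = q ∧ hq) ∨ TakenL A p q d)
    (hb : TakenL A p q b) (hab : a < b) (hbc : b < c) (hcd : c < d) (hac : A a c) (hbd : A b d) : A a d := by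
  obtain ⟨g, hbase, bp, bq, H⟩ := hb.system hs hi
  by_contra hcon
  refine hcon (hcl a b c d hab hbc hcd hac hbd ?_)
  rcases ha with ⟨rfl, ha⟩ | ha
  · rcases hd with ⟨rfl, hd⟩ | hd
    · rcases bp ha with h | ⟨f, hf, hfg⟩
      · exact absurd h hcon
      rcases bq hd with h | ⟨f', hf', hfg'⟩
      · exact absurd h hcon
      exact ⟨f, f', hf, hf', hfg.trans hfg'.symm⟩
    · exact H.linked_left hi.1 (Or.inl ⟨hbase, bp ha⟩) hd
  · rcases hd with ⟨rfl, hd⟩ | hd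
    · exact H.linked_right hi.1 hbase (bq hd) (fun _ => picked_bdR) ha
    · exact H.taken_linked hi.1 ha hd (hab.trans (hbc.trans hcd))

theorem takenL_of_exit (hA : A v t) (ht : t < p) (h1 : p < v) (h2 : v < q) (hs : ∀ u v, A u v → A v u) :
    TakenL A p q v := Or.inl (Or.inl ⟨h1, h2, t, ht, hs _ _ hA⟩)

theorem takenL_of_adj_left (hs : ∀ u v, A u v → A v u) {hp hq : Prop} (hi : GapInv A p q hp hq)
    (hA : A p v) (hv : v < q) (ht : TakenL A p q t) (htv : t < v) : TakenL A p q v := by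
  obtain ⟨g, _, _, _, H⟩ := ht.system hs hi
  exact Or.inl (H.hookL_taken hi.1 hA hv ht htv)

theorem takenL_of_adj_right (hs : ∀ u v, A u v → A v u) {hp hq : Prop} (hi : GapInv A p q hp hq)
    (hN : NoExitR A p q) (hA : A v q) (hv : p < v) (ht : TakenL A p q t) (htv : v < t) : TakenL A p q v := by
  obtain ⟨g, _, _, _, H⟩ := ht.system hs hi
  exact Or.inl (H.hookR_taken hi.1 hN hA hv ht htv)

theorem TakenL.le_of_adj (hs : ∀ u v, A u v → A v u) {hp hq : Prop} (hi : GapInv A p q hp hq)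
    (hv : TakenL A p q v) (hA : A v t) : t ≤ q := by
  obtain ⟨g, _, _, _, H⟩ := hv.system hs hi
  exact H.taken_no_exitR hi.1 hv hA

/-! The first step in a gap without exits. -/

/-- The seed of a gap without exits. Choosing the largest neighbour of `o` puts all other neighbours
of `o` in the gap below the seed, and the edge to the seed becomes the base of the new gaps. The
second alternative guarantees that something is taken in every nonempty gap. -/
def TopVertex (A : V → V → Prop) (o q y : V) : Prop :=
  o < y ∧ y < q ∧ ((A o y ∧ ∀ v, y < v → v < q → ¬ A o v) ∨
    (∀ v, o < v → v < q → ¬ A o v) ∧ ∀ v, o < v → ¬ v < y)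

/-- The edge from `o` to the seed plays the part of an exit: right hooks lie below the seed, and
left hooks lie above a neighbour of `q`, which is then a right hook itself. -/
def PickedZ (A : V → V → Prop) (o q v : V) : Prop :=
  o < v ∧ v < q ∧ (TopVertex A o q v ∨ (A v q ∧ ∃ y, v < y ∧ TopVertex A o q y) ∨
    (A o v ∧ ∃ t, o < t ∧ t < v ∧ A t q))

def TakenZ (A : V → V → Prop) (o q v : V) : Prop := Taken A (PickedZ A o q) o q v

def ChordZ (A : V → V → Prop) (o q v : V) (e : V × V) : Prop :=
  PickedZ A o q v ∧ ((TopVertex A o q v ∧ e = (o, v)) ∨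
    (A v q ∧ (∃ y, v < y ∧ TopVertex A o q y) ∧ e = (v, q)) ∨
    (A o v ∧ (∃ t, o < t ∧ t < v ∧ A t q) ∧ e = (o, v)))

def ExitFree (A : V → V → Prop) (o q : V) : Prop := ∀ t w, o < t → t < q → A t w → o ≤ w ∧ w ≤ q

theorem ExitFree.gapClosed (hs : ∀ u v, A u v → A v u) (h : ExitFree A o q) : GapClosed A o q := by
  rintro v h1 h2 ⟨h3, _⟩
  obtain ⟨e, he, hcov⟩ := h3.cover
  obtain ⟨f, f1, f2, f3, f4⟩ := hcov o le_rfl h1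
  exact (h f.2 f.1 f2 (f3.trans_lt h2) (hs _ _ (f4 v).2.1.1.2)).1.not_gt f1

theorem ExitFree.gapInv (hs : ∀ u v, A u v → A v u) (h : ExitFree A o q) (hp hq : Prop) :
    GapInv A o q hp hq :=
  ⟨h.gapClosed hs, fun ⟨t, u, h1, h2, h3, h4⟩ => h4.elim (fun x => absurd x (h t u h1 h2 h3).1.not_gt)
    fun x => absurd x (h t u h1 h2 h3).2.not_gt⟩

theorem TopVertex.unique {y y' : V} (h : TopVertex A o q y) (h' : TopVertex A o q y') (ho : A o y) :
    y = y' := by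
  obtain ⟨h1, h2, h3 | h3⟩ := h
  swap
  · exact absurd ho (h3.1 y h1 h2)
  obtain ⟨h4, h5, h6 | h6⟩ := h'
  · rcases lt_trichotomy y y' with h | h | h
    · exact absurd h6.1 (h3.2 y' h h5)
    · exact h
    · exact absurd ho (h6.2 y h h2)
  · exact absurd ho (h6.1 y h1 h2)

/-- The base `(o, y)` crosses all chords `(v, q)` with `v < y`, and every further chord `(o, v)` at
a left hook crosses one of these. So all chords of picked vertices are joined to the base. -/
theorem pickedZ_system (hs : ∀ u v, A u v → A v u) (hf : ExitFree A o q) {y : V} (hy : TopVertex A o q y)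
    (hoy : A o y) : PickSystem A o q (o, y) (PickedZ A o q) (ChordZ A o q) := by
  have hyl : o < y ∧ y < q := ⟨hy.1, hy.2.1⟩
  have top : ∀ v, o < v → v < q → A o v → v ≤ y := fun v h1 h2 h3 => by
    obtain ⟨_, _, h | h⟩ := hy
    · by_contra hcon; push Not at hcon; exact h.2 v hcon h2 h3
    · exact absurd h3 (h.1 v h1 h2)
  have topu : ∀ v, TopVertex A o q v → v = y := fun v hv => (hy.unique hv hoy).symm
  have hN : NoExitR A o q := fun t w h1 h2 h3 => (hf t w h1 h2 h3).2
  have hyP : PickedZ A o q y := ⟨hyl.1, hyl.2, Or.inl hy⟩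
  have ple : ∀ v, PickedZ A o q v → v ≤ y := by
    rintro v ⟨h1, h2, h | ⟨_, x, hx, hx2⟩ | ⟨h, _⟩⟩
    · exact (topu v h).le
    · exact hx.le.trans (topu x hx2).le
    · exact top v h1 h2 h
  have rP : ∀ v, o < v → v < y → A v q → PickedZ A o q v ∧ ChordZ A o q v (v, q) := fun v h1 h2 h3 =>
    have : PickedZ A o q v := ⟨h1, h2.trans hyl.2, Or.inr (Or.inl ⟨h3, y, h2, hy⟩)⟩
    ⟨this, this, Or.inr (Or.inl ⟨h3, ⟨y, h2, hy⟩, rfl⟩)⟩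
  -- every picked vertex has one of three kinds of chords
  have kinds : ∀ v e, ChordZ A o q v e → (v = y ∧ e = (o, y)) ∨ (o < v ∧ v < y ∧ A v q ∧ e = (v, q)) ∨
      (o < v ∧ v < q ∧ A o v ∧ e = (o, v) ∧ ∃ t, o < t ∧ t < v ∧ t < y ∧ A t q) := by
    rintro v e ⟨⟨h1, h2, _⟩, ⟨h, rfl⟩ | ⟨h, ⟨x, hx, hx2⟩, rfl⟩ | ⟨h, ⟨t, ht1, ht2, ht3⟩, rfl⟩⟩
    · have := topu v h; subst this; exact Or.inl ⟨rfl, rfl⟩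
    · exact Or.inr (Or.inl ⟨h1, hx.trans_le (topu x hx2).le, h, rfl⟩)
    · exact Or.inr (Or.inr ⟨h1, h2, h, rfl, t, ht1, ht2, ht2.trans_le (top v h1 h2 h), ht3⟩)
  have ex : ∀ v, PickedZ A o q v → ∃ e, ChordZ A o q v e := by
    intro v h
    obtain ⟨h1, h2, h3 | h3 | h3⟩ := id h
    · exact ⟨_, h, Or.inl ⟨h3, rfl⟩⟩
    · exact ⟨_, h, Or.inr (Or.inl ⟨h3.1, h3.2, rfl⟩)⟩
    · exact ⟨_, h, Or.inr (Or.inr ⟨h3.1, h3.2, rfl⟩)⟩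
  have hbase : ∀ t e s s', PickedZ A o q t → ChordZ A o q t e → o ≤ s → s' ≤ q →
      (∀ x, s < x → x < s' → ¬ PickedZ A o q x) → ConnAv A s s' e (o, y) := by
    intro t e s s' ht he h1 h2 hS
    have out : ∀ x, PickedZ A o q x → x ≤ s ∨ s' ≤ x := fun x hx => by
      by_contra hcon; push Not at hcon; exact hS x hcon.1 hcon.2 hx
    have hyc : ChordAv A s s' (o, y) := chordAv_mk hyl.1 hoy (Or.inl h1) (out y hyP)
    have rc : ∀ v, o < v → v < y → A v q → ConnAv A s s' (v, q) (o, y) := fun v g1 g2 g3 =>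
      .of_cross (chordAv_mk (g2.trans hyl.2) g3 (out v (rP v g1 g2 g3).1) (Or.inr h2)) hyc (Or.inr ⟨g1, g2, hyl.2⟩)
    rcases kinds t e he with ⟨rfl, rfl⟩ | ⟨g1, g2, g3, rfl⟩ | ⟨g1, g2, g3, rfl, x, x1, x2, x3, x4⟩
    · exact .refl hyc
    · exact rc t g1 g2 g3
    · exact (ConnAv.of_cross (chordAv_mk g1 g3 (Or.inl h1) (out t ht)) (rc x x1 x3 x4).1
        (Or.inl ⟨x1, x2, g2⟩)).trans (rc x x1 x3 x4)
  refine ⟨hs, fun v h => ⟨h.1, h.2.1⟩, ex, ?_, ?_, ?_, ?_, ?_, hbase, Or.inl hN, ?_⟩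
  · intro v e he
    rcases kinds v e he with ⟨rfl, rfl⟩ | ⟨g1, g2, g3, rfl⟩ | ⟨g1, g2, g3, rfl, x, x1, x2, x3, x4⟩
    · exact Or.inl ⟨o, le_rfl, hoy, rfl⟩
    · exact Or.inr ⟨hN, g3, rfl, y, g2, hyP⟩
    · exact Or.inl ⟨o, le_rfl, g3, rfl⟩
  · intro u t hA hu h1 h2
    exact absurd hu (hf t u h1 h2 (hs _ _ hA)).1.not_gt
  · intro s t hA hsP hst ht
    have hot := hsP.1.trans hst
    have hty := top t hot ht hA
    refine ⟨hot, ht, Or.inr (Or.inr ⟨hA, ?_⟩)⟩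
    obtain ⟨h1, h2, h | ⟨h, _⟩ | ⟨h, x, x1, x2, x3⟩⟩ := hsP
    · exact absurd hst ((topu s h) ▸ hty).not_gt
    · exact ⟨s, h1, hst, h⟩
    · exact ⟨x, x1, x2.trans hst, x3⟩
  · intro s t _ hA hsP hot hts
    exact (rP t hot (hts.trans_le (ple s hsP)) hA).1
  · intro a d ha hd had
    have hal : o < a := ha.1
    have hdq : d < q := hd.2.1
    have hdy := ple d hd
    -- a chord `(t, q)` with `t ≤ a` is joined to a chord of `d`
    have caseR : ∀ t, t ≤ a → o < t → A t q → ∃ f, ChordZ A o q d f ∧ ConnAv A a d (t, q) f := by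
      intro t hta hot hA
      have htc : ChordAv A a d (t, q) := chordAv_mk (hta.trans_lt (had.trans hdq)) hA (Or.inl hta) (Or.inr hdq.le)
      obtain ⟨f, hf⟩ := ex d hd
      refine ⟨f, hf, ?_⟩
      rcases kinds d f hf with ⟨rfl, rfl⟩ | ⟨g1, g2, g3, rfl⟩ | ⟨g1, g2, g3, rfl, _⟩
      · exact .of_cross htc (chordAv_mk hyl.1 hoy (Or.inl hal.le) (Or.inr le_rfl))
          (Or.inr ⟨hot, hta.trans_lt had, hdq⟩)
      · have hyc : ChordAv A a d (o, y) := chordAv_mk hyl.1 hoy (Or.inl hal.le) (Or.inr g2.le)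
        exact (ConnAv.of_cross htc hyc (Or.inr ⟨hot, hta.trans_lt (had.trans g2), hyl.2⟩)).trans
          (.of_cross hyc (chordAv_mk hdq g3 (Or.inr le_rfl) (Or.inr hdq.le)) (Or.inl ⟨g1, g2, hyl.2⟩))
      · exact .of_cross htc (chordAv_mk g1 g3 (Or.inl hal.le) (Or.inr le_rfl))
          (Or.inr ⟨hot, hta.trans_lt had, hdq⟩)
    obtain ⟨e, he⟩ := ex a ha
    rcases kinds a e he with ⟨rfl, rfl⟩ | ⟨g1, g2, g3, rfl⟩ | ⟨g1, g2, g3, rfl, x, x1, x2, x3, x4⟩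
    · exact absurd had hdy.not_gt
    · obtain ⟨f, hf, hc⟩ := caseR a le_rfl g1 g3
      exact ⟨_, f, he, hf, hc⟩
    · obtain ⟨f, hf, hc⟩ := caseR x x2.le x1 x4
      exact ⟨_, f, he, hf, (ConnAv.of_cross (chordAv_mk g1 g3 (Or.inl g1.le) (Or.inl le_rfl)) hc.1
        (Or.inl ⟨x1, x2, g2⟩)).trans hc⟩
  · intro d hd
    have hyc : d ≤ y → ChordAv A o d (o, y) := fun h => chordAv_mk hyl.1 hoy (Or.inl le_rfl) (Or.inr h)
    obtain ⟨e, he⟩ := ex d hd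
    rcases kinds d e he with ⟨rfl, rfl⟩ | ⟨g1, g2, g3, rfl⟩ | ⟨g1, g2, g3, rfl, _⟩
    · exact ⟨_, _, he, .refl (hyc le_rfl), Or.inl (Or.inl rfl)⟩
    · exact ⟨_, _, he, .of_cross (chordAv_mk (g2.trans hyl.2) g3 (Or.inr le_rfl) (Or.inr (g2.trans hyl.2).le))
        (hyc g2.le) (Or.inr ⟨g1, g2, hyl.2⟩), Or.inl (Or.inl rfl)⟩
    · exact ⟨_, _, he, .refl (chordAv_mk g1 g3 (Or.inl le_rfl) (Or.inr le_rfl)), Or.inl (Or.inl rfl)⟩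

end Steps

/-! ### Consequences of the first step, and the step to the right -/

section StepsTwo
variable {V : Type*} [LinearOrder V]
variable {A : V → V → Prop} {p q a b c d o s s' t v z y : V}

theorem TakenZ.lt (h : TakenZ A o q v) : o < v ∧ v < q := by
  rcases h with h | h
  · exact ⟨h.1, h.2.1⟩
  · exact ⟨h.1, h.2.1⟩

/-- If `o` has no neighbour in the gap there are no left hooks, right hooks would lie below the
least vertex of the gap, and a caught vertex would lie between two picked ones. Only the seed
remains. -/
theorem takenZ_degenerate (hs : ∀ u v, A u v → A v u) (hf : ExitFree A o q)
    (hn : ∀ v, o < v → v < q → ¬ A o v) (h : TakenZ A o q z) : TopVertex A o q z := by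
  have hP : ∀ v, PickedZ A o q v → TopVertex A o q v := by
    rintro v ⟨h1, h2, h | ⟨h, y, hy, hy1, hy2, hy3 | hy3⟩ | ⟨h, _⟩⟩
    · exact h
    · exact absurd hy3.1 (hn y hy1 hy2)
    · exact absurd hy (hy3.2 v h1)
    · exact absurd h (hn v h1 h2)
  have hmin : ∀ v, PickedZ A o q v → ∀ x, o < x → ¬ x < v := by
    intro v h
    obtain ⟨h1, h2, h3 | h3⟩ := hP v h
    · exact absurd h3.1 (hn v h1 h2)
    · exact h3.2
  rcases h with h | h
  · exact hP z h
  · exfalso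
    obtain ⟨h1, h2, _, s₁, s₂, g1, g2, h3, h4, _, h5, h6⟩ := h
    have h3 : PickedZ A o q s₁ := by
      rcases h3 with rfl | h3
      · obtain ⟨e, he, hcov⟩ := h5.cover
        obtain ⟨f, f1, f2, f3, f4⟩ := hcov s₁ le_rfl h1
        exact absurd f1 (hf f.2 f.1 f2 (f3.trans_lt h2) (hs _ _ (f4 z).2.1.1.2)).1.not_gt
      · exact h3
    rcases h4 with rfl | h4
    · obtain ⟨e, he, hcov⟩ := h6.cover hs
      obtain ⟨f, f1, f2, f3, f4⟩ := hcov s₂ le_rfl h2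
      exact absurd f2 (hf f.1 f.2 (h1.trans_le f3) f1 (f4 z).2.1.1.2).2.not_gt
    · exact hmin s₂ h4 s₁ h3.1 (g1.trans g2)

theorem takenZ_of_adj_left (hs : ∀ u v, A u v → A v u) (hf : ExitFree A o q) (hy : TopVertex A o q y)
    (hA : A o v) (hv : v < q) (ht : TakenZ A o q t) (htv : t < v) : TakenZ A o q v := by
  have hoy : A o y := by
    by_contra hcon
    obtain ⟨h1, h2, h | h⟩ := hy
    · exact hcon h.1
    · exact h.1 v (ht.lt.1.trans htv) hv hA
  exact Or.inl ((pickedZ_system hs hf hy hoy).hookL_taken (hf.gapClosed hs) hA hv ht htv)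

theorem takenZ_of_adj_right (hs : ∀ u v, A u v → A v u) (hf : ExitFree A o q) (hy : TopVertex A o q y)
    (hA : A v q) (hv : o < v) (ht : TakenZ A o q t) (htv : v < t) : TakenZ A o q v := by
  by_cases hoy : A o y
  · exact Or.inl ((pickedZ_system hs hf hy hoy).hookR_taken (hf.gapClosed hs)
      (fun t w h1 h2 h3 => (hf t w h1 h2 h3).2) hA hv ht htv)
  · have hn : ∀ v, o < v → v < q → ¬ A o v := by
      obtain ⟨h1, h2, h | h⟩ := hy
      · exact absurd h.1 hoy
      · exact h.1
    obtain ⟨h1, h2, h | h⟩ := takenZ_degenerate hs hf hn ht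
    · exact absurd h.1 (hn t h1 h2)
    · exact absurd htv (h.2 v hv)

/-- The base `(o, y)` ends at `o`, so that the lower end is linked from the beginning; the upper end
is linked once it has a taken neighbour. If `o y` is not an edge, only the least vertex of the gap
is taken and the remaining gaps have no exits at all. -/
theorem gapInv_stepZ (hs : ∀ u v, A u v → A v u) (hf : ExitFree A o q) (hy : TopVertex A o q y)
    (h1 : s = o ∨ TakenZ A o q s) (h2 : s' = q ∨ TakenZ A o q s') (hss : s < s')
    (hT : ∀ x, s < x → x < s' → ¬ TakenZ A o q x) {k k' : Prop}
    (hk' : k' → s' = q → ∃ b, TakenZ A o q b ∧ A b q) : GapInv A s s' k k' := by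
  have hps : o ≤ s := h1.elim (fun h => h.ge) fun h => h.lt.1.le
  have hsq : s' ≤ q := h2.elim (fun h => h.le) fun h => h.lt.2.le
  have hyT : TakenZ A o q y := Or.inl ⟨hy.1, hy.2.1, Or.inl hy⟩
  by_cases hoy : A o y
  · have H := pickedZ_system hs hf hy hoy
    have hc := hf.gapClosed hs
    have hTP : ∀ x, s < x → x < s' → ¬ PickedZ A o q x := fun x h1 h2 h3 => hT x h1 h2 (Or.inl h3)
    have hyc : ConnAv A s s' (o, y) (o, y) := H.base y _ s s' ⟨hy.1, hy.2.1, Or.inl hy⟩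
      ⟨⟨hy.1, hy.2.1, Or.inl hy⟩, Or.inl ⟨hy, rfl⟩⟩ hps hsq hTP
    refine ⟨H.gapClosed h1 h2 hT, fun _ => ⟨(o, y), H.gapBase hc hyc.1 ?_ h1 h2 hT, fun _ => ?_, fun hk1 => ?_⟩⟩
    · intro t w g1 g2 g3 g4
      exact absurd g3 (hf t w g1 g2 g4).2.not_gt
    · rcases h1 with rfl | h1
      · exact Or.inr ⟨_, Or.inl rfl, hyc⟩
      · exact H.bdLinked_left hc h1 hsq hTP
    · rcases h2 with rfl | h2
      · obtain ⟨b, hb, hbA⟩ := hk' hk1 rfl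
        have hsT : TakenZ A o s' s := h1.resolve_left fun h => by
          subst h; exact hT b hb.lt.1 hb.lt.2 hb
        exact H.bdLinked_right_of_adj hc hsT hT hb hbA
      · exact H.bdLinked_right hc h2 hps hTP
  · have hn : (∀ v, o < v → v < q → ¬ A o v) ∧ ∀ v, o < v → ¬ v < y := by
      obtain ⟨h1, h2, h | h⟩ := hy
      · exact absurd h.1 hoy
      · exact h
    apply ExitFree.gapInv hs
    have hout : y ≤ s ∨ s' ≤ y := by
      by_contra hcon; push Not at hcon; exact hT y hcon.1 hcon.2 hyT
    rcases hout with hout | hout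
    · have hTs : TakenZ A o q s := h1.resolve_left fun h => by
        subst h; exact hout.not_gt hy.1
      have hsy : s = y := by
        have := takenZ_degenerate hs hf hn.1 hTs
        obtain ⟨h1, h2, h | h⟩ := this
        · exact absurd h.1 (hn.1 s h1 h2)
        · exact le_antisymm (not_lt.1 (h.2 y hy.1)) hout
      have hq : s' = q := h2.resolve_right fun h => by
        have := takenZ_degenerate hs hf hn.1 h
        obtain ⟨h1, h2, h3 | h3⟩ := this
        · exact absurd h3.1 (hn.1 s' h1 h2)
        · have h4 : s' ≤ y := not_lt.1 (h3.2 y hy.1)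
          exact absurd (hsy ▸ hss) h4.not_gt
      subst hq hsy
      intro t w g1 g2 g3
      have := hf t w (hy.1.trans g1) g2 g3
      refine ⟨?_, this.2⟩
      by_contra hcon
      push Not at hcon
      rcases this.1.eq_or_lt with rfl | h
      · exact hn.1 t (hy.1.trans g1) g2 (hs _ _ g3)
      · exact hn.2 w h hcon
    · intro t w g1 g2 g3
      exact absurd (g2.trans_le hout) (hn.2 t (hps.trans_lt g1))

/-- The upper end `q` is not admitted as `d`, since it need not be linked to the base yet. In
`capped_layer` the choice of colours excludes this case. -/
theorem quad_stepZ (hs : ∀ u v, A u v → A v u) (hcl : CrossClosed A) (hf : ExitFree A o q)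
    (hy : TopVertex A o q y) (ha : a = o ∨ TakenZ A o q a) (hd : TakenZ A o q d)
    (hb : TakenZ A o q b) (hab : a < b) (hbc : b < c) (hcd : c < d) (hac : A a c) (hbd : A b d) : A a d := by
  by_cases hoy : A o y
  · have H := pickedZ_system hs hf hy hoy
    have hc := hf.gapClosed hs
    refine hcl a b c d hab hbc hcd hac hbd ?_
    rcases ha with rfl | ha
    · exact H.linked_left hc (Or.inr fun u t h1 h2 h3 h4 => absurd h1 (hf t u h2 h3 (hs _ _ h4)).1.not_gt) hd
    · exact H.taken_linked hc ha hd (hab.trans (hbc.trans hcd))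
  · have hn : (∀ v, o < v → v < q → ¬ A o v) := by
      obtain ⟨h1, h2, h | h⟩ := hy
      · exact absurd h.1 hoy
      · exact h.1
    obtain ⟨h1, h2, h | h⟩ := takenZ_degenerate hs hf hn hd
    · exact absurd h.1 (hn d h1 h2)
    · exact absurd (hbc.trans hcd) (h.2 b hb.lt.1)

/-! Mirror images. -/

/-- The vertices added to the gap `(p, q)` in a step to the right. -/
def TakenR (A : V → V → Prop) (p q v : V) : Prop := @TakenL Vᵒᵈ _ A q p v

def NoExitL (A : V → V → Prop) (p q : V) : Prop := ∀ t w, p < t → t < q → A t w → p ≤ w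

theorem gapBase_dual (hs : ∀ u v, A u v → A v u) {g : V × V} (h : GapBase A p q g) :
    @GapBase Vᵒᵈ _ A q p (g.2, g.1) := by
  refine ⟨chordAv_dual hs h.1, fun u t h1 h2 h3 h4 => ?_, fun t w h1 h2 h3 h4 => ?_⟩
  · obtain ⟨f, f1, f2⟩ := h.2.2 t u h3 h2 h1 (hs _ _ h4)
    exact ⟨(f.2, f.1), crossSym_dual f1, connAv_dual hs f2⟩
  · obtain ⟨f, f1, f2⟩ := h.2.1 w t h3 h2 h1 (hs _ _ h4)
    exact ⟨(f.2, f.1), crossSym_dual f1, connAv_dual hs f2⟩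

theorem bdLinked_dual (hs : ∀ u v, A u v → A v u) {g : V × V} {x : V} (h : BdLinked A p q g x) :
    @BdLinked Vᵒᵈ _ A q p (g.2, g.1) x := by
  rcases h with h | ⟨f, h1, h2⟩
  · exact Or.inl (hs _ _ h)
  · exact Or.inr ⟨(f.2, f.1), h1.symm, connAv_dual hs h2⟩

theorem gapClosed_dual (h : GapClosed A p q) : @GapClosed Vᵒᵈ _ A q p :=
  fun v h1 h2 h3 => h v h2 h1 ⟨h3.2, h3.1⟩

theorem gapInv_dual (hs : ∀ u v, A u v → A v u) {hp hq : Prop} (h : GapInv A p q hp hq) :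
    @GapInv Vᵒᵈ _ A q p hq hp := by
  refine ⟨gapClosed_dual h.1, fun ⟨t, u, h1, h2, h3, h4⟩ => ?_⟩
  obtain ⟨g, g1, g2, g3⟩ := h.2 ⟨t, u, h2, h1, h3, h4.symm⟩
  exact ⟨(g.2, g.1), gapBase_dual hs g1, fun x => bdLinked_dual hs (g3 x), fun x => bdLinked_dual hs (g2 x)⟩

theorem crossClosed_dual (hs : ∀ u v, A u v → A v u) (h : CrossClosed A) : @CrossClosed Vᵒᵈ _ A :=
  fun a b c d h1 h2 h3 h4 h5 h6 =>
    hs _ _ (h d c b a h3 h2 h1 (hs _ _ h5) (hs _ _ h4) (linked_dual (V := Vᵒᵈ) hs h6))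

theorem TakenR.lt (h : TakenR A p q v) : p < v ∧ v < q := (TakenL.lt (V := Vᵒᵈ) h).symm

theorem gapInv_stepR (hs : ∀ u v, A u v → A v u) {hp hq : Prop} (hi : GapInv A p q hp hq)
    (h1 : s = p ∨ TakenR A p q s) (h2 : s' = q ∨ TakenR A p q s') (hss : s < s')
    (hT : ∀ x, s < x → x < s' → ¬ TakenR A p q x) {k k' : Prop}
    (hk : k → s = p → hp ∨ ∃ b, TakenR A p q b ∧ A p b)
    (hk' : k' → s' = q → hq ∨ ∃ b, TakenR A p q b ∧ A b q) : GapInv A s s' k k' :=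
  gapInv_dual (V := Vᵒᵈ) hs (gapInv_stepL (V := Vᵒᵈ) hs (gapInv_dual hs hi) h2 h1 hss
    (fun x g1 g2 => hT x g2 g1)
    (fun g1 g2 => (hk' g1 g2).imp_right fun ⟨b, b1, b2⟩ => ⟨b, b1, hs _ _ b2⟩)
    (fun g1 g2 => (hk g1 g2).imp_right fun ⟨b, b1, b2⟩ => ⟨b, b1, hs _ _ b2⟩))

theorem quad_stepR (hs : ∀ u v, A u v → A v u) (hcl : CrossClosed A) {hp hq : Prop}
    (hi : GapInv A p q hp hq) (ha : (a = p ∧ hp) ∨ TakenR A p q a) (hd : (d = q ∧ hq) ∨ TakenR A p q d)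
    (hc : TakenR A p q c) (hab : a < b) (hbc : b < c) (hcd : c < d) (hac : A a c) (hbd : A b d) : A a d :=
  hs _ _ (quad_stepL (V := Vᵒᵈ) hs (crossClosed_dual hs hcl) (gapInv_dual hs hi) hd ha hc hcd hbc hab
    (hs _ _ hbd) (hs _ _ hac))

theorem takenR_of_exit (hA : A v t) (ht : q < t) (h1 : p < v) (h2 : v < q) (hs : ∀ u v, A u v → A v u) :
    TakenR A p q v := takenL_of_exit (V := Vᵒᵈ) hA ht h2 h1 hs

theorem takenR_of_adj_right (hs : ∀ u v, A u v → A v u) {hp hq : Prop} (hi : GapInv A p q hp hq)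
    (hA : A v q) (hv : p < v) (ht : TakenR A p q t) (htv : v < t) : TakenR A p q v :=
  takenL_of_adj_left (V := Vᵒᵈ) hs (gapInv_dual hs hi) (hs _ _ hA) hv ht htv

theorem takenR_of_adj_left (hs : ∀ u v, A u v → A v u) {hp hq : Prop} (hi : GapInv A p q hp hq)
    (hN : NoExitL A p q) (hA : A p v) (hv : v < q) (ht : TakenR A p q t) (htv : t < v) : TakenR A p q v :=
  takenL_of_adj_right (V := Vᵒᵈ) hs (gapInv_dual hs hi) (fun t w h1 h2 h3 => hN t w h2 h1 h3)
    (hs _ _ hA) hv ht htv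

theorem TakenR.ge_of_adj (hs : ∀ u v, A u v → A v u) {hp hq : Prop} (hi : GapInv A p q hp hq)
    (hv : TakenR A p q v) (hA : A v t) : p ≤ t :=
  TakenL.le_of_adj (V := Vᵒᵈ) hs (gapInv_dual hs hi) hv hA

end StepsTwo

/-! ### Layers -/

def IsGap (X : ℕ → Prop) (p q : ℕ) : Prop := X p ∧ X q ∧ p < q ∧ ∀ x, p < x → x < q → ¬ X x

/-- Add to `X` the vertices that `T` selects in the gaps of `X`. -/
def extendBy (T : ℕ → ℕ → ℕ → Prop) (X : ℕ → Prop) (v : ℕ) : Prop :=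
  X v ∨ ∃ p q, IsGap X p q ∧ p < v ∧ v < q ∧ T p q v

/-- The sets obtained from `D` by alternating steps to the left and to the right. -/
def layer (A : ℕ → ℕ → Prop) (D : ℕ → Prop) : ℕ → ℕ → Prop
  | 0 => extendBy (TakenZ A) D
  | k + 1 => extendBy (if k % 2 = 0 then TakenL A else TakenR A) (layer A D k)

/-- `D` is the set of vertices treated in earlier rounds, among the numbers up to `n`. It contains
both extremes, so every other vertex lies in a gap; and `free` confines the neighbours of such a
vertex to its closed gap. -/
structure PartialState (A : ℕ → ℕ → Prop) (n : ℕ) (D : ℕ → Prop) : Prop where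
  symm : ∀ u v, A u v → A v u
  closed : CrossClosed A
  zero : D 0
  top : D n
  le : ∀ v, D v → v ≤ n
  free : ∀ p q, IsGap D p q → ExitFree A p q

theorem exists_next {X : ℕ → Prop} {n p : ℕ} (hp : X p) (hn : X n) (h : p < n) : ∃ q, IsGap X p q := by
  classical
  have hex : ∃ q, p < q ∧ X q := ⟨n, h, hn⟩
  refine ⟨Nat.find hex, hp, (Nat.find_spec hex).2, (Nat.find_spec hex).1, fun x h1 h2 h3 => ?_⟩
  exact Nat.find_min hex h2 ⟨h1, h3⟩

theorem exists_gap {X : ℕ → Prop} {n v : ℕ} (h0 : X 0) (hn : X n) (hv : ¬ X v) (hvn : v < n) :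
    ∃ p q, IsGap X p q ∧ p < v ∧ v < q := by
  classical
  have h1 : X (Nat.findGreatest X v) := Nat.findGreatest_spec (m := 0) (Nat.zero_le _) h0
  have h2 : Nat.findGreatest X v < v :=
    lt_of_le_of_ne (Nat.findGreatest_le v) fun h => hv (h ▸ h1)
  obtain ⟨q, hq⟩ := exists_next h1 hn (h2.trans hvn)
  refine ⟨_, q, hq, h2, ?_⟩
  by_contra hcon
  push Not at hcon
  rcases hcon.eq_or_lt with h | h
  · exact hv (h ▸ hq.2.1)
  · exact Nat.findGreatest_is_greatest hq.2.2.1 h.le hq.2.1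

theorem IsGap.le_left {X : ℕ → Prop} {p q x v : ℕ} (h : IsGap X p q) (hv : v < q) (hx : X x) (hxv : x ≤ v) : x ≤ p := by
  by_contra hcon; push Not at hcon; exact h.2.2.2 x hcon (hxv.trans_lt hv) hx

theorem IsGap.le_right {X : ℕ → Prop} {p q x v : ℕ} (h : IsGap X p q) (hv : p < v) (hx : X x) (hxv : v ≤ x) : q ≤ x := by
  by_contra hcon; push Not at hcon; exact h.2.2.2 x (hv.trans_le hxv) hcon hx

theorem IsGap.eq {X : ℕ → Prop} {p q p' q' v : ℕ} (h : IsGap X p q) (h' : IsGap X p' q') (h1 : p < v)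
    (h2 : v < q) (h3 : p' < v) (h4 : v < q') : p = p' ∧ q = q' :=
  ⟨le_antisymm (h'.le_left h4 h.1 h1.le) (h.le_left h2 h'.1 h3.le),
    le_antisymm (h.le_right h1 h'.2.1 h4.le) (h'.le_right h3 h.2.1 h2.le)⟩

theorem IsGap.eq_of_left {X : ℕ → Prop} {p q q' : ℕ} (h : IsGap X p q) (h' : IsGap X p q') : q = q' :=
  le_antisymm (h.le_right (Nat.lt_succ_self p) h'.2.1 h'.2.2.1)
    (h'.le_right (Nat.lt_succ_self p) h.2.1 h.2.2.1)

theorem IsGap.eq_of_right {X : ℕ → Prop} {p p' q : ℕ} (h : IsGap X p q) (h' : IsGap X p' q) : p = p' := by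
  have h1 := h.2.2.1
  have h2 := h'.2.2.1
  have := h.le_left (v := q - 1) (by omega) h'.1 (by omega)
  have := h'.le_left (v := q - 1) (by omega) h.1 (by omega)
  omega

theorem extendBy_taken {T : ℕ → ℕ → ℕ → Prop} {X : ℕ → Prop} {p q v : ℕ} (h : extendBy T X v)
    (hg : IsGap X p q) (h1 : p < v) (h2 : v < q) : T p q v := by
  rcases h with h | ⟨p', q', h3, h4, h5, h6⟩
  · exact absurd h (hg.2.2.2 v h1 h2)
  · obtain ⟨rfl, rfl⟩ := hg.eq h3 h1 h2 h4 h5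
    exact h6

theorem refine_gap {T : ℕ → ℕ → ℕ → Prop} {X : ℕ → Prop} {n p' q' : ℕ} (h0 : X 0) (hn : X n)
    (hX : ∀ v, extendBy T X v → v ≤ n) (h : IsGap (extendBy T X) p' q') :
    ∃ p q, IsGap X p q ∧ p ≤ p' ∧ q' ≤ q ∧ (p' = p ∨ T p q p') ∧ (q' = q ∨ T p q q') ∧
      ∀ x, p' < x → x < q' → ¬ T p q x := by
  have hpn : p' < n := h.2.2.1.trans_le (hX q' h.2.1)
  obtain ⟨p, q, hg, h1, h2⟩ : ∃ p q, IsGap X p q ∧ p ≤ p' ∧ p' < q := by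
    by_cases hp : X p'
    · obtain ⟨q, hq⟩ := exists_next hp hn hpn
      exact ⟨p', q, hq, le_rfl, hq.2.2.1⟩
    · obtain ⟨p, q, hq, h1, h2⟩ := exists_gap h0 hn hp hpn
      exact ⟨p, q, hq, h1.le, h2⟩
  have h3 : q' ≤ q := h.le_right (Nat.lt_succ_self p') (Or.inl hg.2.1) h2
  refine ⟨p, q, hg, h1, h3, ?_, ?_, fun x g1 g2 g3 => ?_⟩
  · rcases h1.eq_or_lt with h1 | h1
    · exact Or.inl h1.symm
    · exact Or.inr (extendBy_taken h.1 hg h1 h2)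
  · rcases h3.eq_or_lt with h3 | h3
    · exact Or.inl h3
    · exact Or.inr (extendBy_taken h.2.1 hg (h1.trans_lt h.2.2.1) h3)
  · exact h.2.2.2 x g1 g2 (Or.inr ⟨p, q, hg, h1.trans_lt g1, g2.trans_le h3, g3⟩)

theorem exists_topVertex (A : ℕ → ℕ → Prop) {o q v : ℕ} (h1 : o < v) (h2 : v < q) : ∃ y, TopVertex A o q y := by
  classical
  by_cases h : ∃ x, o < x ∧ x < q ∧ A o x
  · obtain ⟨x, hx⟩ := h
    have hs := Nat.findGreatest_spec (P := fun x => o < x ∧ x < q ∧ A o x) (n := q) hx.2.1.le hx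
    refine ⟨_, hs.1, hs.2.1, Or.inl ⟨hs.2.2, fun v g1 g2 g3 => ?_⟩⟩
    exact Nat.findGreatest_is_greatest g1 g2.le ⟨hs.1.trans g1, g2, g3⟩
  · push Not at h
    exact ⟨o + 1, by omega, by omega, Or.inr ⟨h, fun v _ => by omega⟩⟩

section Layers
variable {A : ℕ → ℕ → Prop} {n : ℕ} {D : ℕ → Prop}

/-- Flagged ends are those known to be linked to the base of the gap: an end outside of `D` was
taken and is linked as such, and an end in `D` is linked as soon as a neighbour on the side of the
gap has been taken. -/
def FlagL (A : ℕ → ℕ → Prop) (D X : ℕ → Prop) (p : ℕ) : Prop := ¬ D p ∨ ∃ b, p < b ∧ X b ∧ ¬ D b ∧ A p b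
def FlagR (A : ℕ → ℕ → Prop) (D X : ℕ → Prop) (q : ℕ) : Prop := ¬ D q ∨ ∃ b, b < q ∧ X b ∧ ¬ D b ∧ A b q

theorem layer_succ_even {k : ℕ} (h : k % 2 = 0) : layer A D (k + 1) = extendBy (TakenL A) (layer A D k) := by
  simp [layer, h]

theorem layer_succ_odd {k : ℕ} (h : k % 2 = 1) : layer A D (k + 1) = extendBy (TakenR A) (layer A D k) := by
  simp [layer, h]

theorem layer_mono_succ {k v : ℕ} (h : layer A D k v) : layer A D (k + 1) v := Or.inl h

theorem layer_mono {j k v : ℕ} (hjk : j ≤ k) (h : layer A D j v) : layer A D k v := by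
  induction hjk with
  | refl => exact h
  | step _ ih => exact layer_mono_succ ih

theorem layer_of_mem {k v : ℕ} (h : D v) : layer A D k v := layer_mono (Nat.zero_le k) (Or.inl h)

namespace PartialState
variable (S : PartialState A n D)
include S

theorem layer_le {k v : ℕ} (h : layer A D k v) : v ≤ n := by
  induction k generalizing v with
  | zero =>
    rcases h with h | ⟨p, q, hg, _, h2, _⟩
    · exact S.le v h
    · exact h2.le.trans (S.le q hg.2.1)
  | succ k ih =>
    rcases h with h | ⟨p, q, hg, _, h2, _⟩
    · exact ih h
    · exact h2.le.trans (ih hg.2.1)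

theorem outer_gap {k p q : ℕ} (h : IsGap (layer A D k) p q) : ∃ o r, IsGap D o r ∧ o ≤ p ∧ q ≤ r := by
  have hpn := h.2.2.1.trans_le (S.layer_le h.2.1)
  by_cases hp : D p
  · obtain ⟨r, hr⟩ := exists_next hp S.top hpn
    exact ⟨p, r, hr, le_rfl, h.le_right (Nat.lt_succ_self p) (layer_of_mem hr.2.1) hr.2.2.1⟩
  · obtain ⟨o, r, hr, h1, h2⟩ := exists_gap S.zero S.top hp hpn
    exact ⟨o, r, hr, h1.le, h.le_right (Nat.lt_succ_self p) (layer_of_mem hr.2.1) h2⟩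

/-- The gap is contained in a gap of `D`, which has no exits; when `q` is in `D` the two have the
same upper end. Thus hooks at ends in `D` are always picked. -/
theorem noExitR {k p q : ℕ} (h : IsGap (layer A D k) p q) (hq : D q) : NoExitR A p q := by
  obtain ⟨o, r, hr, h1, h2⟩ := S.outer_gap h
  have hrq : r ≤ q := hr.le_right (h1.trans_lt h.2.2.1) hq le_rfl
  intro t w g1 g2 g3
  exact (S.free o r hr t w (h1.trans_lt g1) (g2.trans_le h2) g3).2.trans hrq

theorem noExitL {k p q : ℕ} (h : IsGap (layer A D k) p q) (hp : D p) : NoExitL A p q := by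
  obtain ⟨o, r, hr, h1, h2⟩ := S.outer_gap h
  have hrq : p ≤ o := hr.le_left (h.2.2.1.trans_le h2) hp le_rfl
  intro t w g1 g2 g3
  exact hrq.trans (S.free o r hr t w (h1.trans_lt g1) (g2.trans_le h2) g3).1

theorem refineL {k p' q' : ℕ} (hk : k % 2 = 0) (h : IsGap (layer A D (k + 1)) p' q') :
    ∃ p q, IsGap (layer A D k) p q ∧ p ≤ p' ∧ q' ≤ q ∧ (p' = p ∨ TakenL A p q p') ∧
      (q' = q ∨ TakenL A p q q') ∧ ∀ x, p' < x → x < q' → ¬ TakenL A p q x := by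
  rw [layer_succ_even hk] at h
  exact refine_gap (layer_of_mem S.zero) (layer_of_mem S.top)
    (fun v hv => S.layer_le (k := k + 1) (by rwa [layer_succ_even hk])) h

theorem refineR {k p' q' : ℕ} (hk : k % 2 = 1) (h : IsGap (layer A D (k + 1)) p' q') :
    ∃ p q, IsGap (layer A D k) p q ∧ p ≤ p' ∧ q' ≤ q ∧ (p' = p ∨ TakenR A p q p') ∧
      (q' = q ∨ TakenR A p q q') ∧ ∀ x, p' < x → x < q' → ¬ TakenR A p q x := by
  rw [layer_succ_odd hk] at h
  exact refine_gap (layer_of_mem S.zero) (layer_of_mem S.top)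
    (fun v hv => S.layer_le (k := k + 1) (by rwa [layer_succ_odd hk])) h

theorem refineZ {p' q' : ℕ} (h : IsGap (layer A D 0) p' q') :
    ∃ p q, IsGap D p q ∧ p ≤ p' ∧ q' ≤ q ∧ (p' = p ∨ TakenZ A p q p') ∧
      (q' = q ∨ TakenZ A p q q') ∧ ∀ x, p' < x → x < q' → ¬ TakenZ A p q x :=
  refine_gap S.zero S.top (fun v hv => S.layer_le (k := 0) hv) h

theorem mod_two (k : ℕ) : k % 2 = 0 ∨ k % 2 = 1 := Nat.mod_two_eq_zero_or_one k

/-- A vertex that is not yet in the layer sees in `D` only the ends of its gap. -/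
theorem invariants (k : ℕ) :
    (∀ v x p q, IsGap (layer A D k) p q → p < v → v < q → D x → A v x → (x < v → x = p) ∧ (v < x → x = q)) ∧
    (∀ p q, IsGap (layer A D k) p q → GapInv A p q (FlagL A D (layer A D k) p) (FlagR A D (layer A D k) q)) := by
  induction k with
  | zero =>
    refine ⟨fun v x p' q' hg h1 h2 hx hA => ?_, fun p' q' hg => ?_⟩
    · obtain ⟨p, q, hg', g1, g2, g3, g4, g5⟩ := S.refineZ hg
      have hf := S.free p q hg'
      have hpv := g1.trans_lt h1
      have hvq := h2.trans_le g2
      obtain ⟨y, hy⟩ := exists_topVertex A hpv hvq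
      refine ⟨fun hxv => ?_, fun hxv => ?_⟩
      · have : x = p := le_antisymm (hg'.le_left hvq hx hxv.le) (hf v x hpv hvq hA).1
        subst this
        rcases g3 with g3 | g3
        · exact g3.symm
        · exact absurd (takenZ_of_adj_left S.symm hf hy (S.symm _ _ hA) hvq g3 h1) (g5 v h1 h2)
      · have : x = q := le_antisymm (hf v x hpv hvq hA).2 (hg'.le_right hpv hx hxv.le)
        subst this
        rcases g4 with g4 | g4
        · exact g4.symm
        · exact absurd (takenZ_of_adj_right S.symm hf hy hA hpv g4 h2) (g5 v h1 h2)
    · obtain ⟨p, q, hg', g1, g2, g3, g4, g5⟩ := S.refineZ hg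
      have hf := S.free p q hg'
      by_cases hne : ∃ v, p < v ∧ v < q
      · obtain ⟨v, hv1, hv2⟩ := hne
        obtain ⟨y, hy⟩ := exists_topVertex A hv1 hv2
        refine gapInv_stepZ S.symm hf hy g3 g4 hg.2.2.1 g5 fun hk hq => ?_
        subst hq
        -- The flag of an end in `D` stems from a neighbour `b`, and `b` is in this gap because gaps
        -- of `D` have no exits.
        obtain ⟨b, hb1, hb2, hb3, hb4⟩ := hk.resolve_left (fun h => h hg'.2.1)
        have hbp : p < b := by
          by_contra hcon
          push Not at hcon
          obtain ⟨o, r, hr, r1, r2⟩ := exists_gap S.zero S.top hb3 (hb1.trans_le (S.le _ hg'.2.1))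
          have := hr.le_right r1 hg'.1 hcon
          exact (S.free o r hr b _ r1 r2 hb4).2.not_gt (this.trans_lt hg'.2.2.1)
        exact ⟨b, extendBy_taken hb2 hg' hbp hb1, hb4⟩
      · push Not at hne
        have e1 : p' = p := g3.resolve_right fun h => absurd h.lt.2 (hne p' h.lt.1).not_gt
        have e2 : q' = q := g4.resolve_right fun h => absurd h.lt.2 (hne q' h.lt.1).not_gt
        subst e1 e2
        exact hf.gapInv S.symm _ _
  | succ k ih =>
    obtain ⟨ihK, ihI⟩ := ih
    -- neighbours in `D` of new vertices
    have newL : ∀ {p q}, IsGap (layer A D k) p q → FlagL A D (layer A D (k + 1)) p →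
        FlagL A D (layer A D k) p ∨ ∃ b, p < b ∧ b < q ∧ layer A D (k + 1) b ∧ A p b := by
      rintro p q hg (h | ⟨b, b1, b2, b3, b4⟩)
      · exact Or.inl (Or.inl h)
      · by_cases hD : D p
        swap
        · exact Or.inl (Or.inl hD)
        by_cases hb : layer A D k b
        · exact Or.inl (Or.inr ⟨b, b1, hb, b3, b4⟩)
        -- A neighbour `b` that is new in this step has `p` as an end of its gap, by the first
        -- invariant.
        · have hbn : b < n := lt_of_le_of_ne (S.layer_le b2) fun h => b3 (h ▸ S.top)
          obtain ⟨p2, q2, hg2, r1, r2⟩ := exists_gap (layer_of_mem S.zero) (layer_of_mem S.top) hb hbn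
          have := (ihK b p p2 q2 hg2 r1 r2 hD (S.symm _ _ b4)).1 b1
          subst this
          have := hg.eq_of_left hg2
          subst this
          exact Or.inr ⟨b, b1, r2, b2, b4⟩
    have newR : ∀ {p q}, IsGap (layer A D k) p q → FlagR A D (layer A D (k + 1)) q →
        FlagR A D (layer A D k) q ∨ ∃ b, p < b ∧ b < q ∧ layer A D (k + 1) b ∧ A b q := by
      rintro p q hg (h | ⟨b, b1, b2, b3, b4⟩)
      · exact Or.inl (Or.inl h)
      · by_cases hD : D q
        swap
        · exact Or.inl (Or.inl hD)
        by_cases hb : layer A D k b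
        · exact Or.inl (Or.inr ⟨b, b1, hb, b3, b4⟩)
        · have hbn : b < n := lt_of_le_of_ne (S.layer_le b2) fun h => b3 (h ▸ S.top)
          obtain ⟨p2, q2, hg2, r1, r2⟩ := exists_gap (layer_of_mem S.zero) (layer_of_mem S.top) hb hbn
          have := (ihK b q p2 q2 hg2 r1 r2 hD b4).2 b1
          subst this
          have := hg.eq_of_right hg2
          subst this
          exact Or.inr ⟨b, r1, b1, b2, b4⟩
    rcases mod_two S k with hk | hk
    · refine ⟨fun v x p' q' hg h1 h2 hx hA => ?_, fun p' q' hg => ?_⟩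
      · obtain ⟨p, q, hg', g1, g2, g3, g4, g5⟩ := S.refineL hk hg
        have hpv := g1.trans_lt h1
        have hvq := h2.trans_le g2
        have hi := ihI p q hg'
        have hK := ihK v x p q hg' hpv hvq hx hA
        refine ⟨fun hxv => ?_, fun hxv => ?_⟩
        · have := hK.1 hxv
          subst this
          rcases g3 with g3 | g3
          · exact g3.symm
          · exact absurd (takenL_of_adj_left S.symm hi (S.symm _ _ hA) hvq g3 h1) (g5 v h1 h2)
        · have := hK.2 hxv
          subst this
          rcases g4 with g4 | g4
          · exact g4.symm
          · exact absurd (takenL_of_adj_right S.symm hi (S.noExitR hg' hx) hA hpv g4 h2) (g5 v h1 h2)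
      · obtain ⟨p, q, hg', g1, g2, g3, g4, g5⟩ := S.refineL hk hg
        refine gapInv_stepL S.symm (ihI p q hg') g3 g4 hg.2.2.1 g5 (fun hf he => ?_) (fun hf he => ?_)
        · subst he
          refine (newL hg' hf).imp_right fun ⟨b, b1, b2, b3, b4⟩ => ⟨b, ?_, b4⟩
          rw [layer_succ_even hk] at b3
          exact extendBy_taken b3 hg' b1 b2
        · subst he
          refine (newR hg' hf).imp_right fun ⟨b, b1, b2, b3, b4⟩ => ⟨b, ?_, b4⟩
          rw [layer_succ_even hk] at b3
          exact extendBy_taken b3 hg' b1 b2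
    · refine ⟨fun v x p' q' hg h1 h2 hx hA => ?_, fun p' q' hg => ?_⟩
      · obtain ⟨p, q, hg', g1, g2, g3, g4, g5⟩ := S.refineR hk hg
        have hpv := g1.trans_lt h1
        have hvq := h2.trans_le g2
        have hi := ihI p q hg'
        have hK := ihK v x p q hg' hpv hvq hx hA
        refine ⟨fun hxv => ?_, fun hxv => ?_⟩
        · have := hK.1 hxv
          subst this
          rcases g3 with g3 | g3
          · exact g3.symm
          · exact absurd (takenR_of_adj_left S.symm hi (S.noExitL hg' hx) (S.symm _ _ hA) hvq g3 h1) (g5 v h1 h2)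
        · have := hK.2 hxv
          subst this
          rcases g4 with g4 | g4
          · exact g4.symm
          · exact absurd (takenR_of_adj_right S.symm hi hA hpv g4 h2) (g5 v h1 h2)
      · obtain ⟨p, q, hg', g1, g2, g3, g4, g5⟩ := S.refineR hk hg
        refine gapInv_stepR S.symm (ihI p q hg') g3 g4 hg.2.2.1 g5 (fun hf he => ?_) (fun hf he => ?_)
        · subst he
          refine (newL hg' hf).imp_right fun ⟨b, b1, b2, b3, b4⟩ => ⟨b, ?_, b4⟩
          rw [layer_succ_odd hk] at b3
          exact extendBy_taken b3 hg' b1 b2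
        · subst he
          refine (newR hg' hf).imp_right fun ⟨b, b1, b2, b3, b4⟩ => ⟨b, ?_, b4⟩
          rw [layer_succ_odd hk] at b3
          exact extendBy_taken b3 hg' b1 b2

end PartialState
end Layers

/-! ### Levels of vertices, and the colour classes of one round -/

section LayersTwo
variable {A : ℕ → ℕ → Prop} {n : ℕ} {D : ℕ → Prop}

/-- `k` is the first index at which `v` is in a layer. -/
def IsLevel (A : ℕ → ℕ → Prop) (D : ℕ → Prop) (v k : ℕ) : Prop :=
  layer A D k v ∧ ∀ j, j < k → ¬ layer A D j v

theorem exists_level {v k : ℕ} (h : layer A D k v) : ∃ j, j ≤ k ∧ IsLevel A D v j := by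
  classical
  have hex : ∃ j, layer A D j v := ⟨k, h⟩
  exact ⟨Nat.find hex, Nat.find_min' hex h, Nat.find_spec hex, fun j hj => Nat.find_min hex hj⟩

theorem IsLevel.le_iff {v i k : ℕ} (h : IsLevel A D v i) : i ≤ k ↔ layer A D k v :=
  ⟨fun hk => layer_mono hk h.1, fun hk => by by_contra hcon; push Not at hcon; exact h.2 k hcon hk⟩

namespace PartialState
variable (S : PartialState A n D)
include S

theorem gap_at {k v : ℕ} (hv : ¬ layer A D k v) (hvn : v < n) :
    ∃ p q, IsGap (layer A D k) p q ∧ p < v ∧ v < q :=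
  exists_gap (layer_of_mem S.zero) (layer_of_mem S.top) hv hvn

/-- Vertices with a neighbour below their gap are taken within two steps. -/
theorem exit_left {i w u p q : ℕ} (hg : IsGap (layer A D i) p q) (h1 : p < w) (h2 : w < q)
    (hA : A w u) (hu : u < p) : layer A D (i + 2) w := by
  rcases Nat.mod_two_eq_zero_or_one i with hi | hi
  · refine layer_mono_succ ?_
    rw [layer_succ_even hi]
    exact Or.inr ⟨p, q, hg, h1, h2, takenL_of_exit hA hu h1 h2 S.symm⟩
  · by_cases hw : layer A D (i + 1) w
    · exact layer_mono_succ hw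
    obtain ⟨p', q', hg', h3, h4⟩ := S.gap_at hw (h2.trans_le (S.layer_le hg.2.1))
    have hpp : p ≤ p' := hg'.le_left h4 (layer_mono_succ hg.1) h1.le
    rw [layer_succ_even (by omega)]
    exact Or.inr ⟨p', q', hg', h3, h4, takenL_of_exit hA (hu.trans_le hpp) h3 h4 S.symm⟩

theorem exit_right {i w u p q : ℕ} (hg : IsGap (layer A D i) p q) (h1 : p < w) (h2 : w < q)
    (hA : A w u) (hu : q < u) : layer A D (i + 2) w := by
  rcases Nat.mod_two_eq_zero_or_one i with hi | hi
  · by_cases hw : layer A D (i + 1) w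
    · exact layer_mono_succ hw
    obtain ⟨p', q', hg', h3, h4⟩ := S.gap_at hw (h2.trans_le (S.layer_le hg.2.1))
    have hpp : q' ≤ q := hg'.le_right h3 (layer_mono_succ hg.2.1) h2.le
    rw [layer_succ_odd (by omega)]
    exact Or.inr ⟨p', q', hg', h3, h4, takenR_of_exit hA (hpp.trans_lt hu) h3 h4 S.symm⟩
  · refine layer_mono_succ ?_
    rw [layer_succ_odd hi]
    exact Or.inr ⟨p, q, hg, h1, h2, takenR_of_exit hA hu h1 h2 S.symm⟩

/-- Two consecutive steps contain one in each direction, so they take every vertex with a neighbour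
outside of its closed gap. A stable layer can therefore start the next round. -/
theorem exitFree_of_stable {k p q : ℕ} (h : ∀ v, layer A D (k + 2) v → layer A D k v)
    (hg : IsGap (layer A D k) p q) : ExitFree A p q := by
  intro t w h1 h2 hA
  constructor
  · by_contra hcon
    push Not at hcon
    exact hg.2.2.2 t h1 h2 (h t (S.exit_left hg h1 h2 hA hcon))
  · by_contra hcon
    push Not at hcon
    exact hg.2.2.2 t h1 h2 (h t (S.exit_right hg h1 h2 hA hcon))

theorem of_stable {k : ℕ} (h : ∀ v, layer A D (k + 2) v → layer A D k v) :
    PartialState A n (layer A D k) where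
  symm := S.symm
  closed := S.closed
  zero := layer_of_mem S.zero
  top := layer_of_mem S.top
  le _ hv := S.layer_le hv
  free _ _ hg := S.exitFree_of_stable h hg

/-- The seed of a nonempty gap is always taken, so each round makes progress until no vertex is
missing. -/
theorem layer_grows {v : ℕ} (hv : ¬ D v) (hvn : v < n) (k : ℕ) : ∃ y, ¬ D y ∧ layer A D k y := by
  obtain ⟨p, q, hg, h1, h2⟩ := exists_gap S.zero S.top hv hvn
  obtain ⟨y, hy⟩ := exists_topVertex A h1 h2
  refine ⟨y, hg.2.2.2 y hy.1 hy.2.1, layer_mono (Nat.zero_le k) ?_⟩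
  exact Or.inr ⟨p, q, hg, hy.1, hy.2.1, Or.inl ⟨hy.1, hy.2.1, Or.inl hy⟩⟩

/-- If two steps later `w` is still missing, then its neighbour `u` remains an end of its gap. -/
theorem neighbour_is_end {i u w : ℕ} (hu : layer A D i u) (hA : A w u) (hw : ¬ layer A D (i + 2) w) (j : ℕ)
    (hij : i ≤ j) : ∀ p q, IsGap (layer A D j) p q → p < w → w < q → (u < w → u = p) ∧ (w < u → u = q) := by
  induction j, hij using Nat.le_induction with
  | base =>
    intro p q hg h1 h2
    refine ⟨fun h => ?_, fun h => ?_⟩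
    · rcases (hg.le_left h2 hu h.le).eq_or_lt with h3 | h3
      · exact h3
      · exact absurd (S.exit_left hg h1 h2 hA h3) hw
    · rcases (hg.le_right h1 hu h.le).eq_or_lt with h3 | h3
      · exact h3.symm
      · exact absurd (S.exit_right hg h1 h2 hA h3) hw
  | succ j hij ih =>
    intro p' q' hg' h1' h2'
    rcases Nat.mod_two_eq_zero_or_one j with hj | hj
    · obtain ⟨p, q, hg, g1, g2, g3, g4, g5⟩ := S.refineL hj hg'
      have h1 := g1.trans_lt h1'
      have h2 := h2'.trans_le g2
      have hi := (S.invariants j).2 p q hg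
      have ih := ih p q hg h1 h2
      refine ⟨fun h => ?_, fun h => ?_⟩
      · have := ih.1 h
        subst this
        rcases g3 with g3 | g3
        · exact g3.symm
        · exact absurd (takenL_of_adj_left S.symm hi (S.symm _ _ hA) h2 g3 h1') (g5 w h1' h2')
      · have := ih.2 h
        subst this
        rcases g4 with g4 | g4
        · exact g4.symm
        by_cases hN : NoExitR A p u
        · exact absurd (takenL_of_adj_right S.symm hi hN hA h1 g4 h2') (g5 w h1' h2')
        -- the end `u` is new, so that `w` is taken soon
        have hji : j = i := by
          by_contra hne
          obtain ⟨m, rfl⟩ : ∃ m, j = m + 1 := ⟨j - 1, by omega⟩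
          obtain ⟨p0, q0, hg0, k1, k2, k3, k4, k5⟩ := S.refineR (by omega) hg
          have hq0 : u = q0 := le_antisymm k2
            (hg0.le_right (k1.trans_lt hg.2.2.1) (layer_mono (by omega) hu) le_rfl)
          subst hq0
          refine hN fun t x t1 t2 t3 => ?_
          by_contra hcon
          push Not at hcon
          exact k5 t t1 t2 (takenR_of_exit t3 hcon (k1.trans_lt t1) t2 S.symm)
        subst hji
        -- Now `u` lies above the gap of `w`, and the next step, which goes to the right, takes `w`.
        have : q' < u := g4.lt.2
        refine absurd ?_ hw
        rw [layer_succ_odd (by omega)]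
        exact Or.inr ⟨p', q', hg', h1', h2', takenR_of_exit hA this h1' h2' S.symm⟩
    · obtain ⟨p, q, hg, g1, g2, g3, g4, g5⟩ := S.refineR hj hg'
      have h1 := g1.trans_lt h1'
      have h2 := h2'.trans_le g2
      have hi := (S.invariants j).2 p q hg
      have ih := ih p q hg h1 h2
      refine ⟨fun h => ?_, fun h => ?_⟩
      · have := ih.1 h
        subst this
        rcases g3 with g3 | g3
        · exact g3.symm
        by_cases hN : NoExitL A u q
        · exact absurd (takenR_of_adj_left S.symm hi hN (S.symm _ _ hA) h2 g3 h1') (g5 w h1' h2')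
        have hji : j = i := by
          by_contra hne
          obtain ⟨m, rfl⟩ : ∃ m, j = m + 1 := ⟨j - 1, by omega⟩
          obtain ⟨p0, q0, hg0, k1, k2, k3, k4, k5⟩ := S.refineL (by omega) hg
          have hq0 : u = p0 := le_antisymm
            (hg0.le_left (hg.2.2.1.trans_le k2) (layer_mono (by omega) hu) le_rfl) k1
          subst hq0
          refine hN fun t x t1 t2 t3 => ?_
          by_contra hcon
          push Not at hcon
          exact k5 t t1 t2 (takenL_of_exit t3 hcon t1 (t2.trans_le k2) S.symm)
        subst hji
        have : u < p' := g3.lt.1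
        refine absurd ?_ hw
        rw [layer_succ_even (by omega)]
        exact Or.inr ⟨p', q', hg', h1', h2', takenL_of_exit hA this h1' h2' S.symm⟩
      · have := ih.2 h
        subst this
        rcases g4 with g4 | g4
        · exact g4.symm
        · exact absurd (takenR_of_adj_right S.symm hi hA h1 g4 h2') (g5 w h1' h2')

/-- Adjacent vertices entering at the same time are in the same gap. -/
theorem same_gap {k u w p q : ℕ} (hg : IsGap (layer A D k) p q) (h1 : p < w) (h2 : w < q)
    (hu : ¬ layer A D k u) (hu' : layer A D (k + 1) u) (hw' : layer A D (k + 1) w) (hA : A w u) :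
    p < u ∧ u < q := by
  have hun : u < n := lt_of_le_of_ne (S.layer_le hu') fun h => hu (h ▸ layer_of_mem S.top)
  obtain ⟨p2, q2, hg2, r1, r2⟩ := S.gap_at hu hun
  have hi := (S.invariants k).2 p q hg
  have hi2 := (S.invariants k).2 p2 q2 hg2
  have hne : u ≠ p ∧ u ≠ q := ⟨fun h => hu (h ▸ hg.1), fun h => hu (h ▸ hg.2.1)⟩
  rcases Nat.mod_two_eq_zero_or_one k with hk | hk
  · rw [layer_succ_even hk] at hu' hw'
    have t1 := extendBy_taken hu' hg2 r1 r2
    have t2 := extendBy_taken hw' hg h1 h2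
    -- Vertices taken in a step to the left have no neighbours above their gap. Used for `u` and for
    -- `w`, this prevents either gap from lying below the other.
    have l1 := t1.le_of_adj S.symm hi2 (S.symm _ _ hA)
    have l2 := t2.le_of_adj S.symm hi hA
    refine ⟨?_, by omega⟩
    by_contra hcon
    push Not at hcon
    have := hg2.le_right r1 hg.1 hcon
    omega
  · rw [layer_succ_odd hk] at hu' hw'
    have t1 := extendBy_taken hu' hg2 r1 r2
    have t2 := extendBy_taken hw' hg h1 h2
    have l1 := t1.ge_of_adj S.symm hi2 (S.symm _ _ hA)
    have l2 := t2.ge_of_adj S.symm hi hA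
    refine ⟨by omega, ?_⟩
    by_contra hcon
    push Not at hcon
    have := hg2.le_left r2 hg.2.1 hcon
    omega

/-- The classes of the colouring of the layers are capped. -/
theorem capped_layer {N : ℕ} {col : ℕ → ℕ}
    (hmod : ∀ o r, IsGap D o r → ∀ u w i j, o < u → u < r → o < w → w < r → IsLevel A D u i →
      IsLevel A D w j → col u = col w → i % 3 = j % 3)
    (hr : ∀ o r, IsGap D o r → ∀ w j, o < w → w < r → IsLevel A D w j → A w r → col w = col r →
      ∃ b i, o < b ∧ b < r ∧ IsLevel A D b i ∧ i < j ∧ A b r)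
    (hold : ∀ a b c d, D a → D b → D c → D d → a < b → b < c → c < d → col b = col a → col c = col a →
      col d = col a → A a c → A b d → A a d)
    {a b c d : ℕ} (ha : layer A D N a) (hb : layer A D N b) (hc : layer A D N c) (hd : layer A D N d)
    (hab : a < b) (hbc : b < c) (hcd : c < d) (cb : col b = col a) (cc : col c = col a) (cd : col d = col a)
    (hac : A a c) (hbd : A b d) : A a d := by
  by_cases hall : D a ∧ D b ∧ D c ∧ D d
  · exact hold a b c d hall.1 hall.2.1 hall.2.2.1 hall.2.2.2 hab hbc hcd cb cc cd hac hbd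
  have hca := S.symm _ _ hac
  have hdb := S.symm _ _ hbd
  have hdn := S.layer_le hd
  -- Not all vertices are in `D`, and the gaps of `D` have no exits; as the edges `a c` and `b d`
  -- interlace, all four vertices are in one closed gap of `D`.
  obtain ⟨o, r, hg, ho, hr'⟩ : ∃ o r, IsGap D o r ∧ o ≤ a ∧ d ≤ r := by
    have key : ∀ x, ¬ D x → x ≤ d → ∃ o r, IsGap D o r ∧ o < x ∧ x < r := fun x hx hxd =>
      exists_gap S.zero S.top hx (lt_of_le_of_ne (hxd.trans hdn) fun h => hx (h ▸ S.top))
    by_cases hDa : D a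
    · by_cases hDb : D b
      · by_cases hDc : D c
        · obtain ⟨o, r, hg, h1, h2⟩ := key d (fun h => hall ⟨hDa, hDb, hDc, h⟩) le_rfl
          have := (S.free o r hg d b h1 h2 hdb).1
          have := hg.le_left h2 hDc hcd.le
          omega
        · obtain ⟨o, r, hg, h1, h2⟩ := key c hDc hcd.le
          have := (S.free o r hg c a h1 h2 hca).1
          have := hg.le_left h2 hDb hbc.le
          omega
      · obtain ⟨o, r, hg, h1, h2⟩ := key b hDb (hbc.trans hcd).le
        have h3 := (S.free o r hg b d h1 h2 hbd).2
        exact ⟨o, r, hg, (S.free o r hg c a (h1.trans hbc) (by omega) hca).1, h3⟩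
    · obtain ⟨o, r, hg, h1, h2⟩ := key a hDa (by omega)
      have h3 := (S.free o r hg a c h1 h2 hac).2
      exact ⟨o, r, hg, h1.le, (S.free o r hg b d (h1.trans hab) (by omega) hbd).2⟩
  have hin : ∀ x, o < x → x < r → ¬ D x := hg.2.2.2
  have hDa : D a → a = o := fun h => by
    by_contra hne; exact hin a (by omega) (by omega) h
  have hDd : D d → d = r := fun h => by
    by_contra hne; exact hin d (by omega) (by omega) h
  -- the first layer that contains all four vertices
  classical
  have hex : ∃ l, layer A D l a ∧ layer A D l b ∧ layer A D l c ∧ layer A D l d := ⟨N, ha, hb, hc, hd⟩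
  obtain ⟨l, ⟨la, lb, lc, ld⟩, lmin⟩ : ∃ l, (layer A D l a ∧ layer A D l b ∧ layer A D l c ∧ layer A D l d) ∧
      ∀ m, m < l → ¬ (layer A D m a ∧ layer A D m b ∧ layer A D m c ∧ layer A D m d) :=
    ⟨Nat.find hex, Nat.find_spec hex, fun m hm => Nat.find_min hex hm⟩
  rcases l with _ | k
  · obtain ⟨y, hy⟩ := exists_topVertex A (show o < b by omega) (show b < r by omega)
    have hf := S.free o r hg
    have tb : TakenZ A o r b := extendBy_taken lb hg (by omega) (by omega)
    refine quad_stepZ S.symm S.closed hf hy ?_ ?_ tb hab hbc hcd hac hbd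
    · rcases ho.eq_or_lt with h | h
      · exact Or.inl h.symm
      · exact Or.inr (extendBy_taken la hg h (by omega))
    -- The case `d = r` is impossible: a vertex of level 0 with the colour of `r` is not adjacent to
    -- `r`, since `hr` would give a neighbour of smaller level.
    · rcases hr'.eq_or_lt with h | h
      · subst h
        obtain ⟨_, i, _, _, _, hi, _⟩ := hr o d hg b 0 (by omega) (by omega) ⟨lb, fun j hj => absurd hj (by omega)⟩
          hbd (cb.trans cd.symm)
        omega
      · exact extendBy_taken ld hg (by omega) h
  -- a neighbour of the same colour of a new vertex
  have partner : ∀ w u p q, IsGap (layer A D k) p q → p < w → w < q → o < w → w < r → layer A D (k + 1) w →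
      layer A D (k + 1) u → o ≤ u → u ≤ r → A w u → col u = col w →
      (u < w → u = p ∨ (p < u ∧ ¬ layer A D k u)) ∧ (w < u → u = q ∨ (u < q ∧ ¬ layer A D k u)) := by
    intro w u p q hg' h1 h2 h3 h4 hw hu h5 h6 hA hcol
    have hwk : ¬ layer A D k w := hg'.2.2.2 w h1 h2
    by_cases hD : D u
    · have := (S.invariants k).1 w u p q hg' h1 h2 hD hA
      exact ⟨fun h => Or.inl (this.1 h), fun h => Or.inl (this.2 h)⟩
    have hne : o ≠ u ∧ u ≠ r := ⟨fun h => hD (h ▸ hg.1), fun h => hD (h ▸ hg.2.1)⟩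
    by_cases huk : layer A D k u
    · obtain ⟨i, hi, hi2⟩ := exists_level huk
      have hwl : IsLevel A D w (k + 1) := ⟨hw, fun j hj hj2 => hwk (layer_mono (by omega) hj2)⟩
      -- Equal colours mean congruent levels, so `u` is at least three levels older than `w` and
      -- `neighbour_is_end` applies.
      have := hmod o r hg u w i (k + 1) (by omega) (by omega) h3 h4 hi2 hwl hcol
      have := S.neighbour_is_end hi2.1 hA (fun h => hwk (layer_mono (by omega) h)) k hi p q hg' h1 h2
      exact ⟨fun h => Or.inl (this.1 h), fun h => Or.inl (this.2 h)⟩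
    · have := S.same_gap hg' h1 h2 huk hu hw hA
      exact ⟨fun h => Or.inr ⟨this.1, huk⟩, fun h => Or.inr ⟨this.2, huk⟩⟩
  have gap : ∀ x, o ≤ x → x ≤ r → ¬ layer A D k x → ∃ p q, IsGap (layer A D k) p q ∧ p < x ∧ x < q ∧ o < x ∧ x < r := by
    intro x h1 h2 h3
    have hne : o ≠ x ∧ x ≠ r := ⟨fun h => h3 (h ▸ layer_of_mem hg.1), fun h => h3 (h ▸ layer_of_mem hg.2.1)⟩
    obtain ⟨p, q, h4, h5, h6⟩ := S.gap_at h3 (show x < n by have := S.le r hg.2.1; omega)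
    exact ⟨p, q, h4, h5, h6, by omega, by omega⟩
  -- By minimality one of the four vertices is new. If `a` or `c` is new, then both are in one
  -- closed gap, with `b` strictly inside. If `d` is new while `a` and `c` are old, then `b` is in
  -- the closed gap of `d`, which puts the old vertex `c` strictly inside, a contradiction.
  have lbk : ¬ layer A D k b := by
    by_cases ka : layer A D k a
    swap
    · obtain ⟨p, q, h1, h2, h3, h4, h5⟩ := gap a ho (by omega) ka
      have := (partner a c p q h1 h2 h3 h4 h5 la lc (by omega) (by omega) hac cc).2 (by omega)
      exact h1.2.2.2 b (by omega) (by omega)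
    by_cases kc : layer A D k c
    swap
    · obtain ⟨p, q, h1, h2, h3, h4, h5⟩ := gap c (by omega) (by omega) kc
      have := (partner c a p q h1 h2 h3 h4 h5 lc la (by omega) (by omega) hca cc.symm).1 (by omega)
      exact h1.2.2.2 b (by omega) (by omega)
    by_cases kd : layer A D k d
    swap
    · obtain ⟨p, q, h1, h2, h3, h4, h5⟩ := gap d (by omega) hr' kd
      have := (partner d b p q h1 h2 h3 h4 h5 ld lb (by omega) (by omega) hdb (cb.trans cd.symm)).1 (by omega)
      exact absurd kc (h1.2.2.2 c (by omega) (by omega))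
    exact fun kb => lmin k (Nat.lt_succ_self k) ⟨ka, kb, kc, kd⟩
  obtain ⟨p, q, hgk, b1, b2, b3, b4⟩ := gap b (by omega) (by omega) lbk
  have pd := (partner b d p q hgk b1 b2 b3 b4 lb ld (by omega) hr' hbd (cd.trans cb.symm)).2 (by omega)
  have c2 : c < q := by omega
  have c1 : p < c := by omega
  have pa := (partner c a p q hgk c1 c2 (by omega) (by omega) lc la ho (by omega) hca cc.symm).1 (by omega)
  have hi := (S.invariants k).2 p q hgk
  -- If `a` is in `D`, it is the lower end of the whole gap and has the neighbour `c` there. So the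
  -- seed is a neighbour of `a`, and it belongs to layer 0.
  have flagL : a = p → FlagL A D (layer A D k) p := by
    rintro rfl
    by_cases hD : D a
    · have := hDa hD
      subst this
      obtain ⟨y, hy⟩ := exists_topVertex A (show a < b by omega) (show b < r by omega)
      have hy' := hy
      obtain ⟨y1, y2, y3 | y3⟩ := hy
      · exact Or.inr ⟨y, y1, layer_mono (Nat.zero_le k) (Or.inr ⟨a, r, hg, y1, y2, Or.inl ⟨y1, y2, Or.inl hy'⟩⟩),
          hin y y1 y2, y3.1⟩
      · exact absurd hac (y3.1 c (by omega) (by omega))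
    · exact Or.inl hD
  -- The upper end has no seed; here the neighbour of smaller level comes from the choice of
  -- colours, through `hr`.
  have flagR : d = q → FlagR A D (layer A D k) q := by
    rintro rfl
    by_cases hD : D d
    · have := hDd hD
      subst this
      obtain ⟨x, i, x1, x2, x3, x4, x5⟩ := hr o d hg b (k + 1) b3 b4
        ⟨lb, fun j hj hj2 => lbk (layer_mono (by omega) hj2)⟩ hbd (cb.trans cd.symm)
      exact Or.inr ⟨x, x2, layer_mono (by omega) x3.1, hin x x1 x2, x5⟩
    · exact Or.inl hD
  rcases Nat.mod_two_eq_zero_or_one k with hk | hk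
  · rw [layer_succ_even hk] at la lb lc ld
    refine quad_stepL S.symm S.closed hi ?_ ?_ (extendBy_taken lb hgk b1 b2) hab hbc hcd hac hbd
    · rcases pa with h | h
      · exact Or.inl ⟨h, flagL h⟩
      · exact Or.inr (extendBy_taken la hgk h.1 (by omega))
    · rcases pd with h | h
      · exact Or.inl ⟨h, flagR h⟩
      · exact Or.inr (extendBy_taken ld hgk (by omega) h.1)
  · rw [layer_succ_odd hk] at la lb lc ld
    refine quad_stepR S.symm S.closed hi ?_ ?_ (extendBy_taken lc hgk c1 c2) hab hbc hcd hac hbd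
    · rcases pa with h | h
      · exact Or.inl ⟨h, flagL h⟩
      · exact Or.inr (extendBy_taken la hgk h.1 (by omega))
    · rcases pd with h | h
      · exact Or.inl ⟨h, flagR h⟩
      · exact Or.inr (extendBy_taken ld hgk (by omega) h.1)

end PartialState
end LayersTwo

/-! ### Graphs outside of the family are closed under crossings -/

section Family
variable {W : Type*} [LinearOrder W]

/-- Larger ends increase along a crossing sequence, so its edges are automatically distinct; the
numbering `K` of the positions makes this increase transitive. -/
theorem crossingSeq_snoc {H : SimpleGraph W} {r : W → W → Prop} (K : W → ℕ) (hK : ∀ x y, r x y ↔ K x < K y)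
    {u x y x' y' : W} {es : List (W × W)} (h : IsCrossingSeq H r u y es) (hl : es.getLast? = some (x, y))
    (hA : H.Adj x' y') (h1 : r x x') (h2 : r x' y) (h3 : r y y') :
    IsCrossingSeq H r u y' (es ++ [(x', y')]) := by
  have hc : (es ++ [(x', y')]).IsChain (Crosses r) := by
    rw [List.isChain_append]
    refine ⟨h.crosses, List.isChain_singleton _, fun e he f hf => ?_⟩
    rw [hl] at he
    simp only [Option.mem_def, Option.some.injEq, List.head?_cons] at he hf
    subst he hf
    exact ⟨h1, h2, h3⟩
  refine ⟨fun e he => ?_, ?_, ?_, ?_, hc⟩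
  · rcases List.mem_append.1 he with he | he
    · exact h.edge e he
    · rw [List.mem_singleton] at he
      subst he
      exact ⟨(hK _ _).2 (((hK _ _).1 h2).trans ((hK _ _).1 h3)), hA⟩
  · have h4 : (es ++ [(x', y')]).IsChain (fun e f => K e.2 < K f.2) := hc.imp fun e f hef => (hK _ _).1 hef.2.2
    have h5 : (es ++ [(x', y')]).Pairwise (fun e f => K e.2 < K f.2) :=
      @List.IsChain.pairwise _ _ _ ⟨fun h h' => lt_trans h h'⟩ h4
    exact h5.imp fun hlt heq => by subst heq; exact lt_irrefl _ hlt
  · have hf := h.first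
    cases es with
    | nil => simp at hl
    | cons e es => simpa using hf
  · simp

/-- A link between `a` and `d` is a path of crossing chords which may run back and forth, and it
need not be a crossing sequence. What grows along the path is the initial part of the rotated order
that is covered by last chords of crossing sequences from `d`; when it reaches `a`, such a sequence
ends at `a`. -/
theorem crossClosed_of_not_inFamilyH {H : SimpleGraph W} (hH : ¬ InFamilyH H) {f : W → ℕ} (hf : StrictMono f)
    {M : ℕ} (hM : ∀ x, f x < M) {A : ℕ → ℕ → Prop}
    (hA : ∀ u v, A u v ↔ ∃ x y, f x = u ∧ f y = v ∧ H.Adj x y) : CrossClosed A := by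
  intro a b c d hab hbc hcd hac hbd hlink
  obtain ⟨a', c', rfl, rfl, hac'⟩ := (hA _ _).1 hac
  obtain ⟨b', d', rfl, rfl, hbd'⟩ := (hA _ _).1 hbd
  by_contra hcon
  apply hH
  have hab' := hf.lt_iff_lt.1 hab
  have hbc' := hf.lt_iff_lt.1 hbc
  have hcd' := hf.lt_iff_lt.1 hcd
  refine ⟨a', d', (hab'.trans (hbc'.trans hcd')).ne, fun h => hcon ((hA _ _).2 ⟨a', d', rfl, rfl, h⟩), ?_, ?_⟩
  · refine Or.inl ⟨hab'.trans (hbc'.trans hcd'), [(a', c'), (b', d')], ?_, ?_, rfl, rfl, ?_⟩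
    · intro e he
      simp only [List.mem_cons, List.not_mem_nil, or_false] at he
      rcases he with rfl | rfl
      · exact ⟨hab'.trans hbc', hac'⟩
      · exact ⟨hbc'.trans hcd', hbd'⟩
    · simp [hab'.ne]
    · simp [Crosses, hab', hbc', hcd']
  -- the rotation that starts with `d`
  set κ : ℕ → ℕ := fun t => if f d' ≤ t then t else t + M with hκ
  set U : UpperSet W := UpperSet.Ici d' with hU
  have had : f a' < f d' := by omega
  have hK : ∀ x y, RotLT U x y ↔ κ (f x) < κ (f y) := by
    intro x y
    have hx : x ∈ U ↔ f d' ≤ f x := by rw [hU, UpperSet.mem_Ici_iff, hf.le_iff_le]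
    have hy : y ∈ U ↔ f d' ≤ f y := by rw [hU, UpperSet.mem_Ici_iff, hf.le_iff_le]
    have hxy : x < y ↔ f x < f y := hf.lt_iff_lt.symm
    have := hM x
    have := hM y
    simp only [RotLT, hx, hy, hxy, hκ]
    split_ifs <;> omega
  refine Or.inr ⟨hf.lt_iff_lt.1 had, U, (hK _ _).2 (by have := hM d'; simp only [hκ]; split_ifs <;> omega), ?_⟩
  -- `R i j` means that some crossing sequence from `d` ends with a chord from position `i` to
  -- position `j` of the rotated order. `Cov j` means that such chords reach `j` and cover all
  -- positions between `d` and `j`.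
  let R : ℕ → ℕ → Prop := fun i j => j ≤ f a' + M ∧ ∃ es x y, IsCrossingSeq H (RotLT U) d' y es ∧
    es.getLast? = some (x, y) ∧ κ (f x) = i ∧ κ (f y) = j
  let Cov : ℕ → Prop := fun j => (∃ i h, R i h ∧ j ≤ h) ∧ ∀ t, f d' < t → t < j → ∃ i h, R i h ∧ i < t ∧ t < h
  obtain ⟨e, g, hea, hgd, hconn₀⟩ := hlink
  have hconn := hconn₀.symm
  clear hconn₀
  -- the ends of a chord in the rotated order
  have ends : ∀ e : ℕ × ℕ, ChordAv A (f a') (f d') e → ∃ x y, H.Adj x y ∧ κ (f x) < κ (f y) ∧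
      κ (f y) ≤ f a' + M ∧ κ (f x) = min (κ e.1) (κ e.2) ∧ κ (f y) = max (κ e.1) (κ e.2) := by
    rintro ⟨u, v⟩ ⟨⟨h1, h2⟩, h3, h4⟩
    obtain ⟨x, y, rfl, rfl, hxy⟩ := (hA _ _).1 h2
    have := hM x
    have := hM y
    simp only at h1 h3 h4
    by_cases hlt : κ (f x) < κ (f y)
    · refine ⟨x, y, hxy, hlt, ?_, ?_, ?_⟩
      · simp only [hκ] at hlt ⊢; split_ifs at hlt ⊢ <;> omega
      · simp only; omega
      · simp only; omega
    · have hlt : κ (f y) < κ (f x) := by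
        simp only [hκ] at hlt ⊢; split_ifs at hlt ⊢ <;> omega
      refine ⟨y, x, hxy.symm, hlt, ?_, ?_, ?_⟩
      · simp only [hκ] at hlt ⊢; split_ifs at hlt ⊢ <;> omega
      · simp only; omega
      · simp only; omega
  have dmin : ∀ x : W, f d' ≤ κ (f x) := by
    intro x; have := hM d'; simp only [hκ]; split_ifs <;> omega
  have base : Cov (max (κ g.1) (κ g.2)) := by
    obtain ⟨x, y, hxy, h1, h2, h3, h4⟩ := ends g hconn.1
    have hdk : κ (f d') = f d' := by simp [hκ]
    have hxd : κ (f x) = f d' := by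
      have := dmin x
      have := dmin y
      rcases hgd with h | h <;> rw [h] at h3 h4 <;> omega
    have hxd' : x = d' := by
      apply hf.injective
      have := hM d'
      simp only [hκ] at hxd
      split_ifs at hxd <;> omega
    subst hxd'
    have hR : R (f x) (max (κ g.1) (κ g.2)) := by
      refine ⟨h4 ▸ h2, [(x, y)], x, y, ⟨?_, by simp, rfl, rfl, List.isChain_singleton _⟩, rfl, hxd, h4⟩
      intro e he
      rw [List.mem_singleton] at he
      subst he
      exact ⟨(hK _ _).2 h1, hxy⟩
    exact ⟨⟨_, _, hR, le_rfl⟩, fun t ht1 ht2 => ⟨_, _, hR, ht1, ht2⟩⟩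
  have step : ∀ e e', CrossStep A (f a') (f d') e e' → Cov (max (κ e.1) (κ e.2)) → Cov (max (κ e'.1) (κ e'.2)) := by
    rintro e e' ⟨he, he', hcr⟩ ⟨⟨i, h, hR, hj⟩, hcov⟩
    obtain ⟨x', y', hxy', h1', h2', h3', h4'⟩ := ends e' he'
    by_cases hle : max (κ e'.1) (κ e'.2) ≤ max (κ e.1) (κ e.2)
    · exact ⟨⟨i, h, hR, hle.trans hj⟩, fun t ht1 ht2 => hcov t ht1 (ht2.trans_le hle)⟩
    -- A chord that crosses `e` and reaches further must start before the larger end of `e`, and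
    -- after `d`.
    have hx : f d' < min (κ e'.1) (κ e'.2) ∧ min (κ e'.1) (κ e'.2) < max (κ e.1) (κ e.2) := by
      obtain ⟨x, y, hxy, h1, h2, h3, h4⟩ := ends e he
      obtain ⟨u1, u2, hu1, hu2, hu⟩ := (hA _ _).1 he.1.2
      obtain ⟨v1, v2, hv1, hv2, hv⟩ := (hA _ _).1 he'.1.2
      have := hM d'
      have := hM u1
      have := hM u2
      have := hM v1
      have := hM v2
      obtain ⟨⟨a1, _⟩, a2, a3⟩ := he
      obtain ⟨⟨b1, _⟩, b2, b3⟩ := he'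
      rw [hu1] at *
      rw [hu2] at *
      rw [hv1] at *
      rw [hv2] at *
      clear hcov hR hj h3 h4 h3' h4' h1 h2 h1' h2' hconn base
      obtain ⟨e1, e2⟩ := e
      obtain ⟨e3, e4⟩ := e'
      simp only [CrossSym, hκ] at *
      split_ifs at hle ⊢ <;> omega
    -- The start of `e'` is covered by the last chord of a sequence. This chord reaches as far as
    -- `e'` does, or it crosses `e'` and the sequence is continued by `e'`.
    obtain ⟨i', h', hR', hi1, hi2⟩ := hcov _ hx.1 hx.2
    rcases le_or_gt (max (κ e'.1) (κ e'.2)) h' with hh | hh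
    · refine ⟨⟨i', h', hR', hh⟩, fun t ht1 ht2 => ?_⟩
      rcases lt_or_ge t (max (κ e.1) (κ e.2)) with ht | ht
      · exact hcov t ht1 ht
      · exact ⟨i', h', hR', hi1.trans (hx.2.trans_le ht), ht2.trans_le hh⟩
    · obtain ⟨_, es, x, y, hes, hlast, hxi, hyh⟩ := hR'
      have hRn : R (min (κ e'.1) (κ e'.2)) (max (κ e'.1) (κ e'.2)) := by
        refine ⟨h4' ▸ h2', es ++ [(x', y')], x', y', ?_, by simp, h3', h4'⟩
        refine crossingSeq_snoc (fun x => κ (f x)) hK hes hlast hxy' ?_ ?_ ?_ <;> rw [hK] <;> omega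
      refine ⟨⟨_, _, hRn, le_rfl⟩, fun t ht1 ht2 => ?_⟩
      rcases lt_or_ge t (max (κ e.1) (κ e.2)) with ht | ht
      · exact hcov t ht1 ht
      · exact ⟨_, _, hRn, hx.2.trans_le ht, ht2⟩
  have final : Cov (max (κ e.1) (κ e.2)) := by
    have h3 := hconn.2.2
    clear hconn hea
    induction h3 with
    | refl => exact base
    | tail _ h ih => exact step _ _ h ih
  obtain ⟨⟨i, h, ⟨hh, es, x, y, hes, hlast, hx, hy⟩, hle⟩, _⟩ := final
  have hka : f a' + M ≤ max (κ e.1) (κ e.2) := by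
    have : κ (f a') = f a' + M := by simp only [hκ]; rw [if_neg (by omega)]
    rcases hea with h | h <;> rw [h] <;> omega
  -- In the rotated order `a` is the last position at which a chord avoiding the interval from `a`
  -- to `d` can end.
  have hya : y = a' := by
    apply hf.injective
    have h1 := hM y
    have h2 : κ (f y) = f a' + M := by omega
    simp only [hκ] at h2
    split_ifs at h2 <;> omega
  subst hya
  exact ⟨es, hes⟩

end Family

/-- The adjacency relation of a graph on `Fin n`, as a relation of natural numbers. -/
def natAdj {n : ℕ} (G : SimpleGraph (Fin n)) (u v : ℕ) : Prop := ∃ x y : Fin n, (x : ℕ) = u ∧ (y : ℕ) = v ∧ G.Adj x y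

theorem natAdj_symm {n : ℕ} (G : SimpleGraph (Fin n)) (u v : ℕ) (h : natAdj G u v) : natAdj G v u := by
  obtain ⟨x, y, h1, h2, h3⟩ := h
  exact ⟨y, x, h2, h1, h3.symm⟩

theorem natAdj_crossClosed {n : ℕ} {G : SimpleGraph (Fin n)} (h : HFree G) : CrossClosed (natAdj G) := by
  refine crossClosed_of_not_inFamilyH (h Set.univ) (f := fun x => (x.1 : ℕ)) (fun x y hxy => hxy)
    (M := n) (fun x => x.1.2) fun u v => ⟨?_, ?_⟩
  · rintro ⟨x, y, h1, h2, h3⟩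
    exact ⟨⟨x, trivial⟩, ⟨y, trivial⟩, h1, h2, h3⟩
  · rintro ⟨x, y, h1, h2, h3⟩
    exact ⟨x.1, y.1, h1, h2, h3⟩

/-! ### Four colours for triangle-free capped graphs -/

/-- This is `CrossClosed` with the link dropped. Unlike the linked form it refers to four vertices
only, so it survives in induced subgraphs. -/
def Capped (E : ℕ → ℕ → Prop) : Prop := ∀ a b c d, a < b → b < c → c < d → E a c → E b d → E a d

/-- `x` is the largest neighbour of `s`, and above `s`. -/
def IsLast (E : ℕ → ℕ → Prop) (s x : ℕ) : Prop := s < x ∧ E s x ∧ ∀ y, E s y → y ≤ x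

/-- The recursive description of the second class of vertices. -/
def SecondClass (E : ℕ → ℕ → Prop) (B : ℕ → Prop) : Prop :=
  ∀ s, B s ↔ ∃ x, IsLast E s x ∧ ∃ a, a < s ∧ ¬ B a ∧ E a x

/-- Zones repair the base colouring. Its only conflicts are edges between a second-class vertex `t`
and its last neighbour `c`, also of the second class. Then `c` has a first-class neighbour `a` below
`t`, and `t` is in the zone of `a` while `c` is not. -/
def InZone (E : ℕ → ℕ → Prop) (B : ℕ → Prop) (a t : ℕ) : Prop :=
  ¬ B a ∧ a < t ∧ ¬ E a t ∧ ∃ c, IsLast E a c ∧ B c ∧ t < c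

def IsMaxZone (E : ℕ → ℕ → Prop) (B : ℕ → Prop) (a t : ℕ) : Prop :=
  InZone E B a t ∧ ∀ a', InZone E B a' t → a' ≤ a

structure TriangleFreeCapped (E : ℕ → ℕ → Prop) (n : ℕ) (B : ℕ → Prop) : Prop where
  symm : ∀ u v, E u v → E v u
  bound : ∀ u v, E u v → v < n
  capped : Capped E
  tri : ∀ u v w, u < v → v < w → E u v → E v w → E u w → False
  second : SecondClass E B

/-- A colouring with two colours on each class, proper except for some edges `s`, last neighbour of `s`. -/
structure BaseColouring (E : ℕ → ℕ → Prop) (B : ℕ → Prop) (k : ℕ → ℕ) : Prop where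
  first_lt : ∀ t, ¬ B t → k t < 2
  second_le : ∀ t, B t → 2 ≤ k t ∧ k t < 4
  first_ne : ∀ u t, ¬ B u → ¬ B t → u < t → E u t → k u ≠ k t
  second_ne : ∀ s t y, B s → B t → s < t → E s t → t < y → E s y → k s ≠ k t

/-- The colours seen from `t`: a pair of colours is swapped for each zone that contains `t`. -/
structure ZoneColouring (E : ℕ → ℕ → Prop) (B : ℕ → Prop) (k : ℕ → ℕ) (P : ℕ → ℕ → ℕ) : Prop where
  none : ∀ t x, (∀ a, ¬ InZone E B a t) → P t x = k x
  some : ∀ t x a c, IsMaxZone E B a t → IsLast E a c →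
    P t x = if k x = k a then P c c else if k x = k c then P c a else P c x

section FourColour
variable {E : ℕ → ℕ → Prop} {n : ℕ} {B : ℕ → Prop} {k : ℕ → ℕ} {P : ℕ → ℕ → ℕ}

theorem IsLast.unique {s x y : ℕ} (h : IsLast E s x) (h' : IsLast E s y) : x = y :=
  le_antisymm (h'.2.2 x h.2.1) (h.2.2 y h'.2.1)

namespace TriangleFreeCapped
variable (S : TriangleFreeCapped E n B)
include S

theorem exists_last {s t : ℕ} (hst : s < t) (h : E s t) : ∃ x, IsLast E s x ∧ t ≤ x := by
  classical
  have h1 := Nat.findGreatest_spec (P := fun x => E s x) (n := n) (S.bound s t h).le h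
  have h2 : t ≤ Nat.findGreatest (fun x => E s x) n := Nat.le_findGreatest (S.bound s t h).le h
  exact ⟨_, ⟨hst.trans_le h2, h1, fun y hy => Nat.le_findGreatest (S.bound s y hy).le hy⟩, h2⟩

/-- Of two such neighbours `a < a'`, the smaller would also see the last neighbour of `a'`, which
puts `a'` in the second class. So two colours suffice for the first class, chosen upwards. -/
theorem first_left_unique {a a' t : ℕ} (ha : ¬ B a) (ha' : ¬ B a') (h1 : a < t) (h1' : a' < t) (h2 : E a t)
    (h2' : E a' t) : a = a' := by
  have key : ∀ a a' : ℕ, ¬ B a → ¬ B a' → a < a' → a' < t → E a t → E a' t → False := by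
    intro a a' ha ha' haa ha't h2 h2'
    obtain ⟨x, hx, htx⟩ := S.exists_last ha't h2'
    refine ha' ((S.second a').2 ⟨x, hx, a, haa, ha, ?_⟩)
    rcases htx.eq_or_lt with rfl | htx
    · exact h2
    · exact S.capped a a' t x haa ha't htx h2 hx.2.1
  rcases lt_trichotomy a a' with h | h | h
  · exact (key a a' ha ha' h h1' h2 h2').elim
  · exact h
  · exact (key a' a ha' ha h h1 h2' h2).elim

/-- Otherwise compare the last neighbours of `a` and `s`, and the first-class witness `α` of `s`
with `a`. Each position gives a triangle, a larger neighbour of `a`, or a witness that puts `a` in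
the second class. -/
theorem second_is_last {a s : ℕ} (ha : ¬ B a) (hs : B s) (has : a < s) (hE : E a s) : IsLast E a s := by
  obtain ⟨x, hx, hsx⟩ := S.exists_last has hE
  rcases hsx.eq_or_lt with rfl | hsx
  · exact hx
  exfalso
  obtain ⟨R, hR, α, hα, hαB, hαR⟩ := (S.second s).1 hs
  rcases lt_trichotomy α a with h | h | h
  · rcases lt_trichotomy x R with h2 | h2 | h2
    · exact (hx.2.2 R (S.capped a s x R has hsx h2 hx.2.1 hR.2.1)).not_gt h2
    · subst h2
      exact S.tri a s x has hsx hE hR.2.1 hx.2.1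
    · exact ha ((S.second a).2 ⟨x, hx, α, h, hαB, S.capped α a R x h (has.trans hR.1) h2 hαR hx.2.1⟩)
  · subst h
    exact S.tri α s R has hR.1 hE hR.2.1 hαR
  · exact S.tri a s R has hR.1 hE hR.2.1 (S.capped a α s R h hα hR.1 hE hαR)

/-- Edges inside the second class to a vertex which is not the last neighbour. -/
theorem second_edge {s s' R R' α α' : ℕ} (hs : B s) (hs' : B s') (hss : s < s') (hE : E s s') (hR : IsLast E s R)
    (hR' : IsLast E s' R') (hsR : s' < R) (hα : α < s) (hαB : ¬ B α) (hαR : E α R) (hα' : α' < s') (hαB' : ¬ B α')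
    (hαR' : E α' R') : R' < R ∧ α = α' := by
  have hRR : R' < R := by
    rcases lt_trichotomy R' R with h | h | h
    · exact h
    · subst h
      exact (S.tri s s' R' hss hR'.1 hE hR'.2.1 hR.2.1).elim
    · exact absurd (hR.2.2 R' (S.capped s s' R R' hss hsR h hR.2.1 hR'.2.1)) h.not_ge
  refine ⟨hRR, ?_⟩
  rcases lt_trichotomy α' s with h | h | h
  · have := S.capped α' s R' R h (hss.trans hR'.1) hRR hαR' hR.2.1
    exact S.first_left_unique hαB hαB' (hα.trans hR.1) (h.trans hR.1) hαR this
  · exact absurd hs (h ▸ hαB')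
  · exact (S.tri s s' R' hss hR'.1 hE hR'.2.1 (S.capped s α' s' R' h hα' hR'.1 hE hαR')).elim

/-- Within the second class a vertex thus has at most one larger neighbour besides its last
neighbour, and two colours suffice for these edges, chosen downwards. By `second_edge` the three
witnesses are the same vertex `α`; then `α` or `s` is in a triangle. -/
theorem second_edge_unique {s s' s'' y : ℕ} (hs : B s) (hs' : B s') (hs'' : B s'') (h1 : s < s') (h2 : s' < s'')
    (hE : E s s') (hE' : E s s'') (hy : s'' < y) (hEy : E s y) : False := by
  obtain ⟨R, hR, α, hα, hαB, hαR⟩ := (S.second s).1 hs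
  obtain ⟨R', hR', α', hα', hαB', hαR'⟩ := (S.second s').1 hs'
  obtain ⟨R'', hR'', α'', hα'', hαB'', hαR''⟩ := (S.second s'').1 hs''
  have hyR := hR.2.2 y hEy
  obtain ⟨e1, rfl⟩ := S.second_edge hs hs' h1 hE hR hR' (by omega) hα hαB hαR hα' hαB' hαR'
  obtain ⟨e2, rfl⟩ := S.second_edge hs hs'' (h1.trans h2) hE' hR hR'' (by omega) hα hαB hαR hα'' hαB'' hαR''
  rcases lt_trichotomy R' s'' with h | h | h
  · have := S.capped α s R' s'' hα (h1.trans hR'.1) h hαR' hE'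
    exact S.tri α s'' R'' hα'' hR''.1 this hR''.2.1 hαR''
  · subst h
    exact S.tri s s' R' h1 hR'.1 hE hR'.2.1 hE'
  · exact S.tri s s' R' h1 hR'.1 hE hR'.2.1 (S.capped s s' s'' R' h1 h2 h hE' hR'.2.1)

/-- The recursion for `P` in `ZoneColouring` passes from a vertex with largest zone `a` to the last
neighbour `c` of `a`. It is well founded because the largest zone decreases. -/
theorem zone_of_last_lt {a c a' : ℕ} (hc : IsLast E a c) (h : InZone E B a' c) : a' < a := by
  obtain ⟨h1, h2, h3, c', hc', hB, hlt⟩ := h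
  rcases lt_trichotomy a' a with h | h | h
  · exact h
  · subst h; exact absurd hc.2.1 h3
  · exact absurd (hc.2.2 c' (S.capped a a' c c' h h2 hlt hc.2.1 hc'.2.1)) hlt.not_ge

theorem exists_maxZone {a t : ℕ} (h : InZone E B a t) : ∃ m, IsMaxZone E B m t := by
  classical
  have h1 := Nat.findGreatest_spec (P := fun a => InZone E B a t) (n := t) h.2.1.le h
  exact ⟨_, h1, fun a' h' => Nat.le_findGreatest (P := fun a => InZone E B a t) h'.2.1.le h'⟩

/-- A neighbour below the zone. -/
theorem low_neighbour {a t c y : ℕ} (hz : InZone E B a t) (hc : IsLast E a c) (hya : y < a) (hE : E y t) :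
    E y c ∧ B y ∧ ¬ B t ∧ B c ∧ ∃ x, c < x ∧ E y x := by
  obtain ⟨h1, h2, h3, c', hc', hB, hlt⟩ := hz
  have := hc.unique hc'
  subst this
  have hyc : E y c := S.capped y a t c hya h2 hlt hE hc.2.1
  have hy : B y := by
    by_contra hy
    exact h1 ((S.second a).2 ⟨c, hc, y, hya, hy, hyc⟩)
  obtain ⟨R, hR, α, hα, hαB, hαR⟩ := (S.second y).1 hy
  have hcR : c < R := by
    rcases (hR.2.2 c hyc).eq_or_lt with h | h
    · subst h
      have := S.first_left_unique hαB h1 (hα.trans hR.1) hc.1 hαR hc.2.1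
      omega
    · exact h
  refine ⟨hyc, hy, fun ht => ?_, hB, R, hcR, hR.2.1⟩
  exact S.second_edge_unique hy ht hB (hya.trans h2) hlt hE hyc hcR hR.2.1

variable (K : BaseColouring E B k) (Q : ZoneColouring E B k P)
include K Q

/-- `P t` permutes the colours: it is a composition of transpositions, each exchanging a first-class
colour `k a < 2` with a second-class colour `k c ≥ 2`. The bound `m` carries the induction. -/
theorem zone_inj (m t : ℕ) (hm : ∀ a, InZone E B a t → a < m) (x y : ℕ) : P t x = P t y ↔ k x = k y := by
  induction m using Nat.strong_induction_on generalizing t x y with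
  | _ m ih =>
    by_cases h : ∃ a, InZone E B a t
    · obtain ⟨a, ha⟩ := h
      obtain ⟨a, ha⟩ := S.exists_maxZone ha
      obtain ⟨h1, h2, h3, c, hc, hB, hlt⟩ := id ha.1
      have hi := ih a (hm a ha.1) c (fun a' h => S.zone_of_last_lt hc h)
      have k1 := K.first_lt a h1
      have k2 := K.second_le c hB
      rw [Q.some t x a c ha hc, Q.some t y a c ha hc]
      split_ifs <;> rw [hi] <;> omega
    · push Not at h
      rw [Q.none t x h, Q.none t y h]

theorem zone_lt (m t : ℕ) (hm : ∀ a, InZone E B a t → a < m) (x : ℕ) : P t x < 4 := by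
  induction m using Nat.strong_induction_on generalizing t x with
  | _ m ih =>
    by_cases h : ∃ a, InZone E B a t
    · obtain ⟨a, ha⟩ := h
      obtain ⟨a, ha⟩ := S.exists_maxZone ha
      obtain ⟨h1, h2, h3, c, hc, hB, hlt⟩ := id ha.1
      have hi := ih a (hm a ha.1) c (fun a' h => S.zone_of_last_lt hc h)
      rw [Q.some t x a c ha hc]
      split_ifs <;> exact hi _
    · push Not at h
      rw [Q.none t x h]
      by_cases hx : B x
      · exact (K.second_le x hx).2
      · have := K.first_lt x hx
        omega

theorem zone_congr {t t' : ℕ} (h : ∀ a, InZone E B a t ↔ InZone E B a t') (x : ℕ) : P t x = P t' x := by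
  by_cases hz : ∃ a, InZone E B a t
  · obtain ⟨a, ha⟩ := hz
    obtain ⟨a, ha⟩ := S.exists_maxZone ha
    obtain ⟨c, hc, _⟩ := ha.1.2.2.2
    rw [Q.some t x a c ha hc, Q.some t' x a c ⟨(h a).1 ha.1, fun a' h' => ha.2 a' ((h a').2 h')⟩ hc]
  · push Not at hz
    rw [Q.none t x hz, Q.none t' x fun a ha => hz a ((h a).2 ha)]

theorem base_proper {t z : ℕ} (htz : t < z) (hE : E t z) (hk : k t = k z) : B t ∧ B z ∧ IsLast E t z := by
  by_cases ht : B t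
  · by_cases hz : B z
    · refine ⟨ht, hz, ?_⟩
      obtain ⟨x, hx, hzx⟩ := S.exists_last htz hE
      rcases hzx.eq_or_lt with rfl | h
      · exact hx
      · exact absurd hk (K.second_ne t z x ht hz htz hE h hx.2.1)
    · have := K.first_lt z hz
      have := K.second_le t ht
      omega
  · by_cases hz : B z
    · have := K.first_lt t ht
      have := K.second_le z hz
      omega
    · exact absurd hk (K.first_ne t z ht hz htz hE)

/-- The edge `t z` when `t` is in a zone above all zones of `z`. -/
theorem proper_of_zone {t z a : ℕ} (hE : E t z) (ha : IsMaxZone E B a t) (hz : ∀ a', InZone E B a' z → a' < a) :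
    P t t ≠ P z z := by
  obtain ⟨h1, h2, h3, c, hc, hB, hlt⟩ := id ha.1
  have ka := K.first_lt a h1
  have kc := K.second_le c hB
  have hinj := S.zone_inj K Q a c (fun a' h => S.zone_of_last_lt hc h)
  have hzc : z ≤ c := by
    by_contra hcon
    push Not at hcon
    exact absurd (hc.2.2 z (S.capped a t c z h2 hlt hcon hc.2.1 hE)) hcon.not_ge
  rw [Q.some t t a c ha hc]
  -- If `z = c`, then `t` is of the second class, because `a` is the only smaller first-class
  -- neighbour of `c`. The swap moves its colour away from that of `c`, or the two differ already.
  rcases hzc.eq_or_lt with rfl | hzc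
  · have ht : B t := by
      by_contra ht
      have := S.first_left_unique h1 ht hc.1 hlt hc.2.1 hE
      omega
    have := K.second_le t ht
    split_ifs
    · omega
    · rw [ne_eq, hinj]; omega
    · rw [ne_eq, hinj]; omega
  · -- here the zones of `z` are those of `c`
    suffices H : (∀ x, P z x = P c x) ∧ k z ≠ k a ∧ k z ≠ k c ∧ k t ≠ k z by
      obtain ⟨e1, e2, e3, e4⟩ := H
      rw [e1]
      split_ifs <;> rw [ne_eq, hinj] <;> omega
    -- For `z < a` the vertex `z` is a second-class neighbour of `c`; for `a < z` it is a
    -- first-class neighbour of `a`, as it is not in the zone of `a`. In both cases the swap leaves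
    -- the colour of `z` alone.
    rcases lt_trichotomy z a with hza | hza | hza
    · obtain ⟨l1, l2, l3, l4, R, l5, l6⟩ := S.low_neighbour ha.1 hc hza (S.symm _ _ hE)
      refine ⟨fun x => S.zone_congr K Q (fun a' => ⟨?_, ?_⟩) x, ?_, ?_, ?_⟩
      · rintro ⟨g1, g2, g3, c', g4, g5, g6⟩
        have hn : ¬ E a' c := fun h => by
          have := S.first_left_unique g1 h1 (by omega) hc.1 h hc.2.1
          omega
        refine ⟨g1, by omega, hn, c', g4, g5, ?_⟩
        by_contra hcon
        push Not at hcon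
        rcases hcon.eq_or_lt with h | h
        · subst h; exact hn g4.2.1
        · exact hn (S.capped a' z c' c g2 g6 h g4.2.1 l1)
      · intro hz'
        have haa := S.zone_of_last_lt hc hz'
        obtain ⟨g1, g2, g3, c', g4, g5, g6⟩ := hz'
        obtain ⟨R, hR, α, hα, hαB, hαR⟩ := (S.second z).1 l2
        have haz : a' < z := by
          rcases lt_trichotomy a' z with h | h | h
          · exact h
          · subst h; exact absurd l2 g1
          · exfalso
            have hzc' := S.capped z a' c c' h g2 g6 l1 g4.2.1
            rcases (hR.2.2 c' hzc').eq_or_lt with h5 | h5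
            · subst h5
              have := S.first_left_unique hαB g1 (hα.trans hR.1) g4.1 hαR g4.2.1
              omega
            · exact S.second_edge_unique l2 l4 g5 hzc g6 l1 hzc' h5 hR.2.1
        refine ⟨g1, haz, fun h => ?_, c', g4, g5, by omega⟩
        have := (S.second_is_last g1 l2 haz h).unique g4
        omega
      · have := K.second_le z l2; omega
      · exact K.second_ne z c R l2 l4 hzc l1 l5 l6
      · have := K.second_le z l2
        have := K.first_lt t l3
        omega
    · subst hza
      exact absurd (S.symm _ _ hE) h3
    · have haz : E a z := by
        by_contra hcon
        have := hz a ⟨h1, hza, hcon, c, hc, hB, hzc⟩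
        omega
      have hzB : ¬ B z := fun h => by
        have := (S.second_is_last h1 h hza haz).unique hc
        omega
      have kz := K.first_lt z hzB
      have kaz := K.first_ne a z h1 hzB hza haz
      refine ⟨fun x => S.zone_congr K Q (fun a' => ⟨?_, ?_⟩) x, kaz.symm, by omega, ?_⟩
      · intro hz'
        have haa := hz a' hz'
        obtain ⟨g1, g2, g3, c', g4, g5, g6⟩ := hz'
        have hn : ¬ E a' c := fun h => by
          have := S.first_left_unique g1 h1 (by omega) hc.1 h hc.2.1
          omega
        refine ⟨g1, by omega, hn, c', g4, g5, ?_⟩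
        by_contra hcon
        push Not at hcon
        rcases hcon.eq_or_lt with h | h
        · subst h; exact hn g4.2.1
        · exact hn (S.capped a' a c' c haa (by omega) h g4.2.1 hc.2.1)
      · intro hz'
        have haa := S.zone_of_last_lt hc hz'
        obtain ⟨g1, g2, g3, c', g4, g5, g6⟩ := hz'
        refine ⟨g1, by omega, fun h => ?_, c', g4, g5, by omega⟩
        have := S.first_left_unique g1 h1 (by omega) hza h haz
        omega
      · by_cases ht : B t
        · have := K.second_le t ht; omega
        · rcases lt_trichotomy t z with h | h | h
          · exact K.first_ne t z ht hzB h hE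
          · subst h; exact absurd haz h3
          · exact (K.first_ne z t hzB ht h (S.symm _ _ hE)).symm

/-- The zone colouring is a proper colouring with four colours. -/
theorem zone_proper {t z : ℕ} (htz : t < z) (hE : E t z) : P t t ≠ P z z := by
  by_cases h : ∃ a, InZone E B a t ∧ ∀ a', InZone E B a' z → a' < a
  · obtain ⟨a, ha, hz⟩ := h
    obtain ⟨m, hm⟩ := S.exists_maxZone ha
    exact S.proper_of_zone K Q hE hm fun a' ha' => (hz a' ha').trans_le (hm.2 a ha)
  by_cases h' : ∃ a, InZone E B a z ∧ ∀ a', InZone E B a' t → a' < a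
  · obtain ⟨a, ha, hz⟩ := h'
    obtain ⟨m, hm⟩ := S.exists_maxZone ha
    exact (S.proper_of_zone K Q (S.symm _ _ hE) hm fun a' ha' => (hz a' ha').trans_le (hm.2 a ha)).symm
  push Not at h h'
  -- now `t` and `z` have the same largest zone
  have hP : ∀ x, P t x = P z x := by
    intro x
    by_cases hz : ∃ a, InZone E B a t
    · obtain ⟨a, ha⟩ := hz
      obtain ⟨a, ha⟩ := S.exists_maxZone ha
      obtain ⟨a', ha', hle⟩ := h a ha.1
      obtain ⟨m, hm⟩ := S.exists_maxZone ha'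
      obtain ⟨a'', ha'', hle'⟩ := h' m hm.1
      have e : m = a := by
        have := ha.2 a'' ha''
        have := hm.2 a' ha'
        omega
      subst e
      obtain ⟨c, hc, _⟩ := ha.1.2.2.2
      rw [Q.some t x m c ha hc, Q.some z x m c hm hc]
    · push Not at hz
      rw [Q.none t x hz, Q.none z x fun a ha => ?_]
      obtain ⟨a', ha', _⟩ := h' a ha
      exact hz a' ha'
  rw [hP t, ne_eq, S.zone_inj K Q z z (fun a ha => ha.2.1)]
  intro hk
  obtain ⟨hBt, hBz, hl⟩ := S.base_proper K Q htz hE hk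
  obtain ⟨R, hR, α, hα, hαB, hαR⟩ := (S.second t).1 hBt
  have := hl.unique hR
  subst this
  have hαz : α < z := hα.trans htz
  have hlα := S.second_is_last hαB hBz hαz hαR
  -- A conflict puts `t` in the zone of `α`, while the zones of `z` belong to vertices below `α`.
  -- This excludes a common largest zone.
  have hzone : InZone E B α t :=
    ⟨hαB, hα, fun h2 => S.tri α t z hα htz h2 hE hαR, z, hlα, hBz, htz⟩
  obtain ⟨a', ha', hle⟩ := h α hzone
  exact absurd (S.zone_of_last_lt hlα ha') hle.not_gt

end TriangleFreeCapped
end FourColour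

/-! ### Cliques -/

/-- In a capped graph: `u < v` are the first two vertices of a clique with `t + 2` vertices. -/
def CliqueStart (B : ℕ → ℕ → Prop) : ℕ → ℕ → ℕ → Prop
  | 0, u, v => u < v ∧ B u v
  | t + 1, u, v => u < v ∧ B u v ∧ ∃ w, v < w ∧ B u w ∧ B v w ∧ CliqueStart B t v w

section CliqueStart
variable {B B' : ℕ → ℕ → Prop} {t u v n : ℕ}

theorem CliqueStart.lt (h : CliqueStart B t u v) : u < v := by
  cases t <;> exact h.1

theorem CliqueStart.adj (h : CliqueStart B t u v) : B u v := by
  cases t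
  · exact h.2
  · exact h.2.1

theorem CliqueStart.mono (hB : ∀ x y, B x y → B' x y) (h : CliqueStart B t u v) : CliqueStart B' t u v := by
  induction t generalizing u v with
  | zero => exact ⟨h.1, hB _ _ h.2⟩
  | succ t ih =>
    obtain ⟨h1, h2, w, h3, h4, h5, h6⟩ := h
    exact ⟨h1, hB _ _ h2, w, h3, hB _ _ h4, hB _ _ h5, ih h6⟩

/-- Looking two vertices ahead is enough: for a later vertex `x`, the edges `u w` and `v x`
interlace, so `u` sees `x`. -/
theorem CliqueStart.exists_list (hB : Capped B) (h : CliqueStart B t u v) :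
    ∃ l : List ℕ, l.length = t ∧ (u :: v :: l).Pairwise fun x y => x < y ∧ B x y := by
  induction t generalizing u v with
  | zero => exact ⟨[], rfl, by simpa [CliqueStart] using h⟩
  | succ t ih =>
    obtain ⟨h1, h2, w, h3, h4, h5, h6⟩ := h
    obtain ⟨l, hl, hp⟩ := ih h6
    refine ⟨w :: l, by simp [hl], List.Pairwise.cons (fun x hx => ?_) hp⟩
    rcases List.mem_cons.1 hx with rfl | hx'
    · exact ⟨h1, h2⟩
    rcases List.mem_cons.1 hx' with rfl | hx2
    · exact ⟨h1.trans h3, h4⟩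
    · have hvx := (List.pairwise_cons.1 hp).1 x hx'
      have hwx := (List.pairwise_cons.1 (List.pairwise_cons.1 hp).2).1 x hx2
      exact ⟨h1.trans hvx.1, hB u v w x h1 h3 hwx.1 h4 hvx.2⟩

theorem cliqueStart_of_list {l : List ℕ} (h : (u :: v :: l).Pairwise fun x y => x < y ∧ B x y) :
    CliqueStart B l.length u v := by
  induction l generalizing u v with
  | nil => simpa [CliqueStart] using h
  | cons w l ih =>
    have h1 := (List.pairwise_cons.1 h).1
    have h2 := (List.pairwise_cons.1 h).2
    have h3 := (List.pairwise_cons.1 h2).1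
    exact ⟨(h1 v (by simp)).1, (h1 v (by simp)).2, w, (h3 w (by simp)).1, (h1 w (by simp)).2,
      (h3 w (by simp)).2, ih h2⟩

def StartEdge (B : ℕ → ℕ → Prop) (t u v : ℕ) : Prop := CliqueStart B t u v ∨ CliqueStart B t v u

theorem startEdge_iff (huv : u < v) : StartEdge B t u v ↔ CliqueStart B t u v :=
  ⟨fun h => h.elim id fun h => absurd h.lt huv.not_gt, Or.inl⟩

/-- The first edges of largest cliques form a triangle-free capped graph. -/
theorem startEdge_triangleFreeCapped (hs : ∀ x y, B x y → B y x) (hb : ∀ x y, B x y → y < n) (hc : Capped B)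
    (hno : ∀ u v, ¬ CliqueStart B (t + 1) u v) {S : ℕ → Prop} (hS : SecondClass (StartEdge B t) S) :
    TriangleFreeCapped (StartEdge B t) n S where
  symm u v h := h.symm
  bound u v h := h.elim (fun h => hb _ _ h.adj) fun h => hb _ _ (hs _ _ h.adj)
  capped a b c d hab hbc hcd hac hbd := by
    rw [startEdge_iff (by omega)] at *
    have h1 := hac.adj
    cases t with
    | zero => exact ⟨by omega, hc a b c d hab hbc hcd h1 hbd.2⟩
    | succ t =>
      -- The vertex `a` replaces `b` in front of the clique: it sees `d` and the next vertex `w`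
      -- because its edge to `c` interlaces `b d` and `b w`.
      obtain ⟨h2, h3, w, h4, h5, h6, h7⟩ := hbd
      exact ⟨by omega, hc a b c d hab hbc hcd h1 h3, w, h4, hc a b c w hab hbc (by omega) h1 h5, h6, h7⟩
  tri u v w h1 h2 h3 h4 h5 := by
    rw [startEdge_iff (by omega)] at *
    exact hno u v ⟨h1, h3.adj, w, h2, h5.adj, h4.adj, h4⟩
  second := hS

end CliqueStart

/-- The graph on `k₁ < k₂` and their common neighbours above `k₂`. -/
def maskAdj (A : ℕ → ℕ → Prop) (k₁ k₂ x y : ℕ) : Prop :=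
  A x y ∧ (x = k₁ ∨ x = k₂ ∨ (k₂ < x ∧ A k₁ x ∧ A k₂ x)) ∧ (y = k₁ ∨ y = k₂ ∨ (k₂ < y ∧ A k₁ y ∧ A k₂ y))

/-- For common neighbours `a < d` of `k₁ < k₂`, the chords `k₁ a` and `k₂ d` cross. So `a` and `d`
are linked, and `CrossClosed` applies. -/
theorem maskAdj_capped {A : ℕ → ℕ → Prop} (hcl : CrossClosed A) {k₁ k₂ : ℕ} (hk : k₁ < k₂) :
    Capped (maskAdj A k₁ k₂) := by
  rintro a b c d hab hbc hcd ⟨h1, ha, hc⟩ ⟨h2, hb, hd⟩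
  refine ⟨?_, ha, hd⟩
  rcases ha with rfl | rfl | ha
  · exact (hd.resolve_left (by omega) |>.resolve_left (by omega)).2.1
  · exact (hd.resolve_left (by omega) |>.resolve_left (by omega)).2.2
  · have hd := hd.resolve_left (by omega) |>.resolve_left (by omega)
    refine hcl a b c d hab hbc hcd h1 h2 ⟨(k₁, a), (k₂, d), Or.inr rfl, Or.inr rfl, ?_⟩
    exact .of_cross (chordAv_mk (hk.trans ha.1) ha.2.1 (Or.inl (hk.trans ha.1).le) (Or.inl le_rfl))
      (chordAv_mk hd.1 hd.2.2 (Or.inl ha.1.le) (Or.inr le_rfl))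
      (Or.inl ⟨hk, ha.1, (hab.trans (hbc.trans hcd))⟩)

section CliqueNumber
variable {n : ℕ} {G : SimpleGraph (Fin n)}

theorem natAdj_lt {u v : ℕ} (h : natAdj G u v) : u < n ∧ v < n := by
  obtain ⟨x, y, rfl, rfl, _⟩ := h
  exact ⟨x.2, y.2⟩

theorem natAdj_coe {x y : Fin n} : natAdj G x y ↔ G.Adj x y := by
  refine ⟨fun ⟨a, b, h1, h2, h⟩ => ?_, fun h => ⟨x, y, rfl, rfl, h⟩⟩
  rwa [← Fin.ext h1, ← Fin.ext h2]

theorem card_le_cliqueNum_of_pairwise {l : List ℕ} (h2 : 2 ≤ l.length)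
    (h : l.Pairwise fun x y => x < y ∧ natAdj G x y) : l.length ≤ G.cliqueNum := by
  classical
  let s : Finset (Fin n) := Finset.univ.filter fun x => (x : ℕ) ∈ l
  have : Std.Symm fun x y => natAdj G x y ∨ natAdj G y x := ⟨fun _ _ h => h.symm⟩
  have hp : l.Pairwise fun x y => natAdj G x y ∨ natAdj G y x := h.imp fun h => Or.inl h.2
  have hlt : ∀ x ∈ l, x < n := by
    intro x hx
    obtain ⟨y, hy, hne⟩ : ∃ y ∈ l, y ≠ x := by
      by_contra hcon
      push Not at hcon
      have hnd : l.Nodup := h.imp fun h => h.1.ne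
      have : l.toFinset ⊆ {x} := fun y hy => by simpa using hcon y (by simpa using hy)
      have := Finset.card_le_card this
      rw [List.toFinset_card_of_nodup hnd] at this
      simp at this
      omega
    rcases hp.forall hy hx hne with h | h
    · exact (natAdj_lt h).2
    · exact (natAdj_lt h).1
  have hcl : G.IsClique (s : Set (Fin n)) := by
    intro x hx y hy hne
    simp only [s, Finset.coe_filter, Finset.mem_univ, true_and, Set.mem_ofPred_eq] at hx hy
    rcases hp.forall hx hy (fun h => hne (Fin.ext h)) with h | h
    · exact natAdj_coe.1 h
    · exact (natAdj_coe.1 h).symm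
  have hcard : s.card = l.length := by
    rw [← List.toFinset_card_of_nodup (h.imp fun h => h.1.ne)]
    refine Finset.card_bij (fun x _ => (x : ℕ)) (fun x hx => ?_) (fun x _ y _ h => Fin.ext h) fun y hy => ?_
    · simpa [s] using hx
    · have hy : y ∈ l := by simpa using hy
      exact ⟨⟨y, hlt y hy⟩, by simpa [s] using hy, rfl⟩
  rw [← hcard]
  exact hcl.card_le_cliqueNum

/-- A clique lies in the graph masked by its own first two vertices. This graph is capped, so the
recursive description `CliqueStart` yields genuine cliques there; the whole graph need not be
capped. -/
theorem exists_cliqueStart_iff (hcl : CrossClosed (natAdj G)) (t : ℕ) :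
    (∃ k₁ k₂, CliqueStart (maskAdj (natAdj G) k₁ k₂) t k₁ k₂) ↔ t + 2 ≤ G.cliqueNum := by
  constructor
  · rintro ⟨k₁, k₂, h⟩
    obtain ⟨l, hl, hp⟩ := h.exists_list (maskAdj_capped hcl h.lt)
    have := card_le_cliqueNum_of_pairwise (G := G) (l := k₁ :: k₂ :: l) (by simp) (hp.imp fun h => ⟨h.1, h.2.1⟩)
    simp only [List.length_cons, hl] at this
    omega
  · intro h
    obtain ⟨s, hs⟩ := G.exists_isNClique_cliqueNum
    obtain ⟨s', hs', hcard⟩ := Finset.exists_subset_card_eq (hs.card_eq ▸ h)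
    have hcl' : G.IsClique (s' : Set (Fin n)) := hs.isClique.subset (by exact_mod_cast hs')
    obtain ⟨l, hl, hp⟩ : ∃ l : List ℕ, l.length = t + 2 ∧ l.Pairwise fun x y => x < y ∧ natAdj G x y := by
      refine ⟨(s'.sort (· ≤ ·)).map Fin.val, by simp [hcard], ?_⟩
      rw [List.pairwise_map]
      have h1 := s'.sortedLT_sort.pairwise
      refine h1.imp_of_mem fun {a b} ha hb hab => ⟨hab, ⟨a, b, rfl, rfl, ?_⟩⟩
      exact hcl' (by simpa using ha) (by simpa using hb) (fun h => hab.ne (congrArg Fin.val h))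
    obtain ⟨k₁, k₂, l, rfl⟩ : ∃ k₁ k₂ l', l = k₁ :: k₂ :: l' := by
      match l, hl with
      | a :: b :: l, _ => exact ⟨a, b, l, rfl⟩
    refine ⟨k₁, k₂, ?_⟩
    have hlen : l.length = t := by simpa using hl
    rw [← hlen]
    apply cliqueStart_of_list
    have h1 := (List.pairwise_cons.1 hp).1
    have h2 := (List.pairwise_cons.1 (List.pairwise_cons.1 hp).2).1
    have hm : ∀ x ∈ k₁ :: k₂ :: l, x = k₁ ∨ x = k₂ ∨ (k₂ < x ∧ natAdj G k₁ x ∧ natAdj G k₂ x) := by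
      intro x hx
      rcases List.mem_cons.1 hx with h | h
      · exact Or.inl h
      rcases List.mem_cons.1 h with h' | h'
      · exact Or.inr (Or.inl h')
      · exact Or.inr (Or.inr ⟨(h2 x h').1, (h1 x h).2, (h2 x h').2⟩)
    exact hp.imp_of_mem fun {a b} ha hb hab => ⟨hab.1, hab.2, hm a ha, hm b hb⟩

theorem cliqueNum_pos (hn : 0 < n) : 1 ≤ G.cliqueNum := by
  have : G.IsClique (({⟨0, hn⟩} : Finset (Fin n)) : Set (Fin n)) := by simp
  simpa using this.card_le_cliqueNum

theorem cliqueNum_le (G : SimpleGraph (Fin n)) : G.cliqueNum ≤ n := by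
  obtain ⟨s, hs⟩ := G.exists_isNClique_cliqueNum
  rw [← hs.card_eq]
  simpa using Finset.card_le_univ s

end CliqueNumber

/-! ### Iteration -/

/-- Growing subsets of `{0, …, N - 1}` which stay equal once they are equal are stable from `N` on. -/
theorem stable_of_growing {N : ℕ} {S : ℕ → ℕ → Prop} (hmono : ∀ i x, S i x → S (i + 1) x)
    (hlt : ∀ i x, S i x → x < N)
    (hstab : ∀ i, (∀ x, S (i + 1) x → S i x) → ∀ x, S (i + 2) x → S (i + 1) x) (x : ℕ) (h : S (N + 1) x) : S N x := by
  classical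
  by_contra hcon
  have hne : ∀ i, i ≤ N → ∃ x, S (i + 1) x ∧ ¬ S i x := by
    intro i hi
    by_contra hno
    push Not at hno
    have : ∀ j, i ≤ j → ∀ x, S (j + 1) x → S j x := fun j hj => by
      induction j, hj using Nat.le_induction with
      | base => exact hno
      | succ j _ ih => exact hstab j ih
    exact hcon (this N hi x h)
  let C : ℕ → Finset ℕ := fun i => (Finset.range N).filter (S i)
  have hC : ∀ i, i ≤ N + 1 → i ≤ (C i).card := by
    intro i
    induction i with
    | zero => intro _; exact Nat.zero_le _
    | succ i ih =>
      intro hi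
      refine (Nat.succ_le_succ (ih (by omega))).trans (Finset.card_lt_card ?_)
      rw [Finset.ssubset_iff_of_subset]
      · obtain ⟨x, h1, h2⟩ := hne i (by omega)
        exact ⟨x, by simp [C, h1, hlt _ _ h1], by simp [C, h2]⟩
      · intro x hx
        simp only [C, Finset.mem_filter] at hx ⊢
        exact ⟨hx.1, hmono _ _ hx.2⟩
  have h1 := hC (N + 1) le_rfl
  have h2 : (C (N + 1)).card ≤ N := by
    simpa using Finset.card_le_card (Finset.filter_subset (S (N + 1)) (Finset.range N))
  omega

/-! ### A small programming language above the random access machine -/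

/-- Expressions with sums over `{0, …, N - 1}`. -/
inductive Ex where
  | const (k : ℕ)
  | var (x : ℕ)
  | rd (a : ℕ) (e : Ex)
  | add (e f : Ex)
  | sub (e f : Ex)
  | ite (c e f : Ex)
  | sum (x : ℕ) (e : Ex)

/-- Variables below `regBound` belong to programs, the others are used by the compiler. -/
def regBound : ℕ := 60
/-- The array used for parallel assignments. -/
def tmpArr : ℕ := 3
/-- The array of the multiples of `N`. -/
def mulArr : ℕ := 4

namespace Ex

def eval (N : ℕ) (m : ℕ → ℕ → ℕ) : (ℕ → ℕ) → Ex → ℕ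
  | _, const k => k
  | v, var x => v x
  | v, rd a e => m a (eval N m v e)
  | v, add e f => eval N m v e + eval N m v f
  | v, sub e f => eval N m v e - eval N m v f
  | v, ite c e f => if eval N m v c ≠ 0 then eval N m v e else eval N m v f
  | v, sum x e => ∑ i ∈ Finset.range N, eval N m (Function.update v x i) e

def ok : Ex → Bool
  | const _ => true
  | var x => decide (x < regBound)
  | rd a e => decide (a ≠ tmpArr) && e.ok
  | add e f => e.ok && f.ok
  | sub e f => e.ok && f.ok
  | ite c e f => c.ok && e.ok && f.ok
  | sum x e => decide (x < regBound) && decide (x ≠ 2) && e.ok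

/-- This is an upper bound, so both branches of `ite` may be charged; the degree is governed by the
nesting of sums. -/
noncomputable def time : Ex → Polynomial ℕ
  | const _ => 2
  | var _ => 2
  | rd _ e => e.time + 3
  | add e f => e.time + f.time + 4
  | sub e f => e.time + f.time + 4
  | ite c e f => c.time + e.time + f.time + 2
  | sum _ e => Polynomial.X * (e.time + 12) + 12

theorem eval_congr (N : ℕ) (m m' : ℕ → ℕ → ℕ) (e : Ex) (he : e.ok = true) (hm : ∀ a, a ≠ tmpArr → m a = m' a)
    (v v' : ℕ → ℕ) (h : ∀ i, i < regBound → v i = v' i) : e.eval N m v = e.eval N m' v' := by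
  induction e generalizing v v' with
  | const k => rfl
  | var x => exact h x (by simpa [ok] using he)
  | rd a e ih =>
    simp only [ok, Bool.and_eq_true, decide_eq_true_eq] at he
    simp only [eval, ih he.2 v v' h, hm a he.1]
  | add e f ih1 ih2 =>
    simp only [ok, Bool.and_eq_true] at he
    simp only [eval, ih1 he.1 v v' h, ih2 he.2 v v' h]
  | sub e f ih1 ih2 =>
    simp only [ok, Bool.and_eq_true] at he
    simp only [eval, ih1 he.1 v v' h, ih2 he.2 v v' h]
  | ite c e f ih0 ih1 ih2 =>
    simp only [ok, Bool.and_eq_true] at he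
    simp only [eval, ih0 he.1.1 v v' h, ih1 he.1.2 v v' h, ih2 he.2 v v' h]
  | sum x e ih =>
    simp only [ok, Bool.and_eq_true] at he
    refine Finset.sum_congr rfl fun i _ => ih he.2 _ _ fun j hj => ?_
    by_cases hjx : j = x
    · simp [hjx]
    · simp [Function.update_of_ne hjx, h j hj]

end Ex

def RamState.setVar (s : RamState) (x v : ℕ) : RamState := { s with var := Function.update s.var x v }

@[simp] theorem RamState.setVar_arr (s : RamState) (x v : ℕ) : (s.setVar x v).arr = s.arr := rfl
@[simp] theorem RamState.setVar_same (s : RamState) (x v : ℕ) : (s.setVar x v).var x = v := by simp [setVar]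
theorem RamState.setVar_of_ne (s : RamState) {x y : ℕ} (v : ℕ) (h : y ≠ x) : (s.setVar x v).var y = s.var y := by
  simp [setVar, h]

def RamState.setArr (s : RamState) (a : ℕ) (f : ℕ → ℕ) : RamState := { s with arr := Function.update s.arr a f }

@[simp] theorem RamState.setArr_var (s : RamState) (a : ℕ) (f : ℕ → ℕ) : (s.setArr a f).var = s.var := rfl
@[simp] theorem RamState.setArr_same (s : RamState) (a : ℕ) (f : ℕ → ℕ) : (s.setArr a f).arr a = f := by simp [setArr]
theorem RamState.setArr_of_ne (s : RamState) {a b : ℕ} (f : ℕ → ℕ) (h : b ≠ a) : (s.setArr a f).arr b = s.arr b := by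
  simp [setArr, h]

/-- `for x < N do p`, where variable `2` holds `N`. -/
def forProg (x : ℕ) (p : RamProg) : RamProg :=
  .seq (.assign x (.const 0)) (.loop (.sub (.var 2) (.var x)) (.seq p (.assign x (.add (.var x) (.const 1)))))

/-- In each round the test and the increment cost 4 units each; the initialization and the last test
cost 2 and 4. -/
theorem exec_for {x N T : ℕ} {p : RamProg} (Inv : ℕ → RamState → Prop) (hx : x ≠ 2) (s : RamState)
    (hN : s.var 2 = N) (h0 : Inv 0 (s.setVar x 0))
    (step : ∀ i s, i < N → Inv i s → s.var x = i → s.var 2 = N → ∃ s' t, RamExec p s s' t ∧ t ≤ T ∧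
      s'.var x = i ∧ s'.var 2 = N ∧ Inv (i + 1) (s'.setVar x (i + 1))) :
    ∃ s' t, RamExec (forProg x p) s s' t ∧ t ≤ N * (T + 8) + 6 ∧ s'.var x = N ∧ s'.var 2 = N ∧ Inv N s' := by
  have loop : ∀ m i s, i + m = N → Inv i s → s.var x = i → s.var 2 = N → ∃ s' t,
      RamExec (.loop (.sub (.var 2) (.var x)) (.seq p (.assign x (.add (.var x) (.const 1))))) s s' t ∧
      t ≤ m * (T + 8) + 4 ∧ s'.var x = N ∧ s'.var 2 = N ∧ Inv N s' := by
    intro m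
    induction m with
    | zero =>
      intro i s him hI hxi h2
      have : i = N := by omega
      subst this
      exact ⟨s, _, .loop_false (by simp [RamExpr.eval, hxi, h2]), by simp [RamExpr.cost], hxi, h2, hI⟩
    | succ m ih =>
      intro i s him hI hxi h2
      obtain ⟨s1, t1, e1, ht1, hx1, h21, hI1⟩ := step i s (by omega) hI hxi h2
      obtain ⟨s2, t2, e2, ht2, hx2, h22, hI2⟩ := ih (i + 1) (s1.setVar x (i + 1)) (by omega) hI1 (by simp)
        (by rw [RamState.setVar_of_ne _ _ (Ne.symm hx)]; exact h21)
      have e3 : RamExec (.assign x (.add (.var x) (.const 1))) s1 (s1.setVar x (i + 1)) 4 := by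
        have := RamExec.assign s1 x (.add (.var x) (.const 1))
        simpa [RamExpr.eval, RamExpr.cost, hx1, RamState.setVar] using this
      refine ⟨s2, _, .loop_true ?_ (.seq e1 e3) e2, ?_, hx2, h22, hI2⟩
      · simp only [RamExpr.eval, hxi, h2]; omega
      · simp only [RamExpr.cost]
        nlinarith
  obtain ⟨s', t, e, ht, h1, h2, h3⟩ := loop N 0 (s.setVar x 0) (by omega) h0 (by simp)
    (by rw [RamState.setVar_of_ne _ _ (Ne.symm hx)]; exact hN)
  have e0 : RamExec (.assign x (.const 0)) s (s.setVar x 0) 2 := RamExec.assign s x (.const 0)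
  exact ⟨s', _, .seq e0 e, by omega, h1, h2, h3⟩

namespace Ex

/-- The variables from `k` on are used as a stack, so nothing between `regBound` and `k` is
disturbed. The bound variable of a sum serves as loop counter; its old value is kept in `k + 1` and
restored. -/
def comp : Ex → ℕ → RamProg
  | const c, k => .assign k (.const c)
  | var x, k => .assign k (.var x)
  | rd a e, k => .seq (comp e k) (.assign k (.read a (.var k)))
  | add e f, k => .seq (comp e k) (.seq (comp f (k + 1)) (.assign k (.add (.var k) (.var (k + 1)))))
  | sub e f, k => .seq (comp e k) (.seq (comp f (k + 1)) (.assign k (.sub (.var k) (.var (k + 1)))))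
  | ite c e f, k => .seq (comp c k) (.branch (.var k) (comp e k) (comp f k))
  | sum x e, k => .seq (.assign k (.const 0)) (.seq (.assign (k + 1) (.var x))
      (.seq (forProg x (.seq (comp e (k + 2)) (.assign k (.add (.var k) (.var (k + 2)))))) (.assign x (.var (k + 1)))))

/-- The compiled expression `e` leaves its value in the variable `k`. -/
theorem comp_spec (N : ℕ) (e : Ex) (he : e.ok = true) (k : ℕ) (hk : regBound ≤ k) (s : RamState) (hN : s.var 2 = N) :
    ∃ s' t, RamExec (e.comp k) s s' t ∧ t ≤ e.time.eval N ∧ s'.arr = s.arr ∧ (∀ i, i < k → s'.var i = s.var i) ∧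
      s'.var k = e.eval N s.arr s.var := by
  have h2 : 2 < regBound := by decide
  have set_lt : ∀ (s : RamState) (k v : ℕ), ∀ i, i < k → (s.setVar k v).var i = s.var i := fun s k v i hi =>
    s.setVar_of_ne v (by omega)
  induction e generalizing k s with
  | const c =>
    exact ⟨s.setVar k c, _, RamExec.assign s k (.const c), by simp [RamExpr.cost, time], rfl, set_lt s k c, by simp [eval]⟩
  | var x =>
    exact ⟨s.setVar k (s.var x), _, RamExec.assign s k (.var x), by simp [RamExpr.cost, time], rfl, set_lt s k _, by simp [eval]⟩
  | rd a e ih =>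
    simp only [ok, Bool.and_eq_true, decide_eq_true_eq] at he
    obtain ⟨s1, t1, e1, ht1, ha1, hv1, hk1⟩ := ih he.2 k hk s hN
    refine ⟨s1.setVar k (s.arr a (eval N s.arr s.var e)), t1 + 3, .seq e1 ?_, ?_, ha1, fun i hi => ?_, by simp [eval]⟩
    · have := RamExec.assign s1 k (.read a (.var k))
      simpa [RamExpr.eval, RamExpr.cost, hk1, ha1, RamState.setVar] using this
    · simp only [time, Polynomial.eval_add, Polynomial.eval_ofNat]; omega
    · rw [set_lt _ _ _ i hi, hv1 i hi]
  | add e f ih1 ih2 =>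
    simp only [ok, Bool.and_eq_true] at he
    obtain ⟨s1, t1, e1, ht1, ha1, hv1, hk1⟩ := ih1 he.1 k hk s hN
    obtain ⟨s2, t2, e2, ht2, ha2, hv2, hk2⟩ := ih2 he.2 (k + 1) (by omega) s1 (by rw [hv1 2 (by omega), hN])
    have hf : eval N s1.arr s1.var f = eval N s.arr s.var f :=
      eval_congr N _ _ f he.2 (fun a _ => by rw [ha1]) _ _ fun i hi => hv1 i (by omega)
    refine ⟨s2.setVar k (eval N s.arr s.var e + eval N s.arr s.var f), t1 + (t2 + 4), .seq e1 (.seq e2 ?_), ?_, ha2.trans ha1,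
      fun i hi => ?_, by simp [eval]⟩
    · have := RamExec.assign s2 k (.add (.var k) (.var (k + 1)))
      simpa [RamExpr.eval, RamExpr.cost, hk2, hv2 k (by omega), hk1, hf, RamState.setVar] using this
    · simp only [time, Polynomial.eval_add, Polynomial.eval_ofNat]; omega
    · rw [set_lt _ _ _ i hi, hv2 i (by omega), hv1 i hi]
  | sub e f ih1 ih2 =>
    simp only [ok, Bool.and_eq_true] at he
    obtain ⟨s1, t1, e1, ht1, ha1, hv1, hk1⟩ := ih1 he.1 k hk s hN
    obtain ⟨s2, t2, e2, ht2, ha2, hv2, hk2⟩ := ih2 he.2 (k + 1) (by omega) s1 (by rw [hv1 2 (by omega), hN])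
    have hf : eval N s1.arr s1.var f = eval N s.arr s.var f :=
      eval_congr N _ _ f he.2 (fun a _ => by rw [ha1]) _ _ fun i hi => hv1 i (by omega)
    refine ⟨s2.setVar k (eval N s.arr s.var e - eval N s.arr s.var f), t1 + (t2 + 4), .seq e1 (.seq e2 ?_), ?_, ha2.trans ha1,
      fun i hi => ?_, by simp [eval]⟩
    · have := RamExec.assign s2 k (.sub (.var k) (.var (k + 1)))
      simpa [RamExpr.eval, RamExpr.cost, hk2, hv2 k (by omega), hk1, hf, RamState.setVar] using this
    · simp only [time, Polynomial.eval_add, Polynomial.eval_ofNat]; omega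
    · rw [set_lt _ _ _ i hi, hv2 i (by omega), hv1 i hi]
  | ite c e f ih0 ih1 ih2 =>
    simp only [ok, Bool.and_eq_true] at he
    obtain ⟨s0, t0, e0, ht0, ha0, hv0, hk0⟩ := ih0 he.1.1 k hk s hN
    have h20 : s0.var 2 = N := by rw [hv0 2 (by omega), hN]
    have hc : ∀ f : Ex, f.ok = true → eval N s0.arr s0.var f = eval N s.arr s.var f := fun f hf =>
      eval_congr N _ _ f hf (fun a _ => by rw [ha0]) _ _ fun i hi => hv0 i (by omega)
    by_cases hz : eval N s.arr s.var c = 0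
    · obtain ⟨s1, t1, e1, ht1, ha1, hv1, hk1⟩ := ih2 he.2 k hk s0 h20
      refine ⟨s1, _, .seq e0 (.branch_false (by simp [RamExpr.eval, hk0, hz]) e1), ?_, ha1.trans ha0,
        fun i hi => (hv1 i hi).trans (hv0 i hi), by simp [eval, hz, hk1, hc f he.2]⟩
      simp only [time, Polynomial.eval_add, Polynomial.eval_ofNat, RamExpr.cost]; omega
    · obtain ⟨s1, t1, e1, ht1, ha1, hv1, hk1⟩ := ih1 he.1.2 k hk s0 h20
      refine ⟨s1, _, .seq e0 (.branch_true (by simp [RamExpr.eval, hk0, hz]) e1), ?_, ha1.trans ha0,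
        fun i hi => (hv1 i hi).trans (hv0 i hi), by simp [eval, hz, hk1, hc e he.1.2]⟩
      simp only [time, Polynomial.eval_add, Polynomial.eval_ofNat, RamExpr.cost]; omega
  | sum x e ih =>
    simp only [ok, Bool.and_eq_true, decide_eq_true_eq] at he
    obtain ⟨⟨hxb, hx2⟩, he⟩ := he
    let s1 := (s.setVar k 0).setVar (k + 1) (s.var x)
    have e1 : RamExec (.assign k (.const 0)) s (s.setVar k 0) 2 := RamExec.assign s k (.const 0)
    have e2 : RamExec (.assign (k + 1) (.var x)) (s.setVar k 0) s1 2 := by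
      have := RamExec.assign (s.setVar k 0) (k + 1) (.var x)
      simp only [RamExpr.eval, RamExpr.cost, RamState.setVar_of_ne s 0 (show x ≠ k by omega)] at this
      exact this
    have hs1 : ∀ i, i < k → s1.var i = s.var i := fun i hi => by
      simp only [s1]; rw [set_lt _ _ _ i (by omega), set_lt _ _ _ i hi]
    let Inv : ℕ → RamState → Prop := fun i s' => s'.arr = s.arr ∧ (∀ j, j < k → j ≠ x → s'.var j = s.var j) ∧
      s'.var (k + 1) = s.var x ∧ s'.var k = ∑ j ∈ Finset.range i, eval N s.arr (Function.update s.var x j) e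
    obtain ⟨s2, t2, e3, ht2, hx2', _, ha, hv, hsave, hsum⟩ := exec_for (x := x) (N := N) (T := e.time.eval N + 4)
      (p := .seq (comp e (k + 2)) (.assign k (.add (.var k) (.var (k + 2))))) Inv hx2 s1
      (by rw [hs1 2 (by omega), hN])
      (by
        refine ⟨rfl, fun j hj hjx => ?_, ?_, ?_⟩
        · rw [RamState.setVar_of_ne _ _ hjx, hs1 j hj]
        · rw [RamState.setVar_of_ne _ _ (by omega)]; simp [s1]
        · rw [RamState.setVar_of_ne _ _ (by omega)]
          simp only [s1]
          rw [set_lt _ _ _ k (by omega)]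
          simp)
      (by
        rintro i s' hi ⟨ha, hv, hsave, hsum⟩ hxi h2'
        obtain ⟨s3, t3, e3, ht3, ha3, hv3, hk3⟩ := ih he (k + 2) (by omega) s' h2'
        have hev : eval N s'.arr s'.var e = eval N s.arr (Function.update s.var x i) e := by
          refine eval_congr N _ _ e he (fun a _ => by rw [ha]) _ _ fun j hj => ?_
          by_cases hjx : j = x
          · subst hjx; simp [hxi]
          · rw [Function.update_of_ne hjx, hv j (by omega) hjx]
        refine ⟨s3.setVar k (s'.var k + s3.var (k + 2)), t3 + 4, .seq e3 ?_, by omega, ?_, ?_, ?_, ?_, ?_, ?_⟩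
        · have := RamExec.assign s3 k (.add (.var k) (.var (k + 2)))
          simpa [RamExpr.eval, RamExpr.cost, hv3 k (by omega), RamState.setVar] using this
        · rw [RamState.setVar_of_ne _ _ (by omega), hv3 x (by omega), hxi]
        · rw [RamState.setVar_of_ne _ _ (by omega), hv3 2 (by omega), h2']
        · simp [ha3, ha]
        · intro j hj hjx
          rw [RamState.setVar_of_ne _ _ hjx, set_lt _ _ _ j hj, hv3 j (by omega), hv j hj hjx]
        · rw [RamState.setVar_of_ne _ _ (by omega), RamState.setVar_of_ne _ _ (by omega), hv3 _ (by omega), hsave]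
        · rw [RamState.setVar_of_ne _ _ (by omega), RamState.setVar_same, Finset.sum_range_succ, hsum, hk3, hev])
    have e4 : RamExec (.assign x (.var (k + 1))) s2 (s2.setVar x (s.var x)) 2 := by
      have := RamExec.assign s2 x (.var (k + 1))
      simp only [RamExpr.eval, RamExpr.cost, hsave] at this
      exact this
    refine ⟨_, _, .seq e1 (.seq e2 (.seq e3 e4)), ?_, by simp [ha], fun i hi => ?_, ?_⟩
    · simp only [time, Polynomial.eval_add, Polynomial.eval_mul, Polynomial.eval_X, Polynomial.eval_ofNat]
      have : N * (Polynomial.eval N e.time + 4 + 8) = N * (Polynomial.eval N e.time + 12) := by ring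
      omega
    · by_cases hix : i = x
      · subst hix; simp
      · rw [RamState.setVar_of_ne _ _ hix, hv i hi hix]
    · rw [RamState.setVar_of_ne _ _ (by omega), hsum]; rfl

end Ex

/-- `par1` and `par2` assign all entries of a vector or of an `N × N` matrix simultaneously, and
`rep` repeats `N` times. Recursive definitions become repetitions of one parallel assignment. -/
inductive Cmd where
  | set (x : ℕ) (e : Ex)
  | par1 (a x : ℕ) (e : Ex)
  | par2 (a x y : ℕ) (e : Ex)
  | seq (c d : Cmd)
  | rep (c : Cmd)

namespace Cmd

/-- The effect of a command. -/
def run (N : ℕ) : Cmd → RamState → RamState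
  | set x e, s => s.setVar x (e.eval N s.arr s.var)
  | par1 a x e, s => s.setArr a fun i =>
      if i < N then e.eval N s.arr (Function.update s.var x i) else s.arr a i
  | par2 a x y e, s => s.setArr a fun i =>
      if i < N * N then e.eval N s.arr (Function.update (Function.update s.var x (i / N)) y (i % N)) else s.arr a i
  | seq c d, s => run N d (run N c s)
  | rep c, s => (run N c)^[N] s

def ok : Cmd → Bool
  | set x e => decide (x < regBound) && decide (x ≠ 2) && e.ok
  | par1 a x e => decide (a ≠ tmpArr) && decide (a ≠ mulArr) && decide (x < regBound) && decide (x ≠ 2) && e.ok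
  | par2 a x y e => decide (a ≠ tmpArr) && decide (a ≠ mulArr) && decide (x < regBound) && decide (x ≠ 2) &&
      decide (y < regBound) && decide (y ≠ 2) && decide (x ≠ y) && e.ok
  | seq c d => c.ok && d.ok
  | rep c => c.ok

/-- New entries are first stored in `tmpArr` and copied afterwards, so that all of them are computed
from the old memory. The machine cannot multiply, so the position `x * N + y` is found with the
table `mulArr`. -/
def comp : Cmd → ℕ → RamProg
  | set x e, k => .seq (e.comp k) (.assign x (.var k))
  | par1 a x e, k => .seq (.assign k (.var x))
      (.seq (forProg x (.seq (e.comp (k + 1)) (.write tmpArr (.var x) (.var (k + 1)))))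
        (.seq (forProg x (.write a (.var x) (.read tmpArr (.var x)))) (.assign x (.var k))))
  | par2 a x y e, k => .seq (.assign k (.var x)) (.seq (.assign (k + 1) (.var y))
      (.seq (forProg x (forProg y (.seq (e.comp (k + 2))
          (.write tmpArr (.add (.read mulArr (.var x)) (.var y)) (.var (k + 2))))))
        (.seq (forProg x (forProg y (.write a (.add (.read mulArr (.var x)) (.var y))
          (.read tmpArr (.add (.read mulArr (.var x)) (.var y))))))
          (.seq (.assign x (.var k)) (.assign y (.var (k + 1)))))))
  | seq c d, k => .seq (comp c k) (comp d k)
  | rep c, k => forProg k (comp c (k + 1))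

noncomputable def time : Cmd → Polynomial ℕ
  | set _ e => e.time + 2
  | par1 _ _ e => Polynomial.X * (e.time + 11) + 6 + (Polynomial.X * 12 + 6) + 4
  | par2 _ _ _ e => Polynomial.X * ((Polynomial.X * (e.time + 14) + 6) + 8) + 6 +
      (Polynomial.X * ((Polynomial.X * 18 + 6) + 8) + 6) + 8
  | seq c d => c.time + d.time
  | rep c => Polynomial.X * (c.time + 8) + 6

/-- `s` and `h` agree up to the storage of the compiler. -/
def Agree (s h : RamState) : Prop :=
  (∀ i, i < regBound → s.var i = h.var i) ∧ ∀ a, a ≠ tmpArr → s.arr a = h.arr a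

def Ready (N : ℕ) (s : RamState) : Prop := s.var 2 = N ∧ ∀ i, i < N → s.arr mulArr i = i * N

theorem run_ready {N : ℕ} (c : Cmd) (hc : c.ok = true) {s : RamState} (h : Ready N s) : Ready N (c.run N s) := by
  induction c generalizing s with
  | set x e =>
    simp only [ok, Bool.and_eq_true, decide_eq_true_eq] at hc
    exact ⟨(s.setVar_of_ne _ (Ne.symm hc.1.2)).trans h.1, h.2⟩
  | par1 a x e =>
    simp only [ok, Bool.and_eq_true, decide_eq_true_eq] at hc
    refine ⟨h.1, fun i hi => ?_⟩
    rw [run, RamState.setArr_of_ne _ _ (Ne.symm hc.1.1.1.2)]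
    exact h.2 i hi
  | par2 a x y e =>
    simp only [ok, Bool.and_eq_true, decide_eq_true_eq] at hc
    refine ⟨h.1, fun i hi => ?_⟩
    rw [run, RamState.setArr_of_ne _ _ (Ne.symm hc.1.1.1.1.1.1.2)]
    exact h.2 i hi
  | seq c d ih1 ih2 =>
    simp only [ok, Bool.and_eq_true] at hc
    exact ih2 hc.2 (ih1 hc.1 h)
  | rep c ih =>
    rw [run]
    exact Function.Iterate.rec (Ready N) h (fun s hs => ih hc hs) N

theorem Agree.ready {N : ℕ} {s h : RamState} (ha : Agree s h) (hr : Ready N h) : Ready N s :=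
  ⟨(ha.1 2 (by decide)).trans hr.1, fun i hi => by rw [ha.2 mulArr (by decide)]; exact hr.2 i hi⟩

theorem exec_write (s : RamState) (a : ℕ) (i e : RamExpr) : RamExec (.write a i e) s
    (s.setArr a (Function.update (s.arr a) (i.eval s) (e.eval s))) (i.cost + e.cost + 1) := RamExec.write s a i e

theorem exec_assign (s : RamState) (x : ℕ) (e : RamExpr) : RamExec (.assign x e) s
    (s.setVar x (e.eval s)) (e.cost + 1) := RamExec.assign s x e

/-- A simulation: the machine state `s` may differ from the ideal state `h` in the storage of the
compiler, which programs do not read. Compiler variables below `k` are preserved, so loop counters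
survive nested commands. -/
theorem comp_spec (N : ℕ) (c : Cmd) (hc : c.ok = true) (k : ℕ) (hk : regBound ≤ k) (s h : RamState)
    (hs : Agree s h) (hr : Ready N h) :
    ∃ s' t, RamExec (c.comp k) s s' t ∧ t ≤ c.time.eval N ∧ Agree s' (c.run N h) ∧
      ∀ i, regBound ≤ i → i < k → s'.var i = s.var i := by
  have h2 : 2 < regBound := by decide
  induction c generalizing k s h with
  | set x e =>
    simp only [ok, Bool.and_eq_true, decide_eq_true_eq] at hc
    obtain ⟨s1, t1, e1, ht1, ha1, hv1, hk1⟩ := e.comp_spec N hc.2 k hk s (hs.ready hr).1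
    have hev : e.eval N s.arr s.var = e.eval N h.arr h.var := Ex.eval_congr N _ _ e hc.2 hs.2 _ _ hs.1
    refine ⟨s1.setVar x (s1.var k), t1 + 2, .seq e1 (exec_assign s1 x (.var k)), ?_, ⟨fun i hi => ?_, fun a ha => ?_⟩,
      fun i hi1 hi2 => ?_⟩
    · simp only [time, Polynomial.eval_add, Polynomial.eval_ofNat]; omega
    · rw [run, hk1, hev]
      by_cases hix : i = x
      · subst hix; simp
      · rw [RamState.setVar_of_ne _ _ hix, RamState.setVar_of_ne _ _ hix, hv1 i (by omega), hs.1 i hi]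
    · simp [run, ha1, hs.2 a ha]
    · rw [RamState.setVar_of_ne _ _ (by omega), hv1 i hi2]
  | par1 a x e =>
    simp only [ok, Bool.and_eq_true, decide_eq_true_eq] at hc
    obtain ⟨⟨⟨⟨hat, ham⟩, hxb⟩, hx2⟩, he⟩ := hc
    have hN := (hs.ready hr).1
    let val : ℕ → ℕ := fun i => e.eval N h.arr (Function.update h.var x i)
    let s1 := s.setVar k (s.var x)
    have e1 : RamExec (.assign k (.var x)) s s1 2 := exec_assign s k (.var x)
    have hs1 : ∀ i, i < k → s1.var i = s.var i := fun i hi => s.setVar_of_ne _ (by omega)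
    let InvA : ℕ → RamState → Prop := fun i s' => (∀ b, b ≠ tmpArr → s'.arr b = s.arr b) ∧
      (∀ j, j < k → j ≠ x → s'.var j = s.var j) ∧ s'.var k = s.var x ∧ ∀ j, j < i → s'.arr tmpArr j = val j
    obtain ⟨s2, t2, e2, ht2, hx2', h22, a1, a2, a3, a4⟩ := exec_for (x := x) (N := N) (T := e.time.eval N + 3)
      (p := .seq (e.comp (k + 1)) (.write tmpArr (.var x) (.var (k + 1)))) InvA hx2 s1
      (by rw [hs1 2 (by omega), hN])
      (by
        refine ⟨fun b hb => rfl, fun j hj hjx => ?_, ?_, fun j hj => absurd hj (by omega)⟩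
        · rw [RamState.setVar_of_ne _ _ hjx, hs1 j hj]
        · rw [RamState.setVar_of_ne _ _ (by omega)]; simp [s1])
      (by
        rintro i s' hi ⟨a1, a2, a3, a4⟩ hxi h2'
        obtain ⟨s3, t3, e3, ht3, ha3, hv3, hk3⟩ := e.comp_spec N he (k + 1) (by omega) s' h2'
        have hev : e.eval N s'.arr s'.var = val i := by
          refine Ex.eval_congr N _ _ e he (fun b hb => by rw [a1 b hb, hs.2 b hb]) _ _ fun j hj => ?_
          by_cases hjx : j = x
          · subst hjx; simp [hxi]
          · rw [Function.update_of_ne hjx, a2 j (by omega) hjx, hs.1 j hj]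
        refine ⟨_, t3 + 3, .seq e3 (exec_write s3 tmpArr (.var x) (.var (k + 1))), by omega, ?_, ?_, ?_, ?_, ?_, ?_⟩
        · simp [hv3 x (by omega), hxi]
        · simp [hv3 2 (by omega), h2']
        · intro b hb
          rw [RamState.setVar_arr, RamState.setArr_of_ne _ _ hb, ha3, a1 b hb]
        · intro j hj hjx
          rw [RamState.setVar_of_ne _ _ hjx, RamState.setArr_var, hv3 j (by omega), a2 j hj hjx]
        · rw [RamState.setVar_of_ne _ _ (by omega), RamState.setArr_var, hv3 k (by omega), a3]
        · intro j hj
          simp only [RamState.setVar_arr, RamState.setArr_same, RamExpr.eval, hv3 x (by omega), hxi, hk3, hev]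
          by_cases hji : j = i
          · subst hji; simp
          · rw [Function.update_of_ne hji, ha3, a4 j (by omega)])
    let InvB : ℕ → RamState → Prop := fun i s' => (∀ b, b ≠ tmpArr → b ≠ a → s'.arr b = s.arr b) ∧
      (∀ j, j < k → j ≠ x → s'.var j = s.var j) ∧ s'.var k = s.var x ∧ (∀ j, j < N → s'.arr tmpArr j = val j) ∧
      ∀ j, s'.arr a j = if j < i then val j else s.arr a j
    obtain ⟨s3, t3, e3, ht3, hx3, h23, b1, b2, b3, b4, b5⟩ := exec_for (x := x) (N := N) (T := 4)
      (p := .write a (.var x) (.read tmpArr (.var x))) InvB hx2 s2 h22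
      (by
        refine ⟨fun b hb _ => a1 b hb, fun j hj hjx => ?_, ?_, a4, fun j => ?_⟩
        · rw [RamState.setVar_of_ne _ _ hjx, a2 j hj hjx]
        · rw [RamState.setVar_of_ne _ _ (by omega), a3]
        · simp [a1 a hat])
      (by
        rintro i s' hi ⟨b1, b2, b3, b4, b5⟩ hxi h2'
        refine ⟨_, _, exec_write s' a (.var x) (.read tmpArr (.var x)), by simp [RamExpr.cost], ?_, ?_, ?_, ?_, ?_, ?_, ?_⟩
        · simp [hxi]
        · simp [h2']
        · intro b hb hba
          rw [RamState.setVar_arr, RamState.setArr_of_ne _ _ hba, b1 b hb hba]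
        · intro j hj hjx
          rw [RamState.setVar_of_ne _ _ hjx, RamState.setArr_var, b2 j hj hjx]
        · rw [RamState.setVar_of_ne _ _ (by omega), RamState.setArr_var, b3]
        · intro j hj
          rw [RamState.setVar_arr, RamState.setArr_of_ne _ _ (Ne.symm hat), b4 j hj]
        · intro j
          simp only [RamState.setVar_arr, RamState.setArr_same, RamExpr.eval, hxi, b4 i hi]
          by_cases hji : j = i
          · subst hji; simp
          · rw [Function.update_of_ne hji, b5]
            by_cases hlt : j < i
            · rw [if_pos hlt, if_pos (by omega)]
            · rw [if_neg hlt, if_neg (by omega)])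
    refine ⟨_, _, .seq e1 (.seq e2 (.seq e3 (exec_assign s3 x (.var k)))), ?_, ⟨fun i hi => ?_, fun b hb => ?_⟩,
      fun i hi1 hi2 => ?_⟩
    · simp only [time, Polynomial.eval_add, Polynomial.eval_mul, Polynomial.eval_X, Polynomial.eval_ofNat, RamExpr.cost]
      have : N * (Polynomial.eval N e.time + 3 + 8) = N * (Polynomial.eval N e.time + 11) := by ring
      omega
    · by_cases hix : i = x
      · subst hix; simp [RamExpr.eval, b3, run, hs.1 i hi]
      · rw [RamState.setVar_of_ne _ _ hix, b2 i (by omega) hix, run, RamState.setArr_var, hs.1 i hi]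
    · rw [RamState.setVar_arr, run]
      by_cases hba : b = a
      · subst hba
        ext j
        rw [b5 j, RamState.setArr_same, hs.2 b hb]
      · rw [RamState.setArr_of_ne _ _ hba, b1 b hb hba, hs.2 b hb]
    · rw [RamState.setVar_of_ne _ _ (by omega), b2 i hi2 (by omega)]
  | par2 a x y e =>
    simp only [ok, Bool.and_eq_true, decide_eq_true_eq] at hc
    obtain ⟨⟨⟨⟨⟨⟨⟨hat, ham⟩, hxb⟩, hx2⟩, hyb⟩, hy2⟩, hxy⟩, he⟩ := hc
    have hN := (hs.ready hr).1
    have htm : tmpArr ≠ mulArr := by decide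
    have hmul : ∀ i, i < N → s.arr mulArr i = i * N := (hs.ready hr).2
    let val : ℕ → ℕ := fun i => e.eval N h.arr (Function.update (Function.update h.var x (i / N)) y (i % N))
    let s0 := s.setVar k (s.var x)
    have e0 : RamExec (.assign k (.var x)) s s0 2 := exec_assign s k (.var x)
    let s1 := s0.setVar (k + 1) (s.var y)
    have e1 : RamExec (.assign (k + 1) (.var y)) s0 s1 2 := by
      have := exec_assign s0 (k + 1) (.var y)
      have hy : s0.var y = s.var y := s.setVar_of_ne _ (by omega)
      simpa only [RamExpr.eval, hy, RamExpr.cost] using this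
    have hs1 : ∀ i, i < k → s1.var i = s.var i := fun i hi =>
      (s0.setVar_of_ne _ (by omega)).trans (s.setVar_of_ne _ (by omega))
    have hs1k : s1.var k = s.var x := (s0.setVar_of_ne _ (by omega)).trans (by simp [s0])
    have hs1k1 : s1.var (k + 1) = s.var y := by simp [s1]
    have rem : ∀ i j, i < N → j < N → (i * N + j) / N = i ∧ (i * N + j) % N = j := fun i j hi hj => by
      have hpos : 0 < N := by omega
      constructor
      · rw [mul_comm, Nat.mul_add_div hpos, Nat.div_eq_of_lt hj, add_zero]
      · rw [mul_comm, Nat.mul_add_mod, Nat.mod_eq_of_lt hj]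
    let InvA : ℕ → RamState → Prop := fun m s' => (∀ b, b ≠ tmpArr → s'.arr b = s.arr b) ∧
      (∀ j, j < k → j ≠ x → j ≠ y → s'.var j = s.var j) ∧ s'.var k = s.var x ∧ s'.var (k + 1) = s.var y ∧
      ∀ j, j < m → s'.arr tmpArr j = val j
    obtain ⟨s2, t2, e2, ht2, hx2', h22, a1, a2, a3, a3', a4⟩ := exec_for (x := x) (N := N)
      (T := N * (e.time.eval N + 6 + 8) + 6)
      (p := forProg y (.seq (e.comp (k + 2))
          (.write tmpArr (.add (.read mulArr (.var x)) (.var y)) (.var (k + 2)))))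
      (fun i => InvA (i * N)) hx2 s1 (by rw [hs1 2 (by omega), hN])
      (by
        refine ⟨fun b hb => rfl, fun j hj hjx _ => ?_, ?_, ?_, fun j hj => absurd hj (by omega)⟩
        · rw [RamState.setVar_of_ne _ _ hjx, hs1 j hj]
        · rw [RamState.setVar_of_ne _ _ (by omega), hs1k]
        · rw [RamState.setVar_of_ne _ _ (by omega), hs1k1])
      (by
        rintro i s' hi ⟨a1, a2, a3, a3', a4⟩ hxi h2'
        obtain ⟨s3, t3, e3, ht3, hy3, h23, ⟨b1, b2, b3, b3', b4⟩, b5⟩ := exec_for (x := y) (N := N)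
          (T := e.time.eval N + 6)
          (p := .seq (e.comp (k + 2)) (.write tmpArr (.add (.read mulArr (.var x)) (.var y)) (.var (k + 2))))
          (fun j s => InvA (i * N + j) s ∧ s.var x = i) hy2 s' h2'
          (by
            refine ⟨⟨a1, fun j hj hjx hjy => ?_, ?_, ?_, a4⟩, ?_⟩
            · rw [RamState.setVar_of_ne _ _ hjy, a2 j hj hjx hjy]
            · rw [RamState.setVar_of_ne _ _ (by omega), a3]
            · rw [RamState.setVar_of_ne _ _ (by omega), a3']
            · rw [RamState.setVar_of_ne _ _ hxy, hxi])
          (by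
            rintro j s' hj ⟨⟨a1, a2, a3, a3', a4⟩, hxi⟩ hyj h2'
            obtain ⟨s3, t3, e3, ht3, ha3, hv3, hk3⟩ := e.comp_spec N he (k + 2) (by omega) s' h2'
            have hr := rem i j hi hj
            have hev : e.eval N s'.arr s'.var = val (i * N + j) := by
              refine Ex.eval_congr N _ _ e he (fun b hb => by rw [a1 b hb, hs.2 b hb]) _ _ fun l hl => ?_
              rw [hr.1, hr.2]
              by_cases hly : l = y
              · subst hly; simp [hyj]
              · rw [Function.update_of_ne hly]
                by_cases hlx : l = x
                · subst hlx; simp [hxi]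
                · rw [Function.update_of_ne hlx, a2 l (by omega) hlx hly, hs.1 l hl]
            have hm : s3.arr mulArr (s3.var x) = i * N := by
              rw [ha3, a1 _ (Ne.symm htm), hv3 x (by omega), hxi, hmul i hi]
            refine ⟨_, t3 + (4 + 1 + 1), .seq e3 (exec_write s3 tmpArr (.add (.read mulArr (.var x)) (.var y)) (.var (k + 2))),
              by omega, ?_, ?_, ⟨?_, ?_, ?_, ?_, ?_⟩, ?_⟩
            · simp [hv3 y (by omega), hyj]
            · simp [hv3 2 (by omega), h2']
            · intro b hb
              rw [RamState.setVar_arr, RamState.setArr_of_ne _ _ hb, ha3, a1 b hb]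
            · intro j hj hjx hjy
              rw [RamState.setVar_of_ne _ _ hjy, RamState.setArr_var, hv3 j (by omega), a2 j hj hjx hjy]
            · rw [RamState.setVar_of_ne _ _ (by omega), RamState.setArr_var, hv3 k (by omega), a3]
            · rw [RamState.setVar_of_ne _ _ (by omega), RamState.setArr_var, hv3 _ (by omega), a3']
            · intro l hl
              simp only [RamState.setVar_arr, RamState.setArr_same, RamExpr.eval, hm, hv3 y (by omega), hyj, hk3, hev]
              by_cases hji : l = i * N + j
              · subst hji; simp
              · rw [Function.update_of_ne hji, ha3, a4 l (by omega)]
            · rw [RamState.setVar_of_ne _ _ hxy, RamState.setArr_var, hv3 x (by omega), hxi])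
        refine ⟨s3, t3, e3, ht3, b5, h23, b1, fun j hj hjx hjy => ?_, ?_, ?_, ?_⟩
        · rw [RamState.setVar_of_ne _ _ hjx, b2 j hj hjx hjy]
        · rw [RamState.setVar_of_ne _ _ (by omega), b3]
        · rw [RamState.setVar_of_ne _ _ (by omega), b3']
        · have : (i + 1) * N = i * N + N := by ring
          rw [this]; exact b4)
    let InvB : ℕ → RamState → Prop := fun m s' => (∀ b, b ≠ tmpArr → b ≠ a → s'.arr b = s.arr b) ∧
      (∀ j, j < k → j ≠ x → j ≠ y → s'.var j = s.var j) ∧ s'.var k = s.var x ∧ s'.var (k + 1) = s.var y ∧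
      (∀ j, j < N * N → s'.arr tmpArr j = val j) ∧ ∀ j, s'.arr a j = if j < m then val j else s.arr a j
    obtain ⟨s3, t3, e3, ht3, hx3, h23, b1, b2, b3, b3', b4, b5⟩ := exec_for (x := x) (N := N)
      (T := N * (10 + 8) + 6)
      (p := forProg y (.write a (.add (.read mulArr (.var x)) (.var y))
          (.read tmpArr (.add (.read mulArr (.var x)) (.var y)))))
      (fun i => InvB (i * N)) hx2 s2 h22
      (by
        refine ⟨fun b hb _ => a1 b hb, fun j hj hjx hjy => ?_, ?_, ?_, a4, fun j => ?_⟩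
        · rw [RamState.setVar_of_ne _ _ hjx, a2 j hj hjx hjy]
        · rw [RamState.setVar_of_ne _ _ (by omega), a3]
        · rw [RamState.setVar_of_ne _ _ (by omega), a3']
        · simp [a1 a hat])
      (by
        rintro i s' hi ⟨a1, a2, a3, a3', a4, a5⟩ hxi h2'
        obtain ⟨s3, t3, e3, ht3, hy3, h23, ⟨b1, b2, b3, b3', b4, b5⟩, b6⟩ := exec_for (x := y) (N := N) (T := 10)
          (p := .write a (.add (.read mulArr (.var x)) (.var y))
            (.read tmpArr (.add (.read mulArr (.var x)) (.var y))))
          (fun j s => InvB (i * N + j) s ∧ s.var x = i) hy2 s' h2'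
          (by
            refine ⟨⟨a1, fun j hj hjx hjy => ?_, ?_, ?_, a4, a5⟩, ?_⟩
            · rw [RamState.setVar_of_ne _ _ hjy, a2 j hj hjx hjy]
            · rw [RamState.setVar_of_ne _ _ (by omega), a3]
            · rw [RamState.setVar_of_ne _ _ (by omega), a3']
            · rw [RamState.setVar_of_ne _ _ hxy, hxi])
          (by
            rintro j s' hj ⟨⟨a1, a2, a3, a3', a4, a5⟩, hxi⟩ hyj h2'
            have hm : s'.arr mulArr (s'.var x) = i * N := by
              rw [a1 _ (Ne.symm htm) (Ne.symm ham), hxi, hmul i hi]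
            have hlt : i * N + j < N * N := by nlinarith
            refine ⟨_, _, exec_write s' a (.add (.read mulArr (.var x)) (.var y))
              (.read tmpArr (.add (.read mulArr (.var x)) (.var y))), by simp [RamExpr.cost], ?_, ?_, ⟨?_, ?_, ?_, ?_, ?_, ?_⟩, ?_⟩
            · simp [hyj]
            · simp [h2']
            · intro b hb hba
              rw [RamState.setVar_arr, RamState.setArr_of_ne _ _ hba, a1 b hb hba]
            · intro j hj hjx hjy
              rw [RamState.setVar_of_ne _ _ hjy, RamState.setArr_var, a2 j hj hjx hjy]
            · rw [RamState.setVar_of_ne _ _ (by omega), RamState.setArr_var, a3]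
            · rw [RamState.setVar_of_ne _ _ (by omega), RamState.setArr_var, a3']
            · intro j hj
              rw [RamState.setVar_arr, RamState.setArr_of_ne _ _ (Ne.symm hat), a4 j hj]
            · intro l
              simp only [RamState.setVar_arr, RamState.setArr_same, RamExpr.eval, hm, hyj, a4 _ hlt]
              by_cases hji : l = i * N + j
              · subst hji; simp
              · rw [Function.update_of_ne hji, a5]
                by_cases hlt : l < i * N + j
                · rw [if_pos hlt, if_pos (by omega)]
                · rw [if_neg hlt, if_neg (by omega)]
            · rw [RamState.setVar_of_ne _ _ hxy, RamState.setArr_var, hxi])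
        refine ⟨s3, t3, e3, ht3, b6, h23, b1, fun j hj hjx hjy => ?_, ?_, ?_, b4, ?_⟩
        · rw [RamState.setVar_of_ne _ _ hjx, b2 j hj hjx hjy]
        · rw [RamState.setVar_of_ne _ _ (by omega), b3]
        · rw [RamState.setVar_of_ne _ _ (by omega), b3']
        · have : (i + 1) * N = i * N + N := by ring
          rw [this]; exact b5)
    have e4 := exec_assign s3 x (.var k)
    have e5 := exec_assign (s3.setVar x (s3.var k)) y (.var (k + 1))
    refine ⟨_, _, .seq e0 (.seq e1 (.seq e2 (.seq e3 (.seq e4 e5)))), ?_, ⟨fun i hi => ?_, fun b hb => ?_⟩,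
      fun i hi1 hi2 => ?_⟩
    · simp only [time, Polynomial.eval_add, Polynomial.eval_mul, Polynomial.eval_X, Polynomial.eval_ofNat, RamExpr.cost]
      have : N * (Polynomial.eval N e.time + 6 + 8) = N * (Polynomial.eval N e.time + 14) := by ring
      rw [this] at ht2
      norm_num only at ht3 ⊢
      omega
    · simp only [RamExpr.eval, run, RamState.setArr_var]
      rw [RamState.setVar_of_ne _ (y := k + 1) _ (by omega), b3, b3']
      by_cases hiy : i = y
      · subst hiy; simp [hs.1 i hi]
      · rw [RamState.setVar_of_ne _ _ hiy]
        by_cases hix : i = x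
        · subst hix; simp [hs.1 i hi]
        · rw [RamState.setVar_of_ne _ _ hix, b2 i (by omega) hix hiy, hs.1 i hi]
    · simp only [RamState.setVar_arr, run]
      by_cases hba : b = a
      · subst hba
        ext j
        rw [b5 j, RamState.setArr_same, hs.2 b hb]
      · rw [RamState.setArr_of_ne _ _ hba, b1 b hb hba, hs.2 b hb]
    · rw [RamState.setVar_of_ne _ _ (by omega), RamState.setVar_of_ne _ _ (by omega), b2 i hi2 (by omega) (by omega)]
  | seq c d ih1 ih2 =>
    simp only [ok, Bool.and_eq_true] at hc
    obtain ⟨s1, t1, e1, ht1, hA1, hv1⟩ := ih1 hc.1 k hk s h hs hr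
    obtain ⟨s2, t2, e2, ht2, hA2, hv2⟩ := ih2 hc.2 k hk s1 _ hA1 (c.run_ready hc.1 hr)
    refine ⟨s2, _, .seq e1 e2, ?_, hA2, fun i h1 h2 => (hv2 i h1 h2).trans (hv1 i h1 h2)⟩
    simp only [time, Polynomial.eval_add]; omega
  | rep c ih =>
    have hrdy : ∀ i, Ready N ((c.run N)^[i] h) := fun i =>
      Function.Iterate.rec (Ready N) hr (fun s hs => c.run_ready hc hs) i
    obtain ⟨s', t, e, ht, h1, h2', h3, h4⟩ := exec_for (x := k) (N := N) (T := c.time.eval N) (p := c.comp (k + 1))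
      (fun i s' => Agree s' ((c.run N)^[i] h) ∧ ∀ j, regBound ≤ j → j < k → s'.var j = s.var j) (by omega) s
      (hs.ready hr).1
      (by
        refine ⟨⟨fun i hi => ?_, hs.2⟩, fun j _ hj => s.setVar_of_ne _ (by omega)⟩
        rw [RamState.setVar_of_ne _ _ (by omega)]
        exact hs.1 i hi)
      (by
        rintro i s' hi ⟨hA, hv⟩ hxi h2'
        obtain ⟨s2, t2, e2, ht2, hA2, hv2⟩ := ih hc (k + 1) (by omega) s' _ hA (hrdy i)
        refine ⟨s2, t2, e2, ht2, (hv2 k hk (by omega)).trans hxi, ?_, ⟨fun j hj => ?_, ?_⟩, fun j h1 h3 => ?_⟩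
        · exact (hA2.ready (c.run_ready hc (hrdy i))).1
        · rw [RamState.setVar_of_ne _ _ (by omega), Function.iterate_succ_apply', hA2.1 j hj]
        · rw [Function.iterate_succ_apply']; exact hA2.2
        · rw [RamState.setVar_of_ne _ _ (by omega), hv2 j h1 (by omega), hv j h1 h3])
    refine ⟨s', t, e, ?_, h3, h4⟩
    simp only [time, Polynomial.eval_add, Polynomial.eval_mul, Polynomial.eval_X, Polynomial.eval_ofNat]
    omega

end Cmd

/-! ### Formulas -/

namespace Ex

def lt (e f : Ex) : Ex := sub f e
def neg (e : Ex) : Ex := ite e (const 0) (const 1)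
def conj (e f : Ex) : Ex := ite e f (const 0)
def disj (e f : Ex) : Ex := add e f
def eq (e f : Ex) : Ex := neg (add (sub e f) (sub f e))
/-- The entry `(x, y)` of the matrix `a`. -/
def cell (a x y : ℕ) : Ex := rd a (add (rd mulArr (var x)) (var y))

/-- Nonzero means true, so that a sum over `{0, …, N - 1}` is an existential quantifier and an
addition is a disjunction. -/
def Holds (N : ℕ) (m : ℕ → ℕ → ℕ) (v : ℕ → ℕ) (e : Ex) : Prop := e.eval N m v ≠ 0

section Holds
variable {N : ℕ} {m : ℕ → ℕ → ℕ} {v : ℕ → ℕ} {c e f : Ex} {a x y i k : ℕ}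

theorem eval_const : (const k).eval N m v = k := rfl
theorem eval_var : (var x).eval N m v = v x := rfl
theorem eval_rd : (rd a e).eval N m v = m a (e.eval N m v) := rfl
theorem eval_add : (add e f).eval N m v = e.eval N m v + f.eval N m v := rfl
theorem eval_sub : (sub e f).eval N m v = e.eval N m v - f.eval N m v := rfl
open Classical in
theorem eval_ite : (ite c e f).eval N m v = if c.Holds N m v then e.eval N m v else f.eval N m v := by
  unfold Holds
  simp only [eval]
  congr
theorem eval_sum : (sum x e).eval N m v = ∑ i ∈ Finset.range N, e.eval N m (Function.update v x i) := rfl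

theorem holds_iff : e.Holds N m v ↔ e.eval N m v ≠ 0 := Iff.rfl
theorem holds_var : (var x).Holds N m v ↔ v x ≠ 0 := Iff.rfl
theorem holds_lt : (lt e f).Holds N m v ↔ e.eval N m v < f.eval N m v := by
  simp [Holds, lt, eval, Nat.sub_eq_zero_iff_le]
theorem holds_neg : (neg e).Holds N m v ↔ ¬ e.Holds N m v := by
  by_cases h : e.eval N m v = 0 <;> simp [Holds, neg, eval, h]
theorem holds_conj : (conj e f).Holds N m v ↔ e.Holds N m v ∧ f.Holds N m v := by
  by_cases h : e.eval N m v = 0 <;> simp [Holds, conj, eval, h]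
theorem holds_disj : (disj e f).Holds N m v ↔ e.Holds N m v ∨ f.Holds N m v := by
  simp only [Holds, disj, eval]; omega
theorem holds_eq : (eq e f).Holds N m v ↔ e.eval N m v = f.eval N m v := by
  rw [eq, holds_neg]
  simp only [Holds, eval]; omega
theorem holds_sum : (sum x e).Holds N m v ↔ ∃ i, i < N ∧ e.Holds N m (Function.update v x i) := by
  simp [Holds, eval]

theorem eval_cell (hm : ∀ i, i < N → m mulArr i = i * N) (hx : v x < N) :
    (cell a x y).eval N m v = m a (v x * N + v y) := by
  simp [cell, eval, hm _ hx]

theorem eval_sum_single {j : ℕ} (hj : j < N) (h : ∀ i, i < N → i ≠ j → e.eval N m (Function.update v x i) = 0) :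
    (sum x e).eval N m v = e.eval N m (Function.update v x j) :=
  Finset.sum_eq_single j (fun i hi hij => h i (Finset.mem_range.1 hi) hij) fun h => absurd (Finset.mem_range.2 hj) h

end Holds
end Ex

/-- Quantifiers in formulas range below `N`, those in the mathematical definitions over all numbers;
the bound `hQ` reconciles them. -/
theorem exists_bounded_congr {N : ℕ} {P Q : ℕ → Prop} (h : ∀ i, i < N → (P i ↔ Q i)) (hQ : ∀ i, Q i → i < N) :
    (∃ i, i < N ∧ P i) ↔ ∃ i, Q i :=
  ⟨fun ⟨i, hi, hP⟩ => ⟨i, (h i hi).1 hP⟩, fun ⟨i, hq⟩ => ⟨i, hQ i hq, (h i (hQ i hq)).2 hq⟩⟩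

/-! ### Formulas for the vertices taken in a step -/

/-- The natural order and its dual. -/
@[reducible] def ordOf : Bool → LinearOrder ℕ
  | true => inferInstance
  | false => inferInstanceAs (LinearOrder ℕᵒᵈ)

theorem ordOf_between {N : ℕ} (b : Bool) {p t q : ℕ} (h1 : (ordOf b).lt p t) (h2 : (ordOf b).lt t q) (hp : p < N)
    (hq : q < N) : t < N := by
  cases b
  · exact lt_trans (show t < p from h1) hp
  · exact lt_trans (show t < q from h2) hq

def adjArr : ℕ := 5
def reachArr : Bool → ℕ
  | true => 6
  | false => 7

/-- The memory holds the graph and its reachability relations. -/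
structure GraphMem (N : ℕ) (m : ℕ → ℕ → ℕ) (A : ℕ → ℕ → Prop) : Prop where
  mul : ∀ i, i < N → m mulArr i = i * N
  adj : ∀ u v, u < N → v < N → (m adjArr (u * N + v) ≠ 0 ↔ A u v)
  bound : ∀ u v, A u v → u < N ∧ v < N
  reach : ∀ b u v, u < N → v < N → (m (reachArr b) (u * N + v) ≠ 0 ↔ @LeftReach ℕ (ordOf b) A u v)

namespace Ex

/-- The flag `b` selects the order or its dual, so one set of formulas describes both directions.
Bound variables are numbered from the last argument `k` on. -/
def before (b : Bool) (x y : ℕ) : Ex := if b then lt (var x) (var y) else lt (var y) (var x)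

def exitF (b : Bool) (p q t k : ℕ) : Ex :=
  conj (before b p t) (conj (before b t q) (sum k (conj (before b k p) (cell adjArr k t))))

def noExitF (b : Bool) (p q k : ℕ) : Ex :=
  neg (sum k (sum (k + 1) (conj (before b p k) (conj (before b k q)
    (conj (cell adjArr k (k + 1)) (before b q (k + 1)))))))

def hookL0F (b : Bool) (p q v k : ℕ) : Ex :=
  conj (before b p v) (conj (before b v q) (conj (cell adjArr p v)
    (sum k (conj (before b k v) (exitF b p q k (k + 1))))))

def hookRF (b : Bool) (p q v k : ℕ) : Ex :=
  conj (noExitF b p q k) (conj (before b p v) (conj (before b v q) (conj (cell adjArr v q)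
    (sum k (conj (before b v k) (disj (exitF b p q k (k + 1)) (hookL0F b p q k (k + 1))))))))

def hookLF (b : Bool) (p q v k : ℕ) : Ex :=
  conj (before b p v) (conj (before b v q) (conj (cell adjArr p v)
    (sum k (conj (before b k v) (disj (exitF b p q k (k + 1)) (hookRF b p q k (k + 1)))))))

def pickedF (b : Bool) (p q v k : ℕ) : Ex :=
  disj (exitF b p q v k) (disj (hookRF b p q v k) (hookLF b p q v k))

/-- `P v k` is a formula about the variable `v` that binds variables from `k` on. -/
def takenF (b : Bool) (P : ℕ → ℕ → Ex) (p q z k : ℕ) : Ex :=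
  disj (P z k) (conj (before b p z) (conj (before b z q) (conj (neg (P z k)) (sum k (sum (k + 1)
    (conj (before b k z) (conj (before b z (k + 1)) (conj (disj (eq (var k) (var p)) (P k (k + 2)))
    (conj (disj (eq (var (k + 1)) (var q)) (P (k + 1) (k + 2)))
    (conj (neg (sum (k + 2) (conj (before b k (k + 2)) (conj (before b (k + 2) (k + 1)) (P (k + 2) (k + 3))))))
    (conj (cell (reachArr b) z k) (cell (reachArr (!b)) z (k + 1)))))))))))))

def topF (o q y k : ℕ) : Ex :=
  conj (before true o y) (conj (before true y q) (disj
    (conj (cell adjArr o y) (neg (sum k (conj (before true y k) (conj (before true k q) (cell adjArr o k))))))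
    (conj (neg (sum k (conj (before true o k) (conj (before true k q) (cell adjArr o k)))))
      (neg (sum k (conj (before true o k) (before true k y)))))))

def pickedZF (o q v k : ℕ) : Ex :=
  conj (before true o v) (conj (before true v q) (disj (topF o q v k) (disj
    (conj (cell adjArr v q) (sum k (conj (before true v k) (topF o q k (k + 1)))))
    (conj (cell adjArr o v) (sum k (conj (before true o k) (conj (before true k v) (cell adjArr k q))))))))

section Taken
variable {N : ℕ} {m : ℕ → ℕ → ℕ} {A : ℕ → ℕ → Prop} (H : GraphMem N m A) {v : ℕ → ℕ} {b : Bool} {p q t x y k : ℕ}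

theorem holds_before : (before b x y).Holds N m v ↔ (ordOf b).lt (v x) (v y) := by
  cases b
  · exact holds_lt
  · exact holds_lt

include H

theorem holds_adj (hx : v x < N) (hy : v y < N) : (cell adjArr x y).Holds N m v ↔ A (v x) (v y) := by
  rw [holds_iff, eval_cell H.mul hx, H.adj _ _ hx hy]

theorem holds_reach (hx : v x < N) (hy : v y < N) :
    (cell (reachArr b) x y).Holds N m v ↔ @LeftReach ℕ (ordOf b) A (v x) (v y) := by
  rw [holds_iff, eval_cell H.mul hx, H.reach b _ _ hx hy]

theorem holds_exitF (hp : p < k) (ht : t < k) (bt : v t < N) :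
    (exitF b p q t k).Holds N m v ↔ @ExitL ℕ (ordOf b) A (v p) (v q) (v t) := by
  simp only [exitF, holds_conj, holds_sum, holds_before, ExitL]
  refine and_congr Iff.rfl (and_congr Iff.rfl (exists_bounded_congr (fun i hi => ?_) fun i hi => (H.bound _ _ hi.2).1))
  simp [holds_adj H, hp.ne, ht.ne, hi, bt]

theorem holds_noExitF (hp : p < k) (hq : q < k) (bp : v p < N) (bq : v q < N) :
    (noExitF b p q k).Holds N m v ↔ @NoExitR ℕ (ordOf b) A (v p) (v q) := by
  have : @NoExitR ℕ (ordOf b) A (v p) (v q) ↔ ¬ ∃ t w, (ordOf b).lt (v p) t ∧ (ordOf b).lt t (v q) ∧ A t w ∧ (ordOf b).lt (v q) w := by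
    constructor
    · rintro h ⟨t, w, h1, h2, h3, h4⟩
      exact (@not_lt ℕ (ordOf b) _ _).2 (h t w h1 h2 h3) h4
    · exact fun h t w h1 h2 h3 => (@not_lt ℕ (ordOf b) _ _).1 fun h4 => h ⟨t, w, h1, h2, h3, h4⟩
  rw [this, noExitF, holds_neg, holds_sum]
  refine not_congr (exists_bounded_congr (fun i hi => ?_) fun i ⟨w, h1, h2, h3⟩ => ordOf_between b h1 h2 bp bq)
  rw [holds_sum]
  refine exists_bounded_congr (fun j hj => ?_) fun i hi => (H.bound _ _ hi.2.2.1).2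
  simp [holds_conj, holds_before, holds_adj H, hp.ne, hq.ne, (hp.trans (Nat.lt_succ_self k)).ne,
    (hq.trans (Nat.lt_succ_self k)).ne, hi, hj]

theorem holds_hookL0F (hp : p < k) (hq : q < k) (ht : t < k) (bp : v p < N) (bq : v q < N) (bt : v t < N) :
    (hookL0F b p q t k).Holds N m v ↔ @HookL0 ℕ (ordOf b) A (v p) (v q) (v t) := by
  simp only [hookL0F, holds_conj, holds_sum, holds_before, HookL0, holds_adj H bp bt]
  refine and_congr Iff.rfl (and_congr Iff.rfl (and_congr Iff.rfl
    (exists_bounded_congr (fun i hi => ?_) fun i hi => ordOf_between b hi.2.1 hi.2.2.1 bp bq)))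
  rw [holds_exitF H (by omega) (by omega) (by simpa)]
  simp [hp.ne, hq.ne, ht.ne]

theorem holds_hookRF (hp : p < k) (hq : q < k) (ht : t < k) (bp : v p < N) (bq : v q < N) (bt : v t < N) :
    (hookRF b p q t k).Holds N m v ↔ @HookR ℕ (ordOf b) A (v p) (v q) (v t) := by
  simp only [hookRF, holds_conj, holds_sum, holds_before, HookR, holds_adj H bt bq, holds_noExitF H hp hq bp bq]
  refine and_congr Iff.rfl (and_congr Iff.rfl (and_congr Iff.rfl (and_congr Iff.rfl
    (exists_bounded_congr (fun i hi => ?_) fun i hi => ?_))))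
  · rw [holds_disj, holds_exitF H (by omega) (by omega) (by simpa),
      holds_hookL0F H (by omega) (by omega) (by omega) (by simpa [hp.ne]) (by simpa [hq.ne]) (by simpa)]
    simp [hp.ne, hq.ne, ht.ne]
  · exact hi.2.elim (fun h => ordOf_between b h.1 h.2.1 bp bq) fun h => ordOf_between b h.1 h.2.1 bp bq

theorem holds_hookLF (hp : p < k) (hq : q < k) (ht : t < k) (bp : v p < N) (bq : v q < N) (bt : v t < N) :
    (hookLF b p q t k).Holds N m v ↔ @HookL ℕ (ordOf b) A (v p) (v q) (v t) := by
  simp only [hookLF, holds_conj, holds_sum, holds_before, HookL, holds_adj H bp bt]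
  refine and_congr Iff.rfl (and_congr Iff.rfl (and_congr Iff.rfl
    (exists_bounded_congr (fun i hi => ?_) fun i hi => ?_)))
  · rw [holds_disj, holds_exitF H (by omega) (by omega) (by simpa),
      holds_hookRF H (by omega) (by omega) (by omega) (by simpa [hp.ne]) (by simpa [hq.ne]) (by simpa)]
    simp [hp.ne, hq.ne, ht.ne]
  · exact hi.2.elim (fun h => ordOf_between b h.1 h.2.1 bp bq) fun h => ordOf_between b h.2.1 h.2.2.1 bp bq

theorem holds_pickedF (hp : p < k) (hq : q < k) (ht : t < k) (bp : v p < N) (bq : v q < N) (bt : v t < N) :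
    (pickedF b p q t k).Holds N m v ↔ @Picked ℕ (ordOf b) A (v p) (v q) (v t) := by
  simp only [pickedF, holds_disj, Picked, holds_exitF H hp ht bt, holds_hookLF H hp hq ht bp bq bt,
    holds_hookRF H hp hq ht bp bq bt]

theorem holds_takenF {F : ℕ → ℕ → Ex} {P : ℕ → Prop} (hp : p < k) (hq : q < k) (ht : t < k) (bp : v p < N)
    (bq : v q < N) (bt : v t < N) (hP : ∀ x, P x → x < N)
    (hF : ∀ (w : ℕ → ℕ) x j, p < j → q < j → x < j → w p = v p → w q = v q → w x < N → ((F x j).Holds N m w ↔ P (w x))) :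
    (takenF b F p q t k).Holds N m v ↔ @Taken ℕ (ordOf b) A P (v p) (v q) (v t) := by
  have hR : ∀ z x, @RightReach ℕ (ordOf b) A z x ↔ @LeftReach ℕ (ordOf !b) A z x := by
    intro z x
    cases b <;> rfl
  simp only [takenF, holds_disj, holds_conj, holds_neg, holds_before, Taken, Caught, hF v t k hp hq ht rfl rfl bt]
  refine or_congr Iff.rfl (and_congr Iff.rfl (and_congr Iff.rfl (and_congr Iff.rfl ?_)))
  rw [holds_sum]
  refine exists_bounded_congr (fun i hi => ?_) ?_
  · rw [holds_sum]
    refine exists_bounded_congr (fun j hj => ?_) ?_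
    · have up : ∀ x, x < k → Function.update (Function.update v k i) (k + 1) j x = v x := fun x hx => by
        simp [hx.ne, (hx.trans (Nat.lt_succ_self k)).ne]
      have upk : Function.update (Function.update v k i) (k + 1) j k = i := by simp
      have upk1 : Function.update (Function.update v k i) (k + 1) j (k + 1) = j := by simp
      generalize Function.update (Function.update v k i) (k + 1) j = w at up upk upk1
      simp only [holds_conj, holds_before, holds_disj, holds_eq, eval_var, holds_neg, upk, upk1, up p hp, up q hq, up t ht,
        hF w k (k + 2) (by omega) (by omega) (by omega) (up p hp) (up q hq) (upk ▸ hi),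
        hF w (k + 1) (k + 2) (by omega) (by omega) (by omega) (up p hp) (up q hq) (upk1 ▸ hj),
        holds_reach H (v := w) (show w t < N by rw [up t ht]; exact bt) (show w k < N by rw [upk]; exact hi),
        holds_reach H (v := w) (show w t < N by rw [up t ht]; exact bt) (show w (k + 1) < N by rw [upk1]; exact hj), hR]
      refine and_congr Iff.rfl (and_congr Iff.rfl (and_congr Iff.rfl (and_congr Iff.rfl (and_congr ?_ Iff.rfl))))
      have : (∀ x, (ordOf b).lt i x → (ordOf b).lt x j → ¬ P x) ↔ ¬ ∃ x, (ordOf b).lt i x ∧ (ordOf b).lt x j ∧ P x := by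
        push Not; rfl
      rw [holds_sum]
      refine Iff.trans (not_congr (exists_bounded_congr (fun x hx => ?_) fun x hx => hP x hx.2.2)) this.symm
      rw [holds_conj, holds_conj, hF _ (k + 2) (k + 3) (by omega) (by omega) (by omega)
        (by rw [Function.update_of_ne (by omega), up p hp]) (by rw [Function.update_of_ne (by omega), up q hq]) (by simpa)]
      simp [holds_before, upk, upk1]
    · rintro s ⟨_, _, _, h, _⟩
      exact h.elim (fun h => h ▸ bq) fun h => hP _ h
  · rintro s ⟨_, _, _, h, _⟩
    exact h.elim (fun h => h ▸ bp) fun h => hP _ h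

theorem holds_takenL (hp : p < k) (hq : q < k) (ht : t < k) (bp : v p < N) (bq : v q < N) (bt : v t < N) :
    (takenF b (pickedF b p q) p q t k).Holds N m v ↔ @TakenL ℕ (ordOf b) A (v p) (v q) (v t) := by
  refine holds_takenF H hp hq ht bp bq bt (fun x hx => ?_) fun w x j h1 h2 h3 h4 h5 h6 => ?_
  · rcases hx with h | h | h
    · exact ordOf_between b h.1 h.2.1 bp bq
    · exact ordOf_between b h.2.1 h.2.2.1 bp bq
    · exact ordOf_between b h.1 h.2.1 bp bq
  · rw [holds_pickedF H h1 h2 h3 (h4 ▸ bp) (h5 ▸ bq) h6, h4, h5]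

theorem holds_topF (hp : p < k) (hq : q < k) (ht : t < k) (bp : v p < N) (bq : v q < N) (bt : v t < N) :
    (topF p q t k).Holds N m v ↔ TopVertex A (v p) (v q) (v t) := by
  have e1 : ∀ a : ℕ, (∀ x, a < x → x < v q → ¬ A (v p) x) ↔ ¬ ∃ x, a < x ∧ x < v q ∧ A (v p) x := fun a => by
    push Not; rfl
  have e2 : (∀ x, v p < x → ¬ x < v t) ↔ ¬ ∃ x, v p < x ∧ x < v t := by push Not; rfl
  simp only [topF, holds_conj, holds_disj, holds_neg, holds_before, holds_sum, TopVertex, holds_adj H bp bt, e1, e2]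
  refine and_congr Iff.rfl (and_congr Iff.rfl (or_congr (and_congr Iff.rfl (not_congr ?_)) (and_congr (not_congr ?_) (not_congr ?_))))
  · refine exists_bounded_congr (fun i hi => ?_) fun i h => h.2.1.trans bq
    simp [holds_adj H, hp.ne, hq.ne, ht.ne, hi, bp]
  · refine exists_bounded_congr (fun i hi => ?_) fun i h => h.2.1.trans bq
    simp [holds_adj H, hp.ne, hq.ne, hi, bp]
  · refine exists_bounded_congr (fun i hi => ?_) fun i h => h.2.trans bt
    simp [hp.ne, ht.ne]

theorem holds_pickedZF (hp : p < k) (hq : q < k) (ht : t < k) (bp : v p < N) (bq : v q < N) (bt : v t < N) :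
    (pickedZF p q t k).Holds N m v ↔ PickedZ A (v p) (v q) (v t) := by
  simp only [pickedZF, holds_conj, holds_disj, holds_before, holds_sum, PickedZ, holds_adj H bp bt, holds_adj H bt bq,
    holds_topF H hp hq ht bp bq bt]
  refine and_congr Iff.rfl (and_congr Iff.rfl (or_congr Iff.rfl (or_congr (and_congr Iff.rfl ?_) (and_congr Iff.rfl ?_))))
  · refine exists_bounded_congr (fun i hi => ?_) fun i h => h.2.2.1.trans bq
    rw [holds_topF H (by omega) (by omega) (by omega) (by simpa [hp.ne]) (by simpa [hq.ne]) (by simpa)]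
    simp [hp.ne, hq.ne, ht.ne]
  · refine exists_bounded_congr (fun i hi => ?_) fun i h => h.2.1.trans bt
    simp [holds_adj H, hp.ne, hq.ne, ht.ne, hi, bq]

theorem holds_takenZ (hp : p < k) (hq : q < k) (ht : t < k) (bp : v p < N) (bq : v q < N) (bt : v t < N) :
    (takenF true (pickedZF p q) p q t k).Holds N m v ↔ TakenZ A (v p) (v q) (v t) := by
  refine holds_takenF H hp hq ht bp bq bt (fun x hx => hx.2.1.trans bq) fun w x j h1 h2 h3 h4 h5 h6 => ?_
  rw [holds_pickedZF H h1 h2 h3 (h4 ▸ bp) (h5 ▸ bq) h6, h4, h5]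

end Taken
end Ex

/-! ### Frame conditions for commands -/

namespace Cmd

/-- A Boolean function of the syntax, so that for a concrete command and array the frame condition
holds by `rfl`. -/
def keepsArr (b : ℕ) : Cmd → Bool
  | set _ _ => true
  | par1 a _ _ => decide (b ≠ a)
  | par2 a _ _ _ => decide (b ≠ a)
  | seq c d => keepsArr b c && keepsArr b d
  | rep c => keepsArr b c

def keepsVar (y : ℕ) : Cmd → Bool
  | set x _ => decide (y ≠ x)
  | par1 _ _ _ => true
  | par2 _ _ _ _ => true
  | seq c d => keepsVar y c && keepsVar y d
  | rep c => keepsVar y c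

section Frame
variable {N : ℕ} {c : Cmd} {s : RamState} {a b x y : ℕ} {e : Ex}

theorem run_arr_of_keeps (h : c.keepsArr b = true) (s : RamState) : (c.run N s).arr b = s.arr b := by
  induction c generalizing s with
  | set x e => rfl
  | par1 a x e => exact s.setArr_of_ne _ (by simpa [keepsArr] using h)
  | par2 a x y e => exact s.setArr_of_ne _ (by simpa [keepsArr] using h)
  | seq c d ih1 ih2 =>
    simp only [keepsArr, Bool.and_eq_true] at h
    exact (ih2 h.2 _).trans (ih1 h.1 s)
  | rep c ih =>
    exact Function.Iterate.rec (fun s' => s'.arr b = s.arr b) rfl (fun s' hs' => (ih h s').trans hs') N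

theorem run_var_of_keeps (h : c.keepsVar y = true) (s : RamState) : (c.run N s).var y = s.var y := by
  induction c generalizing s with
  | set x e => exact s.setVar_of_ne _ (by simpa [keepsVar] using h)
  | par1 a x e => rfl
  | par2 a x y e => rfl
  | seq c d ih1 ih2 =>
    simp only [keepsVar, Bool.and_eq_true] at h
    exact (ih2 h.2 _).trans (ih1 h.1 s)
  | rep c ih =>
    exact Function.Iterate.rec (fun s' => s'.var y = s.var y) rfl (fun s' hs' => (ih h s').trans hs') N

theorem iterate_arr_of_keeps (h : c.keepsArr b = true) (s : RamState) (i : ℕ) : ((c.run N)^[i] s).arr b = s.arr b :=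
  Function.Iterate.rec (fun s' => s'.arr b = s.arr b) rfl (fun s' hs' => (run_arr_of_keeps h s').trans hs') i

theorem iterate_var_of_keeps (h : c.keepsVar y = true) (s : RamState) (i : ℕ) : ((c.run N)^[i] s).var y = s.var y :=
  Function.Iterate.rec (fun s' => s'.var y = s.var y) rfl (fun s' hs' => (run_var_of_keeps h s').trans hs') i

theorem run_par1 {i : ℕ} (hi : i < N) :
    ((par1 a x e).run N s).arr a i = e.eval N s.arr (Function.update s.var x i) := by
  simp [run, hi]

theorem run_par2 {i j : ℕ} (hi : i < N) (hj : j < N) : ((par2 a x y e).run N s).arr a (i * N + j) =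
    e.eval N s.arr (Function.update (Function.update s.var x i) y j) := by
  have hpos : 0 < N := by omega
  have h1 : (i * N + j) / N = i := by rw [mul_comm, Nat.mul_add_div hpos, Nat.div_eq_of_lt hj, add_zero]
  have h2 : (i * N + j) % N = j := by rw [mul_comm, Nat.mul_add_mod, Nat.mod_eq_of_lt hj]
  have h3 : i * N + j < N * N := by nlinarith
  simp [run, h1, h2, h3]

end Frame
end Cmd

/-! ### Computing the reachability relations -/

open Cmd Ex

/-- One round of the inductive definition of `LeftReach` for all pairs at once. Variables 10 and 11
are the source and the target, 12 is the lower end of the last chord and 13 the point from which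
this chord starts. -/
def reachStep (b : Bool) : Cmd :=
  .par2 (reachArr b) 10 11 (.sum 12 (.conj (before b 12 11) (.disj (.conj (cell adjArr 12 10) (before b 12 10))
    (.sum 13 (.conj (before b 13 10) (.conj (cell (reachArr b) 10 13) (cell adjArr 12 13)))))))

structure AdjMem (N : ℕ) (m : ℕ → ℕ → ℕ) (A : ℕ → ℕ → Prop) : Prop where
  mul : ∀ i, i < N → m mulArr i = i * N
  adj : ∀ u v, u < N → v < N → (m adjArr (u * N + v) ≠ 0 ↔ A u v)
  bound : ∀ u v, A u v → u < N ∧ v < N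

section
variable {N : ℕ} {A : ℕ → ℕ → Prop} {s : RamState}

theorem AdjMem.congr {m m' : ℕ → ℕ → ℕ} (H : AdjMem N m A) (h1 : m' mulArr = m mulArr) (h2 : m' adjArr = m adjArr) :
    AdjMem N m' A :=
  ⟨fun i hi => by rw [h1, H.mul i hi], fun u v hu hv => by rw [h2, H.adj u v hu hv], H.bound⟩

theorem AdjMem.holds_adj {m : ℕ → ℕ → ℕ} (H : AdjMem N m A) {v : ℕ → ℕ} {x y : ℕ} (hx : v x < N) (hy : v y < N) :
    (cell adjArr x y).Holds N m v ↔ A (v x) (v y) := by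
  rw [holds_iff, eval_cell H.mul hx, H.adj _ _ hx hy]

theorem run_reachStep (b : Bool) (H : AdjMem N s.arr A) {v x : ℕ} (hv : v < N) (hx : x < N) :
    ((reachStep b).run N s).arr (reachArr b) (v * N + x) ≠ 0 ↔ ∃ u, (ordOf b).lt u x ∧ ((A u v ∧ (ordOf b).lt u v) ∨
      ∃ w, w < N ∧ (ordOf b).lt w v ∧ s.arr (reachArr b) (v * N + w) ≠ 0 ∧ A u w) := by
  rw [reachStep, run_par2 hv hx, ← holds_iff, holds_sum]
  refine exists_bounded_congr (fun u hu => ?_) fun u hu => hu.2.elim (fun h => (H.bound _ _ h.1).1) fun ⟨w, h⟩ => (H.bound _ _ h.2.2.2).1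
  rw [holds_conj, holds_disj, holds_conj, holds_sum, H.holds_adj (by simpa) (by simpa), holds_before, holds_before]
  simp only [ne_eq, Nat.reduceEqDiff, not_false_eq_true, Function.update_of_ne, Function.update_self]
  refine and_congr Iff.rfl (or_congr Iff.rfl (exists_congr fun w => and_congr_right fun hw => ?_))
  rw [holds_conj, holds_conj, holds_before, H.holds_adj (by simpa) (by simpa), holds_iff (e := cell _ _ _), eval_cell H.mul (by simpa)]
  simp

/-- For fixed `v` the points reached after `i` rounds form growing subsets of `{0, …, N - 1}` which
stay equal once they are equal, so `N` rounds suffice. -/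
theorem run_reach (b : Bool) (H : AdjMem N s.arr A) (h0 : ∀ i, s.arr (reachArr b) i = 0) {v x : ℕ} (hv : v < N) (hx : x < N) :
    ((Cmd.rep (reachStep b)).run N s).arr (reachArr b) (v * N + x) ≠ 0 ↔ @LeftReach ℕ (ordOf b) A v x := by
  let st : ℕ → RamState := fun i => ((reachStep b).run N)^[i] s
  let S : ℕ → ℕ → Prop := fun i x => x < N ∧ (st i).arr (reachArr b) (v * N + x) ≠ 0
  have Hs : ∀ i, AdjMem N (st i).arr A := fun i => H.congr
    (iterate_arr_of_keeps (by cases b <;> rfl) s i) (iterate_arr_of_keeps (by cases b <;> rfl) s i)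
  have step : ∀ i x, S (i + 1) x ↔ x < N ∧ ∃ u, (ordOf b).lt u x ∧ ((A u v ∧ (ordOf b).lt u v) ∨
      ∃ w, S i w ∧ (ordOf b).lt w v ∧ A u w) := by
    intro i x
    refine and_congr_right fun hx => ?_
    have : st (i + 1) = (reachStep b).run N (st i) := Function.iterate_succ_apply' _ _ _
    rw [this, run_reachStep b (Hs i) hv hx]
    refine exists_congr fun u => and_congr Iff.rfl (or_congr Iff.rfl (exists_congr fun w => ?_))
    simp only [S]; tauto
  have mono : ∀ i x, S i x → S (i + 1) x := by
    intro i
    induction i with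
    | zero => exact fun x h => absurd (h0 _) h.2
    | succ i ih =>
      intro x h
      rw [step] at h ⊢
      obtain ⟨h1, u, h2, h3⟩ := h
      exact ⟨h1, u, h2, h3.imp_right fun ⟨w, hw, h4⟩ => ⟨w, ih w hw, h4⟩⟩
  have stab : ∀ x, S (N + 1) x → S N x := stable_of_growing mono (fun i x h => h.1) fun i hi x h => by
    rw [step] at h ⊢
    obtain ⟨h1, u, h2, h3⟩ := h
    exact ⟨h1, u, h2, h3.imp_right fun ⟨w, hw, h4⟩ => ⟨w, hi w hw, h4⟩⟩
  have sound : ∀ i x, S i x → @LeftReach ℕ (ordOf b) A v x := by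
    intro i
    induction i with
    | zero => exact fun x h => absurd (h0 _) h.2
    | succ i ih =>
      intro x h
      obtain ⟨_, u, h2, h3 | ⟨w, hw, h3, h4⟩⟩ := (step i x).1 h
      · exact @LeftReach.base ℕ (ordOf b) A v u x h3.1 h3.2 h2
      · exact @LeftReach.step ℕ (ordOf b) A v w u x (ih w hw) h3 h4 h2
  have complete : ∀ x, @LeftReach ℕ (ordOf b) A v x → x < N → S N x := by
    intro x h
    induction h with
    | base h1 h2 h3 => exact fun hx => stab _ ((step N _).2 ⟨hx, _, h3, Or.inl ⟨h1, h2⟩⟩)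
    | step h1 h2 h3 h4 ih => exact fun hx => stab _ ((step N _).2 ⟨hx, _, h4, Or.inr ⟨_, ih (H.bound _ _ h3).2, h2, h3⟩⟩)
  exact ⟨fun h => sound N x ⟨hx, h⟩, fun h => (complete x h hx).2⟩

end

/-! ### Computing the layers -/

def baseArr : ℕ := 8
def curArr : ℕ := 9
def nextArr : ℕ := 10
def levelArr : ℕ := 11
def contactArr : ℕ := 12
def colArr : ℕ := 13
/-- The variable that holds the number of the layer modulo `3`. -/
def phaseVar : ℕ := 3

/-- `M` contains a neighbour of `q` in the gap of `D` below `q`. -/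
def Contact (A : ℕ → ℕ → Prop) (D M : ℕ → Prop) (q : ℕ) : Prop :=
  ∃ b, M b ∧ b < q ∧ A b q ∧ ∀ x, D x → ¬ x < b → ¬ x < q

namespace Ex

def succMod (e : Ex) : Ex := ite (lt e (const 2)) (add e (const 1)) (const 0)

theorem eval_succMod {N : ℕ} {m : ℕ → ℕ → ℕ} {v : ℕ → ℕ} {e : Ex} :
    (succMod e).eval N m v = if e.eval N m v < 2 then e.eval N m v + 1 else 0 := by
  rw [succMod, eval_ite]
  simp only [holds_lt, eval_const, eval_add]

def gapF (a p q k : ℕ) : Ex :=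
  conj (rd a (var p)) (conj (rd a (var q)) (conj (lt (var p) (var q))
    (neg (sum k (conj (lt (var p) (var k)) (conj (lt (var k) (var q)) (rd a (var k))))))))

/-- `T` is a formula about the ends `11` and `12` of a gap and the vertex `10`. -/
def extendF (T : Ex) : Ex :=
  disj (rd curArr (var 10)) (sum 11 (sum 12 (conj (gapF curArr 11 12 13) (conj (lt (var 11) (var 10))
    (conj (lt (var 10) (var 12)) T)))))

def contactF : Ex :=
  sum 11 (conj (rd nextArr (var 11)) (conj (lt (var 11) (var 10)) (conj (cell adjArr 11 10)
    (neg (sum 12 (conj (rd baseArr (var 12)) (conj (neg (lt (var 12) (var 11))) (lt (var 12) (var 10)))))))))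

section
variable {N : ℕ} {m : ℕ → ℕ → ℕ} {v : ℕ → ℕ} {a p q k x : ℕ}

theorem holds_rd : (rd a (var x)).Holds N m v ↔ m a (v x) ≠ 0 := Iff.rfl

theorem holds_gapF {X : ℕ → Prop} (hX : ∀ i, i < N → (m a i ≠ 0 ↔ X i)) (hp : p < k) (hq : q < k) (bp : v p < N) (bq : v q < N) :
    (gapF a p q k).Holds N m v ↔ IsGap X (v p) (v q) := by
  have e1 : (∀ x, v p < x → x < v q → ¬ X x) ↔ ¬ ∃ x, v p < x ∧ x < v q ∧ X x := by push Not; rfl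
  simp only [gapF, holds_conj, holds_rd, holds_lt, eval_var, holds_neg, holds_sum, hX _ bp, hX _ bq, IsGap, e1]
  refine and_congr Iff.rfl (and_congr Iff.rfl (and_congr Iff.rfl (not_congr
    (exists_bounded_congr (fun i hi => ?_) fun i h => h.2.1.trans bq))))
  simp [hp.ne, hq.ne, hX i hi]

theorem holds_extendF {X : ℕ → Prop} {F : Ex} {T : ℕ → ℕ → ℕ → Prop} (hX : ∀ i, i < N → (m curArr i ≠ 0 ↔ X i))
    (hb : ∀ i, X i → i < N)
    (hF : ∀ w : ℕ → ℕ, w 10 < N → w 11 < N → w 12 < N → (F.Holds N m w ↔ T (w 11) (w 12) (w 10))) (hv : v 10 < N) :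
    (extendF F).Holds N m v ↔ extendBy T X (v 10) := by
  rw [extendF, holds_disj, holds_rd, hX _ hv, holds_sum]
  refine or_congr Iff.rfl (exists_bounded_congr (fun p hp => ?_) fun p ⟨q, h, _⟩ => hb _ h.1)
  rw [holds_sum]
  refine exists_bounded_congr (fun q hq => ?_) fun q h => hb _ h.1.2.1
  rw [holds_conj, holds_conj, holds_conj, holds_gapF hX (by omega) (by omega) (by simpa) (by simpa), hF _ (by simpa) (by simpa) (by simpa)]
  simp [holds_lt, eval_var]

theorem holds_contactF {A : ℕ → ℕ → Prop} (H : GraphMem N m A) {D M : ℕ → Prop}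
    (hD : ∀ i, i < N → (m baseArr i ≠ 0 ↔ D i)) (hM : ∀ i, i < N → (m nextArr i ≠ 0 ↔ M i)) (hv : v 10 < N) :
    contactF.Holds N m v ↔ Contact A D M (v 10) := by
  rw [contactF, holds_sum]
  refine exists_bounded_congr (fun b hb => ?_) fun b h => h.2.1.trans hv
  have e1 : (∀ x, D x → ¬ x < b → ¬ x < v 10) ↔ ¬ ∃ x, D x ∧ ¬ x < b ∧ x < v 10 := by push Not; rfl
  rw [holds_conj, holds_conj, holds_conj, holds_adj H (by simpa) (by simpa), holds_rd, holds_neg, holds_sum, e1, holds_lt]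
  simp only [eval_var, ne_eq, Nat.reduceEqDiff, not_false_eq_true, Function.update_of_ne, Function.update_self, hM b hb]
  refine and_congr Iff.rfl (and_congr Iff.rfl (and_congr Iff.rfl (not_congr ?_)))
  refine exists_bounded_congr (fun x hx => ?_) fun x h => h.2.2.trans hv
  rw [holds_conj, holds_conj, holds_rd, holds_neg, holds_lt, holds_lt]
  simp only [eval_var, ne_eq, Nat.reduceEqDiff, not_false_eq_true, Function.update_of_ne, Function.update_self]
  exact and_congr (hD x hx) Iff.rfl

end
end Ex

def layerStep (T : Ex) : Cmd :=
  .seq (.par1 nextArr 10 (extendF T)) (.seq (.set phaseVar (succMod (.var phaseVar)))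
    (.seq (.par1 levelArr 10 (.ite (.conj (.rd nextArr (.var 10)) (.neg (.rd curArr (.var 10)))) (.var phaseVar)
      (.rd levelArr (.var 10))))
    (.seq (.par1 contactArr 10 (.ite (.conj (.neg (.rd contactArr (.var 10))) contactF) (.add (.var phaseVar) (.const 1))
      (.rd contactArr (.var 10))))
    (.par1 curArr 10 (.rd nextArr (.var 10))))))

/-- It is used with `M = chain A D`, so a vertex that enters with `M (j + 1)` has level `j`. The
phase starts at 2, which gives the residue 0 to layer 0. In `contactArr` the residue of the first
contact is stored plus one, and 0 means that there was none. -/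
structure ChainMem (N : ℕ) (A : ℕ → ℕ → Prop) (D : ℕ → Prop) (M : ℕ → ℕ → Prop) (k : ℕ) (s : RamState) : Prop where
  graph : GraphMem N s.arr A
  base : ∀ v, v < N → (s.arr baseArr v ≠ 0 ↔ D v)
  cur : ∀ v, v < N → (s.arr curArr v ≠ 0 ↔ M k v)
  phase : s.var phaseVar = (k + 2) % 3
  level : ∀ v, v < N → ∀ j, j < k → M (j + 1) v → ¬ M j v → s.arr levelArr v = j % 3
  none : ∀ q, q < N → ¬ Contact A D (M k) q → s.arr contactArr q = 0
  first : ∀ q, q < N → ∀ j, j < k → Contact A D (M (j + 1)) q → ¬ Contact A D (M j) q → s.arr contactArr q = j % 3 + 1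

theorem GraphMem.congr {N : ℕ} {A : ℕ → ℕ → Prop} {m m' : ℕ → ℕ → ℕ} (H : GraphMem N m A) (h1 : m' mulArr = m mulArr)
    (h2 : m' adjArr = m adjArr) (h3 : ∀ b, m' (reachArr b) = m (reachArr b)) : GraphMem N m' A :=
  ⟨fun i hi => by rw [h1, H.mul i hi], fun u v hu hv => by rw [h2, H.adj u v hu hv], H.bound,
    fun b u v hu hv => by rw [h3, H.reach b u v hu hv]⟩

theorem run_layerStep {N : ℕ} {A : ℕ → ℕ → Prop} {D : ℕ → Prop} {M : ℕ → ℕ → Prop} {k : ℕ} {s : RamState} {F : Ex}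
    {T : ℕ → ℕ → ℕ → Prop} (hs : ChainMem N A D M k s) (hmono : ∀ j v, M j v → M (j + 1) v) (hb : ∀ v, M k v → v < N)
    (hT : M (k + 1) = extendBy T (M k))
    (hF : ∀ w : ℕ → ℕ, w 10 < N → w 11 < N → w 12 < N → (F.Holds N s.arr w ↔ T (w 11) (w 12) (w 10))) :
    ChainMem N A D M (k + 1) ((layerStep F).run N s) := by
  classical
  have hM : ∀ i j v, i ≤ j → M i v → M j v := fun i j v hij h => by
    induction hij with
    | refl => exact h
    | step _ ih => exact hmono _ _ ih
  have hC : ∀ q, Contact A D (M k) q → Contact A D (M (k + 1)) q := fun q ⟨b, h1, h2⟩ => ⟨b, hmono k b h1, h2⟩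
  let s1 := (Cmd.par1 nextArr 10 (extendF F)).run N s
  have n1 : ∀ v, v < N → (s1.arr nextArr v ≠ 0 ↔ M (k + 1) v) := fun v hv => by
    simp only [s1, run_par1 hv]
    rw [← holds_iff, holds_extendF hs.cur hb hF (by simpa), hT]
    simp
  have o1 : ∀ b, b ≠ nextArr → s1.arr b = s.arr b := fun b hb => s.setArr_of_ne _ hb
  have v1 : s1.var = s.var := rfl
  change ChainMem N A D M (k + 1) ((Cmd.par1 curArr 10 _).run N ((Cmd.par1 contactArr 10 _).run N
    ((Cmd.par1 levelArr 10 _).run N ((Cmd.set phaseVar _).run N s1))))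
  clear_value s1
  let s2 := (Cmd.set phaseVar (succMod (.var phaseVar))).run N s1
  have a2 : s2.arr = s1.arr := rfl
  have p2 : s2.var phaseVar = k % 3 := by
    simp only [s2, run, RamState.setVar_same, eval_succMod, eval_var, v1, hs.phase]
    split <;> omega
  change ChainMem N A D M (k + 1) ((Cmd.par1 curArr 10 _).run N ((Cmd.par1 contactArr 10 _).run N
    ((Cmd.par1 levelArr 10 _).run N s2)))
  clear_value s2
  let s3 := (Cmd.par1 levelArr 10 (.ite (.conj (.rd nextArr (.var 10)) (.neg (.rd curArr (.var 10)))) (.var phaseVar)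
      (.rd levelArr (.var 10)))).run N s2
  have l3 : ∀ v, v < N → s3.arr levelArr v = if M (k + 1) v ∧ ¬ M k v then k % 3 else s.arr levelArr v := fun v hv => by
    simp only [s3, run_par1 hv, eval_ite, holds_conj, holds_neg, holds_rd, eval_rd, eval_var, Function.update_self, a2,
      o1 curArr (by decide), o1 levelArr (by decide), n1 v hv, hs.cur v hv]
    rw [Function.update_of_ne (by decide), p2]
  have o3 : ∀ b, b ≠ levelArr → s3.arr b = s1.arr b := fun b hb => by rw [← a2]; exact s2.setArr_of_ne _ hb
  have p3 : s3.var phaseVar = k % 3 := p2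
  change ChainMem N A D M (k + 1) ((Cmd.par1 curArr 10 _).run N ((Cmd.par1 contactArr 10 _).run N s3))
  clear_value s3
  let s4 := (Cmd.par1 contactArr 10 (.ite (.conj (.neg (.rd contactArr (.var 10))) contactF) (.add (.var phaseVar) (.const 1))
      (.rd contactArr (.var 10)))).run N s3
  have H3 : GraphMem N s3.arr A := hs.graph.congr (by rw [o3 _ (by decide), o1 _ (by decide)])
    (by rw [o3 _ (by decide), o1 _ (by decide)]) fun b => by rw [o3 _ (by cases b <;> decide), o1 _ (by cases b <;> decide)]
  have c4 : ∀ v, v < N → s4.arr contactArr v = if s.arr contactArr v = 0 ∧ Contact A D (M (k + 1)) v then k % 3 + 1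
      else s.arr contactArr v := fun v hv => by
    simp only [s4, run_par1 hv, eval_ite, holds_conj, holds_neg, holds_rd, eval_rd, eval_var, Function.update_self, eval_add, eval_const,
      o3 contactArr (by decide), o1 contactArr (by decide), not_not]
    rw [Function.update_of_ne (by decide), p3, holds_contactF H3 (D := D) (M := M (k + 1))
      (fun i hi => by rw [o3 _ (by decide), o1 _ (by decide)]; exact hs.base i hi)
      (fun i hi => by rw [o3 _ (by decide)]; exact n1 i hi) (by simpa), Function.update_self]
  have o4 : ∀ b, b ≠ contactArr → s4.arr b = s3.arr b := fun b hb => s3.setArr_of_ne _ hb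
  have p4 : s4.var phaseVar = k % 3 := p3
  change ChainMem N A D M (k + 1) ((Cmd.par1 curArr 10 _).run N s4)
  clear_value s4
  have hG : GraphMem N ((Cmd.par1 curArr 10 (.rd nextArr (.var 10))).run N s4).arr A := H3.congr
    (by rw [run_arr_of_keeps rfl, o4 _ (by decide)]) (by rw [run_arr_of_keeps rfl, o4 _ (by decide)])
    fun b => by rw [run_arr_of_keeps (by cases b <;> rfl), o4 _ (by cases b <;> decide)]
  refine ⟨hG, fun v hv => ?_, fun v hv => ?_, ?_, fun v hv j hj h1 h2 => ?_, fun q hq h => ?_, fun q hq j hj h1 h2 => ?_⟩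
  · rw [run_arr_of_keeps rfl, o4 _ (by decide), o3 _ (by decide), o1 _ (by decide)]; exact hs.base v hv
  · rw [run_par1 hv, eval_rd, eval_var, Function.update_self, o4 _ (by decide), o3 _ (by decide)]; exact n1 v hv
  · rw [run_var_of_keeps rfl, p4]; omega
  · rw [run_arr_of_keeps rfl, o4 _ (by decide), l3 v hv]
    rcases Nat.lt_succ_iff_lt_or_eq.1 hj with hj | rfl
    · rw [if_neg (fun h => h.2 (hM _ _ _ (by omega) h1)), hs.level v hv j hj h1 h2]
    · rw [if_pos ⟨h1, h2⟩]
  · rw [run_arr_of_keeps rfl, c4 q hq, if_neg (fun h' => h h'.2)]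
    exact hs.none q hq fun h' => h (hC q h')
  · rw [run_arr_of_keeps rfl, c4 q hq]
    rcases Nat.lt_succ_iff_lt_or_eq.1 hj with hj | rfl
    · have := hs.first q hq j hj h1 h2
      rw [if_neg (by omega), this]
    · rw [if_pos ⟨hs.none q hq h2, h1⟩]

/-! ### One round of the decomposition -/

/-- The sets `D, layer 0, layer 1, …`. -/
def chain (A : ℕ → ℕ → Prop) (D : ℕ → Prop) : ℕ → ℕ → Prop
  | 0 => D
  | k + 1 => layer A D k

def initRound : Cmd :=
  .seq (.par1 curArr 10 (.rd baseArr (.var 10))) (.seq (.par1 contactArr 10 (.const 0)) (.set phaseVar (.const 2)))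

def doubleStep : Cmd :=
  .seq (layerStep (takenF true (pickedF true 11 12) 11 12 10 13)) (layerStep (takenF false (pickedF false 12 11) 12 11 10 13))

def layersCmd : Cmd :=
  .seq (layerStep (takenF true (pickedZF 11 12) 11 12 10 13)) (.rep doubleStep)

namespace Ex

def nextF : Ex :=
  conj (rd baseArr (var 11)) (conj (lt (var 10) (var 11))
    (neg (sum 12 (conj (rd baseArr (var 12)) (conj (lt (var 10) (var 12)) (lt (var 12) (var 11)))))))

def shiftF (l c k : Ex) : Ex :=
  ite (eq l (succMod (succMod k))) c (ite (eq l k) (succMod c) (succMod (succMod c)))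

def colourF : Ex :=
  ite (rd baseArr (var 10)) (rd colArr (var 10)) (sum 11 (ite nextF
    (shiftF (rd levelArr (var 10)) (rd colArr (var 11)) (sub (rd contactArr (var 11)) (const 1))) (const 0)))

end Ex

def finishRound : Cmd := .seq (.par1 colArr 10 colourF) (.par1 baseArr 10 (.rd curArr (.var 10)))

def roundCmd : Cmd := .seq initRound (.seq layersCmd finishRound)

section
variable {N n : ℕ} {A : ℕ → ℕ → Prop} {D : ℕ → Prop} {s : RamState}

theorem layer_add_two_congr {D : ℕ → Prop} {i j : ℕ} (h : i % 2 = j % 2) (hl : layer A D i = layer A D j) :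
    layer A D (i + 2) = layer A D (j + 2) := by
  simp only [layer, h, hl, Nat.add_mod i 1, Nat.add_mod j 1]

/-- Only even indices are compared, because the rule of a step depends on the parity of its index:
two equal consecutive even layers stay equal. -/
theorem PartialState.layer_stable (S : PartialState A n D) (hn : n < N) {v : ℕ} (h : layer A D (2 * N + 2) v) :
    layer A D (2 * N) v := by
  refine stable_of_growing (N := N) (S := fun i => layer A D (2 * i)) (fun i x h => layer_mono (by omega) h)
    (fun i x h => (S.layer_le h).trans_lt hn) (fun i hi x h => ?_) v h
  have e : layer A D (2 * i + 2) = layer A D (2 * i) := by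
    funext y
    exact propext ⟨hi y, layer_mono (by omega)⟩
  have := layer_add_two_congr (i := 2 * i + 2) (j := 2 * i) (by omega) e
  exact (congrFun this x).mp h

theorem PartialState.layer_top (S : PartialState A n D) (hn : n < N) {k v : ℕ} (h : layer A D k v) : layer A D (2 * N) v := by
  have e : ∀ j, layer A D (2 * N + 2 * j) = layer A D (2 * N) := by
    intro j
    induction j with
    | zero => rfl
    | succ j ih =>
      have h1 := layer_add_two_congr (i := 2 * N + 2 * j) (j := 2 * N) (by omega) ih
      have h2 : layer A D (2 * N + 2) = layer A D (2 * N) := by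
        funext y
        exact propext ⟨S.layer_stable hn, layer_mono (by omega)⟩
      exact h1.trans h2
  rw [← e k]
  exact layer_mono (by omega) h

theorem chain_mono (j v : ℕ) (h : chain A D j v) : chain A D (j + 1) v := by
  cases j
  · exact Or.inl h
  · exact layer_mono_succ h

theorem PartialState.chain_lt (S : PartialState A n D) (hn : n < N) {k v : ℕ} (h : chain A D k v) : v < N := by
  cases k
  · exact (S.le v h).trans_lt hn
  · exact (S.layer_le h).trans_lt hn

theorem run_layersCmd (S : PartialState A n D) (hn : n < N) (hs : ChainMem N A D (chain A D) 0 s) :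
    ChainMem N A D (chain A D) (2 * N + 1) (layersCmd.run N s) := by
  have h1 : ChainMem N A D (chain A D) 1 ((layerStep (takenF true (pickedZF 11 12) 11 12 10 13)).run N s) :=
    run_layerStep hs chain_mono (fun v h => S.chain_lt hn h) (T := TakenZ A) rfl fun w h1 h2 h3 =>
      holds_takenZ hs.graph (by omega) (by omega) (by omega) h2 h3 h1
  have h2 : ∀ i, ChainMem N A D (chain A D) (2 * i + 1)
      ((doubleStep.run N)^[i] ((layerStep (takenF true (pickedZF 11 12) 11 12 10 13)).run N s)) := by
    intro i
    induction i with
    | zero => exact h1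
    | succ i ih =>
      rw [Function.iterate_succ_apply']
      have h2 := run_layerStep (F := takenF true (pickedF true 11 12) 11 12 10 13) (T := TakenL A) ih chain_mono
        (fun v h => S.chain_lt hn h) (layer_succ_even (k := 2 * i) (by omega)) fun w h1 h2 h3 =>
          holds_takenL ih.graph (by omega) (by omega) (by omega) h2 h3 h1
      exact run_layerStep (F := takenF false (pickedF false 12 11) 12 11 10 13) (T := TakenR A) h2 chain_mono
        (fun v h => S.chain_lt hn h) (layer_succ_odd (k := 2 * i + 1) (by omega)) fun w h1 h3 h4 =>
          holds_takenL h2.graph (by omega) (by omega) (by omega) h4 h3 h1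
  exact h2 N

/-- The state between two rounds. -/
structure RoundMem (N n : ℕ) (A : ℕ → ℕ → Prop) (D : ℕ → Prop) (s : RamState) : Prop where
  graph : GraphMem N s.arr A
  state : PartialState A n D
  base : ∀ v, v < N → (s.arr baseArr v ≠ 0 ↔ D v)
  col_lt : ∀ v, D v → s.arr colArr v < 3
  capped : ∀ a b c d, D a → D b → D c → D d → a < b → b < c → c < d → s.arr colArr b = s.arr colArr a →
    s.arr colArr c = s.arr colArr a → s.arr colArr d = s.arr colArr a → A a c → A b d → A a d

/-- Here `c` is the colour of the upper end `r` of the gap and `k` the residue of the first level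
with a neighbour of `r`. The colour of `r` is given to the levels congruent to `k + 2`, so a
neighbour of `r` with this colour is not on the first such level. This is the condition `hr` of
`capped_layer`. -/
def shiftCol (l c k : ℕ) : ℕ :=
  if l = (k + 2) % 3 then c else if l = k then (c + 1) % 3 else (c + 2) % 3

theorem eval_shiftF {m : ℕ → ℕ → ℕ} {v : ℕ → ℕ} {l c k : Ex} (hc : c.eval N m v < 3) (hk : k.eval N m v < 3) :
    (shiftF l c k).eval N m v = shiftCol (l.eval N m v) (c.eval N m v) (k.eval N m v) := by
  have e : ∀ x : ℕ, x < 3 → (if x < 2 then x + 1 else 0) = (x + 1) % 3 := fun x hx => by split <;> omega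
  simp only [shiftF, eval_ite, holds_eq, eval_succMod, e _ hc, e _ hk, e _ (Nat.mod_lt _ (show 0 < 3 by omega)), shiftCol,
    Nat.mod_add_mod]

theorem shiftCol_lt {l c k : ℕ} (hc : c < 3) : shiftCol l c k < 3 := by
  unfold shiftCol; split_ifs <;> omega

theorem shiftCol_inj {l l' c k : ℕ} (hl : l < 3) (hl' : l' < 3) (hk : k < 3)
    (h : shiftCol l c k = shiftCol l' c k) : l = l' := by
  unfold shiftCol at h; split_ifs at h <;> omega

theorem shiftCol_eq {l c k : ℕ} (hc : c < 3) (h : shiftCol l c k = c) : l = (k + 2) % 3 := by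
  unfold shiftCol at h; split_ifs at h <;> omega

theorem holds_nextF {m : ℕ → ℕ → ℕ} {v : ℕ → ℕ} (hD : ∀ v, v < N → (m baseArr v ≠ 0 ↔ D v)) {o r : ℕ} (hg : IsGap D o r)
    (h1 : o < v 10) (h2 : v 10 < r) (hr : r < N) (h11 : v 11 < N) : nextF.Holds N m v ↔ v 11 = r := by
  simp only [nextF, holds_conj, holds_neg, holds_rd, holds_lt, eval_var, holds_sum, hD _ h11]
  constructor
  · rintro ⟨g1, g2, g3⟩
    refine le_antisymm ?_ (hg.le_right h1 g1 g2.le)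
    by_contra hcon
    push Not at hcon
    exact g3 ⟨r, hr, by simpa using (hD r hr).2 hg.2.1, by simpa using h2, by simpa using hcon⟩
  · intro h
    refine ⟨h ▸ hg.2.1, h ▸ h2, ?_⟩
    rintro ⟨i, hi, g1, g2, g3⟩
    simp only [ne_eq, Nat.reduceEqDiff, not_false_eq_true, Function.update_of_ne, Function.update_self] at g1 g2 g3
    exact hg.2.2.2 i (by omega) (by omega) ((hD i hi).1 g1)

/-- Old vertices keep their colours and new ones get shifted levels, so `capped_layer` controls the
classes; layer `2 * N` is stable and is a partial state by `of_stable`. -/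
theorem run_roundCmd (hn : n < N) (hs : RoundMem N n A D s) :
    RoundMem N n A (layer A D (2 * N)) (roundCmd.run N s) := by
  classical
  have S := hs.state
  let s1 := initRound.run N s
  have k1 : ∀ b, b ≠ curArr → b ≠ contactArr → s1.arr b = s.arr b := fun b h1 h2 =>
    run_arr_of_keeps (by simp [initRound, keepsArr, h1, h2]) s
  have h1 : ChainMem N A D (chain A D) 0 s1 := by
    refine ⟨hs.graph.congr (k1 _ (by decide) (by decide)) (k1 _ (by decide) (by decide)) fun b => k1 _ (by cases b <;> decide) (by cases b <;> decide),
      fun v hv => ?_, fun v hv => ?_, by simp [s1, initRound, run, eval_const], fun v hv j hj => absurd hj (by omega), fun q hq _ => ?_,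
      fun v hv j hj => absurd hj (by omega)⟩
    · rw [k1 _ (by decide) (by decide)]; exact hs.base v hv
    · have : s1.arr curArr v = s.arr baseArr v := by
        change ((Cmd.seq _ _).run N ((Cmd.par1 curArr 10 (.rd baseArr (.var 10))).run N s)).arr curArr v = _
        rw [run_arr_of_keeps rfl, run_par1 hv]
        simp [eval_rd, eval_var]
      rw [this]; exact hs.base v hv
    · change ((Cmd.set _ _).run N ((Cmd.par1 contactArr 10 (.const 0)).run N _)).arr contactArr q = _
      rw [run_arr_of_keeps rfl, run_par1 hq]
      rfl
  have e2 := run_layersCmd S hn h1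
  let s2 := layersCmd.run N s1
  have c2 : s2.arr colArr = s.arr colArr := (run_arr_of_keeps rfl s1).trans (k1 _ (by decide) (by decide))
  change RoundMem N n A (layer A D (2 * N)) (finishRound.run N s2)
  have e2 : ChainMem N A D (chain A D) (2 * N + 1) s2 := e2
  clear_value s2
  have cD : ∀ v, v < N → D v → (finishRound.run N s2).arr colArr v = s.arr colArr v := fun v hv hDv => by
    change ((Cmd.par1 baseArr 10 _).run N ((Cmd.par1 colArr 10 colourF).run N s2)).arr colArr v = _
    rw [run_arr_of_keeps rfl, run_par1 hv, colourF, eval_ite, if_pos (by rw [holds_rd]; simpa using (e2.base v hv).2 hDv), eval_rd, c2]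
    simp [eval_var]
  have hcontact0 : ∀ q, ¬ Contact A D D q := fun q ⟨b, h1, h2, _, h3⟩ => h3 b h1 (lt_irrefl b) h2
  have hfirst : ∀ q k, Contact A D (chain A D k) q → ∃ j, j < k ∧ Contact A D (chain A D (j + 1)) q ∧ ¬ Contact A D (chain A D j) q := by
    intro q k
    induction k with
    | zero => exact fun h => absurd h (hcontact0 q)
    | succ k ih =>
      intro h
      by_cases h' : Contact A D (chain A D k) q
      · obtain ⟨j, hj, h2⟩ := ih h'
        exact ⟨j, by omega, h2⟩
      · exact ⟨k, by omega, h, h'⟩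
  -- Without contact the entry is 0 and so is its truncated predecessor; any shift is then
  -- admissible.
  have hK : ∀ q, q < N → s2.arr contactArr q - 1 < 3 := fun q hq => by
    by_cases h : Contact A D (chain A D (2 * N + 1)) q
    · obtain ⟨j, hj, h2, h3⟩ := hfirst q _ h
      rw [e2.first q hq j hj h2 h3]; omega
    · rw [e2.none q hq h]; omega
  have cG : ∀ o r v, IsGap D o r → o < v → v < r → (finishRound.run N s2).arr colArr v =
      shiftCol (s2.arr levelArr v) (s.arr colArr r) (s2.arr contactArr r - 1) := fun o r v hg h1 h2 => by
    have hr : r < N := (S.le r hg.2.1).trans_lt hn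
    have hv : v < N := h2.trans hr
    change ((Cmd.par1 baseArr 10 _).run N ((Cmd.par1 colArr 10 colourF).run N s2)).arr colArr v = _
    have key : ∀ i, i < N → (nextF.Holds N s2.arr (Function.update (Function.update s2.var 10 v) 11 i) ↔ i = r) := fun i hi => by
      rw [holds_nextF e2.base hg (by simpa) (by simpa) hr (by simpa)]
      simp
    rw [run_arr_of_keeps rfl, run_par1 hv, colourF, eval_ite,
      if_neg (by rw [holds_rd]; simpa using mt (e2.base v hv).1 (hg.2.2.2 v h1 h2)), eval_sum_single hr, eval_ite, if_pos ((key r hr).2 rfl),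
      eval_shiftF]
    · simp [eval_rd, eval_var, eval_sub, eval_const, c2]
    · simpa [eval_rd, eval_var, c2] using hs.col_lt r hg.2.1
    · simpa [eval_rd, eval_var, eval_sub, eval_const] using hK r hr
    · intro i hi hir
      rw [eval_ite, if_neg (fun h => hir ((key i hi).1 h)), eval_const]
  have hlev : ∀ o r v i, IsGap D o r → o < v → v < r → IsLevel A D v i → s2.arr levelArr v = i % 3 := by
    intro o r v i hg h1 h2 hi
    refine e2.level v (h2.trans ((S.le r hg.2.1).trans_lt hn)) i ?_ hi.1 ?_
    · have := hi.le_iff.2 (S.layer_top hn hi.1)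
      omega
    · cases i
      · exact hg.2.2.2 v h1 h2
      · exact hi.2 _ (by omega)
  have hcap : ∀ a b c d, layer A D (2 * N) a → layer A D (2 * N) b → layer A D (2 * N) c → layer A D (2 * N) d → a < b → b < c → c < d →
      (finishRound.run N s2).arr colArr b = (finishRound.run N s2).arr colArr a →
      (finishRound.run N s2).arr colArr c = (finishRound.run N s2).arr colArr a →
      (finishRound.run N s2).arr colArr d = (finishRound.run N s2).arr colArr a → A a c → A b d → A a d := by
    intro a b c d ha hb hc hd hab hbc hcd cb cc cd
    refine S.capped_layer (N := 2 * N) (col := (finishRound.run N s2).arr colArr) ?_ ?_ ?_ ha hb hc hd hab hbc hcd cb cc cd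
    · intro o r hg u w i j hu1 hu2 hw1 hw2 hi hj huw
      rw [cG o r u hg hu1 hu2, cG o r w hg hw1 hw2, hlev o r u i hg hu1 hu2 hi, hlev o r w j hg hw1 hw2 hj] at huw
      exact shiftCol_inj (by omega) (by omega) (hK r ((S.le r hg.2.1).trans_lt hn)) huw
    · intro o r hg w j hw1 hw2 hj hA hcol
      have hr : r < N := (S.le r hg.2.1).trans_lt hn
      rw [cG o r w hg hw1 hw2, cD r hr hg.2.1, hlev o r w j hg hw1 hw2 hj] at hcol
      have hcol := shiftCol_eq (hs.col_lt r hg.2.1) hcol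
      have hcon : Contact A D (chain A D (j + 1)) r := ⟨w, hj.1, hw2, hA, fun x hx h1 h2 => hg.2.2.2 x (by omega) h2 hx⟩
      obtain ⟨j0, hj0, h1, h2⟩ := hfirst r _ hcon
      have hjN := hj.le_iff.2 (S.layer_top hn hj.1)
      -- The first contact is at level `j0 ≤ j`, and the colour of `r` means `j ≡ j0 + 2` modulo 3;
      -- hence `j0 < j`.
      rw [e2.first r hr j0 (by omega) h1 h2] at hcol
      obtain ⟨b, hb, hbr, hbA, hbD⟩ := h1
      obtain ⟨i, hi, hlb⟩ := exists_level (A := A) (D := D) (k := j0) (v := b) hb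
      have hob : o < b := by
        by_contra h
        exact hbD o hg.1 (by omega) hg.2.2.1
      exact ⟨b, i, hob, hbr, hlb, by omega, hbA⟩
    · intro a b c d ha hb hc hd
      rw [cD a ((S.le a ha).trans_lt hn) ha, cD b ((S.le b hb).trans_lt hn) hb, cD c ((S.le c hc).trans_lt hn) hc, cD d ((S.le d hd).trans_lt hn) hd]
      exact hs.capped a b c d ha hb hc hd
  refine ⟨e2.graph.congr (run_arr_of_keeps rfl s2) (run_arr_of_keeps rfl s2) fun b => run_arr_of_keeps (by cases b <;> rfl) s2,
    S.of_stable fun v h => S.layer_stable hn h, fun v hv => ?_, fun v hv => ?_, hcap⟩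
  · change ((Cmd.par1 baseArr 10 (.rd curArr (.var 10))).run N ((Cmd.par1 colArr 10 colourF).run N s2)).arr baseArr v ≠ 0 ↔ _
    rw [run_par1 hv, eval_rd, eval_var, Function.update_self, run_arr_of_keeps rfl]
    exact e2.cur v hv
  · have hvn := S.layer_le hv
    by_cases hDv : D v
    · rw [cD v (hvn.trans_lt hn) hDv]; exact hs.col_lt v hDv
    · obtain ⟨o, r, hg, h1, h2⟩ := exists_gap S.zero S.top hDv (lt_of_le_of_ne hvn fun h => hDv (h ▸ S.top))
      rw [cG o r v hg h1 h2]
      exact shiftCol_lt (hs.col_lt r hg.2.1)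

/-- After `N` rounds all vertices are coloured. -/
theorem run_rounds (hn : n < N) (hs : RoundMem N n A D s) : RoundMem N n A (fun v => v ≤ n) ((Cmd.rep roundCmd).run N s) := by
  let Ds : ℕ → ℕ → Prop := fun i => (fun D => layer A D (2 * N))^[i] D
  have hsucc : ∀ i, Ds (i + 1) = layer A (Ds i) (2 * N) := fun i => Function.iterate_succ_apply' _ _ _
  have h : ∀ i, RoundMem N n A (Ds i) ((roundCmd.run N)^[i] s) := by
    intro i
    induction i with
    | zero => exact hs
    | succ i ih =>
      rw [Function.iterate_succ_apply', hsucc]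
      exact run_roundCmd hn ih
  have full : ∀ i, (∀ x, Ds (i + 1) x → Ds i x) → ∀ v, v ≤ n → Ds i v := by
    intro i hi v hv
    by_contra hcon
    obtain ⟨y, h1, h2⟩ := (h i).state.layer_grows hcon (lt_of_le_of_ne hv fun e => hcon (e ▸ (h i).state.top)) (2 * N)
    exact h1 (hi y (by rw [hsucc]; exact h2))
  have stab := stable_of_growing (N := N) (S := Ds) (fun i x hx => by rw [hsucc]; exact layer_of_mem hx)
    (fun i x hx => ((h i).state.le x hx).trans_lt hn)
    (fun i hi x hx => by
      rw [hsucc]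
      exact layer_of_mem (full i hi x ((h (i + 2)).state.le x hx)))
  have e : Ds N = fun v => v ≤ n := by
    funext v
    exact propext ⟨(h N).state.le v, full N stab v⟩
  have := h N
  rwa [e] at this

end

/-! ### Computing the clique number -/

def cliqueArr : ℕ := 14
def hitArr : ℕ := 15

/-- The formulas `F x y` describe the relation `B` in the state `s`. -/
def RelMem (N : ℕ) (s : RamState) (F : ℕ → ℕ → Ex) (B : ℕ → ℕ → Prop) : Prop :=
  ∀ w : ℕ → ℕ, (∀ i, i < 10 → w i = s.var i) → ∀ x y, w x < N → w y < N → ((F x y).Holds N s.arr w ↔ B (w x) (w y))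

namespace Ex

def cliqueInitF (F : ℕ → ℕ → Ex) : Ex := conj (lt (var 10) (var 11)) (F 10 11)

def cliqueNextF (F : ℕ → ℕ → Ex) : Ex :=
  conj (lt (var 10) (var 11)) (conj (F 10 11) (sum 12 (conj (lt (var 11) (var 12)) (conj (F 10 12) (conj (F 11 12)
    (cell cliqueArr 11 12))))))

def maskF (x y : ℕ) : Ex :=
  conj (cell adjArr x y) (conj
    (disj (eq (var x) (var 4)) (disj (eq (var x) (var 5)) (conj (lt (var 5) (var x)) (conj (cell adjArr 4 x) (cell adjArr 5 x)))))
    (disj (eq (var y) (var 4)) (disj (eq (var y) (var 5)) (conj (lt (var 5) (var y)) (conj (cell adjArr 4 y) (cell adjArr 5 y))))))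

end Ex

section
variable {N : ℕ} {s : RamState} {F : ℕ → ℕ → Ex} {A B : ℕ → ℕ → Prop}

theorem holds_cliqueInitF (hB : RelMem N s F B) {u v : ℕ} (hu : u < N) (hv : v < N) :
    (cliqueInitF F).Holds N s.arr (Function.update (Function.update s.var 10 u) 11 v) ↔ CliqueStart B 0 u v := by
  rw [cliqueInitF, holds_conj, holds_lt, hB _ (fun i hi => ?_) _ _ (by simpa) (by simpa)]
  · simp [eval_var, CliqueStart]
  · rw [Function.update_of_ne (by omega), Function.update_of_ne (by omega)]

theorem holds_cliqueNextF (hB : RelMem N s F B) (hm : ∀ i, i < N → s.arr mulArr i = i * N) (hb : ∀ u v, B u v → v < N) {t : ℕ}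
    (hF : ∀ u v, u < N → v < N → (s.arr cliqueArr (u * N + v) ≠ 0 ↔ CliqueStart B t u v)) {u v : ℕ} (hu : u < N) (hv : v < N) :
    (cliqueNextF F).Holds N s.arr (Function.update (Function.update s.var 10 u) 11 v) ↔ CliqueStart B (t + 1) u v := by
  rw [cliqueNextF, holds_conj, holds_conj, holds_sum, holds_lt, hB _ (fun i hi => ?_) _ _ (by simpa) (by simpa)]
  · simp only [eval_var, ne_eq, Nat.reduceEqDiff, not_false_eq_true, Function.update_of_ne, Function.update_self]
    refine and_congr Iff.rfl (and_congr Iff.rfl (exists_bounded_congr (fun w hw => ?_) fun w h => hb _ _ h.2.1))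
    have hlow : ∀ i, i < 10 → Function.update (Function.update (Function.update s.var 10 u) 11 v) 12 w i = s.var i := fun i hi => by
      rw [Function.update_of_ne (by omega), Function.update_of_ne (by omega), Function.update_of_ne (by omega)]
    rw [holds_conj, holds_conj, holds_conj, holds_lt, hB _ hlow _ _ (by simpa) (by simpa), hB _ hlow _ _ (by simpa) (by simpa),
      holds_iff (e := cell _ _ _), eval_cell hm (by simpa)]
    simp only [eval_var, ne_eq, Nat.reduceEqDiff, not_false_eq_true, Function.update_of_ne, Function.update_self]
    rw [← ne_eq, hF v w hv hw]
  · rw [Function.update_of_ne (by omega), Function.update_of_ne (by omega)]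

theorem relMem_maskF (H : AdjMem N s.arr A) (h4 : s.var 4 < N) (h5 : s.var 5 < N) : RelMem N s maskF (maskAdj A (s.var 4) (s.var 5)) := by
  intro w hw x y hx hy
  have e4 := hw 4 (by omega)
  have e5 := hw 5 (by omega)
  simp only [maskF, holds_conj, holds_disj, holds_eq, holds_lt, eval_var, H.holds_adj hx hy, H.holds_adj (e4 ▸ h4) hx,
    H.holds_adj (e4 ▸ h4) hy, H.holds_adj (e5 ▸ h5) hx, H.holds_adj (e5 ▸ h5) hy, e4, e5, maskAdj]

end

/-- Variable 6 counts `t`. Before round `t` the matrix `cliqueArr` describes `CliqueStart` for `t`,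
and the round records in entry `t` of `hitArr` whether the pair in variables 4 and 5 starts such a
clique. -/
def pairStep : Cmd :=
  .seq (.par1 hitArr 10 (.disj (.rd hitArr (.var 10)) (.conj (.eq (.var 10) (.var 6)) (cell cliqueArr 4 5))))
    (.seq (.par2 cliqueArr 10 11 (cliqueNextF maskF)) (.set 6 (.add (.var 6) (.const 1))))

def pairCmd : Cmd := .seq (.par2 cliqueArr 10 11 (cliqueInitF maskF)) (.seq (.set 6 (.const 0)) (.rep pairStep))

def rowCmd : Cmd := .seq (.set 5 (.const 0)) (.rep (.seq pairCmd (.set 5 (.add (.var 5) (.const 1)))))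

/-- The numbers `t` that are hit are those with `t + 2 ≤ ω`, which are `ω - 1` many for a nonempty
graph. The missing 1 is added if variable 0, the number of vertices, is nonzero. -/
def cliqueNumCmd : Cmd :=
  .seq (.par1 hitArr 10 (.const 0)) (.seq (.set 4 (.const 0)) (.seq (.rep (.seq rowCmd (.set 4 (.add (.var 4) (.const 1)))))
    (.set 1 (.add (.ite (.var 0) (.const 1) (.const 0)) (.sum 10 (.ite (.rd hitArr (.var 10)) (.const 1) (.const 0)))))))

section
variable {N : ℕ} {s : RamState} {A : ℕ → ℕ → Prop}

theorem AdjMem.run {c : Cmd} (H : AdjMem N s.arr A) (h1 : c.keepsArr mulArr = true) (h2 : c.keepsArr adjArr = true) :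
    AdjMem N (c.run N s).arr A := H.congr (run_arr_of_keeps h1 s) (run_arr_of_keeps h2 s)

theorem run_pairCmd (H : AdjMem N s.arr A) (h4 : s.var 4 < N) (h5 : s.var 5 < N) {t : ℕ} (ht : t < N) :
    (pairCmd.run N s).arr hitArr t ≠ 0 ↔ s.arr hitArr t ≠ 0 ∨
      CliqueStart (maskAdj A (s.var 4) (s.var 5)) t (s.var 4) (s.var 5) := by
  have hb : ∀ u v, maskAdj A (s.var 4) (s.var 5) u v → v < N := fun u v h => (H.bound _ _ h.1).2
  let s0 := (Cmd.set 6 (.const 0)).run N ((Cmd.par2 cliqueArr 10 11 (cliqueInitF maskF)).run N s)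
  let st : ℕ → RamState := fun i => (pairStep.run N)^[i] s0
  have H0 : ∀ i, AdjMem N (st i).arr A := fun i =>
    H.congr (iterate_arr_of_keeps rfl s0 i) (iterate_arr_of_keeps rfl s0 i)
  have v4 : ∀ i, (st i).var 4 = s.var 4 := fun i => iterate_var_of_keeps rfl s0 i
  have v5 : ∀ i, (st i).var 5 = s.var 5 := fun i => iterate_var_of_keeps rfl s0 i
  have key : ∀ i, (st i).var 6 = i ∧
      (∀ u v, u < N → v < N → ((st i).arr cliqueArr (u * N + v) ≠ 0 ↔ CliqueStart (maskAdj A (s.var 4) (s.var 5)) i u v)) ∧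
      ∀ t, t < N → ((st i).arr hitArr t ≠ 0 ↔ s.arr hitArr t ≠ 0 ∨
        (t < i ∧ CliqueStart (maskAdj A (s.var 4) (s.var 5)) t (s.var 4) (s.var 5))) := by
    intro i
    induction i with
    | zero =>
      refine ⟨rfl, fun u v hu hv => ?_, fun t ht => by simp [st, s0, run, RamState.setArr_of_ne s _ (show hitArr ≠ cliqueArr by decide)]⟩
      change ((Cmd.par2 cliqueArr 10 11 (cliqueInitF maskF)).run N s).arr cliqueArr _ ≠ 0 ↔ _
      rw [run_par2 hu hv, ← holds_iff, holds_cliqueInitF (relMem_maskF H h4 h5) hu hv]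
    | succ i ih =>
      have e : st (i + 1) = pairStep.run N (st i) := Function.iterate_succ_apply' _ _ _
      rw [e]
      have Hi := H0 i
      have e4 := v4 i
      have e5 := v5 i
      generalize st i = s1 at *
      obtain ⟨i1, i2, i3⟩ := ih
      let s2 := (Cmd.par1 hitArr 10 (.disj (.rd hitArr (.var 10)) (.conj (.eq (.var 10) (.var 6)) (cell cliqueArr 4 5)))).run N s1
      have a2 : ∀ b, b ≠ hitArr → s2.arr b = s1.arr b := fun b hb => s1.setArr_of_ne _ hb
      have hm := relMem_maskF (s := s2) (Hi.congr (a2 _ (by decide)) (a2 _ (by decide))) (e4.symm ▸ h4) (e5.symm ▸ h5)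
      have w4 : s2.var 4 = s.var 4 := e4
      have w5 : s2.var 5 = s.var 5 := e5
      rw [w4, w5] at hm
      have h2 : ∀ t, t < N → (s2.arr hitArr t ≠ 0 ↔ s1.arr hitArr t ≠ 0 ∨ (t = i ∧ s1.arr cliqueArr (s.var 4 * N + s.var 5) ≠ 0)) := fun t ht => by
        simp only [s2, run_par1 ht]
        rw [← holds_iff, holds_disj, holds_conj, holds_eq, holds_rd, holds_iff (e := cell _ _ _), eval_cell Hi.mul (by simpa [e4])]
        simp [eval_var, e4, e5, i1]
      have e2 : pairStep.run N s1 = (Cmd.set 6 (.add (.var 6) (.const 1))).run N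
        ((Cmd.par2 cliqueArr 10 11 (cliqueNextF maskF)).run N s2) := rfl
      rw [e2]
      have p2 : s2.var 6 = i := i1
      clear_value s2
      refine ⟨by simp [run, eval_add, eval_var, eval_const, p2], fun u v hu hv => ?_, fun t ht => ?_⟩
      · change ((Cmd.par2 cliqueArr 10 11 (cliqueNextF maskF)).run N s2).arr cliqueArr _ ≠ 0 ↔ _
        rw [run_par2 hu hv, ← holds_iff, holds_cliqueNextF hm (by rw [a2 _ (by decide)]; exact Hi.mul) hb
          (fun u v hu hv => by rw [a2 _ (by decide)]; exact i2 u v hu hv) hu hv]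
      · rw [run_arr_of_keeps rfl, run_arr_of_keeps rfl, h2 t ht, i3 t ht, i2 _ _ h4 h5]
        constructor
        · rintro ((h | ⟨h1, h2⟩) | ⟨rfl, h2⟩)
          · exact Or.inl h
          · exact Or.inr ⟨by omega, h2⟩
          · exact Or.inr ⟨by omega, h2⟩
        · rintro (h | ⟨h1, h3⟩)
          · exact Or.inl (Or.inl h)
          · rcases Nat.lt_succ_iff_lt_or_eq.1 h1 with h1 | rfl
            · exact Or.inl (Or.inr ⟨h1, h3⟩)
            · exact Or.inr ⟨rfl, h3⟩
  change (st N).arr hitArr t ≠ 0 ↔ _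
  rw [(key N).2.2 t ht]
  simp [ht]

theorem run_rowCmd (H : AdjMem N s.arr A) (h4 : s.var 4 < N) {t : ℕ} (ht : t < N) :
    (rowCmd.run N s).arr hitArr t ≠ 0 ↔ s.arr hitArr t ≠ 0 ∨
      ∃ k, k < N ∧ CliqueStart (maskAdj A (s.var 4) k) t (s.var 4) k := by
  let s0 := (Cmd.set 5 (.const 0)).run N s
  let c : Cmd := .seq pairCmd (.set 5 (.add (.var 5) (.const 1)))
  let st : ℕ → RamState := fun i => (c.run N)^[i] s0
  have H0 : ∀ i, AdjMem N (st i).arr A := fun i => H.congr (iterate_arr_of_keeps rfl s0 i) (iterate_arr_of_keeps rfl s0 i)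
  have v4 : ∀ i, (st i).var 4 = s.var 4 := fun i => iterate_var_of_keeps rfl s0 i
  have key : ∀ i, i ≤ N → (st i).var 5 = i ∧ ((st i).arr hitArr t ≠ 0 ↔ s.arr hitArr t ≠ 0 ∨
      ∃ k, k < i ∧ CliqueStart (maskAdj A (s.var 4) k) t (s.var 4) k) := by
    intro i
    induction i with
    | zero => exact fun _ => ⟨rfl, by simp [st, s0, run]⟩
    | succ i ih =>
      intro hi
      obtain ⟨i1, i2⟩ := ih (by omega)
      have e : st (i + 1) = (Cmd.set 5 (.add (.var 5) (.const 1))).run N (pairCmd.run N (st i)) := Function.iterate_succ_apply' _ _ _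
      rw [e]
      constructor
      · simp only [run, RamState.setVar_same, eval_add, eval_var, eval_const]
        rw [run_var_of_keeps rfl, i1]
      · rw [run_arr_of_keeps rfl, run_pairCmd (H0 i) (v4 i ▸ h4) (by omega) ht, i2, v4, i1]
        constructor
        · rintro ((h | ⟨k, h1, h2⟩) | h2)
          · exact Or.inl h
          · exact Or.inr ⟨k, by omega, h2⟩
          · exact Or.inr ⟨i, by omega, h2⟩
        · rintro (h | ⟨k, h1, h2⟩)
          · exact Or.inl (Or.inl h)
          · rcases Nat.lt_succ_iff_lt_or_eq.1 h1 with h1 | rfl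
            · exact Or.inl (Or.inr ⟨k, h1, h2⟩)
            · exact Or.inr h2
  exact (key N le_rfl).2

theorem run_cliqueNumCmd {n : ℕ} {G : SimpleGraph (Fin n)} (hn : n < N) (hcl : CrossClosed (natAdj G)) (H : AdjMem N s.arr (natAdj G))
    (h0 : s.var 0 = n) : (cliqueNumCmd.run N s).var 1 = G.cliqueNum := by
  classical
  let s0 := (Cmd.set 4 (.const 0)).run N ((Cmd.par1 hitArr 10 (.const 0)).run N s)
  let c : Cmd := .seq rowCmd (.set 4 (.add (.var 4) (.const 1)))
  let st : ℕ → RamState := fun i => (c.run N)^[i] s0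
  have H0 : ∀ i, AdjMem N (st i).arr (natAdj G) := fun i => H.congr (iterate_arr_of_keeps rfl s0 i) (iterate_arr_of_keeps rfl s0 i)
  have key : ∀ i, i ≤ N → (st i).var 4 = i ∧ ∀ t, t < N → ((st i).arr hitArr t ≠ 0 ↔
      ∃ l k, l < i ∧ k < N ∧ CliqueStart (maskAdj (natAdj G) l k) t l k) := by
    intro i
    induction i with
    | zero =>
      refine fun _ => ⟨rfl, fun t ht => ?_⟩
      have : (st 0).arr hitArr t = 0 := by
        change ((Cmd.par1 hitArr 10 (.const 0)).run N s).arr hitArr t = 0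
        rw [run_par1 ht, eval_const]
      simp [this]
    | succ i ih =>
      intro hi
      obtain ⟨i1, i2⟩ := ih (by omega)
      have e : st (i + 1) = (Cmd.set 4 (.add (.var 4) (.const 1))).run N (rowCmd.run N (st i)) := Function.iterate_succ_apply' _ _ _
      rw [e]
      constructor
      · simp only [run, RamState.setVar_same, eval_add, eval_var, eval_const]
        rw [run_var_of_keeps rfl, i1]
      · intro t ht
        rw [run_arr_of_keeps rfl, run_rowCmd (H0 i) (by omega) ht, i2 t ht, i1]
        constructor
        · rintro (⟨l, k, h1, h2⟩ | ⟨k, h1, h2⟩)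
          · exact ⟨l, k, by omega, h2⟩
          · exact ⟨i, k, by omega, h1, h2⟩
        · rintro ⟨l, k, h1, h2⟩
          rcases Nat.lt_succ_iff_lt_or_eq.1 h1 with h1 | rfl
          · exact Or.inl ⟨l, k, h1, h2⟩
          · exact Or.inr ⟨k, h2⟩
  have hit : ∀ t, t < N → ((st N).arr hitArr t ≠ 0 ↔ t + 2 ≤ G.cliqueNum) := fun t ht => by
    rw [(key N le_rfl).2 t ht, ← exists_cliqueStart_iff hcl]
    constructor
    · rintro ⟨l, k, _, _, h⟩
      exact ⟨l, k, h⟩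
    · rintro ⟨l, k, h⟩
      have := H.bound _ _ h.adj.1
      exact ⟨l, k, this.1, this.2, h⟩
  have hv0 : (st N).var 0 = n := (iterate_var_of_keeps rfl s0 N).trans h0
  change ((Cmd.set 1 _).run N (st N)).var 1 = _
  have hsum : ∑ i ∈ Finset.range N, (if (st N).arr hitArr i ≠ 0 then 1 else 0) = G.cliqueNum - 1 := by
    rw [Finset.sum_congr rfl fun i hi => if_congr (hit i (Finset.mem_range.1 hi)) rfl rfl, Finset.sum_boole]
    have := _root_.cliqueNum_le G
    have e : (Finset.range N).filter (fun i => i + 2 ≤ G.cliqueNum) = Finset.range (G.cliqueNum - 1) := by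
      ext i
      simp only [Finset.mem_filter, Finset.mem_range]
      omega
    rw [e]
    simp
  simp only [run, RamState.setVar_same, eval_add, eval_ite, holds_var, holds_rd, eval_sum, eval_const, hv0, Function.update_self]
  rw [hsum]
  by_cases hz : n = 0
  · have := _root_.cliqueNum_le G
    simp [hz]; omega
  · have := cliqueNum_pos (G := G) (Nat.pos_of_ne_zero hz)
    simp [hz]; omega

end

/-! ### Recursive definitions by iteration -/

/-- If the values of rank `m` depend only on values of smaller rank, then iteration becomes stationary. -/
theorem iterate_stationary {I : ℕ → Prop} {R : ℕ → ℕ → Prop} {f : (ℕ → ℕ) → ℕ → ℕ} {g : ℕ → ℕ → ℕ}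
    (hg : ∀ i v, I v → g (i + 1) v = f (g i) v)
    (hf : ∀ i j m v, I v → R m v → (∀ u m', I u → m' < m → R m' u → g i u = g j u) → f (g i) v = f (g j) v) (m v : ℕ)
    (hv : I v) (hR : R m v) (i j : ℕ) (hi : m < i) (hj : m < j) : g i v = g j v := by
  induction m using Nat.strong_induction_on generalizing v i j with
  | _ m ih =>
    obtain ⟨i, rfl⟩ : ∃ i', i = i' + 1 := ⟨i - 1, by omega⟩
    obtain ⟨j, rfl⟩ : ∃ j', j = j' + 1 := ⟨j - 1, by omega⟩
    rw [hg i v hv, hg j v hv]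
    exact hf i j m v hv hR fun u m' hu hm' hRu => ih m' hm' u hu hRu i j (by omega) (by omega)

section
variable {N : ℕ} {s : RamState} {a x y : ℕ} {e : Ex}

/-- If every index has a rank below `N` and the right-hand side uses only entries of smaller rank,
then `N` repetitions solve the recursive equation, whatever the initial entries are. -/
theorem run_rep_par1 {R : ℕ → ℕ → Prop} (hR : ∀ v, v < N → ∃ m, m < N ∧ R m v)
    (hf : ∀ (m m' : ℕ → ℕ → ℕ) (k v : ℕ), (∀ b, b ≠ a → m b = s.arr b) → (∀ b, b ≠ a → m' b = s.arr b) → v < N → R k v →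
      (∀ u k', u < N → k' < k → R k' u → m a u = m' a u) →
      e.eval N m (Function.update s.var x v) = e.eval N m' (Function.update s.var x v)) {v : ℕ} (hv : v < N) :
    ((Cmd.rep (.par1 a x e)).run N s).arr a v =
      e.eval N ((Cmd.rep (.par1 a x e)).run N s).arr (Function.update s.var x v) := by
  let st : ℕ → RamState := fun i => ((Cmd.par1 a x e).run N)^[i] s
  have hvar : ∀ i, (st i).var = s.var := fun i => funext fun y => iterate_var_of_keeps rfl s i
  have harr : ∀ i b, b ≠ a → (st i).arr b = s.arr b := fun i b hb => iterate_arr_of_keeps (by simpa [keepsArr] using hb) s i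
  have hg : ∀ i v, v < N → (st (i + 1)).arr a v = e.eval N (st i).arr (Function.update s.var x v) := fun i v hv => by
    have : st (i + 1) = (Cmd.par1 a x e).run N (st i) := Function.iterate_succ_apply' _ _ _
    rw [this, run_par1 hv, hvar]
  have hup : ∀ i, Function.update s.arr a ((st i).arr a) = (st i).arr := fun i => by
    funext b
    by_cases hb : b = a
    · subst hb; simp
    · rw [Function.update_of_ne hb, harr i b hb]
  obtain ⟨m, hm, hRm⟩ := hR v hv
  have := iterate_stationary (I := fun v => v < N) (R := R) (g := fun i => (st i).arr a)
    (f := fun g v => e.eval N (Function.update s.arr a g) (Function.update s.var x v))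
    (fun i v hv => by rw [hup]; exact hg i v hv)
    (fun i j m v hv hR h => by
      rw [hup, hup]
      exact hf _ _ m v (harr i) (harr j) hv hR h) m v hv hRm N (N + 1) hm (by omega)
  exact this.trans (hg N v hv)

theorem run_rep_par2 {R : ℕ → ℕ → Prop} (hR : ∀ v, v < N → ∃ m, m < N ∧ R m v)
    (hf : ∀ (m m' : ℕ → ℕ → ℕ) (k u v : ℕ), (∀ b, b ≠ a → m b = s.arr b) → (∀ b, b ≠ a → m' b = s.arr b) → u < N → v < N → R k u →
      (∀ u' v' k', u' < N → v' < N → k' < k → R k' u' → m a (u' * N + v') = m' a (u' * N + v')) →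
      e.eval N m (Function.update (Function.update s.var x u) y v) = e.eval N m' (Function.update (Function.update s.var x u) y v))
    {u v : ℕ} (hu : u < N) (hv : v < N) :
    ((Cmd.rep (.par2 a x y e)).run N s).arr a (u * N + v) =
      e.eval N ((Cmd.rep (.par2 a x y e)).run N s).arr (Function.update (Function.update s.var x u) y v) := by
  let st : ℕ → RamState := fun i => ((Cmd.par2 a x y e).run N)^[i] s
  have hvar : ∀ i, (st i).var = s.var := fun i => funext fun y => iterate_var_of_keeps rfl s i
  have harr : ∀ i b, b ≠ a → (st i).arr b = s.arr b := fun i b hb => iterate_arr_of_keeps (by simpa [keepsArr] using hb) s i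
  have hg : ∀ i u v, u < N → v < N → (st (i + 1)).arr a (u * N + v) =
      e.eval N (st i).arr (Function.update (Function.update s.var x u) y v) := fun i u v hu hv => by
    have : st (i + 1) = (Cmd.par2 a x y e).run N (st i) := Function.iterate_succ_apply' _ _ _
    rw [this, run_par2 hu hv, hvar]
  have hup : ∀ i, Function.update s.arr a ((st i).arr a) = (st i).arr := fun i => by
    funext b
    by_cases hb : b = a
    · subst hb; simp
    · rw [Function.update_of_ne hb, harr i b hb]
  have hdiv : ∀ k, k < N * N → k / N < N ∧ k % N < N ∧ k / N * N + k % N = k := fun k hk => by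
    have hpos : 0 < N := Nat.pos_of_ne_zero fun h => by simp [h] at hk
    exact ⟨Nat.div_lt_of_lt_mul hk, Nat.mod_lt _ hpos, by rw [mul_comm]; exact Nat.div_add_mod k N⟩
  have hlt : ∀ u v, u < N → v < N → u * N + v < N * N := fun u v hu hv => by nlinarith
  have hdm : ∀ u v, u < N → v < N → (u * N + v) / N = u := fun u v hu hv => by
    rw [mul_comm, Nat.mul_add_div (by omega), Nat.div_eq_of_lt hv, add_zero]
  obtain ⟨m, hm, hRm⟩ := hR u hu
  have := iterate_stationary (I := fun k => k < N * N) (R := fun m k => R m (k / N)) (g := fun i => (st i).arr a)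
    (f := fun g k => e.eval N (Function.update s.arr a g) (Function.update (Function.update s.var x (k / N)) y (k % N)))
    (fun i k hk => by
      rw [hup]
      obtain ⟨h1, h2, h3⟩ := hdiv k hk
      rw [← hg i _ _ h1 h2, h3])
    (fun i j m k hk hR h => by
      rw [hup, hup]
      obtain ⟨h1, h2, h3⟩ := hdiv k hk
      exact hf _ _ m _ _ (harr i) (harr j) h1 h2 hR fun u' v' k' hu' hv' hk' hR' =>
        h _ k' (hlt u' v' hu' hv') hk' (by rw [hdm u' v' hu' hv']; exact hR')) m (u * N + v) (hlt u v hu hv)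
    (by rw [hdm u v hu hv]; exact hRm) N (N + 1) hm (by omega)
  exact this.trans (hg N u v hu hv)

end

/-! ### Computing the four-colouring of a triangle-free capped graph -/

def edgeArr : ℕ := 16
def secArr : ℕ := 17
def kArr : ℕ := 18
def zoneArr : ℕ := 19

namespace Ex

def lastF (s x k : ℕ) : Ex :=
  conj (lt (var s) (var x)) (conj (cell edgeArr s x) (neg (sum k (conj (lt (var x) (var k)) (cell edgeArr s k)))))

def secF : Ex :=
  ite (sum 11 (conj (lastF 10 11 12) (sum 12 (conj (lt (var 12) (var 10)) (conj (neg (rd secArr (var 12))) (cell edgeArr 12 11))))))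
    (const 1) (const 0)

def baseF : Ex :=
  ite (rd secArr (var 10))
    (ite (sum 11 (conj (lt (var 10) (var 11)) (conj (rd secArr (var 11)) (conj (cell edgeArr 10 11)
      (conj (sum 12 (conj (lt (var 11) (var 12)) (cell edgeArr 10 12))) (eq (rd kArr (var 11)) (const 2))))))) (const 3) (const 2))
    (ite (sum 11 (conj (lt (var 11) (var 10)) (conj (neg (rd secArr (var 11))) (conj (cell edgeArr 11 10)
      (neg (rd kArr (var 11))))))) (const 1) (const 0))

def inZoneF (a t k : ℕ) : Ex :=
  conj (neg (rd secArr (var a))) (conj (lt (var a) (var t)) (conj (neg (cell edgeArr a t))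
    (sum k (conj (lastF a k (k + 1)) (conj (rd secArr (var k)) (lt (var t) (var k)))))))

def maxZoneF : Ex := conj (inZoneF 12 10 13) (neg (sum 13 (conj (lt (var 12) (var 13)) (inZoneF 13 10 14))))

/-- At most one vertex is the largest zone and at most one is its last neighbour, so these sums have
at most one relevant term and act as definite descriptions. -/
def zoneF : Ex :=
  ite (sum 12 (inZoneF 12 10 13))
    (sum 12 (ite maxZoneF (sum 13 (ite (lastF 12 13 14)
      (ite (eq (rd kArr (var 11)) (rd kArr (var 12))) (cell zoneArr 13 13)
        (ite (eq (rd kArr (var 11)) (rd kArr (var 13))) (cell zoneArr 13 12) (cell zoneArr 13 11)))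
      (const 0))) (const 0)))
    (rd kArr (var 11))

end Ex

structure EdgeMem (N : ℕ) (m : ℕ → ℕ → ℕ) (E : ℕ → ℕ → Prop) : Prop where
  mul : ∀ i, i < N → m mulArr i = i * N
  edge : ∀ u v, u < N → v < N → (m edgeArr (u * N + v) ≠ 0 ↔ E u v)
  bound : ∀ u v, E u v → u < N ∧ v < N

section
variable {N : ℕ} {m : ℕ → ℕ → ℕ} {E : ℕ → ℕ → Prop} {B : ℕ → Prop} (H : EdgeMem N m E) {v : ℕ → ℕ} {x y a t k : ℕ}
include H

theorem EdgeMem.congr {m' : ℕ → ℕ → ℕ} (h1 : m' mulArr = m mulArr) (h2 : m' edgeArr = m edgeArr) : EdgeMem N m' E :=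
  ⟨fun i hi => by rw [h1, H.mul i hi], fun u v hu hv => by rw [h2, H.edge u v hu hv], H.bound⟩

theorem EdgeMem.holds_edge (hx : v x < N) (hy : v y < N) : (cell edgeArr x y).Holds N m v ↔ E (v x) (v y) := by
  rw [holds_iff, eval_cell H.mul hx, H.edge _ _ hx hy]

theorem EdgeMem.holds_lastF (h1 : x < k) (h2 : y < k) (hx : v x < N) (hy : v y < N) :
    (lastF x y k).Holds N m v ↔ IsLast E (v x) (v y) := by
  have e1 : (∀ z, E (v x) z → z ≤ v y) ↔ ¬ ∃ z, v y < z ∧ E (v x) z := by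
    push Not
    exact forall_congr' fun z => ⟨fun h h' h'' => absurd (h h'') (by omega), fun h h' => by by_contra h2; exact h (by omega) h'⟩
  simp only [lastF, holds_conj, holds_lt, eval_var, holds_neg, holds_sum, H.holds_edge hx hy, IsLast, e1]
  refine and_congr Iff.rfl (and_congr Iff.rfl (not_congr (exists_bounded_congr (fun i hi => ?_) fun i h => (H.bound _ _ h.2).2)))
  rw [H.holds_edge (by simpa [h1.ne]) (by simpa)]
  simp [h1.ne, h2.ne]

open Classical in
theorem EdgeMem.eval_secF (hv : v 10 < N) : secF.eval N m v =
    if ∃ x, IsLast E (v 10) x ∧ ∃ a, a < v 10 ∧ m secArr a = 0 ∧ E a x then 1 else 0 := by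
  rw [secF, eval_ite]
  refine if_congr ?_ rfl rfl
  rw [holds_sum]
  refine exists_bounded_congr (fun x hx => ?_) fun x h => (H.bound _ _ h.1.2.1).2
  rw [holds_conj, H.holds_lastF (by omega) (by omega) (by simpa) (by simpa), holds_sum]
  simp only [ne_eq, Nat.reduceEqDiff, not_false_eq_true, Function.update_of_ne, Function.update_self]
  refine and_congr Iff.rfl (exists_bounded_congr (fun a ha => ?_) fun a h => h.1.trans hv)
  rw [holds_conj, holds_conj, holds_lt, holds_neg, holds_rd, H.holds_edge (by simpa) (by simpa)]
  simp [eval_var]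

open Classical in
theorem EdgeMem.eval_baseF (hB : ∀ i, i < N → (m secArr i ≠ 0 ↔ B i)) (hv : v 10 < N) : baseF.eval N m v =
    if B (v 10) then
      if ∃ t, v 10 < t ∧ B t ∧ E (v 10) t ∧ (∃ y, t < y ∧ E (v 10) y) ∧ m kArr t = 2 then 3 else 2
    else if ∃ u, u < v 10 ∧ ¬ B u ∧ E u (v 10) ∧ m kArr u = 0 then 1 else 0 := by
  rw [baseF, eval_ite]
  refine if_congr (hB _ hv) ?_ ?_
  · rw [eval_ite]
    refine if_congr ?_ rfl rfl
    rw [holds_sum]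
    refine exists_bounded_congr (fun t ht => ?_) fun t h => (H.bound _ _ h.2.2.1).2
    rw [holds_conj, holds_conj, holds_conj, holds_conj, holds_lt, holds_rd, H.holds_edge (by simpa) (by simpa), holds_sum, holds_eq]
    simp only [ne_eq, Nat.reduceEqDiff, not_false_eq_true, Function.update_of_ne, Function.update_self, eval_var, eval_rd, eval_const]
    refine and_congr Iff.rfl (and_congr (hB t ht) (and_congr Iff.rfl (and_congr ?_ Iff.rfl)))
    refine exists_bounded_congr (fun y hy => ?_) fun y h => (H.bound _ _ h.2).2
    rw [holds_conj, holds_lt, H.holds_edge (by simpa) (by simpa)]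
    simp [eval_var]
  · rw [eval_ite]
    refine if_congr ?_ rfl rfl
    rw [holds_sum]
    refine exists_bounded_congr (fun u hu => ?_) fun u h => h.1.trans hv
    rw [holds_conj, holds_conj, holds_conj, holds_neg, holds_neg, holds_lt, holds_rd, H.holds_edge (by simpa) (by simpa), holds_rd]
    simp only [ne_eq, Nat.reduceEqDiff, not_false_eq_true, Function.update_of_ne, Function.update_self, eval_var, not_not]
    exact and_congr Iff.rfl (and_congr (not_not.symm.trans (not_congr (hB u hu))) Iff.rfl)

theorem EdgeMem.holds_inZoneF (hB : ∀ i, i < N → (m secArr i ≠ 0 ↔ B i)) (h1 : a < k) (h2 : t < k) (ha : v a < N) (ht : v t < N) :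
    (inZoneF a t k).Holds N m v ↔ InZone E B (v a) (v t) := by
  simp only [inZoneF, holds_conj, holds_neg, holds_rd, holds_lt, eval_var, holds_sum, H.holds_edge ha ht, hB _ ha, InZone]
  refine and_congr Iff.rfl (and_congr Iff.rfl (and_congr Iff.rfl (exists_bounded_congr (fun c hc => ?_) fun c h => (H.bound _ _ h.1.2.1).2)))
  rw [H.holds_lastF (by omega) (by omega) (by simpa [h1.ne]) (by simpa)]
  simp only [h1.ne, h2.ne, ne_eq, not_false_eq_true, Function.update_of_ne, Function.update_self]
  exact and_congr Iff.rfl (and_congr (hB c hc) Iff.rfl)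

theorem EdgeMem.holds_maxZoneF (hB : ∀ i, i < N → (m secArr i ≠ 0 ↔ B i)) (h12 : v 12 < N) (h10 : v 10 < N) :
    maxZoneF.Holds N m v ↔ IsMaxZone E B (v 12) (v 10) := by
  have e1 : (∀ a', InZone E B a' (v 10) → a' ≤ v 12) ↔ ¬ ∃ a', v 12 < a' ∧ InZone E B a' (v 10) := by
    push Not
    exact forall_congr' fun z => ⟨fun h h' h'' => absurd (h h'') (by omega), fun h h' => by by_contra h2; exact h (by omega) h'⟩
  rw [maxZoneF, holds_conj, H.holds_inZoneF hB (by omega) (by omega) h12 h10, holds_neg, holds_sum, IsMaxZone, e1]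
  refine and_congr Iff.rfl (not_congr (exists_bounded_congr (fun i hi => ?_) fun i h => h.2.2.1.trans h10))
  rw [holds_conj, holds_lt, H.holds_inZoneF hB (by omega) (by omega) (by simpa) (by simpa)]
  simp [eval_var]

theorem EdgeMem.eval_zoneF_none (hB : ∀ i, i < N → (m secArr i ≠ 0 ↔ B i)) (h10 : v 10 < N) (h : ∀ a, ¬ InZone E B a (v 10)) :
    zoneF.eval N m v = m kArr (v 11) := by
  classical
  rw [zoneF, eval_ite, if_neg]
  · rfl
  · rw [holds_sum]
    rintro ⟨i, hi, h2⟩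
    rw [H.holds_inZoneF hB (by omega) (by omega) (by simpa) (by simpa)] at h2
    exact h i (by simpa using h2)

theorem EdgeMem.eval_zoneF_some (hB : ∀ i, i < N → (m secArr i ≠ 0 ↔ B i)) (h10 : v 10 < N) {a c : ℕ} (hz : IsMaxZone E B a (v 10))
    (hc : IsLast E a c) : zoneF.eval N m v = if m kArr (v 11) = m kArr a then m zoneArr (c * N + c) else
      if m kArr (v 11) = m kArr c then m zoneArr (c * N + a) else m zoneArr (c * N + v 11) := by
  classical
  obtain ⟨ha, hcN⟩ := H.bound _ _ hc.2.1
  rw [zoneF, eval_ite, if_pos]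
  · rw [eval_sum_single ha, eval_ite, if_pos, eval_sum_single hcN, eval_ite, if_pos]
    · simp only [eval_ite, holds_eq, eval_rd, eval_var]
      rw [eval_cell H.mul (by simpa), eval_cell H.mul (by simpa), eval_cell H.mul (by simpa)]
      simp
    · rw [H.holds_lastF (by omega) (by omega) (by simpa) (by simpa)]
      simpa
    · intro i hi hne
      rw [eval_ite, if_neg, eval_const]
      rw [H.holds_lastF (by omega) (by omega) (by simpa) (by simpa)]
      exact fun h => hne (IsLast.unique (by simpa using h) hc)
    · rw [H.holds_maxZoneF hB (by simpa) (by simpa)]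
      simpa
    · intro i hi hne
      rw [eval_ite, if_neg, eval_const]
      rw [H.holds_maxZoneF hB (by simpa) (by simpa)]
      intro h
      have h : IsMaxZone E B i (v 10) := by simpa using h
      exact hne (le_antisymm (hz.2 i h.1) (h.2 a hz.1))
  · rw [holds_sum]
    refine ⟨a, ha, ?_⟩
    rw [H.holds_inZoneF hB (by omega) (by omega) (by simpa) (by simpa)]
    simpa using hz.1

end

def fourColourCmd : Cmd :=
  .seq (.rep (.par1 secArr 10 secF)) (.seq (.rep (.par1 kArr 10 baseF)) (.rep (.par2 zoneArr 10 11 zoneF)))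

section
variable {N : ℕ} {s : RamState} {E : ℕ → ℕ → Prop}

theorem run_sec (H : EdgeMem N s.arr E) :
    SecondClass E fun v => v < N ∧ ((Cmd.rep (.par1 secArr 10 secF)).run N s).arr secArr v ≠ 0 := by
  classical
  have fix : ∀ v, v < N → ((Cmd.rep (.par1 secArr 10 secF)).run N s).arr secArr v =
      secF.eval N ((Cmd.rep (.par1 secArr 10 secF)).run N s).arr (Function.update s.var 10 v) := by
    intro v hv
    refine run_rep_par1 (R := fun m v => v = m) (fun v hv => ⟨v, hv, rfl⟩) ?_ hv
    intro m m' k v hm hm' hv hk h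
    subst hk
    rw [(H.congr (hm _ (by decide)) (hm _ (by decide))).eval_secF (by simpa), (H.congr (hm' _ (by decide)) (hm' _ (by decide))).eval_secF (by simpa)]
    refine if_congr (exists_congr fun x => and_congr Iff.rfl (exists_congr fun a => and_congr_right fun ha => ?_)) rfl rfl
    simp only [Function.update_self] at ha
    rw [h a a (ha.trans hv) ha rfl]
  have H' := H.congr (m' := ((Cmd.rep (.par1 secArr 10 secF)).run N s).arr) (run_arr_of_keeps rfl s) (run_arr_of_keeps rfl s)
  intro t
  constructor
  · rintro ⟨h1, h2⟩
    rw [fix t h1, H'.eval_secF (by simpa)] at h2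
    simp only [Function.update_self] at h2
    split_ifs at h2 with h3
    · obtain ⟨x, hx, a, ha, ha0, hE⟩ := h3
      exact ⟨x, hx, a, ha, fun h => h.2 ha0, hE⟩
    · exact absurd rfl h2
  · rintro ⟨x, hx, a, ha, ha0, hE⟩
    have ht := (H.bound _ _ hx.2.1).1
    refine ⟨ht, ?_⟩
    rw [fix t ht, H'.eval_secF (by simpa), if_pos]
    · simp
    · simp only [Function.update_self]
      exact ⟨x, hx, a, ha, by by_contra h; exact ha0 ⟨ha.trans ht, h⟩, hE⟩

/-- A first-class vertex avoids the colour of its only smaller first-class neighbour, and a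
second-class vertex avoids that of its only larger second-class neighbour which is not its last
neighbour. -/
theorem run_base {B : ℕ → Prop} (hN : 0 < N) (H : EdgeMem N s.arr E) (hB : ∀ i, i < N → (s.arr secArr i ≠ 0 ↔ B i)) (T : TriangleFreeCapped E N B) :
    BaseColouring E B fun v => ((Cmd.rep (.par1 kArr 10 baseF)).run N s).arr kArr (if v < N then v else 0) := by
  classical
  have hBt : ∀ t, B t → t < N := fun t h => by
    obtain ⟨x, hx, _⟩ := (T.second t).1 h
    exact (H.bound _ _ hx.2.1).1
  have fix : ∀ v, v < N → ((Cmd.rep (.par1 kArr 10 baseF)).run N s).arr kArr v =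
      baseF.eval N ((Cmd.rep (.par1 kArr 10 baseF)).run N s).arr (Function.update s.var 10 v) := by
    intro v hv
    -- First-class colours are found upwards, with rank `v`, and second-class colours downwards,
    -- with rank `N - 1 - v`.
    refine run_rep_par1 (R := fun m v => if B v then m + v + 1 = N else v = m) (fun v hv => ?_) ?_ hv
    · by_cases h : B v
      · exact ⟨N - 1 - v, by omega, by rw [if_pos h]; omega⟩
      · exact ⟨v, hv, by rw [if_neg h]⟩
    intro m m' k v hm hm' hv hk h
    rw [(H.congr (hm _ (by decide)) (hm _ (by decide))).eval_baseF (B := B) (fun i hi => by rw [hm _ (by decide)]; exact hB i hi) (by simpa),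
      (H.congr (hm' _ (by decide)) (hm' _ (by decide))).eval_baseF (B := B) (fun i hi => by rw [hm' _ (by decide)]; exact hB i hi) (by simpa)]
    simp only [Function.update_self]
    by_cases hv' : B v
    · rw [if_pos hv', if_pos hv']
      rw [if_pos hv'] at hk
      refine if_congr (exists_congr fun t => and_congr_right fun h1 => and_congr_right fun h2 => ?_) rfl rfl
      have ht := hBt t h2
      rw [h t (N - 1 - t) ht (by omega) (by rw [if_pos h2]; omega)]
    · rw [if_neg hv', if_neg hv']
      rw [if_neg hv'] at hk
      refine if_congr (exists_congr fun t => and_congr_right fun h1 => and_congr_right fun h2 => ?_) rfl rfl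
      rw [h t t (by omega) (by omega) (by rw [if_neg h2])]
  have H' := H.congr (m' := ((Cmd.rep (.par1 kArr 10 baseF)).run N s).arr) (run_arr_of_keeps rfl s) (run_arr_of_keeps rfl s)
  have hB' : ∀ i, i < N → (((Cmd.rep (.par1 kArr 10 baseF)).run N s).arr secArr i ≠ 0 ↔ B i) := fun i hi => by
    rw [run_arr_of_keeps rfl s]; exact hB i hi
  generalize ((Cmd.rep (.par1 kArr 10 baseF)).run N s) = s1 at *
  have val : ∀ v, v < N → s1.arr kArr v = if B v then
      if ∃ t, v < t ∧ B t ∧ E v t ∧ (∃ y, t < y ∧ E v y) ∧ s1.arr kArr t = 2 then 3 else 2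
      else if ∃ u, u < v ∧ ¬ B u ∧ E u v ∧ s1.arr kArr u = 0 then 1 else 0 := fun v hv => by
    rw [fix v hv, H'.eval_baseF hB' (by simpa)]
    simp only [Function.update_self]
  have first : ∀ v, v < N → ¬ B v → s1.arr kArr v < 2 := fun v hv h => by
    rw [val v hv, if_neg h]; split <;> omega
  refine ⟨fun t ht => ?_, fun t ht => ?_, fun u t hu ht hut hE => ?_, fun u t y hu ht hut hE hty hy => ?_⟩
  -- Indices from `N` on borrow the colour of vertex 0, which is of the first class because nothing
  -- lies below it.
  · split
    · exact first t (by assumption) ht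
    · refine first 0 hN fun h => ?_
      obtain ⟨x, _, a, ha, _⟩ := (T.second 0).1 h
      omega
  · have := hBt t ht
    rw [if_pos this, val t this, if_pos ht]
    split <;> omega
  · obtain ⟨hu', ht'⟩ := H.bound _ _ hE
    simp only [if_pos hu', if_pos ht']
    intro he
    have h1 := first u hu' hu
    rw [val t ht', if_neg ht] at he
    split_ifs at he with h
    · obtain ⟨u', g1, g2, g3, g4⟩ := h
      have := T.first_left_unique hu g2 hut g1 hE g3
      subst this
      omega
    · exact h ⟨u, hut, hu, hE, he⟩
  · obtain ⟨hu', ht'⟩ := H.bound _ _ hE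
    simp only [if_pos hu', if_pos ht']
    intro he
    rw [val u hu', if_pos hu] at he
    have h2 : s1.arr kArr t = 2 ∨ s1.arr kArr t = 3 := by
      rw [val t ht', if_pos ht]; split <;> omega
    split_ifs at he with h
    · obtain ⟨t', g1, g2, g3, ⟨y', g4, g4'⟩, g5⟩ := h
      rcases lt_trichotomy t t' with h3 | h3 | h3
      · exact T.second_edge_unique hu ht g2 hut h3 hE g3 g4 g4'
      · subst h3; omega
      · exact T.second_edge_unique hu g2 ht g1 h3 g3 hE hty hy
    · exact h ⟨t, hut, ht, hE, ⟨y, hty, hy⟩, he.symm⟩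

theorem run_zone {B : ℕ → Prop} (hN : 0 < N) (H : EdgeMem N s.arr E) (hB : ∀ i, i < N → (s.arr secArr i ≠ 0 ↔ B i))
    (T : TriangleFreeCapped E N B) : ZoneColouring E B (fun v => s.arr kArr (if v < N then v else 0)) fun t x =>
      if t < N then ((Cmd.rep (.par2 zoneArr 10 11 zoneF)).run N s).arr zoneArr (t * N + if x < N then x else 0)
      else s.arr kArr (if x < N then x else 0) := by
  classical
  have up10 : ∀ u v : ℕ, Function.update (Function.update s.var 10 u) 11 v 10 = u := fun u v => by simp
  have up11 : ∀ u v : ℕ, Function.update (Function.update s.var 10 u) 11 v 11 = v := fun u v => by simp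
  have fix : ∀ u v, u < N → v < N → ((Cmd.rep (.par2 zoneArr 10 11 zoneF)).run N s).arr zoneArr (u * N + v) =
      zoneF.eval N ((Cmd.rep (.par2 zoneArr 10 11 zoneF)).run N s).arr (Function.update (Function.update s.var 10 u) 11 v) := by
    intro u v hu hv
    -- A rank of row `u` is any strict upper bound for the zones that contain `u`; by
    -- `zone_of_last_lt` the row of `c` has the smaller rank `a`.
    refine run_rep_par2 (R := fun m u => ∀ a, InZone E B a u → a < m) (fun v hv => ⟨v, hv, fun a h => h.2.1⟩) ?_ hu hv
    intro m m' k u v hm hm' hu hv hk h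
    have Hm := H.congr (hm _ (by decide)) (hm _ (by decide))
    have Hm' := H.congr (hm' _ (by decide)) (hm' _ (by decide))
    have Bm : ∀ i, i < N → (m secArr i ≠ 0 ↔ B i) := fun i hi => by rw [hm _ (by decide)]; exact hB i hi
    have Bm' : ∀ i, i < N → (m' secArr i ≠ 0 ↔ B i) := fun i hi => by rw [hm' _ (by decide)]; exact hB i hi
    by_cases hz : ∃ a, InZone E B a u
    · obtain ⟨a, ha⟩ := hz
      obtain ⟨a, ha⟩ := T.exists_maxZone ha
      obtain ⟨c, hc, _⟩ := ha.1.2.2.2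
      obtain ⟨haN, hcN⟩ := H.bound _ _ hc.2.1
      have hr : ∀ x, x < N → m zoneArr (c * N + x) = m' zoneArr (c * N + x) := fun x hx =>
        h c x a hcN hx (hk a ha.1) fun a' ha' => T.zone_of_last_lt hc ha'
      rw [Hm.eval_zoneF_some Bm (by rw [up10]; exact hu) (by rw [up10]; exact ha) hc,
        Hm'.eval_zoneF_some Bm' (by rw [up10]; exact hu) (by rw [up10]; exact ha) hc]
      rw [up11, hr c hcN, hr a haN, hr v hv, hm kArr (by decide), hm' kArr (by decide)]
    · push Not at hz
      rw [Hm.eval_zoneF_none Bm (by rw [up10]; exact hu) (by rw [up10]; exact hz),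
        Hm'.eval_zoneF_none Bm' (by rw [up10]; exact hu) (by rw [up10]; exact hz), hm kArr (by decide), hm' kArr (by decide)]
  have H' := H.congr (m' := ((Cmd.rep (.par2 zoneArr 10 11 zoneF)).run N s).arr) (run_arr_of_keeps rfl s) (run_arr_of_keeps rfl s)
  have hB' : ∀ i, i < N → (((Cmd.rep (.par2 zoneArr 10 11 zoneF)).run N s).arr secArr i ≠ 0 ↔ B i) := fun i hi => by
    rw [run_arr_of_keeps rfl s]; exact hB i hi
  have hk' : ((Cmd.rep (.par2 zoneArr 10 11 zoneF)).run N s).arr kArr = s.arr kArr := run_arr_of_keeps rfl s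
  generalize ((Cmd.rep (.par2 zoneArr 10 11 zoneF)).run N s).arr = m at *
  have hcl : ∀ x, (if x < N then x else 0) < N := fun x => by split <;> omega
  constructor
  · intro t x hz
    split
    · rw [fix t _ (by assumption) (hcl x), H'.eval_zoneF_none hB' (by rwa [up10]) (by rw [up10]; exact hz), up11, hk']
    · rfl
  · intro t x a c ha hc
    obtain ⟨haN, hcN⟩ := H.bound _ _ hc.2.1
    have htN : t < N := by
      obtain ⟨_, _, _, c', hc', _, h⟩ := ha.1
      exact h.trans (H.bound _ _ hc'.2.1).2
    simp only [if_pos htN, if_pos haN, if_pos hcN]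
    rw [fix t _ htN (hcl x), H'.eval_zoneF_some hB' (by rwa [up10]) (by rw [up10]; exact ha) hc, up11, hk']

theorem run_fourColourCmd (hN : 0 < N) (H : EdgeMem N s.arr E) (hT : ∀ B, SecondClass E B → TriangleFreeCapped E N B) :
    (∀ t, t < N → (fourColourCmd.run N s).arr zoneArr (t * N + t) < 4) ∧
    ∀ t z, t < z → E t z → (fourColourCmd.run N s).arr zoneArr (t * N + t) ≠ (fourColourCmd.run N s).arr zoneArr (z * N + z) := by
  let s1 := (Cmd.rep (.par1 secArr 10 secF)).run N s
  let s2 := (Cmd.rep (.par1 kArr 10 baseF)).run N s1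
  let B : ℕ → Prop := fun v => v < N ∧ s1.arr secArr v ≠ 0
  have T : TriangleFreeCapped E N B := hT B (run_sec H)
  have H1 : EdgeMem N s1.arr E := H.congr (run_arr_of_keeps rfl s) (run_arr_of_keeps rfl s)
  have H2 : EdgeMem N s2.arr E := H1.congr (run_arr_of_keeps rfl s1) (run_arr_of_keeps rfl s1)
  have hB1 : ∀ i, i < N → (s1.arr secArr i ≠ 0 ↔ B i) := fun i hi => by simp [B, hi]
  have hB2 : ∀ i, i < N → (s2.arr secArr i ≠ 0 ↔ B i) := fun i hi => by
    rw [show s2.arr secArr = s1.arr secArr from run_arr_of_keeps rfl s1]; exact hB1 i hi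
  have K := run_base hN H1 hB1 T
  have Q := run_zone hN H2 hB2 T
  change (∀ t, t < N → ((Cmd.rep (.par2 zoneArr 10 11 zoneF)).run N s2).arr zoneArr (t * N + t) < 4) ∧ _
  constructor
  · intro t ht
    have := T.zone_lt K Q t t (fun a ha => ha.2.1) t
    simpa only [if_pos ht] using this
  · intro t z htz hE
    obtain ⟨ht, hz⟩ := H.bound _ _ hE
    have := T.zone_proper K Q htz hE
    simp only [if_pos ht, if_pos hz] at this
    exact this

end

/-! ### Refining the colour classes -/

def labelArr : ℕ := 1
def resArr : ℕ := 20

/-- The graph induced on the colour class of `r`. -/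
def classAdj (A : ℕ → ℕ → Prop) (f : ℕ → ℕ) (r u v : ℕ) : Prop := A u v ∧ f u = f r ∧ f v = f r

def Ex.classF (x y : ℕ) : Ex :=
  .conj (cell adjArr x y) (.conj (.eq (.rd labelArr (.var x)) (.rd labelArr (.var 8))) (.eq (.rd labelArr (.var y)) (.rd labelArr (.var 8))))

/-- A repetition has `N` rounds, so the matrix is left unchanged once cliques with as many vertices
as variable 6 says are reached. -/
def cliqueStep : Cmd :=
  .seq (.par2 cliqueArr 10 11 (.ite (.lt (.add (.var 7) (.const 2)) (.var 6)) (cliqueNextF classF) (cell cliqueArr 10 11)))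
    (.set 7 (.add (.var 7) (.const 1)))

/-- Variable `6` holds the largest size of a clique in the class of the vertex in variable `8`. -/
def startEdgeCmd : Cmd :=
  .seq (.par2 cliqueArr 10 11 (cliqueInitF classF)) (.seq (.set 7 (.const 0)) (.seq (.rep cliqueStep)
    (.par2 edgeArr 10 11 (.disj (cell cliqueArr 10 11) (cell cliqueArr 11 10)))))

def classCmd : Cmd :=
  .seq startEdgeCmd (.seq fourColourCmd (.seq
    (.par1 resArr 10 (.ite (.eq (.rd labelArr (.var 10)) (.rd labelArr (.var 8))) (cell zoneArr 10 10) (.rd resArr (.var 10))))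
    (.set 8 (.add (.var 8) (.const 1)))))

def Ex.quad (e : Ex) : Ex := .add (.add e e) (.add e e)

/-- The new label `4 * label + residue` encodes the pair. Once variable 6 is at most 1 the classes
have no edges and the labels stay. -/
def refineCmd : Cmd :=
  .seq (.set 8 (.const 0)) (.seq (.rep classCmd) (.seq
    (.par1 labelArr 10 (.ite (.lt (.const 1) (.var 6)) (.add (.quad (.rd labelArr (.var 10))) (.rd resArr (.var 10)))
      (.rd labelArr (.var 10))))
    (.set 6 (.sub (.var 6) (.const 1)))))

section
variable {N : ℕ} {s : RamState} {A : ℕ → ℕ → Prop}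

theorem relMem_classF (H : AdjMem N s.arr A) : RelMem N s classF (classAdj A (s.arr labelArr) (s.var 8)) := by
  intro w hw x y hx hy
  simp only [classF, holds_conj, holds_eq, eval_rd, eval_var, H.holds_adj hx hy, hw 8 (by omega), classAdj]

theorem run_startEdgeCmd (H : AdjMem N s.arr A) {j : ℕ} (hj : s.var 6 = j) (hj2 : 2 ≤ j) (hjN : j ≤ N) :
    EdgeMem N (startEdgeCmd.run N s).arr (StartEdge (classAdj A (s.arr labelArr) (s.var 8)) (j - 2)) := by
  classical
  set B := classAdj A (s.arr labelArr) (s.var 8) with hBdef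
  have hb : ∀ u v, B u v → u < N ∧ v < N := fun u v h => H.bound _ _ h.1
  let s0 := (Cmd.set 7 (.const 0)).run N ((Cmd.par2 cliqueArr 10 11 (cliqueInitF classF)).run N s)
  let st : ℕ → RamState := fun i => (cliqueStep.run N)^[i] s0
  have H0 : ∀ i, AdjMem N (st i).arr A := fun i =>
    H.congr (iterate_arr_of_keeps rfl s0 i) (iterate_arr_of_keeps rfl s0 i)
  have hrel : ∀ i, RelMem N (st i) classF B := fun i => by
    have := relMem_classF (H0 i)
    rw [show (st i).arr labelArr = s.arr labelArr from iterate_arr_of_keeps rfl s0 i,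
      show (st i).var 8 = s.var 8 from iterate_var_of_keeps rfl s0 i] at this
    exact this
  have v6 : ∀ i, (st i).var 6 = j := fun i => (iterate_var_of_keeps rfl s0 i).trans hj
  have key : ∀ i, (st i).var 7 = i ∧
      ∀ u v, u < N → v < N → ((st i).arr cliqueArr (u * N + v) ≠ 0 ↔ CliqueStart B (min i (j - 2)) u v) := by
    intro i
    induction i with
    | zero =>
      refine ⟨rfl, fun u v hu hv => ?_⟩
      change ((Cmd.par2 cliqueArr 10 11 (cliqueInitF classF)).run N s).arr cliqueArr _ ≠ 0 ↔ _
      rw [run_par2 hu hv, ← holds_iff, holds_cliqueInitF (relMem_classF H) hu hv, Nat.zero_min]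
    | succ i ih =>
      obtain ⟨i1, i2⟩ := ih
      have e : st (i + 1) = (Cmd.set 7 (.add (.var 7) (.const 1))).run N ((Cmd.par2 cliqueArr 10 11
        (.ite (.lt (.add (.var 7) (.const 2)) (.var 6)) (cliqueNextF classF) (cell cliqueArr 10 11))).run N (st i)) :=
        Function.iterate_succ_apply' _ _ _
      rw [e]
      constructor
      · simp only [run, RamState.setVar_same, eval_add, eval_var, eval_const, RamState.setArr_var, i1]
      · intro u v hu hv
        rw [run_arr_of_keeps rfl, run_par2 hu hv, eval_ite]
        simp only [holds_lt, eval_add, eval_var, eval_const, ne_eq, Nat.reduceEqDiff, not_false_eq_true, Function.update_of_ne, i1, v6]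
        split
        · rw [← ne_eq, ← holds_iff, holds_cliqueNextF (t := i) (hrel i) (H0 i).mul (fun u v h => (hb u v h).2)
            (fun u v hu hv => by rw [i2 u v hu hv, min_eq_left (by omega)]) hu hv, min_eq_left (by omega)]
        · rw [← ne_eq, eval_cell (H0 i).mul (by simpa)]
          simp only [ne_eq, Nat.reduceEqDiff, not_false_eq_true, Function.update_of_ne, Function.update_self]
          rw [← ne_eq, i2 u v hu hv, min_eq_right (by omega), min_eq_right (by omega)]
  have hfin : ∀ u v, u < N → v < N → ((st N).arr cliqueArr (u * N + v) ≠ 0 ↔ CliqueStart B (j - 2) u v) := fun u v hu hv => by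
    rw [(key N).2 u v hu hv, min_eq_right (by omega)]
  refine ⟨?_, fun u v hu hv => ?_, fun u v h => h.elim (fun h => hb _ _ h.adj) fun h => (hb _ _ h.adj).symm⟩
  · rw [run_arr_of_keeps rfl]; exact H.mul
  · change ((Cmd.par2 edgeArr 10 11 (.disj (cell cliqueArr 10 11) (cell cliqueArr 11 10))).run N (st N)).arr edgeArr _ ≠ 0 ↔ _
    rw [run_par2 hu hv, ← holds_iff, holds_disj, holds_iff, holds_iff, eval_cell (H0 N).mul (by simpa), eval_cell (H0 N).mul (by simpa)]
    simp only [ne_eq, Nat.reduceEqDiff, not_false_eq_true, Function.update_of_ne, Function.update_self]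
    rw [← ne_eq, ← ne_eq, hfin u v hu hv, hfin v u hv hu, StartEdge]

theorem run_classCmd (hN : 0 < N) (H : AdjMem N s.arr A) (hsymm : ∀ u v, A u v → A v u) {j : ℕ} (hj : s.var 6 = j) (hj2 : 2 ≤ j) (hjN : j ≤ N)
    (hc : Capped (classAdj A (s.arr labelArr) (s.var 8)))
    (hno : ∀ u v, ¬ CliqueStart (classAdj A (s.arr labelArr) (s.var 8)) (j - 1) u v) :
    (∀ v, v < N → s.arr labelArr v = s.arr labelArr (s.var 8) → (classCmd.run N s).arr resArr v < 4) ∧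
    (∀ u v, CliqueStart (classAdj A (s.arr labelArr) (s.var 8)) (j - 2) u v →
      (classCmd.run N s).arr resArr u ≠ (classCmd.run N s).arr resArr v) ∧
    ∀ v, v < N → s.arr labelArr v ≠ s.arr labelArr (s.var 8) → (classCmd.run N s).arr resArr v = s.arr resArr v := by
  classical
  let s1 := startEdgeCmd.run N s
  have H1 : EdgeMem N s1.arr _ := run_startEdgeCmd H hj hj2 hjN
  obtain ⟨h1, h2⟩ := run_fourColourCmd hN H1 fun S hS => startEdge_triangleFreeCapped (fun x y h => ⟨hsymm _ _ h.1, h.2.2, h.2.1⟩)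
    (fun x y h => (H.bound _ _ h.1).2) hc (by rw [show j - 2 + 1 = j - 1 by omega]; exact hno) hS
  let s2 := fourColourCmd.run N s1
  have l2 : s2.arr labelArr = s.arr labelArr := (run_arr_of_keeps rfl s1).trans (run_arr_of_keeps rfl s)
  have r2 : s2.arr resArr = s.arr resArr := (run_arr_of_keeps rfl s1).trans (run_arr_of_keeps rfl s)
  have v8 : s2.var 8 = s.var 8 := (run_var_of_keeps rfl s1).trans (run_var_of_keeps rfl s)
  have m2 : ∀ i, i < N → s2.arr mulArr i = i * N := fun i hi => by
    rw [show s2.arr mulArr = s1.arr mulArr from run_arr_of_keeps rfl s1]; exact H1.mul i hi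
  have val : ∀ v, v < N → (classCmd.run N s).arr resArr v =
      if s.arr labelArr v = s.arr labelArr (s.var 8) then s2.arr zoneArr (v * N + v) else s.arr resArr v := fun v hv => by
    change ((Cmd.set 8 _).run N ((Cmd.par1 resArr 10 (.ite (.eq (.rd labelArr (.var 10)) (.rd labelArr (.var 8))) (cell zoneArr 10 10)
      (.rd resArr (.var 10)))).run N s2)).arr resArr v = _
    rw [run_arr_of_keeps rfl, run_par1 hv, eval_ite, eval_cell m2 (by simpa)]
    simp only [holds_eq, eval_rd, eval_var, ne_eq, Nat.reduceEqDiff, not_false_eq_true, Function.update_of_ne, Function.update_self,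
      l2, r2, v8]
  refine ⟨fun v hv h => ?_, fun u v h => ?_, fun v hv h => ?_⟩
  · rw [val v hv, if_pos h]; exact h1 v hv
  · obtain ⟨hA, hu, hv⟩ := id h.adj
    obtain ⟨huN, hvN⟩ := H.bound _ _ hA
    rw [val u huN, val v hvN, if_pos hu, if_pos hv]
    exact h2 u v h.lt (Or.inl h)
  · rw [val v hv, if_neg h]

/-- The state between two refinements: the classes are capped, and have no cliques of more than `j` vertices. -/
structure LabelMem (N : ℕ) (A : ℕ → ℕ → Prop) (w j : ℕ) (s : RamState) : Prop where
  adj : AdjMem N s.arr A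
  var : s.var 6 = j
  le : j ≤ w
  capped : ∀ r, r < N → Capped (classAdj A (s.arr labelArr) r)
  -- The excluded cliques have `max j 1 + 1` vertices, so even after the countdown has reached 0 the
  -- condition says that classes have no edges.
  noClique : ∀ r u v, r < N → ¬ CliqueStart (classAdj A (s.arr labelArr) r) (max j 1 - 1) u v
  bound : ∀ v, v < N → s.arr labelArr v < 3 * 4 ^ (w - max j 1)

/-- A clique with `j` vertices in a new class would have its first edge in this class, but the
residues colour the first edges of such cliques properly. -/
theorem run_refineCmd (hN : 0 < N) (hsymm : ∀ u v, A u v → A v u) {w j : ℕ} (hw : w ≤ N) (hs : LabelMem N A w j s) :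
    LabelMem N A w (j - 1) (refineCmd.run N s) := by
  classical
  let s0 := (Cmd.set 8 (.const 0)).run N s
  let st : ℕ → RamState := fun i => (classCmd.run N)^[i] s0
  have H0 : ∀ i, AdjMem N (st i).arr A := fun i =>
    hs.adj.congr (iterate_arr_of_keeps rfl s0 i) (iterate_arr_of_keeps rfl s0 i)
  have l0 : ∀ i, (st i).arr labelArr = s.arr labelArr := fun i => iterate_arr_of_keeps rfl s0 i
  have v6 : ∀ i, (st i).var 6 = j := fun i => (iterate_var_of_keeps rfl s0 i).trans hs.var
  have v8 : ∀ i, (st i).var 8 = i := by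
    intro i
    induction i with
    | zero => rfl
    | succ i ih =>
      have e : st (i + 1) = (Cmd.set 8 (.add (.var 8) (.const 1))).run N ((Cmd.par1 resArr 10 _).run N
        (fourColourCmd.run N (startEdgeCmd.run N (st i)))) := Function.iterate_succ_apply' _ _ _
      rw [e]
      simp only [run, RamState.setVar_same, eval_add, eval_var, eval_const, RamState.setArr_var]
      rw [run_var_of_keeps rfl, run_var_of_keeps rfl, ih]
  have key : 2 ≤ j → ∀ i, i ≤ N → ∀ r, r < i →
      (∀ v, v < N → s.arr labelArr v = s.arr labelArr r → (st i).arr resArr v < 4) ∧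
      ∀ u v, CliqueStart (classAdj A (s.arr labelArr) r) (j - 2) u v → (st i).arr resArr u ≠ (st i).arr resArr v := by
    intro hj2 i
    induction i with
    | zero => exact fun _ r hr => absurd hr (by omega)
    | succ i ih =>
      intro hi r hr
      have e : st (i + 1) = classCmd.run N (st i) := Function.iterate_succ_apply' _ _ _
      obtain ⟨g1, g2, g3⟩ := run_classCmd hN (H0 i) hsymm (v6 i) hj2 (hs.le.trans hw) (by rw [l0, v8]; exact hs.capped i (by omega))
        (fun u v => by
          rw [l0, v8]
          have := hs.noClique i u v (by omega)
          rwa [max_eq_left (by omega)] at this)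
      rw [l0, v8] at g1 g2 g3
      rw [e]
      -- A class is coloured again for each of its representatives `i`, and the latest colouring
      -- counts; the residues of other classes are untouched.
      by_cases hri : s.arr labelArr r = s.arr labelArr i
      · have hcl : classAdj A (s.arr labelArr) r = classAdj A (s.arr labelArr) i := by
          funext u v
          simp only [classAdj, hri]
        rw [hcl, hri]
        exact ⟨g1, g2⟩
      · have hri' : r < i := lt_of_le_of_ne (by omega) fun h => hri (by rw [h])
        obtain ⟨f1, f2⟩ := ih (by omega) r hri'
        refine ⟨fun v hv h => ?_, fun u v h => ?_⟩
        · rw [g3 v hv (by rw [h]; exact hri)]; exact f1 v hv h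
        · obtain ⟨hA, hu, hv⟩ := id h.adj
          obtain ⟨huN, hvN⟩ := hs.adj.bound _ _ hA
          rw [g3 u huN (by rw [hu]; exact hri), g3 v hvN (by rw [hv]; exact hri)]
          exact f2 u v h
  have val : ∀ v, v < N → (refineCmd.run N s).arr labelArr v =
      if 1 < j then 4 * s.arr labelArr v + (st N).arr resArr v else s.arr labelArr v := fun v hv => by
    change ((Cmd.set 6 _).run N ((Cmd.par1 labelArr 10 (.ite (.lt (.const 1) (.var 6)) (.add (.quad (.rd labelArr (.var 10)))
      (.rd resArr (.var 10))) (.rd labelArr (.var 10)))).run N (st N))).arr labelArr v = _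
    rw [run_arr_of_keeps rfl, run_par1 hv, eval_ite]
    simp only [holds_lt, quad, eval_add, eval_rd, eval_var, eval_const, ne_eq, Nat.reduceEqDiff, not_false_eq_true, Function.update_of_ne,
      Function.update_self, l0, v6]
    congr 1
    ring
  have var6 : (refineCmd.run N s).var 6 = j - 1 := by
    change ((Cmd.set 6 (.sub (.var 6) (.const 1))).run N ((Cmd.par1 labelArr 10 _).run N (st N))).var 6 = _
    simp only [run, RamState.setVar_same, eval_sub, eval_var, eval_const, RamState.setArr_var, v6]
  have hadj : AdjMem N (refineCmd.run N s).arr A := hs.adj.run rfl rfl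
  generalize refineCmd.run N s = s' at *
  by_cases hj : 1 < j
  · have val' : ∀ v, v < N → s'.arr labelArr v = 4 * s.arr labelArr v + (st N).arr resArr v := fun v hv => by
      rw [val v hv, if_pos hj]
    have hlt : ∀ v, v < N → (st N).arr resArr v < 4 := fun v hv => ((key hj N le_rfl) v hv).1 v hv rfl
    have hsub : ∀ r, r < N → ∀ u v, classAdj A (s'.arr labelArr) r u v → classAdj A (s.arr labelArr) r u v ∧
        (st N).arr resArr u = (st N).arr resArr v := by
      rintro r hr u v ⟨hA, h1, h2⟩
      obtain ⟨hu, hv⟩ := hs.adj.bound _ _ hA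
      rw [val' u hu, val' r hr] at h1
      rw [val' v hv, val' r hr] at h2
      have := hlt u hu
      have := hlt v hv
      have := hlt r hr
      exact ⟨⟨hA, by omega, by omega⟩, by omega⟩
    refine ⟨hadj, var6, by have := hs.le; omega, fun r hr a b c d hab hbc hcd hac hbd => ?_, fun r u v hr h => ?_, fun v hv => ?_⟩
    · exact ⟨(hs.capped r hr a b c d hab hbc hcd (hsub r hr _ _ hac).1 (hsub r hr _ _ hbd).1).1, hac.2.1, hbd.2.2⟩
    · rw [max_eq_left (by omega)] at h
      have h' := h.mono fun x y hxy => (hsub r hr x y hxy).1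
      exact (key hj N le_rfl r hr).2 u v h' (hsub r hr u v h.adj).2
    · have h1 := hs.bound v hv
      have h2 := hlt v hv
      have h3 := hs.le
      rw [val' v hv]
      rw [max_eq_left (by omega)] at h1 ⊢
      rw [show w - (j - 1) = w - j + 1 by omega, pow_succ]
      omega
  · have val' : ∀ v, v < N → s'.arr labelArr v = s.arr labelArr v := fun v hv => by rw [val v hv, if_neg hj]
    have hcl : ∀ r, r < N → classAdj A (s'.arr labelArr) r = classAdj A (s.arr labelArr) r := fun r hr => by
      funext u v
      refine propext (and_congr_right fun hA => ?_)
      obtain ⟨hu, hv⟩ := hs.adj.bound _ _ hA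
      rw [val' u hu, val' v hv, val' r hr]
    have hmax : max (j - 1) 1 = max j 1 := by omega
    refine ⟨hadj, var6, by have := hs.le; omega, fun r hr => ?_, fun r u v hr => ?_, fun v hv => ?_⟩
    · rw [hcl r hr]; exact hs.capped r hr
    · rw [hcl r hr, hmax]; exact hs.noClique r u v hr
    · rw [val' v hv, hmax]; exact hs.bound v hv

/-- After `N` refinements the labels form a proper colouring. -/
theorem run_refinements (hN : 0 < N) (hsymm : ∀ u v, A u v → A v u) {w : ℕ} (hw : w ≤ N) (hs : LabelMem N A w w s) :
    (∀ v, v < N → ((Cmd.rep refineCmd).run N s).arr labelArr v < 3 * 4 ^ (w - 1)) ∧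
    ∀ u v, A u v → u < v → ((Cmd.rep refineCmd).run N s).arr labelArr u ≠ ((Cmd.rep refineCmd).run N s).arr labelArr v := by
  have h : ∀ i, LabelMem N A w (w - i) ((refineCmd.run N)^[i] s) := by
    intro i
    induction i with
    | zero => exact hs
    | succ i ih =>
      rw [Function.iterate_succ_apply', ← Nat.sub_sub]
      exact run_refineCmd hN hsymm hw ih
  have h1 := h N
  rw [Nat.sub_eq_zero_of_le hw] at h1
  change (∀ v, v < N → ((refineCmd.run N)^[N] s).arr labelArr v < _) ∧ ∀ u v, A u v → u < v →
    ((refineCmd.run N)^[N] s).arr labelArr u ≠ ((refineCmd.run N)^[N] s).arr labelArr v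
  refine ⟨fun v hv => h1.bound v hv, fun u v hA huv he => ?_⟩
  exact h1.noClique u u v (hs.adj.bound _ _ hA).1 ⟨huv, hA, rfl, he.symm⟩

end

/-! ### The program -/

/-- The program works with `N = n + 1` vertices, the last one isolated, while input rows have length
`n`; the row offset `u * n` is obtained as `u * N - u`. -/
def copyCmd : Cmd :=
  .par2 adjArr 10 11 (.conj (.conj (.lt (.var 10) (.var 0)) (.lt (.var 11) (.var 0)))
    (.rd 0 (.add (.sub (.rd mulArr (.var 10)) (.var 10)) (.var 11))))

def graphCmd : Cmd := .seq copyCmd (.seq (.rep (reachStep true)) (.rep (reachStep false)))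

def classesCmd : Cmd :=
  .seq (.par1 baseArr 10 (.disj (.eq (.var 10) (.const 0)) (.eq (.var 10) (.var 0)))) (.rep roundCmd)

def labelsCmd : Cmd :=
  .seq (.par1 labelArr 10 (.rd colArr (.var 10))) (.seq (.set 6 (.var 1)) (.rep refineCmd))

def mainCmd : Cmd := .seq graphCmd (.seq classesCmd (.seq cliqueNumCmd labelsCmd))

/-- Set variable `2` to the number `N` of vertices plus one, and tabulate its multiples. -/
def setupProg : RamProg :=
  .seq (.assign 2 (.add (.var 0) (.const 1)))
    (forProg 60 (.seq (.write mulArr (.var 60) (.var 61)) (.assign 61 (.add (.var 61) (.var 2)))))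

def mainProg : RamProg := .seq setupProg (mainCmd.comp regBound)

noncomputable def mainTime : Polynomial ℕ :=
  (Polynomial.X * 15 + 10 + mainCmd.time).comp (Polynomial.X + 1)

/-! ### Correctness and running time of the program -/

section
variable {n : ℕ} {G : SimpleGraph (Fin n)} {s : RamState}

theorem ramInput_adj {u v : ℕ} (hu : u < n) (hv : v < n) : (ramInput G).arr 0 (u * n + v) ≠ 0 ↔ natAdj G u v := by
  classical
  have key : ∀ {a b c d : ℕ}, b < n → d < n → a * n + b = c * n + d → a = c ∧ b = d := by
    intro a b c d hb hd h
    have h1 : (n * a + b) / n = a := by rw [Nat.mul_add_div (by omega), Nat.div_eq_of_lt hb, add_zero]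
    have h2 : (n * c + d) / n = c := by rw [Nat.mul_add_div (by omega), Nat.div_eq_of_lt hd, add_zero]
    rw [mul_comm a, mul_comm c] at h
    have hac : a = c := by rw [← h1, ← h2, h]
    subst hac
    exact ⟨rfl, by omega⟩
  constructor
  · intro h
    simp only [ramInput, true_and, ne_eq, ite_eq_right_iff, one_ne_zero, imp_false, not_not] at h
    obtain ⟨x, y, he, hadj⟩ := h
    obtain ⟨rfl, rfl⟩ := key hv y.2 he
    exact ⟨x, y, rfl, rfl, hadj⟩
  · rintro ⟨x, y, rfl, rfl, hadj⟩
    simp only [ramInput, true_and, ne_eq, ite_eq_right_iff, one_ne_zero, imp_false, not_not]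
    exact ⟨x, y, rfl, hadj⟩

/-- The state in which the main command is started. -/
structure StartMem (n : ℕ) (G : SimpleGraph (Fin n)) (s : RamState) : Prop where
  ready : Ready (n + 1) s
  size : s.var 0 = n
  input : s.arr 0 = (ramInput G).arr 0
  zero : ∀ a, a ≠ 0 → a ≠ mulArr → ∀ i, s.arr a i = 0

theorem run_graphCmd (hs : StartMem n G s) : GraphMem (n + 1) (graphCmd.run (n + 1) s).arr (natAdj G) := by
  have hb : ∀ u v, natAdj G u v → u < n + 1 ∧ v < n + 1 := fun u v h => by
    have := natAdj_lt h
    omega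
  let s1 := copyCmd.run (n + 1) s
  have H1 : AdjMem (n + 1) s1.arr (natAdj G) := by
    refine ⟨fun i hi => ?_, fun u v hu hv => ?_, hb⟩
    · rw [show s1.arr mulArr = s.arr mulArr from run_arr_of_keeps rfl s]; exact hs.ready.2 i hi
    · rw [show s1 = copyCmd.run (n + 1) s from rfl, copyCmd, run_par2 hu hv, ← holds_iff, holds_conj, holds_conj, holds_lt, holds_lt, holds_iff]
      simp only [eval_rd, eval_add, eval_sub, eval_var, ne_eq, Nat.reduceEqDiff, not_false_eq_true, Function.update_of_ne,
        Function.update_self, hs.size, hs.ready.2 u hu, hs.input, OfNat.zero_ne_ofNat]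
      rw [show u * (n + 1) - u = u * n by rw [Nat.mul_succ]; omega]
      constructor
      · rintro ⟨⟨h1, h2⟩, h3⟩
        exact (ramInput_adj h1 h2).1 h3
      · intro h
        obtain ⟨h1, h2⟩ := natAdj_lt h
        exact ⟨⟨h1, h2⟩, (ramInput_adj h1 h2).2 h⟩
  let s2 := (Cmd.rep (reachStep true)).run (n + 1) s1
  have H2 : AdjMem (n + 1) s2.arr (natAdj G) := H1.run rfl rfl
  have H3 : AdjMem (n + 1) ((Cmd.rep (reachStep false)).run (n + 1) s2).arr (natAdj G) := H2.run rfl rfl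
  have z1 : ∀ b i, s1.arr (reachArr b) i = 0 := fun b i => by
    rw [show s1.arr (reachArr b) = s.arr (reachArr b) from run_arr_of_keeps (by cases b <;> rfl) s]
    exact hs.zero _ (by cases b <;> decide) (by cases b <;> decide) i
  refine ⟨H3.mul, H3.adj, hb, fun b u v hu hv => ?_⟩
  change ((Cmd.rep (reachStep false)).run (n + 1) s2).arr (reachArr b) _ ≠ 0 ↔ _
  cases b
  · refine run_reach false H2 (fun i => ?_) hu hv
    rw [show s2.arr (reachArr false) = s1.arr (reachArr false) from run_arr_of_keeps rfl s1]
    exact z1 false i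
  · rw [run_arr_of_keeps rfl]
    exact run_reach true H1 (z1 true) hu hv

theorem GraphMem.adjMem {N : ℕ} {m : ℕ → ℕ → ℕ} {A : ℕ → ℕ → Prop} (H : GraphMem N m A) : AdjMem N m A := ⟨H.mul, H.adj, H.bound⟩

/-- The rounds start from `{0, n}`. The isolated vertex `n` bounds the order from above, so the only
gap has no exits, and no four vertices have to be checked. -/
theorem run_classesCmd (hG : HFree G) (H : GraphMem (n + 1) s.arr (natAdj G)) (h0 : s.var 0 = n) (hcol : ∀ i, s.arr colArr i = 0) :
    RoundMem (n + 1) n (natAdj G) (fun v => v ≤ n) (classesCmd.run (n + 1) s) := by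
  let s1 := (Cmd.par1 baseArr 10 (.disj (.eq (.var 10) (.const 0)) (.eq (.var 10) (.var 0)))).run (n + 1) s
  have hcol1 : ∀ i, s1.arr colArr i = 0 := fun i => by
    rw [show s1.arr colArr = s.arr colArr from run_arr_of_keeps rfl s]; exact hcol i
  refine run_rounds (s := s1) (D := fun v => v = 0 ∨ v = n) (Nat.lt_succ_self n) ⟨H.congr (run_arr_of_keeps rfl s) (run_arr_of_keeps rfl s)
    (fun b => run_arr_of_keeps (by cases b <;> rfl) s), ⟨natAdj_symm G, natAdj_crossClosed hG, Or.inl rfl, Or.inr rfl,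
    fun v h => ?_, ?_⟩, fun v hv => ?_, fun v _ => ?_, ?_⟩
  · rcases h with rfl | rfl <;> omega
  · rintro p q ⟨hp, hq, hpq, _⟩ t w _ _ hA
    have := natAdj_lt hA
    have hp' : p = 0 ∨ p = n := hp
    have hq' : q = 0 ∨ q = n := hq
    omega
  · simp only [s1, run_par1 hv]
    rw [← holds_iff, holds_disj, holds_eq, holds_eq]
    simp [eval_var, eval_const, h0]
  · rw [hcol1]; omega
  · intro a b c d ha hb hc hd hab hbc hcd
    have hb' : b = 0 ∨ b = n := hb
    have hc' : c = 0 ∨ c = n := hc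
    have hd' : d = 0 ∨ d = n := hd
    omega

theorem run_labelsCmd (h1 : s.var 1 = G.cliqueNum) (hR : RoundMem (n + 1) n (natAdj G) (fun v => v ≤ n) s) :
    (∀ v, v < n → (labelsCmd.run (n + 1) s).arr labelArr v < 3 * 4 ^ (G.cliqueNum - 1)) ∧
    ∀ u v, natAdj G u v → u < v → (labelsCmd.run (n + 1) s).arr labelArr u ≠ (labelsCmd.run (n + 1) s).arr labelArr v := by
  let s1 := (Cmd.set 6 (.var 1)).run (n + 1) ((Cmd.par1 labelArr 10 (.rd colArr (.var 10))).run (n + 1) s)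
  have hlab : ∀ v, v < n + 1 → s1.arr labelArr v = s.arr colArr v := fun v hv => by
    change ((Cmd.par1 labelArr 10 (.rd colArr (.var 10))).run (n + 1) s).arr labelArr v = _
    rw [run_par1 hv]
    simp [eval_rd, eval_var]
  have hadj : AdjMem (n + 1) s1.arr (natAdj G) := hR.graph.adjMem.congr rfl rfl
  have hcap : ∀ r, r < n + 1 → Capped (classAdj (natAdj G) (s1.arr labelArr) r) := by
    rintro r hr a b c d hab hbc hcd ⟨hac, ha, hc⟩ ⟨hbd, hb, hd⟩
    have h1 := natAdj_lt hac
    have h2 := natAdj_lt hbd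
    refine ⟨?_, ha, hd⟩
    rw [hlab _ (by omega), hlab _ hr] at ha hb hc hd
    exact hR.capped a b c d (by omega) (by omega) (by omega) (by omega) hab hbc hcd (hb.trans ha.symm) (hc.trans ha.symm) (hd.trans ha.symm) hac hbd
  have hL : LabelMem (n + 1) (natAdj G) G.cliqueNum G.cliqueNum s1 := by
    refine ⟨hadj, ?_, le_rfl, hcap, fun r u v hr h => ?_, fun v hv => ?_⟩
    · simp [s1, run, eval_var, h1]
    · obtain ⟨l, hl, hp⟩ := h.exists_list (hcap r hr)
      have := card_le_cliqueNum_of_pairwise (G := G) (l := u :: v :: l) (by simp) (hp.imp fun h => ⟨h.1, h.2.1⟩)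
      simp only [List.length_cons, hl] at this
      omega
    · rw [hlab v hv, Nat.sub_eq_zero_of_le (le_max_left _ _)]
      simpa using hR.col_lt v (by omega)
  have hw := cliqueNum_le G
  obtain ⟨g1, g2⟩ := run_refinements (Nat.succ_pos n) (natAdj_symm G) (by omega) hL
  exact ⟨fun v hv => g1 v (by omega), g2⟩

theorem run_mainCmd (hG : HFree G) (hs : StartMem n G s) :
    (mainCmd.run (n + 1) s).var 1 = G.cliqueNum ∧
    (∀ v, v < n → (mainCmd.run (n + 1) s).arr labelArr v < 3 * 4 ^ (G.cliqueNum - 1)) ∧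
    ∀ u v, natAdj G u v → u < v → (mainCmd.run (n + 1) s).arr labelArr u ≠ (mainCmd.run (n + 1) s).arr labelArr v := by
  let s1 := graphCmd.run (n + 1) s
  let s2 := classesCmd.run (n + 1) s1
  let s3 := cliqueNumCmd.run (n + 1) s2
  have H1 : GraphMem (n + 1) s1.arr (natAdj G) := run_graphCmd hs
  have R2 : RoundMem (n + 1) n (natAdj G) (fun v => v ≤ n) s2 := run_classesCmd hG H1 ((run_var_of_keeps rfl s).trans hs.size) fun i => by
    rw [show s1.arr colArr = s.arr colArr from run_arr_of_keeps rfl s]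
    exact hs.zero _ (by decide) (by decide) i
  have e3 : s3.var 1 = G.cliqueNum := run_cliqueNumCmd (Nat.lt_succ_self n) (natAdj_crossClosed hG) R2.graph.adjMem
    (((run_var_of_keeps rfl s1).trans (run_var_of_keeps rfl s)).trans hs.size)
  have c3 : s3.arr colArr = s2.arr colArr := run_arr_of_keeps rfl s2
  have R3 : RoundMem (n + 1) n (natAdj G) (fun v => v ≤ n) s3 :=
    ⟨R2.graph.congr (run_arr_of_keeps rfl s2) (run_arr_of_keeps rfl s2) fun b => run_arr_of_keeps (by cases b <;> rfl) s2, R2.state,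
      fun v hv => by rw [show s3.arr baseArr = s2.arr baseArr from run_arr_of_keeps rfl s2]; exact R2.base v hv,
      by rw [c3]; exact R2.col_lt, by rw [c3]; exact R2.capped⟩
  obtain ⟨g1, g2⟩ := run_labelsCmd e3 R3
  exact ⟨(run_var_of_keeps (c := labelsCmd) rfl s3).trans e3, g1, g2⟩

theorem exec_setupProg (G : SimpleGraph (Fin n)) :
    ∃ s t, RamExec setupProg (ramInput G) s t ∧ t ≤ (n + 1) * 15 + 10 ∧ StartMem n G s := by
  classical
  have h0 : (ramInput G).var 0 = n := by simp [ramInput]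
  have hz : ∀ x, x ≠ 0 → (ramInput G).var x = 0 := fun x hx => by simp [ramInput, hx]
  have hza : ∀ a, a ≠ 0 → ∀ i, (ramInput G).arr a i = 0 := fun a ha i => by simp [ramInput, ha]
  have e1 : RamExec (.assign 2 (.add (.var 0) (.const 1))) (ramInput G) ((ramInput G).setVar 2 (n + 1)) 4 := by
    have := RamExec.assign (ramInput G) 2 (.add (.var 0) (.const 1))
    simp only [RamExpr.eval, RamExpr.cost, h0] at this
    exact this
  obtain ⟨s, t, e2, ht, _, h2, i0, i1, i2, i3⟩ := exec_for (x := 60) (N := n + 1) (T := 7)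
    (p := .seq (.write mulArr (.var 60) (.var 61)) (.assign 61 (.add (.var 61) (.var 2))))
    (fun i s => s.var 0 = n ∧ s.var 61 = i * (n + 1) ∧ (∀ j, j < i → s.arr mulArr j = j * (n + 1)) ∧
      ∀ b, b ≠ mulArr → s.arr b = (ramInput G).arr b) (by decide) ((ramInput G).setVar 2 (n + 1)) (by simp)
    (by
      refine ⟨?_, ?_, fun j hj => absurd hj (by omega), fun b _ => rfl⟩
      · rw [RamState.setVar_of_ne _ _ (by decide), RamState.setVar_of_ne _ _ (by decide), h0]
      · rw [RamState.setVar_of_ne _ _ (by decide), RamState.setVar_of_ne _ _ (by decide), hz _ (by decide), zero_mul])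
    (by
      rintro i s hi ⟨i0, i1, i2, i3⟩ hx h2
      refine ⟨_, _, .seq (exec_write s mulArr (.var 60) (.var 61)) (exec_assign _ 61 (.add (.var 61) (.var 2))), by simp [RamExpr.cost], ?_, ?_, ?_, ?_, ?_, ?_⟩
      · rw [RamState.setVar_of_ne _ _ (by decide)]; exact hx
      · rw [RamState.setVar_of_ne _ _ (by decide)]; exact h2
      · rw [RamState.setVar_of_ne _ _ (by decide), RamState.setVar_of_ne _ _ (by decide)]; exact i0
      · rw [RamState.setVar_of_ne _ _ (by decide), RamState.setVar_same]
        simp only [RamExpr.eval, RamState.setArr_var, i1, h2]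
        ring
      · intro j hj
        simp only [RamState.setVar_arr, RamState.setArr_same, RamExpr.eval, hx, i1]
        rcases Nat.lt_succ_iff_lt_or_eq.1 hj with hj | rfl
        · rw [Function.update_of_ne hj.ne, i2 j hj]
        · rw [Function.update_self]
      · intro b hb
        rw [RamState.setVar_arr, RamState.setVar_arr, RamState.setArr_of_ne _ _ hb, i3 b hb])
  refine ⟨s, _, .seq e1 e2, by omega, ⟨h2, i2⟩, i0, i3 0 (by decide), fun a ha ha' i => ?_⟩
  rw [i3 a ha', hza a ha]

theorem exec_mainProg (hG : HFree G) : ∃ s t, RamExec mainProg (ramInput G) s t ∧ t ≤ mainTime.eval n ∧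
    s.outNumber = G.cliqueNum ∧ (∀ u v : Fin n, G.Adj u v → s.outColour u ≠ s.outColour v) ∧
    ∀ v : Fin n, s.outColour v < 3 * 4 ^ (G.cliqueNum - 1) := by
  obtain ⟨s1, t1, e1, ht1, hs1⟩ := exec_setupProg G
  obtain ⟨s2, t2, e2, ht2, ⟨hv, ha⟩, _⟩ := Cmd.comp_spec (n + 1) mainCmd rfl regBound le_rfl s1 s1
    ⟨fun _ _ => rfl, fun _ _ => rfl⟩ hs1.ready
  obtain ⟨g1, g2, g3⟩ := run_mainCmd hG hs1
  have hout : ∀ v, s2.outColour v = (mainCmd.run (n + 1) s1).arr labelArr v := fun v => by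
    rw [RamState.outColour, ha 1 (by decide)]; rfl
  refine ⟨s2, _, .seq e1 e2, ?_, ?_, fun u v h => ?_, fun v => ?_⟩
  · simp only [mainTime, Polynomial.eval_comp, Polynomial.eval_add, Polynomial.eval_mul, Polynomial.eval_X, Polynomial.eval_ofNat,
      Polynomial.eval_one]
    omega
  · rw [RamState.outNumber, hv 1 (by decide), g1]
  · rw [hout, hout]
    rcases lt_or_gt_of_ne (Fin.val_ne_of_ne h.ne) with huv | huv
    · exact g3 u v (natAdj_coe.2 h) huv
    · exact (g3 v u (natAdj_coe.2 h.symm) huv).symm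
  · rw [hout]; exact g2 v v.2

end

/-! ### Arbitrary finite ordered graphs -/

section Transfer
variable {W W' : Type*} [LinearOrder W] [LinearOrder W'] {H : SimpleGraph W} {H' : SimpleGraph W'} {f : W → W'}

theorem IsCrossingSeq.map {r : W → W → Prop} {r' : W' → W' → Prop} {u v : W} {es : List (W × W)} (h : IsCrossingSeq H r u v es)
    (hf : Function.Injective f) (hr : ∀ x y, r x y → r' (f x) (f y)) (hA : ∀ x y, H.Adj x y → H'.Adj (f x) (f y)) :
    IsCrossingSeq H' r' (f u) (f v) (es.map (Prod.map f f)) := by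
  refine ⟨fun e he => ?_, h.nodup.map (hf.prodMap hf), ?_, ?_, ?_⟩
  · obtain ⟨e', he', rfl⟩ := List.mem_map.1 he
    exact ⟨hr _ _ (h.edge e' he').1, hA _ _ (h.edge e' he').2⟩
  · have := congrArg (Option.map f) h.first
    simpa [List.head?_map, Option.map_map, Function.comp_def] using this
  · have := congrArg (Option.map f) h.last
    simpa [List.getLast?_map, Option.map_map, Function.comp_def] using this
  · rw [List.isChain_map]
    exact h.crosses.imp fun e e' he => ⟨hr _ _ he.1, hr _ _ he.2.1, hr _ _ he.2.2⟩

/-- Crossing sequences involve only edges and the order. The rotation by `U` becomes the one by the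
upper closure of its image, whose preimage is `U` again. -/
theorem HasCrossingSeq.map (hf : StrictMono f) (hA : ∀ x y, H.Adj x y → H'.Adj (f x) (f y)) {u v : W} (h : HasCrossingSeq H u v) :
    HasCrossingSeq H' (f u) (f v) := by
  rcases h with ⟨h1, es, h2⟩ | ⟨h1, U, h2, es, h3⟩
  · exact Or.inl ⟨hf h1, _, h2.map hf.injective (fun x y h => hf h) hA⟩
  · have hU : ∀ x, f x ∈ upperClosure (f '' (U : Set W)) ↔ x ∈ U := fun x => by
      rw [mem_upperClosure]
      constructor
      · rintro ⟨_, ⟨y, hy, rfl⟩, hyx⟩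
        exact U.upper (hf.le_iff_le.1 hyx) hy
      · exact fun hx => ⟨_, ⟨x, hx, rfl⟩, le_rfl⟩
    have hr : ∀ x y, RotLT U x y → RotLT (upperClosure (f '' (U : Set W))) (f x) (f y) := fun x y h => by
      simp only [RotLT, hU]
      exact h.imp_right fun h => ⟨h.1, hf h.2⟩
    exact Or.inr ⟨hf h1, _, hr _ _ h2, _, h3.map hf.injective hr hA⟩

/-- In a comap the non-adjacency of `u` and `v` carries over as well, so a bad induced subgraph
makes the whole graph, induced on `Set.univ`, a member of the family. -/
theorem HFree.comap {V' : Type*} [LinearOrder V'] {G : SimpleGraph V'} (hG : HFree G) {f : W → V'} (hf : StrictMono f) : HFree (G.comap f) := by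
  rintro S ⟨u, v, huv, hn, h1, h2⟩
  let g : S → (Set.univ : Set V') := fun x => ⟨f x, trivial⟩
  have hg : StrictMono g := fun x y h => hf h
  have hA : ∀ x y, ((G.comap f).induce S).Adj x y → (G.induce Set.univ).Adj (g x) (g y) := fun x y h => h
  exact hG Set.univ ⟨g u, g v, hg.injective.ne huv, hn, h1.map hg hA, h2.map hg hA⟩

end Transfer

/-- The colouring is the output of the program for the graph transported to `Fin n`. -/
theorem HFree.chromaticNumber_le {V : Type*} [LinearOrder V] [Finite V] {G : SimpleGraph V} (hG : HFree G) :
    G.chromaticNumber ≤ ((3 * 4 ^ (G.cliqueNum - 1) : ℕ) : ℕ∞) := by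
  have := Fintype.ofFinite V
  let e : Fin (Fintype.card V) ≃o V := Fintype.orderIsoFinOfCardEq V rfl
  obtain ⟨s, t, _, _, _, h1, h2⟩ := exec_mainProg (hG.comap e.strictMono)
  have hcl : (G.comap e).cliqueNum ≤ G.cliqueNum := by
    obtain ⟨S, hS⟩ := (G.comap e).exists_isNClique_cliqueNum
    have h3 := (hS.map (f := e.toEquiv.toEmbedding)).mono (G.map_comap_le e.toEquiv.toEmbedding)
    rw [← h3.card_eq]
    exact h3.isClique.card_le_cliqueNum
  refine SimpleGraph.Colorable.chromaticNumber_le ((SimpleGraph.colorable_iff_exists_bdd_nat_coloring _).2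
    ⟨SimpleGraph.Coloring.mk (fun v => s.outColour (e.symm v)) fun {u v} h => h1 _ _ (by simpa using h), fun v => ?_⟩)
  exact (h2 (e.symm v)).trans_le (by gcongr; omega)

theorem three_mul_four_pow_le {w : ℕ} (hw : 2 ≤ w) : 3 * 4 ^ (w - 1) ≤ 3 * 4 ^ w * (w - 1) :=
  (Nat.mul_le_mul_left 3 (Nat.pow_le_pow_right (by omega) (by omega))).trans (Nat.le_mul_of_pos_right _ (by omega))

theorem theorem3 :
    (∀ (V : Type*) [LinearOrder V] [Finite V] (G : SimpleGraph V),
      HFree G → 2 ≤ G.cliqueNum →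
        G.chromaticNumber ≤ ((3 * 4 ^ G.cliqueNum * (G.cliqueNum - 1) : ℕ) : ℕ∞) ∧
        (OrderedHoleFree G →
          G.chromaticNumber ≤ ((3 * 4 ^ (G.cliqueNum - 1) : ℕ) : ℕ∞))) ∧
    ∃ (p : RamProg) (T : Polynomial ℕ), ∀ (n : ℕ) (G : SimpleGraph (Fin n)), HFree G →
      ∃ (s : RamState) (t : ℕ), RamExec p (ramInput G) s t ∧ t ≤ T.eval n ∧
        s.outNumber = G.cliqueNum ∧
        (∀ u v : Fin n, G.Adj u v → s.outColour u ≠ s.outColour v) ∧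
        (2 ≤ G.cliqueNum →
          (∀ v : Fin n, s.outColour v < 3 * 4 ^ G.cliqueNum * (G.cliqueNum - 1)) ∧
          (OrderedHoleFree G →
            ∀ v : Fin n, s.outColour v < 3 * 4 ^ (G.cliqueNum - 1))) := by
  refine ⟨fun V _ _ G hG hw => ⟨hG.chromaticNumber_le.trans (by exact_mod_cast three_mul_four_pow_le hw), fun _ => hG.chromaticNumber_le⟩,
    mainProg, mainTime, fun n G hG => ?_⟩
  obtain ⟨s, t, h1, h2, h3, h4, h5⟩ := exec_mainProg hG
  exact ⟨s, t, h1, h2, h3, h4, fun hw => ⟨fun v => (h5 v).trans_le (three_mul_four_pow_le hw), fun _ => h5⟩⟩
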